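/- Let $d\ge 1$ and let $v:\mathbb{T}^d\to\mathbb{R}$ be a measurable, bounded function on the flat unit torus $\mathbb{T}^d=\mathbb{R}^d/\mathbb{Z}^d$ with $v\ge 0$, $v(-x)=v(x)$, and non-negative Fourier coefficients $\hat v(p)=\int_{\mathbb{T}^d}v(x)e^{-ip\cdot x}\,dx\ge 0$, $p\in(2\pi\mathbb{Z})^d$. For $N\ge 2$ let $$H_N=-\sum_{i=1}^N\Delta_i+\frac1{N-1}\sum_{1\le i<j\le N}v(x_i-x_j)$$ act on $L^2_{\rm sym}(\mathbb{T}^{dN})$, the permutation-symmetric square-integrable functions of $N$ variables $x_i\in\mathbb{T}^d$, with $\Delta$ the Laplacian on the torus (domain $H^2$), and let $E_0(N)$ be its ground state energy, i.e. the infimum of $\langle\Psi,H_N\Psi\rangle$ over normalized $\Psi$ in its domain. For $p\in(2\pi\mathbb{Z})^d\setminus\{0\}$ put $$e_p=\sqrt{|p|^4+2|p|^2\hat v(p)},\qquad E^{\rm Bog}=-\frac12\sum_{p\ne 0}\bigl(|p|^2+\hat v(p)-e_p\bigr).$$ The sum defining $E^{\rm Bog}$ converges, and there are constants $C$ and $N_0$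 depending only on $v$ (and $d$) such that for all $N\ge N_0$ the following holds. 1. $\bigl|E_0(N)-\tfrac N2\hat v(0)-E^{\rm Bog}\bigr|\le C N^{-1/2}$. 2. $L^2_{\rm sym}(\mathbb{T}^{dN})$ has an orthonormal basis of eigenfunctions of $H_N$; the spectrum of $H_N-E_0(N)$ consists exactly of the corresponding eigenvalues $\lambda_0\le\lambda_1\le\lambda_2\le\cdots$, listed with multiplicity. Let $\mu_0\le\mu_1\le\cdots$ be the list, in increasing order and with one entry for each finitely supported family $(n_p)_{p\neq 0}$ of non-negative integers, of the sums $\sum_{p\in(2\pi\mathbb{Z})^d\setminus\{0\}}e_p\,n_p$. Then for every energy $\xi>0$: - (a) if $\lambda_i\le\xi$, then $|\lambda_i-\mu_i|\le C\,\xi^{3/2}N^{-1/2}$; in particular every point of the spectrum of $H_N-E_0(N)$ below $\xi$ is of the form $\sum_p e_pn_p+O(\xi^{3/2}N^{-1/2})$; - (b) conversely, for every finitely supported $(n_p)$ with $\sum_p e_pn_p\le\xi$ there is an eigenvalue $\lambda_i$ with $|\lambda_i-\sum_p e_pn_p|\le C\,\xi^{3/2}N^{-1/2}$; - (c) if moreover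 $\xi\le N$, then also $\mu_i\le\xi$ implies $|\lambda_i-\mu_i|\le C\,\xi^{3/2}N^{-1/2}$, so that the correspondence respects multiplicities. -/

import Mathlib

open MeasureTheory
open scoped InnerProductSpace ENNReal

-- The circle `ℝ/ℤ` carries the Haar probability measure, as in Mathlib's multivariate Fourier series.
attribute [local instance] instMeasureSpaceUnitAddCircle

noncomputable section

namespace BoseGas

/-! ### Unbounded operators -/

section Operators

variable {E : Type*} [NormedAddCommGroup E] [InnerProductSpace ℂ E]

/-- `z` is in the resolvent set of the (unbounded) operator `A` if `A - z` maps the domain of `A`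
bijectively onto the whole space, with bounded inverse. -/
def IsResolventPoint (A : E →ₗ.[ℂ] E) (z : ℂ) : Prop :=
  Function.Bijective (fun f : A.domain => A f - z • (f : E)) ∧
    ∃ K : ℝ, ∀ f : A.domain, ‖(f : E)‖ ≤ K * ‖A f - z • (f : E)‖

/-- The spectrum of an unbounded operator: the complement of the resolvent set. -/
def opSpectrum (A : E →ₗ.[ℂ] E) : Set ℂ := {z | ¬ IsResolventPoint A z}

/-- The ground state energy: the infimum of `⟨ψ, A ψ⟩` over normalized `ψ` in the domain of `A`. -/
def groundStateEnergy (A : E →ₗ.[ℂ] E) : ℝ :=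
  sInf {r : ℝ | ∃ f : A.domain, ‖(f : E)‖ = 1 ∧ r = (⟪(f : E), A f⟫_ℂ).re}

/-- The part of an operator in a subspace `S`: it acts as `A` on those `f ∈ S` in the domain of `A`
with `A f ∈ S`. If `A` leaves `S` invariant, this is the restriction of `A` to `S`. -/
def partIn (S : Submodule ℂ E) (A : E →ₗ.[ℂ] E) : S →ₗ.[ℂ] S where
  domain :=
    { carrier := {f | ∃ h : (f : E) ∈ A.domain, A ⟨f, h⟩ ∈ S}
      zero_mem' := ⟨A.domain.zero_mem, by
        have : (⟨((0 : S) : E), A.domain.zero_mem⟩ : A.domain) = 0 := rfl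
        rw [this, LinearPMap.map_zero]; exact S.zero_mem⟩
      add_mem' := by
        rintro f g ⟨hf, hf'⟩ ⟨hg, hg'⟩
        refine ⟨A.domain.add_mem hf hg, ?_⟩
        have : (⟨((f + g : S) : E), A.domain.add_mem hf hg⟩ : A.domain) = ⟨f, hf⟩ + ⟨g, hg⟩ := rfl
        rw [this, LinearPMap.map_add]; exact S.add_mem hf' hg'
      smul_mem' := by
        rintro c f ⟨hf, hf'⟩
        refine ⟨A.domain.smul_mem c hf, ?_⟩
        have : (⟨((c • f : S) : E), A.domain.smul_mem c hf⟩ : A.domain) = c • ⟨f, hf⟩ := rfl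
        rw [this, LinearPMap.map_smul]; exact S.smul_mem c hf' }
  toFun :=
    { toFun := fun f => ⟨A ⟨f.1, f.2.1⟩, f.2.2⟩
      map_add' := fun f g => Subtype.ext (A.map_add ⟨f.1, f.2.1⟩ ⟨g.1, g.2.1⟩)
      map_smul' := fun c f => Subtype.ext (A.map_smul c ⟨f.1, f.2.1⟩) }

end Operators

/-! ### Operators on the torus -/

section Torus

variable (ι : Type*) [Fintype ι]

/-- The space of complex square integrable functions on the unit torus `(ℝ/ℤ)^ι`. -/
abbrev L2 : Type _ := Lp ℂ 2 (volume : Measure (UnitAddTorus ι))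

variable {ι}

/-- `|p|²` for the momentum `p = 2πk`, `k ∈ ℤ^ι`. -/
def momSq (k : ι → ℤ) : ℝ := (2 * Real.pi) ^ 2 * ∑ i, (k i : ℝ) ^ 2

variable (ι)

/-- The Sobolev space `H²` of the unit torus: the `f ∈ L²` for which `|2πk|² f̂(k)` is square
summable, where `f̂(k)` is the Fourier coefficient of `f` along `x ↦ exp (2πi k·x)`. -/
def sobolevTwo : Submodule ℂ (L2 ι) where
  carrier := {f | Memℓp (E := fun _ : ι → ℤ => ℂ)
    (fun k => (momSq k : ℂ) * UnitAddTorus.mFourierBasis.repr f k) 2}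
  zero_mem' := by
    have h := zero_memℓp (E := fun _ : ι → ℤ => ℂ) (p := 2)
    rw [Set.mem_ofPred_eq]
    convert h using 1
    funext k
    simp
  add_mem' := by
    intro f g hf hg
    have h := Memℓp.add hf hg
    rw [Set.mem_ofPred_eq]
    convert h using 1
    funext k
    simp [mul_add]
  smul_mem' := by
    intro c f hf
    have h := Memℓp.const_smul hf c
    rw [Set.mem_ofPred_eq]
    convert h using 1
    funext k
    simp [mul_left_comm]

/-- `-Δ` on the unit torus, as a self-adjoint operator with domain `H²`: it multiplies the Fourier
coefficient at `k` by `|2πk|²`. -/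
def negLaplacian : L2 ι →ₗ.[ℂ] L2 ι where
  domain := sobolevTwo ι
  toFun :=
    { toFun := fun f => UnitAddTorus.mFourierBasis.repr.symm
        (⟨fun k => (momSq k : ℂ) * UnitAddTorus.mFourierBasis.repr (f : L2 ι) k, f.2⟩ :
          lp (fun _ : ι → ℤ => ℂ) 2)
      map_add' := by
        intro f g
        rw [← map_add]
        refine congrArg _ (Subtype.ext (funext fun k => ?_))
        have h : UnitAddTorus.mFourierBasis.repr ((f + g : sobolevTwo ι) : L2 ι) k
            = UnitAddTorus.mFourierBasis.repr (f : L2 ι) k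
              + UnitAddTorus.mFourierBasis.repr (g : L2 ι) k := by
          rw [Submodule.coe_add, map_add]; rfl
        exact (congrArg ((momSq k : ℂ) * ·) h).trans (mul_add _ _ _)
      map_smul' := by
        intro c f
        rw [RingHom.id_apply, ← map_smul]
        refine congrArg _ (Subtype.ext (funext fun k => ?_))
        have h : UnitAddTorus.mFourierBasis.repr ((c • f : sobolevTwo ι) : L2 ι) k
            = c * UnitAddTorus.mFourierBasis.repr (f : L2 ι) k := by
          rw [Submodule.coe_smul, map_smul]; rfl
        exact (congrArg ((momSq k : ℂ) * ·) h).trans (mul_left_comm _ _ _) }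

variable {ι}

/-- The operator of multiplication by a real function `W`, on its maximal domain. -/
def mulOp (W : UnitAddTorus ι → ℝ) : L2 ι →ₗ.[ℂ] L2 ι where
  domain :=
    { carrier := {f | MemLp (fun x => (W x : ℂ) * f x) 2 volume}
      zero_mem' := by
        refine (memLp_congr_ae ?_).2 (MemLp.zero (ε := ℂ) (p := 2) (μ := volume))
        filter_upwards [Lp.coeFn_zero ℂ 2 (volume : Measure (UnitAddTorus ι))] with x hx
        exact (congrArg ((W x : ℂ) * ·) hx).trans (mul_zero _)
      add_mem' := by
        intro f g hf hg
        refine (memLp_congr_ae ?_).2 (MemLp.add hf hg)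
        filter_upwards [Lp.coeFn_add f g] with x hx
        exact (congrArg ((W x : ℂ) * ·) hx).trans (mul_add _ _ _)
      smul_mem' := by
        intro c f hf
        refine (memLp_congr_ae ?_).2 (MemLp.const_smul hf c)
        filter_upwards [Lp.coeFn_smul c f] with x hx
        exact (congrArg ((W x : ℂ) * ·) hx).trans (mul_left_comm _ _ _) }
  toFun :=
    { toFun := fun f => MemLp.toLp (fun x => (W x : ℂ) * (f : L2 ι) x) f.2
      map_add' := by
        intro f g
        rw [← MemLp.toLp_add]
        refine MemLp.toLp_congr _ _ ?_
        filter_upwards [Lp.coeFn_add (f : L2 ι) (g : L2 ι)] with x hx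
        exact (congrArg ((W x : ℂ) * ·) hx).trans (mul_add _ _ _)
      map_smul' := by
        intro c f
        rw [RingHom.id_apply, ← MemLp.toLp_const_smul]
        refine MemLp.toLp_congr _ _ ?_
        filter_upwards [Lp.coeFn_smul c (f : L2 ι)] with x hx
        exact (congrArg ((W x : ℂ) * ·) hx).trans (mul_left_comm _ _ _) }

end Torus

/-! ### The Bose gas

A configuration of `N` particles on the torus `𝕋^d` is a point of `(ℝ/ℤ)^(Fin N × Fin d)`; the
position of particle `i` is `fun a => x (i, a)`. -/

section Gas

variable {d N : ℕ}

/-- Relabel the particles by a permutation. -/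
def relabel (σ : Equiv.Perm (Fin N)) (x : UnitAddTorus (Fin N × Fin d)) :
    UnitAddTorus (Fin N × Fin d) :=
  fun q => x (σ q.1, q.2)

theorem measurePreserving_relabel (σ : Equiv.Perm (Fin N)) :
    MeasurePreserving (relabel (d := d) σ) volume volume := by
  have : SigmaFinite (volume : Measure UnitAddCircle) :=
    inferInstanceAs (SigmaFinite (AddCircle.haarAddCircle : Measure UnitAddCircle))
  have h := volume_measurePreserving_piCongrLeft (fun _ : Fin N × Fin d => UnitAddCircle)
    (Equiv.prodCongr σ.symm (Equiv.refl (Fin d)))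
  convert h using 1
  funext x q
  obtain ⟨q, rfl⟩ := (Equiv.prodCongr σ.symm (Equiv.refl (Fin d))).surjective q
  rw [MeasurableEquiv.coe_piCongrLeft, Equiv.piCongrLeft_apply_apply]
  simp [relabel]

variable (d N)

/-- The permutation-symmetric square integrable functions of `N` variables in `𝕋^d`. -/
def bosonSpace : Submodule ℂ (L2 (Fin N × Fin d)) where
  carrier := {f | ∀ σ : Equiv.Perm (Fin N),
    Lp.compMeasurePreserving (relabel σ) (measurePreserving_relabel σ) f = f}
  zero_mem' := fun σ => map_zero _
  add_mem' := fun hf hg σ => by rw [map_add, hf σ, hg σ]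
  smul_mem' := fun c f hf σ =>
    ((Lp.compMeasurePreservingₗ ℂ (relabel σ) (measurePreserving_relabel σ)).map_smul c f).trans
      (congrArg (c • ·) (hf σ))

variable {d}

/-- The interaction `(N - 1)⁻¹ ∑_{i<j} v(x_i - x_j)`. -/
def interaction (v : UnitAddTorus (Fin d) → ℝ) (x : UnitAddTorus (Fin N × Fin d)) : ℝ :=
  ((N : ℝ) - 1)⁻¹ * ∑ i : Fin N, ∑ j ∈ Finset.Ioi i, v (fun a => x (i, a) - x (j, a))

/-- The Hamiltonian `H_N = -∑ᵢ Δᵢ + (N - 1)⁻¹ ∑_{i<j} v(x_i - x_j)` on the bosonic space. -/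
def hamiltonian (v : UnitAddTorus (Fin d) → ℝ) : bosonSpace d N →ₗ.[ℂ] bosonSpace d N :=
  partIn (bosonSpace d N) (negLaplacian (Fin N × Fin d) + mulOp (interaction N v))

/-- The Fourier coefficient `v̂(p) = ∫ v(x) exp (-ip·x) dx` at `p = 2πk` (which is real for even
`v`). -/
def vhat (v : UnitAddTorus (Fin d) → ℝ) (k : Fin d → ℤ) : ℝ :=
  (UnitAddTorus.mFourierCoeff (fun x => (v x : ℂ)) k).re

/-- The elementary excitation energy `e_p = √(|p|⁴ + 2 |p|² v̂(p))` at `p = 2πk`. -/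
def elemEnergy (v : UnitAddTorus (Fin d) → ℝ) (k : Fin d → ℤ) : ℝ :=
  Real.sqrt (momSq k ^ 2 + 2 * momSq k * vhat v k)

/-- The summand `|p|² + v̂(p) - e_p` of the Bogoliubov energy, for `p = 2πk ≠ 0`. -/
def bogTerm (v : UnitAddTorus (Fin d) → ℝ) (k : {k : Fin d → ℤ // k ≠ 0}) : ℝ :=
  momSq k.1 + vhat v k.1 - elemEnergy v k.1

/-- The Bogoliubov energy `E^Bog = -½ ∑_{p ≠ 0} (|p|² + v̂(p) - e_p)`. -/
def bogEnergy (v : UnitAddTorus (Fin d) → ℝ) : ℝ := -(1 / 2) * ∑' k, bogTerm v k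

/-- Finitely supported families of occupation numbers `n_p ∈ {0, 1, 2, …}`, `p ≠ 0`. -/
abbrev Occupation (d : ℕ) : Type := {k : Fin d → ℤ // k ≠ 0} →₀ ℕ

/-- The sum of elementary excitations `∑_{p ≠ 0} e_p n_p`. -/
def excitationSum (v : UnitAddTorus (Fin d) → ℝ) (n : Occupation d) : ℝ :=
  n.sum fun k m => elemEnergy v k.1 * (m : ℝ)

end Gas

end BoseGas

end

noncomputable section
namespace BoseGas

/-! ### Enumeration by increasing value -/

/-! Expand a bosonic state in plane waves and record only the occupation numbers of the nonzero
momenta; the number of condensate particles (`p = 0`) is `N` minus the rest. This maps the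
`N`-particle space unitarily onto the square summable functions of occupations with `n.degree ≤ N`
(`amp`, `fock`, `tsum_esq_fock`). All `N` then live in one space, on which the Bogoliubov
Hamiltonian ∑ |p|² a†_p a_p + ∑ v̂(p) (a†_p a_p + ½ (a†_p a†_{-p} + a_p a_{-p})) acts. A linear
change of creation and annihilation operators diagonalizes it, with ground state energy E^Bog and
excitation energies ∑ e_p n_p (`Quadratic.sum_form_eq`, `Quadratic.mul_nsq_le`,
`Quadratic.trial_le`). It remains to compare H_N - (N/2) v̂(0) with it on states of low energy.

A momentum transfer `p ≠ 0` between two particles involves four momenta, two before and two after,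
and at least two of them are nonzero. The terms with exactly two nonzero momenta give the quadratic
Hamiltonian once the condensate operators are replaced by numbers. The terms with three or four are
errors. With N₊ the number of excited particles, `abs_pairForm_sub_le` bounds the total error by
‖G‖^{1/2} ‖N₊G‖^{3/2} N^{-1/2} and terms of lower order. This is the origin of ξ^{3/2} N^{-1/2},
provided ‖N₊G‖ = O(1 + ξ) ‖G‖ for the states in play.

That moment bound is needed on both sides. For H_N it is `IsPotential.sqrt_nsq_numOp_le`: pair H_N f
with N₊ f, use that the kinetic energy dominates N₊ and that the interaction is bounded below by its
mean field value up to a constant (`IsPotential.le_interaction`), and commute √N₊ through the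
interaction at bounded cost (`abs_pairForm_numOp_sub_le`). For quasi-particle states it follows from
expressing N₊ in quasi-particle operators (`Bogoliubov.sqrt_nsq_numOp_le`). It also shows that
truncating these states to at most `N` particles is harmless (`Quadratic.cut_trial_le`).

Min-max is then used in both directions. Among combinations of the first `i + 1` eigenvectors of H_N
there is one orthogonal to the first `i` quasi-particle states, which bounds the eigenvalue from
below (`IsPotential.bogoliubov_le_eigenvalue`); truncated combinations of the first `i + 1`
quasi-particle states bound it from above (`IsPotential.eigenvalue_le_bogoliubov`). When the energy
is of order `N` or larger the allowed error is of the size of the energy, and crude comparisons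
suffice.

A bounded function with nonnegative Fourier coefficients has summable ones
(`summable_re_mFourierCoeff`). Their sum `B` controls the convergence of E^Bog, the stability of the
interaction and all error constants that do not come from the sup bound `b`. In particular the
estimates are uniform in a finite momentum cutoff, which keeps the Bogoliubov transformation
elementary and is removed at fixed `N` by letting its error `τ` tend to zero. -/

/-- An infinite type with a real function whose sublevel sets are finite can be enumerated so that
the function increases. -/
theorem exists_equiv_nat_monotone {J : Type*} [Infinite J] (f : J → ℝ)
    (hf : ∀ r, {j | f j ≤ r}.Finite) : ∃ e : ℕ ≃ J, Monotone (fun i => f (e i)) := by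
  classical
  have hc : Countable J := by
    rw [← Set.countable_univ_iff]
    refine (Set.countable_iUnion fun n : ℕ => (hf n).countable).mono fun j _ => ?_
    obtain ⟨n, hn⟩ := exists_nat_ge (f j)
    exact Set.mem_iUnion.2 ⟨n, hn⟩
  obtain ⟨g, hg⟩ := exists_injective_nat J
  -- Ties of `f` are broken by an arbitrary injection into `ℕ`, so that `J` becomes a linear order
  -- with finite initial segments.
  let L : J → ℝ ×ₗ ℕ := fun j => toLex (f j, g j)
  have hL : Function.Injective L := fun a b h => hg (congrArg (fun z => (ofLex z).2) h)
  let : LinearOrder J := LinearOrder.lift' L hL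
  have hle : ∀ a b : J, a ≤ b → f a ≤ f b := by
    intro a b h
    have h' : L a ≤ L b := h
    rcases Prod.Lex.le_iff.1 h' with h1 | h1
    · exact h1.le
    · exact h1.1.le
  have hfin : ∀ b : J, (Set.Iic b).Finite := fun b => (hf (f b)).subset fun a ha => hle a b ha
  let : LocallyFiniteOrderBot J := LocallyFiniteOrderBot.ofIic J (fun b => (hfin b).toFinset)
    (fun a x => by simp)
  let r : J → ℕ := fun j => (Finset.Iio j).card
  have hr : StrictMono r := fun a b h =>
    Finset.card_lt_card (Finset.ssubset_iff_of_subset (Finset.Iio_subset_Iio h.le) |>.2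
      ⟨a, by simpa using h, by simp⟩)
  -- The rank `r` takes every value below one it takes: the predecessor of `j` is the maximum of
  -- `Finset.Iio j`. An infinite range closed downwards is all of `ℕ`.
  have hclosed : ∀ (n : ℕ) (j : J), r j = n → ∀ m < n, ∃ i, r i = m := by
    intro n
    induction n with
    | zero => intro j _ m hm; omega
    | succ n ih =>
      intro j hj m hm
      have hne : (Finset.Iio j).Nonempty := by
        rw [← Finset.card_pos]; change 0 < r j; omega
      let i := (Finset.Iio j).max' hne
      have hi : i < j := by
        exact Finset.mem_Iio.1 ((Finset.Iio j).max'_mem hne)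
      have hij : Finset.Iio j = insert i (Finset.Iio i) := by
        ext x
        simp only [Finset.mem_Iio, Finset.mem_insert]
        constructor
        · intro hx
          exact (Finset.le_max' (Finset.Iio j) x (by simpa using hx)).eq_or_lt
        · rintro (rfl | hx)
          · exact hi
          · exact hx.trans hi
      have hri : r i = n := by
        have : r j = r i + 1 := by
          change (Finset.Iio j).card = _
          rw [hij, Finset.card_insert_of_notMem (by simp)]
        omega
      rcases Nat.lt_succ_iff_lt_or_eq.1 hm with h | h
      · exact ih i hri m h
      · exact ⟨i, hri.trans h.symm⟩
  have hsurj : Function.Surjective r := by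
    intro n
    have hinf : (Set.range r).Infinite := Set.infinite_range_of_injective hr.injective
    obtain ⟨_, ⟨j, rfl⟩, hj⟩ := hinf.exists_gt n
    exact hclosed (r j) j rfl n hj
  let e := (Equiv.ofBijective r ⟨hr.injective, hsurj⟩).symm
  refine ⟨e, fun m n hmn => hle _ _ ?_⟩
  rw [← hr.le_iff_le]
  have h : ∀ n, r (e n) = n := Equiv.ofBijective_apply_symm_apply r _
  rwa [h, h]

/-! ### Operators with compact resolvent -/

section CompactResolvent

open Module Module.End Filter Topology

variable {E : Type*} [NormedAddCommGroup E] [InnerProductSpace ℂ E]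

/-- A compact operator is small on all but finitely many members of an orthonormal family. -/
theorem finite_setOf_le_norm_of_isCompactOperator {J : Type*} {v : J → E} (hv : Orthonormal ℂ v)
    {K : E →L[ℂ] E} (hK : IsCompactOperator K) {κ : J → ℝ} (hκ : ∀ j, K (v j) = (κ j : ℂ) • v j)
    {ε : ℝ} (hε : 0 < ε) : {j | ε ≤ κ j}.Finite := by
  by_contra hinf
  have hinf : {j | ε ≤ κ j}.Infinite := hinf
  let g : ℕ → J := fun n => (hinf.natEmbedding _ n : {j | ε ≤ κ j})
  have hg : Function.Injective g := fun a b h => (hinf.natEmbedding _).injective (Subtype.ext h)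
  have hgε : ∀ n, ε ≤ κ (g n) := fun n => ((hinf.natEmbedding _ n : {j | ε ≤ κ j})).2
  obtain ⟨C, hC, hsub⟩ := hK.image_closedBall_subset_compact (f := K.toLinearMap) 1
  have hmem : ∀ n, K (v (g n)) ∈ C := fun n => hsub ⟨v (g n), by
    simp [hv.1 (g n)], rfl⟩
  obtain ⟨a, -, φ, hφ, hlim⟩ := hC.tendsto_subseq hmem
  have hcau := hlim.cauchySeq
  rw [Metric.cauchySeq_iff] at hcau
  obtain ⟨n₀, hn₀⟩ := hcau ε hε
  have h := hn₀ n₀ le_rfl (n₀ + 1) (Nat.le_succ _)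
  have hne : g (φ n₀) ≠ g (φ (n₀ + 1)) := fun h => by
    have := hφ.injective (hg h); omega
  have hort : ⟪v (g (φ n₀)), v (g (φ (n₀ + 1)))⟫_ℂ = 0 := hv.2 hne
  -- Images of distinct members remain orthogonal, so by Pythagoras they are at distance at least
  -- `√2 ε`; no subsequence can be Cauchy.
  have hsq : ‖K (v (g (φ n₀))) - K (v (g (φ (n₀ + 1))))‖ * ‖K (v (g (φ n₀))) - K (v (g (φ (n₀ + 1))))‖
      = κ (g (φ n₀)) * κ (g (φ n₀)) + κ (g (φ (n₀ + 1))) * κ (g (φ (n₀ + 1))) := by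
    rw [← sq, norm_sub_sq (𝕜 := ℂ)]
    rw [hκ, hκ, inner_smul_left, inner_smul_right, hort]
    simp [norm_smul, hv.1, sq]
  have h1 := hgε (φ n₀)
  have h2 := hgε (φ (n₀ + 1))
  rw [dist_eq_norm] at h
  have h3 : ‖K (v (g (φ n₀))) - K (v (g (φ (n₀ + 1))))‖ * ‖K (v (g (φ n₀))) - K (v (g (φ (n₀ + 1))))‖
      < ε * ε := mul_self_lt_mul_self (norm_nonneg _) h
  nlinarith

/-- A positive definite compact operator on an infinite-dimensional Hilbert space has an orthonormal
basis of eigenvectors with decreasing eigenvalues. -/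
theorem exists_hilbertBasis_of_isCompactOperator [CompleteSpace E]
    (hE : ¬ FiniteDimensional ℂ E) {K : E →L[ℂ] E} (hK : IsCompactOperator K)
    (hsym : (K : E →ₗ[ℂ] E).IsSymmetric) (hpos : ∀ x, x ≠ 0 → 0 < (⟪x, K x⟫_ℂ).re) :
    ∃ (ψ : HilbertBasis ℕ ℂ E) (κ : ℕ → ℝ), (∀ i, 0 < κ i) ∧ Antitone κ ∧
      Tendsto κ atTop (𝓝 0) ∧ ∀ i, K (ψ i) = (κ i : ℂ) • ψ i := by
  classical
  -- Positivity excludes the eigenvalue zero, the only one whose eigenspace could have infinite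
  -- dimension.
  have hbot : eigenspace (K : End ℂ E) 0 = ⊥ := by
    rw [Submodule.eq_bot_iff]
    intro x hx
    by_contra hne
    have h0 : K x = 0 := by simpa using mem_eigenspace_iff.1 hx
    have := hpos x hne
    simp [h0] at this
  have hfd : ∀ μ : ℂ, FiniteDimensional ℂ (eigenspace (K : End ℂ E) μ) := by
    intro μ
    rcases eq_or_ne μ 0 with rfl | hμ
    · rw [hbot]; infer_instance
    · exact ContinuousLinearMap.finite_dimensional_eigenspace hK μ hμ
  let b : ∀ μ : ℂ, OrthonormalBasis (Fin (Module.finrank ℂ (eigenspace (K : End ℂ E) μ))) ℂ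
      (eigenspace (K : End ℂ E) μ) := fun μ => stdOrthonormalBasis ℂ _
  let J := Σ μ : ℂ, Fin (Module.finrank ℂ (eigenspace (K : End ℂ E) μ))
  let v : J → E := fun j => (b j.1 j.2 : E)
  have hv : Orthonormal ℂ v :=
    hsym.orthogonalFamily_eigenspaces.orthonormal_sigma_orthonormal
      (v_family := fun μ => b μ) (fun μ => (b μ).orthonormal)
  have hKv : ∀ j, K (v j) = j.1 • v j := fun j => mem_eigenspace_iff.1 (b j.1 j.2).2
  have hvne : ∀ j, v j ≠ 0 := fun j => hv.ne_zero j
  have hself : ∀ j, ⟪v j, v j⟫_ℂ = 1 := fun j => by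
    rw [inner_self_eq_norm_sq_to_K, hv.1 j]; simp
  have hreal : ∀ j : J, ((j.1.re : ℝ) : ℂ) = j.1 := by
    intro j
    have h := hsym (v j) (v j)
    rw [ContinuousLinearMap.coe_coe, hKv, inner_smul_left, inner_smul_right, hself] at h
    simpa using Complex.conj_eq_iff_real.1 (by simpa using h) |>.elim fun r hr => by simp [hr]
  let κ : J → ℝ := fun j => j.1.re
  have hκ : ∀ j, K (v j) = (κ j : ℂ) • v j := fun j => by rw [hKv, hreal]
  have hκpos : ∀ j, 0 < κ j := by
    intro j
    have := hpos (v j) (hvne j)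
    rw [hκ, inner_smul_right, hself] at this
    simpa using this
  have hspan : (Submodule.span ℂ (Set.range v))ᗮ = ⊥ := by
    rw [← ContinuousLinearMap.orthogonalComplement_iSup_eigenspaces_eq_bot hK hsym]
    congr 1
    apply le_antisymm
    · rw [Submodule.span_le]
      rintro _ ⟨j, rfl⟩
      exact Submodule.mem_iSup_of_mem j.1 (b j.1 j.2).2
    · refine iSup_le fun μ => ?_
      intro x hx
      have hx' := (b μ).sum_repr ⟨x, hx⟩
      have hx'' := congrArg (Submodule.subtype _) hx'
      rw [map_sum] at hx''
      rw [← show _ = x from hx'']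
      refine Submodule.sum_mem _ fun i _ => ?_
      rw [map_smul]
      exact Submodule.smul_mem _ _ (Submodule.subset_span ⟨⟨μ, i⟩, rfl⟩)
  have hinfJ : Infinite J := by
    by_contra hfin
    rw [not_infinite_iff_finite] at hfin
    apply hE
    have : Submodule.span ℂ (Set.range v) = ⊤ := by
      have : FiniteDimensional ℂ (Submodule.span ℂ (Set.range v)) :=
        FiniteDimensional.span_of_finite ℂ (Set.finite_range v)
      exact (Submodule.orthogonal_eq_bot_iff).1 hspan
    exact ⟨by rw [← this]; exact Submodule.fg_span (Set.finite_range v)⟩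
  have hfinlev : ∀ r, {j | (κ j)⁻¹ ≤ r}.Finite := by
    intro r
    refine (finite_setOf_le_norm_of_isCompactOperator hv hK hκ
      (ε := (max r 1)⁻¹) (by positivity)).subset fun j hj => ?_
    have : (κ j)⁻¹ ≤ max r 1 := le_trans hj (le_max_left _ _)
    exact inv_le_of_inv_le₀ (hκpos j) this
  -- Decreasing eigenvalues are obtained by listing their inverses increasingly; compactness makes
  -- the sublevel sets of the inverses finite.
  obtain ⟨e, he⟩ := exists_equiv_nat_monotone (fun j => (κ j)⁻¹) hfinlev
  have hve : Orthonormal ℂ (v ∘ e) := hv.comp e e.injective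
  have hspan' : (Submodule.span ℂ (Set.range (v ∘ e)))ᗮ = ⊥ := by
    rwa [EquivLike.range_comp]
  refine ⟨HilbertBasis.mkOfOrthogonalEqBot hve hspan', κ ∘ e, fun i => hκpos _, ?_, ?_, ?_⟩
  · intro i j hij
    exact (inv_le_inv₀ (hκpos _) (hκpos _)).1 (he hij)
  · rw [Metric.tendsto_atTop]
    intro ε hε
    have hf := (finite_setOf_le_norm_of_isCompactOperator hv hK hκ hε).preimage
      (e.injective.injOn (s := e ⁻¹' {j | ε ≤ κ j}))
    obtain ⟨n, hn⟩ := hf.bddAbove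
    refine ⟨n + 1, fun m hm => ?_⟩
    have : m ∉ e ⁻¹' {j | ε ≤ κ j} := fun h => by have := hn h; omega
    have h2 : κ (e m) < ε := by simpa using this
    rw [Real.dist_eq, sub_zero, Function.comp_apply, abs_of_pos (hκpos _)]
    exact h2
  · intro i
    rw [HilbertBasis.coe_mkOfOrthogonalEqBot]
    exact hκ _

/-- `A` is diagonal in the Hilbert basis `ψ`, with eigenvalues `ev` in increasing order. -/
structure IsEigenbasis (A : E →ₗ.[ℂ] E) (ψ : HilbertBasis ℕ ℂ E) (ev : ℕ → ℝ) : Prop where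
  mono : Monotone ev
  eigen : ∀ i, ∃ h : ψ i ∈ A.domain, A ⟨ψ i, h⟩ = (ev i : ℂ) • ψ i
  inner_apply : ∀ (f : A.domain) i, ⟪ψ i, A f⟫_ℂ = ev i * ⟪ψ i, (f : E)⟫_ℂ
  spectrum_eq : opSpectrum A = Set.range fun i => (ev i : ℂ)

/-- `K` plays the part of `(A + c)⁻¹`: `hA` makes it a right inverse and `hdom` makes its range the
whole domain. Its eigenvectors are those of `A`, with eigenvalues `κ⁻¹ - c`, which tend to infinity
because `κ` tends to zero. Hence a point that is not an eigenvalue has positive distance from all of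
them and lies in the resolvent set. -/
theorem exists_isEigenbasis [CompleteSpace E] (hE : ¬ FiniteDimensional ℂ E)
    {K : E →L[ℂ] E} (hK : IsCompactOperator K)
    (hsym : (K : E →ₗ[ℂ] E).IsSymmetric) (hpos : ∀ x, x ≠ 0 → 0 < (⟪x, K x⟫_ℂ).re)
    (A : E →ₗ.[ℂ] E) (c : ℝ) (hA : ∀ g, ∃ h : K g ∈ A.domain, A ⟨K g, h⟩ = g - (c : ℂ) • K g)
    (hdom : ∀ f : A.domain, ∃ g, K g = f) :
    ∃ (ψ : HilbertBasis ℕ ℂ E) (ev : ℕ → ℝ), IsEigenbasis A ψ ev := by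
  obtain ⟨ψ, κ, hκ, hanti, hlim, hψ⟩ := exists_hilbertBasis_of_isCompactOperator hE hK hsym hpos
  let ev : ℕ → ℝ := fun i => (κ i)⁻¹ - c
  have hκc : ∀ i, (κ i : ℂ) ≠ 0 := fun i => by exact_mod_cast (hκ i).ne'
  have hKin : ∀ g i, ⟪ψ i, K g⟫_ℂ = κ i * ⟪ψ i, g⟫_ℂ := by
    intro g i
    have := hsym (ψ i) g
    rw [ContinuousLinearMap.coe_coe, hψ, inner_smul_left] at this
    simpa using this.symm
  have hin : ∀ (f : A.domain) i, ⟪ψ i, A f⟫_ℂ = ev i * ⟪ψ i, (f : E)⟫_ℂ := by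
    intro f i
    obtain ⟨g, hg⟩ := hdom f
    obtain ⟨h, hh⟩ := hA g
    have hf : f = ⟨K g, h⟩ := Subtype.ext hg.symm
    rw [hf, hh, inner_sub_right, inner_smul_right, hKin]
    have := hκc i
    simp only [ev]
    push_cast
    field_simp
  have heig : ∀ i, ∃ h : ψ i ∈ A.domain, A ⟨ψ i, h⟩ = (ev i : ℂ) • ψ i := by
    intro i
    obtain ⟨h, hh⟩ := hA ((κ i : ℂ)⁻¹ • ψ i)
    have h1 : K ((κ i : ℂ)⁻¹ • ψ i) = ψ i := by
      rw [map_smul, hψ, smul_smul, inv_mul_cancel₀ (hκc i), one_smul]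
    have h2 : ψ i ∈ A.domain := h1 ▸ h
    refine ⟨h2, ?_⟩
    have : (⟨ψ i, h2⟩ : A.domain) = ⟨K ((κ i : ℂ)⁻¹ • ψ i), h⟩ := Subtype.ext h1.symm
    rw [this, hh, h1, ← sub_smul]
    simp [ev]
  have hevlim : Tendsto ev atTop atTop := by
    have h1 : Tendsto (fun i => (κ i)⁻¹) atTop atTop :=
      (tendsto_nhdsWithin_iff.2 ⟨hlim, Eventually.of_forall hκ⟩).inv_tendsto_nhdsGT_zero
    exact tendsto_atTop_add_const_right _ (-c) h1
  have hmono : Monotone ev := fun i j hij => by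
    have := (inv_le_inv₀ (hκ i) (hκ j)).2 (hanti hij)
    simp only [ev]; linarith
  refine ⟨ψ, ev, hmono, heig, hin, ?_⟩
  ext z
  simp only [opSpectrum, Set.mem_ofPred_eq, Set.mem_range]
  constructor
  · intro hz
    by_contra hne
    push Not at hne
    apply hz
    -- the eigenvalues stay away from `z`
    obtain ⟨δ, hδ, hdist⟩ : ∃ δ > 0, ∀ i, δ ≤ ‖(ev i : ℂ) - z‖ := by
      obtain ⟨n, hn⟩ := (hevlim.eventually_ge_atTop (z.re + 1)).exists_forall_of_atTop
      have hpos : ∀ i, 0 < ‖(ev i : ℂ) - z‖ := fun i => norm_pos_iff.2 (sub_ne_zero.2 (hne i))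
      obtain ⟨i₀, -, hi₀⟩ := (Finset.range (n + 1)).exists_min_image
        (fun i => ‖(ev i : ℂ) - z‖) ⟨0, by simp⟩
      refine ⟨min 1 ‖(ev i₀ : ℂ) - z‖, lt_min one_pos (hpos _), fun i => ?_⟩
      rcases le_or_gt n i with hi | hi
      · refine (min_le_left _ _).trans ?_
        have h1 : (1 : ℝ) ≤ ((ev i : ℂ) - z).re := by
          have := hn i hi
          simp; linarith
        exact h1.trans (Complex.re_le_norm _)
      · exact (min_le_right _ _).trans (hi₀ i (by simp; omega))
    have hlow : ∀ f : A.domain, δ * ‖(f : E)‖ ≤ ‖A f - z • (f : E)‖ := by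
      intro f
      have hcoef : ∀ i, ψ.repr (A f - z • (f : E)) i = ((ev i : ℂ) - z) * ψ.repr (f : E) i := by
        intro i
        rw [ψ.repr_apply_apply, ψ.repr_apply_apply, inner_sub_right, inner_smul_right, hin]
        ring
      have e1 : ‖ψ.repr (A f - z • (f : E))‖ = ‖A f - z • (f : E)‖ := ψ.repr.norm_map _
      have e2 : ‖ψ.repr (f : E)‖ = ‖(f : E)‖ := ψ.repr.norm_map _
      rw [← e1, ← e2, ← abs_of_pos hδ, ← Real.norm_eq_abs, ← Complex.norm_real, ← norm_smul]
      refine lp.norm_mono (by norm_num) fun i => ?_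
      rw [hcoef, lp.coeFn_smul, Pi.smul_apply, norm_smul, norm_mul]
      refine mul_le_mul_of_nonneg_right ?_ (norm_nonneg _)
      rw [Complex.norm_real, Real.norm_eq_abs, abs_of_pos hδ]
      exact hdist i
    refine ⟨⟨?_, ?_⟩, δ⁻¹, fun f => ?_⟩
    · intro f₁ f₂ h
      have h0 := hlow (f₁ - f₂)
      have : A (f₁ - f₂) - z • ((f₁ - f₂ : A.domain) : E) = 0 := by
        rw [LinearPMap.map_sub, Submodule.coe_sub, smul_sub]
        have h' : A f₁ - z • (f₁ : E) = A f₂ - z • (f₂ : E) := h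
        rw [sub_sub_sub_comm, h', sub_self]
      rw [this, norm_zero] at h0
      have h1 : ‖((f₁ - f₂ : A.domain) : E)‖ = 0 :=
        le_antisymm (by nlinarith [norm_nonneg ((f₁ - f₂ : A.domain) : E)]) (norm_nonneg _)
      have h2 : ((f₁ - f₂ : A.domain) : E) = 0 := norm_eq_zero.1 h1
      exact sub_eq_zero.1 (Subtype.ext h2)
    · intro h
      -- multiply the coefficients by the bounded sequence `(ev i + c) / (ev i - z)`
      have hbd : ∀ i, ‖((ev i : ℂ) + c) / ((ev i : ℂ) - z)‖ ≤ 1 + ‖z + c‖ / δ := by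
        intro i
        have hne' : (ev i : ℂ) - z ≠ 0 := sub_ne_zero.2 (hne i)
        have : ((ev i : ℂ) + c) / ((ev i : ℂ) - z) = 1 + (z + c) / ((ev i : ℂ) - z) := by
          field_simp; ring
        rw [this]
        refine (norm_add_le _ _).trans ?_
        rw [norm_one, norm_div]
        gcongr
        exact hdist i
      have hmem : Memℓp (E := fun _ : ℕ => ℂ)
          (fun i => ((ev i : ℂ) + c) / ((ev i : ℂ) - z) * ψ.repr h i) 2 := by
        have h1 : Memℓp (E := fun _ : ℕ => ℂ) (((1 + ‖z + c‖ / δ : ℝ) : ℂ) • ⇑(ψ.repr h)) 2 :=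
          Memℓp.const_smul (lp.memℓp (ψ.repr h)) _
        refine h1.mono' (fun i => ?_)
        rw [Pi.smul_apply, norm_smul, norm_mul, Complex.norm_real, Real.norm_eq_abs,
          abs_of_nonneg (by positivity)]
        exact mul_le_mul_of_nonneg_right (hbd i) (norm_nonneg _)
      let g : E := ψ.repr.symm ⟨_, hmem⟩
      have hg : ∀ i, ⟪ψ i, g⟫_ℂ = ((ev i : ℂ) + c) / ((ev i : ℂ) - z) * ⟪ψ i, h⟫_ℂ := by
        intro i
        rw [← ψ.repr_apply_apply, ← ψ.repr_apply_apply]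
        simp only [g, LinearIsometryEquiv.apply_symm_apply]
      obtain ⟨hKg, hAg⟩ := hA g
      refine ⟨⟨K g, hKg⟩, ?_⟩
      apply ψ.repr.injective
      ext i
      rw [ψ.repr_apply_apply, ψ.repr_apply_apply]
      change ⟪ψ i, A ⟨K g, hKg⟩ - z • K g⟫_ℂ = _
      rw [inner_sub_right, hin, inner_smul_right]
      change (ev i : ℂ) * ⟪ψ i, K g⟫_ℂ - z * ⟪ψ i, K g⟫_ℂ = _
      rw [hKin, hg]
      have hne' : (ev i : ℂ) - z ≠ 0 := sub_ne_zero.2 (hne i)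
      have hec : (ev i : ℂ) + c = (κ i : ℂ)⁻¹ := by simp [ev]
      rw [hec]
      have := hκc i
      field_simp
    · rw [← mul_le_mul_iff_right₀ hδ, ← mul_assoc, mul_inv_cancel₀ hδ.ne', one_mul]
      exact hlow f
  · rintro ⟨i, rfl⟩ ⟨⟨hinj, -⟩, -⟩
    obtain ⟨h, hh⟩ := heig i
    have h0 : (⟨ψ i, h⟩ : A.domain) = 0 := by
      apply hinj
      simp [hh]
    have h1 : ψ i = 0 := congrArg Subtype.val h0
    exact ψ.orthonormal.ne_zero i h1

/-- A diagonalizable operator plus a bounded perturbation: if `A = R⁻¹ - c + V` with `R` compact,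
`R⁻¹ ≥ c` and `‖V‖ < c`, then `A` has an eigenbasis. -/
theorem exists_isEigenbasis_of_perturbation [CompleteSpace E] (hE : ¬ FiniteDimensional ℂ E)
    {R V : E →L[ℂ] E} (hR : IsCompactOperator R) (hRsym : (R : E →ₗ[ℂ] E).IsSymmetric)
    (hRinj : Function.Injective R) (hV : (V : E →ₗ[ℂ] E).IsSymmetric) {c : ℝ}
    (hRc : ∀ u, c * ‖R u‖ ^ 2 ≤ (⟪u, R u⟫_ℂ).re) (hVc : ‖V‖ < c) (A : E →ₗ.[ℂ] E)
    (hA : ∀ u, ∃ h : R u ∈ A.domain, A ⟨R u, h⟩ = u - (c : ℂ) • R u + V (R u))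
    (hdom : ∀ f : A.domain, ∃ u, R u = f) :
    ∃ (ψ : HilbertBasis ℕ ℂ E) (ev : ℕ → ℝ), IsEigenbasis A ψ ev := by
  have hc : 0 < c := (norm_nonneg V).trans_lt hVc
  have hRnorm : ‖R‖ ≤ c⁻¹ := by
    refine R.opNorm_le_bound (by positivity) fun u => ?_
    have h1 := (hRc u).trans ((Complex.re_le_norm _).trans (norm_inner_le_norm u (R u)))
    rcases (norm_nonneg (R u)).eq_or_lt with h0 | h0
    · rw [← h0]; positivity
    · rw [← mul_le_mul_iff_right₀ hc, ← mul_assoc, mul_inv_cancel₀ hc.ne', one_mul]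
      nlinarith
  have ht : ‖-(V * R)‖ < 1 := by
    rw [norm_neg]
    refine (norm_mul_le V R).trans_lt ?_
    calc ‖V‖ * ‖R‖ ≤ ‖V‖ * c⁻¹ := by gcongr
      _ < c * c⁻¹ := by gcongr
      _ = 1 := mul_inv_cancel₀ hc.ne'
  -- Since `(A + c) R u = u + V (R u)`, the operator `R (1 + V R)⁻¹` inverts `A + c`; the inverse of
  -- `1 + V R` is a Neumann series.
  let U := Units.oneSub (-(V * R)) ht
  have hUval : ∀ u, (U : E →L[ℂ] E) u = u + V (R u) := by
    intro u; simp [U]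
  let I : E →L[ℂ] E := (U⁻¹ : (E →L[ℂ] E)ˣ)
  have hUI : ∀ g, I g + V (R (I g)) = g := by
    intro g
    rw [← hUval]
    have : (U : E →L[ℂ] E) * I = 1 := U.mul_inv
    exact congrArg (fun T : E →L[ℂ] E => T g) this
  have hIU : ∀ u, I (u + V (R u)) = u := by
    intro u
    rw [← hUval]
    have : I * (U : E →L[ℂ] E) = 1 := U.inv_mul
    exact congrArg (fun T : E →L[ℂ] E => T u) this
  have hsymR : ∀ x y, ⟪R x, y⟫_ℂ = ⟪x, R y⟫_ℂ := fun x y => hRsym x y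
  have hsymV : ∀ x y, ⟪V x, y⟫_ℂ = ⟪x, V y⟫_ℂ := fun x y => hV x y
  refine exists_isEigenbasis hE (K := R.comp I) (hR.comp_clm I) ?_ ?_ A c ?_ ?_
  · intro g h
    change ⟪R (I g), h⟫_ℂ = ⟪g, R (I h)⟫_ℂ
    conv_lhs => rw [← hUI h]
    conv_rhs => rw [← hUI g]
    rw [inner_add_left, inner_add_right, hsymV, hsymR]
  · intro g hg
    have hI : I g ≠ 0 := fun h => hg (by rw [← hUI g, h]; simp)
    have hRI : R (I g) ≠ 0 := fun h => hI (hRinj (by rw [h, map_zero]))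
    change 0 < (⟪g, R (I g)⟫_ℂ).re
    have h0 : ⟪g, R (I g)⟫_ℂ = ⟪I g + V (R (I g)), R (I g)⟫_ℂ := by rw [hUI]
    rw [h0, inner_add_left, Complex.add_re, ← hsymR]
    have h1 := hRc (I g)
    rw [← hsymR] at h1
    -- The perturbation costs at most `‖V‖` times `‖R (I g)‖²`, while `hRc` provides `c` times it.
    have h2 : -(‖V‖ * ‖R (I g)‖ ^ 2) ≤ (⟪V (R (I g)), R (I g)⟫_ℂ).re := by
      have h3 := (Complex.abs_re_le_norm _).trans (norm_inner_le_norm (𝕜 := ℂ) (V (R (I g))) (R (I g)))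
      have h4 : ‖V (R (I g))‖ * ‖R (I g)‖ ≤ ‖V‖ * ‖R (I g)‖ ^ 2 := by
        rw [sq, ← mul_assoc]
        exact mul_le_mul_of_nonneg_right (V.le_opNorm _) (norm_nonneg _)
      linarith [neg_abs_le (⟪V (R (I g)), R (I g)⟫_ℂ).re]
    have h5 : 0 < ‖R (I g)‖ ^ 2 := by positivity
    nlinarith
  · intro g
    obtain ⟨h, hh⟩ := hA (I g)
    refine ⟨h, ?_⟩
    change A ⟨R (I g), h⟩ = g - (c : ℂ) • R (I g)
    rw [hh]
    conv_rhs => rw [← hUI g]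
    simp only [hIU]
    abel
  · intro f
    obtain ⟨u, hu⟩ := hdom f
    exact ⟨u + V (R u), by rw [ContinuousLinearMap.comp_apply, hIU, hu]⟩

theorem hasSum_norm_sq {ι : Type*} (ψ : HilbertBasis ι ℂ E) (f : E) :
    HasSum (fun i => ‖⟪ψ i, f⟫_ℂ‖ ^ 2) (‖f‖ ^ 2) := by
  have h := (Complex.hasSum_iff _ _).1 (ψ.hasSum_inner_mul_inner f f) |>.1
  have h1 : (⟪f, f⟫_ℂ).re = ‖f‖ ^ 2 := by
    rw [inner_self_eq_norm_sq_to_K]; norm_cast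
  rw [h1] at h
  refine h.congr_fun fun i => ?_
  rw [← inner_conj_symm f (ψ i), ← Complex.normSq_eq_conj_mul_self, Complex.ofReal_re,
    Complex.normSq_eq_norm_sq]

namespace IsEigenbasis

variable {A : E →ₗ.[ℂ] E} {ψ : HilbertBasis ℕ ℂ E} {ev : ℕ → ℝ}

theorem hasSum_re_inner (hA : IsEigenbasis A ψ ev) (f : A.domain) :
    HasSum (fun i => ev i * ‖⟪ψ i, (f : E)⟫_ℂ‖ ^ 2) (⟪(f : E), A f⟫_ℂ).re := by
  have h := (Complex.hasSum_iff _ _).1 (ψ.hasSum_inner_mul_inner (f : E) (A f)) |>.1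
  refine h.congr_fun fun i => ?_
  rw [hA.inner_apply, ← inner_conj_symm (f : E) (ψ i), mul_left_comm,
    ← Complex.normSq_eq_conj_mul_self, Complex.normSq_eq_norm_sq]
  norm_cast

/-- Half of the min-max principle: the expansion of `f` contains only eigenvalues from `ev i` on. -/
theorem le_re_inner_of_orthogonal (hA : IsEigenbasis A ψ ev) (f : A.domain) (i : ℕ)
    (hf : ∀ j < i, ⟪ψ j, (f : E)⟫_ℂ = 0) : ev i * ‖(f : E)‖ ^ 2 ≤ (⟪(f : E), A f⟫_ℂ).re := by
  refine hasSum_le (fun j => ?_) ((hasSum_norm_sq ψ (f : E)).mul_left (ev i)) (hA.hasSum_re_inner f)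
  rcases lt_or_ge j i with hj | hj
  · simp [hf j hj]
  · exact mul_le_mul_of_nonneg_right (hA.mono hj) (by positivity)

theorem groundStateEnergy_eq (hA : IsEigenbasis A ψ ev) : groundStateEnergy A = ev 0 := by
  obtain ⟨h, hh⟩ := hA.eigen 0
  refine IsLeast.csInf_eq ⟨⟨⟨ψ 0, h⟩, ψ.orthonormal.1 0, ?_⟩, ?_⟩
  · rw [hh, inner_smul_right, inner_self_eq_norm_sq_to_K, ψ.orthonormal.1 0]
    simp
  · rintro _ ⟨f, hf, rfl⟩
    have := hA.le_re_inner_of_orthogonal f 0 (fun j hj => absurd hj (Nat.not_lt_zero j))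
    rwa [hf, one_pow, mul_one] at this

/-- A nonzero vector in the kernel of `i` linear functionals on an `i + 1`-dimensional space. -/
theorem exists_ne_zero_forall_eq_zero {i : ℕ} (L : (Fin (i + 1) → ℂ) →ₗ[ℂ] (Fin i → ℂ)) :
    ∃ c, c ≠ 0 ∧ ∀ j, L c j = 0 := by
  have h : LinearMap.ker L ≠ ⊥ := LinearMap.ker_ne_bot_of_finrank_lt (by simp)
  obtain ⟨c, hc, hne⟩ := Submodule.exists_mem_ne_zero_of_ne_bot h
  exact ⟨c, hne, fun j => congrFun (LinearMap.mem_ker.1 hc) j⟩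

/-- The upper bound of the min-max principle. -/
theorem le_of_forall_re_inner_le (hA : IsEigenbasis A ψ ev) {i : ℕ} {b : ℝ}
    (F : (Fin (i + 1) → ℂ) →ₗ[ℂ] E) (hF : ∀ c, F c ∈ A.domain)
    (hne : ∀ c, c ≠ 0 → F c ≠ 0)
    (hb : ∀ c, (⟪F c, A ⟨F c, hF c⟩⟫_ℂ).re ≤ b * ‖F c‖ ^ 2) : ev i ≤ b := by
  obtain ⟨c, hc, h0⟩ := exists_ne_zero_forall_eq_zero
    ((LinearMap.pi fun j : Fin i => (innerSL ℂ (ψ j)).toLinearMap) ∘ₗ F)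
  have h1 := hA.le_re_inner_of_orthogonal ⟨F c, hF c⟩ i (fun j hj => h0 ⟨j, hj⟩)
  have h2 : 0 < ‖F c‖ ^ 2 := by have := hne c hc; positivity
  exact le_of_mul_le_mul_right (h1.trans (hb c)) h2

/-- Linear combinations of the first `i + 1` eigenvectors. -/
def lowSpan (ψ : HilbertBasis ℕ ℂ E) (i : ℕ) : (Fin (i + 1) → ℂ) →ₗ[ℂ] E :=
  Fintype.linearCombination ℂ (fun j : Fin (i + 1) => ψ j)

theorem lowSpan_apply (i : ℕ) (c : Fin (i + 1) → ℂ) : lowSpan ψ i c = ∑ j, c j • ψ j :=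
  Fintype.linearCombination_apply ..

theorem norm_sq_sum_smul (i : ℕ) (c : Fin (i + 1) → ℂ) :
    ‖∑ j, c j • ψ (j : ℕ)‖ ^ 2 = ∑ j, ‖c j‖ ^ 2 := by
  have ho : Orthonormal ℂ (fun j : Fin (i + 1) => ψ j) :=
    ψ.orthonormal.comp _ Fin.val_injective
  have h := ho.inner_sum c c Finset.univ
  rw [inner_self_eq_norm_sq_to_K] at h
  have h2 : ((‖∑ j, c j • ψ (j : ℕ)‖ ^ 2 : ℝ) : ℂ) = ((∑ j, ‖c j‖ ^ 2 : ℝ) : ℂ) := by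
    push_cast
    rw [show (((‖∑ j, c j • ψ (j : ℕ)‖ : ℝ) : ℂ)) ^ 2 = _ from h]
    refine Finset.sum_congr rfl fun j _ => ?_
    rw [← Complex.normSq_eq_conj_mul_self, Complex.normSq_eq_norm_sq]
    norm_cast
  exact_mod_cast h2

/-- The form bound alone would not do later: the number of excited particles is controlled in norm,
through the norm of `(A - ev 0) f`, so the second bound is recorded as well. -/
theorem lowSpan_spec (hA : IsEigenbasis A ψ ev) (i : ℕ) (c : Fin (i + 1) → ℂ) :
    ∃ h : lowSpan ψ i c ∈ A.domain,
      (⟪lowSpan ψ i c, A ⟨lowSpan ψ i c, h⟩⟫_ℂ).re ≤ ev i * ‖lowSpan ψ i c‖ ^ 2 ∧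
      ‖A ⟨lowSpan ψ i c, h⟩ - (ev 0 : ℂ) • lowSpan ψ i c‖ ≤ (ev i - ev 0) * ‖lowSpan ψ i c‖ := by
  have hmem : lowSpan ψ i c ∈ A.domain := by
    rw [lowSpan_apply]
    exact Submodule.sum_mem _ fun j _ => Submodule.smul_mem _ _ (hA.eigen j).1
  have hap : A ⟨lowSpan ψ i c, hmem⟩ = ∑ j : Fin (i + 1), ((ev j : ℂ) * c j) • ψ (j : ℕ) := by
    have : (⟨lowSpan ψ i c, hmem⟩ : A.domain)
        = ∑ j, c j • (⟨ψ (j : ℕ), (hA.eigen j).1⟩ : A.domain) := by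
      apply Subtype.ext
      rw [AddSubmonoidClass.coe_finsetSum]
      exact lowSpan_apply i c
    rw [this]
    change A.toFun _ = _
    rw [map_sum]
    refine Finset.sum_congr rfl fun j _ => ?_
    rw [map_smul]
    change c j • A ⟨ψ (j : ℕ), (hA.eigen j).1⟩ = _
    rw [(hA.eigen j).2, smul_smul, mul_comm]
  refine ⟨hmem, ?_, ?_⟩
  · have ho : Orthonormal ℂ (fun j : Fin (i + 1) => ψ j) :=
      ψ.orthonormal.comp _ Fin.val_injective
    rw [hap, lowSpan_apply, norm_sq_sum_smul, ho.inner_sum c _ Finset.univ, Complex.re_sum,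
      Finset.mul_sum]
    refine Finset.sum_le_sum fun j _ => ?_
    rw [mul_left_comm, ← Complex.normSq_eq_conj_mul_self, Complex.normSq_eq_norm_sq,
      ← Complex.ofReal_mul, Complex.ofReal_re]
    exact mul_le_mul_of_nonneg_right (hA.mono (Nat.lt_succ_iff.1 j.2)) (by positivity)
  · have h0 : 0 ≤ ev i - ev 0 := sub_nonneg.2 (hA.mono (Nat.zero_le i))
    have hdiff : A ⟨lowSpan ψ i c, hmem⟩ - (ev 0 : ℂ) • lowSpan ψ i c
        = ∑ j : Fin (i + 1), (((ev j - ev 0 : ℝ) : ℂ) * c j) • ψ (j : ℕ) := by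
      rw [hap, lowSpan_apply, Finset.smul_sum, ← Finset.sum_sub_distrib]
      refine Finset.sum_congr rfl fun j _ => ?_
      rw [smul_smul, ← sub_smul]
      push_cast
      ring_nf
    refine le_of_sq_le_sq ?_ (by positivity)
    rw [hdiff, norm_sq_sum_smul, mul_pow, lowSpan_apply, norm_sq_sum_smul, Finset.mul_sum]
    refine Finset.sum_le_sum fun j _ => ?_
    rw [norm_mul, mul_pow, Complex.norm_real, Real.norm_eq_abs, sq_abs]
    have h1 : 0 ≤ ev j - ev 0 := sub_nonneg.2 (hA.mono (Nat.zero_le _))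
    have h2 : ev j ≤ ev i := hA.mono (Nat.lt_succ_iff.1 j.2)
    gcongr

end IsEigenbasis

end CompactResolvent

/-! ### Square summable functions -/

section SqSum

open ComplexConjugate

variable {X Y : Type*}

/-- Square summability of a complex function on a discrete set. -/
def SqSum (f : X → ℂ) : Prop := Summable fun x => ‖f x‖ ^ 2

/-- The squared `ℓ²` norm. -/
def nsq (f : X → ℂ) : ℝ := ∑' x, ‖f x‖ ^ 2

/-- The `ℓ²` inner product. -/
def ip (f g : X → ℂ) : ℂ := ∑' x, conj (f x) * g x

theorem nsq_nonneg (f : X → ℂ) : 0 ≤ nsq f := tsum_nonneg fun _ => by positivity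

/-- Creation and annihilation operators are unbounded on `ℓ²` but defined on all functions, so bare
functions are used and summability is a separate predicate. Facts about the Hilbert space are
transported through this equivalence. -/
theorem sqSum_iff_memℓp {f : X → ℂ} : SqSum f ↔ Memℓp (E := fun _ : X => ℂ) f 2 := by
  rw [memℓp_gen_iff (by norm_num), SqSum]
  norm_num

theorem lp_sqSum (f : lp (fun _ : X => ℂ) 2) : SqSum (f : X → ℂ) := sqSum_iff_memℓp.2 (lp.memℓp f)

/-- A square summable function as an element of the Hilbert space `ℓ²`. -/
def SqSum.toLp {f : X → ℂ} (hf : SqSum f) : lp (fun _ : X => ℂ) 2 := ⟨f, sqSum_iff_memℓp.1 hf⟩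

@[simp] theorem SqSum.toLp_apply {f : X → ℂ} (hf : SqSum f) (x : X) : hf.toLp x = f x := rfl

theorem lp_norm_sq (f : lp (fun _ : X => ℂ) 2) : ‖f‖ ^ 2 = nsq (f : X → ℂ) := by
  have := lp.norm_rpow_eq_tsum (p := 2) (by norm_num) f
  norm_num at this
  exact this

theorem SqSum.norm_toLp_sq {f : X → ℂ} (hf : SqSum f) : ‖hf.toLp‖ ^ 2 = nsq f := lp_norm_sq _

theorem SqSum.norm_toLp {f : X → ℂ} (hf : SqSum f) : ‖hf.toLp‖ = √(nsq f) := by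
  rw [← hf.norm_toLp_sq, Real.sqrt_sq (norm_nonneg _)]

theorem lp_inner (f g : lp (fun _ : X => ℂ) 2) : ⟪f, g⟫_ℂ = ip (f : X → ℂ) g := by
  rw [lp.inner_eq_tsum]
  exact tsum_congr fun x => by rw [RCLike.inner_apply, mul_comm]

theorem SqSum.inner_toLp {f g : X → ℂ} (hf : SqSum f) (hg : SqSum g) :
    ⟪hf.toLp, hg.toLp⟫_ℂ = ip f g := lp_inner _ _

theorem SqSum.add {f g : X → ℂ} (hf : SqSum f) (hg : SqSum g) : SqSum (f + g) :=
  sqSum_iff_memℓp.2 ((sqSum_iff_memℓp.1 hf).add (sqSum_iff_memℓp.1 hg))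

theorem SqSum.smul {f : X → ℂ} (hf : SqSum f) (c : ℂ) : SqSum (c • f) :=
  sqSum_iff_memℓp.2 ((sqSum_iff_memℓp.1 hf).const_smul c)

theorem SqSum.sub {f g : X → ℂ} (hf : SqSum f) (hg : SqSum g) : SqSum (f - g) :=
  sqSum_iff_memℓp.2 ((sqSum_iff_memℓp.1 hf).sub (sqSum_iff_memℓp.1 hg))

theorem SqSum.zero : SqSum (0 : X → ℂ) := sqSum_iff_memℓp.2 (zero_memℓp)

theorem SqSum.mono {f : X → ℂ} {g : Y → ℂ} {e : X → Y} (he : Function.Injective e) (hg : SqSum g)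
    (h : ∀ x, ‖f x‖ ≤ ‖g (e x)‖) : SqSum f :=
  Summable.of_nonneg_of_le (fun _ => by positivity)
    (fun x => pow_le_pow_left₀ (norm_nonneg _) (h x) 2) (hg.comp_injective he)

theorem SqSum.of_le {f g : X → ℂ} (hg : SqSum g) (h : ∀ x, ‖f x‖ ≤ ‖g x‖) : SqSum f :=
  hg.mono Function.injective_id h

theorem nsq_mono {f g : X → ℂ} (hg : SqSum g) (h : ∀ x, ‖f x‖ ≤ ‖g x‖) : nsq f ≤ nsq g :=
  (hg.of_le h).tsum_le_tsum (fun x => pow_le_pow_left₀ (norm_nonneg _) (h x) 2) hg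

theorem SqSum.summable_mul {f g : X → ℂ} (hf : SqSum f) (hg : SqSum g) :
    Summable fun x => conj (f x) * g x := by
  have := lp.summable_inner (𝕜 := ℂ) hf.toLp hg.toLp
  refine this.congr fun x => ?_
  rw [RCLike.inner_apply, mul_comm]; rfl

theorem norm_ip_le {f g : X → ℂ} (hf : SqSum f) (hg : SqSum g) :
    ‖ip f g‖ ≤ √(nsq f) * √(nsq g) := by
  rw [← hf.inner_toLp hg, ← hf.norm_toLp, ← hg.norm_toLp]
  exact norm_inner_le_norm _ _

theorem ip_self (f : X → ℂ) : ip f f = (nsq f : ℂ) := by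
  rw [ip, nsq, Complex.ofReal_tsum]
  refine tsum_congr fun x => ?_
  rw [← Complex.normSq_eq_conj_mul_self, Complex.normSq_eq_norm_sq]

theorem ip_conj (f g : X → ℂ) : conj (ip f g) = ip g f := by
  rw [ip, ip, Complex.conj_tsum]
  exact tsum_congr fun x => by simp [mul_comm]

theorem re_ip_comm (f g : X → ℂ) : (ip f g).re = (ip g f).re := by
  rw [← ip_conj f g, Complex.conj_re]

theorem ip_add_right {f g h : X → ℂ} (hf : SqSum f) (hg : SqSum g) (hh : SqSum h) :
    ip f (g + h) = ip f g + ip f h := by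
  simp only [ip, Pi.add_apply, mul_add]
  exact (hf.summable_mul hg).tsum_add (hf.summable_mul hh)

theorem ip_add_left {f g h : X → ℂ} (hf : SqSum f) (hg : SqSum g) (hh : SqSum h) :
    ip (f + g) h = ip f h + ip g h := by
  simp only [ip, Pi.add_apply, map_add, add_mul]
  exact (hf.summable_mul hh).tsum_add (hg.summable_mul hh)

theorem ip_smul_right (c : ℂ) (f g : X → ℂ) : ip f (c • g) = c * ip f g := by
  simp only [ip, Pi.smul_apply, smul_eq_mul, mul_left_comm _ c, tsum_mul_left]

theorem ip_smul_left (c : ℂ) (f g : X → ℂ) : ip (c • f) g = conj c * ip f g := by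
  simp only [ip, Pi.smul_apply, smul_eq_mul, map_mul, mul_assoc, tsum_mul_left]

@[simp] theorem ip_zero_right (g : X → ℂ) : ip g 0 = 0 := by simp [ip]

theorem nsq_smul (c : ℂ) (f : X → ℂ) : nsq (c • f) = ‖c‖ ^ 2 * nsq f := by
  simp only [nsq, Pi.smul_apply, smul_eq_mul, norm_mul, mul_pow, tsum_mul_left]

@[simp] theorem nsq_zero : nsq (0 : X → ℂ) = 0 := by simp [nsq]

theorem nsq_add {f g : X → ℂ} (hf : SqSum f) (hg : SqSum g) :
    nsq (f + g) = nsq f + 2 * (ip f g).re + nsq g := by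
  have h := ip_self (f + g)
  rw [ip_add_left hf hg (hf.add hg), ip_add_right hf hf hg, ip_add_right hg hf hg, ip_self,
    ip_self] at h
  have := congrArg Complex.re h
  simp only [Complex.add_re, Complex.ofReal_re] at this
  rw [re_ip_comm g f] at this
  linarith

theorem sqrt_nsq_add_le {f g : X → ℂ} (hf : SqSum f) (hg : SqSum g) :
    √(nsq (f + g)) ≤ √(nsq f) + √(nsq g) := by
  rw [← hf.norm_toLp, ← hg.norm_toLp, ← (hf.add hg).norm_toLp]
  exact norm_add_le hf.toLp hg.toLp

theorem norm_sq_le_nsq {f : X → ℂ} (hf : SqSum f) (x : X) : ‖f x‖ ^ 2 ≤ nsq f :=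
  hf.le_tsum x fun _ _ => by positivity

theorem nsq_eq_zero_iff {f : X → ℂ} (hf : SqSum f) : nsq f = 0 ↔ f = 0 := by
  refine ⟨fun h => funext fun x => ?_, fun h => by simp [h]⟩
  have := norm_sq_le_nsq hf x
  rw [h] at this
  simpa using le_antisymm this (by positivity)

theorem sqSum_of_finite_support {f : X → ℂ} (hf : f.support.Finite) : SqSum f :=
  summable_of_hasFiniteSupport (hf.subset fun x hx => by
    simpa using hx)

theorem sqSum_finset_sum {ι : Type*} (s : Finset ι) {f : ι → X → ℂ} (hf : ∀ i ∈ s, SqSum (f i)) :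
    SqSum (∑ i ∈ s, f i) := by
  classical
  induction s using Finset.induction_on with
  | empty => simpa using SqSum.zero
  | insert a s ha ih =>
    rw [Finset.sum_insert ha]
    exact (hf a (by simp)).add (ih fun i hi => hf i (by simp [hi]))

theorem sqrt_nsq_finset_sum_le {ι : Type*} (s : Finset ι) {f : ι → X → ℂ}
    (hf : ∀ i ∈ s, SqSum (f i)) : √(nsq (∑ i ∈ s, f i)) ≤ ∑ i ∈ s, √(nsq (f i)) := by
  classical
  induction s using Finset.induction_on with
  | empty => simp
  | insert a s ha ih =>
    rw [Finset.sum_insert ha, Finset.sum_insert ha]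
    have h1 : ∀ i ∈ s, SqSum (f i) := fun i hi => hf i (by simp [hi])
    exact (sqrt_nsq_add_le (hf a (by simp)) (sqSum_finset_sum s h1)).trans
      (by linarith [ih h1])

/-- A linear map preserving squared norms preserves inner products. -/
theorem ip_map_of_nsq_map (L : (X → ℂ) →ₗ[ℂ] (Y → ℂ)) (M : (X → ℂ) →ₗ[ℂ] (X → ℂ))
    (hM : ∀ f, SqSum f → SqSum (M f))
    (hL : ∀ f, SqSum f → SqSum (L f) ∧ nsq (L f) = nsq (M f)) {f g : X → ℂ} (hf : SqSum f)
    (hg : SqSum g) : ip (L f) (L g) = ip (M f) (M g) := by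
  have hre : ∀ f g : X → ℂ, SqSum f → SqSum g → (ip (L f) (L g)).re = (ip (M f) (M g)).re := by
    intro f g hf hg
    have h1 := nsq_add (hL f hf).1 (hL g hg).1
    have h2 := nsq_add (hM f hf) (hM g hg)
    rw [← map_add, (hL _ (hf.add hg)).2, (hL _ hf).2, (hL _ hg).2] at h1
    rw [← map_add] at h2
    linarith
  apply Complex.ext (hre f g hf hg)
  -- Polarization: the imaginary part is the real part with `g` multiplied by `Complex.I`.
  have h := hre f (Complex.I • g) hf (hg.smul _)
  rw [map_smul, map_smul, ip_smul_right, ip_smul_right] at h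
  simpa using h

end SqSum

/-! ### Ladder operators -/

section Ladder

open ComplexConjugate

variable {P : Type*}

/-- Induction over occupation numbers, adding one particle at a time. -/
theorem occupation_induction {motive : (P →₀ ℕ) → Prop} (h0 : motive 0)
    (hadd : ∀ n p, motive n → motive (n + Finsupp.single p 1)) (n : P →₀ ℕ) : motive n := by
  classical
  obtain ⟨s, rfl⟩ := (Multiset.toFinsupp (α := P)).surjective n
  induction s using Multiset.induction_on with
  | empty => simpa using h0
  | cons p s ih =>
    rw [← Multiset.singleton_add, Multiset.toFinsupp_add, Multiset.toFinsupp_singleton, add_comm]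
    exact hadd _ _ ih

theorem sub_single_add_single {n : P →₀ ℕ} {p : P} (h : n p ≠ 0) :
    n - Finsupp.single p 1 + Finsupp.single p 1 = n :=
  tsub_add_cancel_of_le (Finsupp.single_le_iff.2 (Nat.one_le_iff_ne_zero.2 h))

theorem add_single_apply_of_ne (n : P →₀ ℕ) {p q : P} (h : p ≠ q) :
    (n + Finsupp.single p 1 : P →₀ ℕ) q = n q := by
  rw [Finsupp.add_apply, Finsupp.single_eq_of_ne h.symm, add_zero]

theorem sub_single_apply_of_ne (n : P →₀ ℕ) {p q : P} (h : p ≠ q) :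
    (n - Finsupp.single p 1 : P →₀ ℕ) q = n q := by
  rw [Finsupp.tsub_apply, Finsupp.single_eq_of_ne h.symm, tsub_zero]

theorem add_single_apply_self (n : P →₀ ℕ) (p : P) :
    (n + Finsupp.single p 1 : P →₀ ℕ) p = n p + 1 := by
  rw [Finsupp.add_apply, Finsupp.single_eq_same]

theorem add_single_sub_single {n : P →₀ ℕ} {p q : P} (h : n q ≠ 0) :
    n + Finsupp.single p 1 - Finsupp.single q 1 = n - Finsupp.single q 1 + Finsupp.single p 1 :=
  (tsub_add_eq_add_tsub (Finsupp.single_le_iff.2 (Nat.one_le_iff_ne_zero.2 h))).symm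

theorem degree_add_single (n : P →₀ ℕ) (p : P) : (n + Finsupp.single p 1).degree = n.degree + 1 := by
  rw [map_add, Finsupp.degree_single]

/-- The annihilation operator of the mode `p`. -/
def ann (p : P) : ((P →₀ ℕ) → ℂ) →ₗ[ℂ] ((P →₀ ℕ) → ℂ) where
  toFun f n := (√((n p : ℝ) + 1) : ℝ) * f (n + Finsupp.single p 1)
  map_add' f g := by ext n; simp [mul_add]
  map_smul' c f := by ext n; simp [mul_left_comm]

/-- The creation operator of the mode `p`. -/
def cre (p : P) : ((P →₀ ℕ) → ℂ) →ₗ[ℂ] ((P →₀ ℕ) → ℂ) where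
  toFun f n := (√(n p : ℝ) : ℝ) * f (n - Finsupp.single p 1)
  map_add' f g := by ext n; simp [mul_add]
  map_smul' c f := by ext n; simp [mul_left_comm]

theorem ann_apply (p : P) (f : (P →₀ ℕ) → ℂ) (n : P →₀ ℕ) :
    ann p f n = (√((n p : ℝ) + 1) : ℝ) * f (n + Finsupp.single p 1) := rfl

theorem cre_apply (p : P) (f : (P →₀ ℕ) → ℂ) (n : P →₀ ℕ) :
    cre p f n = (√(n p : ℝ) : ℝ) * f (n - Finsupp.single p 1) := rfl

/-- The canonical commutation relations hold for arbitrary functions, because each value of `ann p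
f` or `cre p f` involves a single value of `f`. The truncated subtraction at `n p = 0` is harmless
since the prefactor `√(n p)` vanishes there. -/
theorem ann_cre_self (p : P) (f : (P →₀ ℕ) → ℂ) : ann p (cre p f) = cre p (ann p f) + f := by
  ext n
  rw [Pi.add_apply, ann_apply, cre_apply, cre_apply, ann_apply, add_single_apply_self,
    add_tsub_cancel_right]
  push_cast
  rw [← mul_assoc, ← Complex.ofReal_mul, Real.mul_self_sqrt (by positivity)]
  rcases eq_or_ne (n p) 0 with h | h
  · simp [h]
  · rw [sub_single_add_single h, Pi.sub_apply, Finsupp.single_eq_same,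
      Nat.cast_sub (Nat.one_le_iff_ne_zero.2 h), Nat.cast_one, sub_add_cancel, ← mul_assoc,
      ← Complex.ofReal_mul, Real.mul_self_sqrt (by positivity)]
    push_cast; ring

theorem ann_cre_of_ne {p q : P} (h : p ≠ q) (f : (P →₀ ℕ) → ℂ) :
    ann p (cre q f) = cre q (ann p f) := by
  ext n
  rw [ann_apply, cre_apply, cre_apply, ann_apply, add_single_apply_of_ne n h,
    sub_single_apply_of_ne n h.symm]
  rcases eq_or_ne (n q) 0 with h0 | h0
  · simp [h0]
  · rw [add_single_sub_single h0]; ring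

theorem ann_comm (p q : P) (f : (P →₀ ℕ) → ℂ) : ann p (ann q f) = ann q (ann p f) := by
  rcases eq_or_ne p q with rfl | h
  · rfl
  ext n
  rw [ann_apply, ann_apply, ann_apply, ann_apply, add_single_apply_of_ne n h,
    add_single_apply_of_ne n h.symm, add_right_comm]
  ring

theorem cre_comm (p q : P) (f : (P →₀ ℕ) → ℂ) : cre p (cre q f) = cre q (cre p f) := by
  rcases eq_or_ne p q with rfl | h
  · rfl
  ext n
  rw [cre_apply, cre_apply, cre_apply, cre_apply, sub_single_apply_of_ne n h,
    sub_single_apply_of_ne n h.symm, tsub_right_comm]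
  ring

/-- Reindexing a sum over occupations with at least one particle in the mode `p`. -/
theorem hasSum_add_single_iff {M : Type*} [AddCommMonoid M] [TopologicalSpace M] (p : P)
    {h : (P →₀ ℕ) → M} (h0 : ∀ n, n p = 0 → h n = 0) {a : M} :
    HasSum (fun n => h (n + Finsupp.single p 1)) a ↔ HasSum h a := by
  refine Function.Injective.hasSum_iff (add_left_injective (Finsupp.single p 1)) fun n hn => ?_
  by_contra hne
  exact hn ⟨n - Finsupp.single p 1, sub_single_add_single fun h => hne (h0 n h)⟩

theorem tsum_add_single {M : Type*} [AddCommMonoid M] [TopologicalSpace M] [T2Space M] (p : P)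
    {h : (P →₀ ℕ) → M} (h0 : ∀ n, n p = 0 → h n = 0) :
    ∑' n, h (n + Finsupp.single p 1) = ∑' n, h n := by
  refine Function.Injective.tsum_eq (add_left_injective (Finsupp.single p 1)) fun n hn => ?_
  exact ⟨n - Finsupp.single p 1, sub_single_add_single fun h => hn (h0 n h)⟩

/-- Creation and annihilation operators are adjoint to each other. -/
theorem ip_cre_left (p : P) (f g : (P →₀ ℕ) → ℂ) : ip (cre p f) g = ip f (ann p g) := by
  -- Adjointness is a mere reindexing of one series, so no summability is needed.
  rw [ip, ip, ← tsum_add_single p (h := fun n => conj (cre p f n) * g n)]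
  · refine tsum_congr fun n => ?_
    rw [cre_apply, ann_apply, add_single_apply_self, add_tsub_cancel_right, map_mul,
      Complex.conj_ofReal]
    push_cast
    ring
  · intro n hn
    simp [cre_apply, hn]

theorem ip_ann_left (p : P) (f g : (P →₀ ℕ) → ℂ) : ip (ann p f) g = ip f (cre p g) := by
  rw [← ip_conj, ← ip_cre_left, ip_conj]

theorem norm_ann_sq (p : P) (f : (P →₀ ℕ) → ℂ) (n : P →₀ ℕ) :
    ‖ann p f n‖ ^ 2 = ((n p : ℝ) + 1) * ‖f (n + Finsupp.single p 1)‖ ^ 2 := by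
  rw [ann_apply, norm_mul, mul_pow, Complex.norm_real, Real.norm_eq_abs, sq_abs,
    Real.sq_sqrt (by positivity)]

theorem norm_cre_sq (p : P) (f : (P →₀ ℕ) → ℂ) (n : P →₀ ℕ) :
    ‖cre p f n‖ ^ 2 = (n p : ℝ) * ‖f (n - Finsupp.single p 1)‖ ^ 2 := by
  rw [cre_apply, norm_mul, mul_pow, Complex.norm_real, Real.norm_eq_abs, sq_abs,
    Real.sq_sqrt (by positivity)]

/-- Weighted sums of `‖a_p f‖²`. -/
theorem hasSum_ann_sq_iff (p : P) (f : (P →₀ ℕ) → ℂ) (w : (P →₀ ℕ) → ℝ) {a : ℝ} :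
    HasSum (fun n => w (n + Finsupp.single p 1) * ‖ann p f n‖ ^ 2) a ↔
      HasSum (fun n => w n * ((n p : ℝ) * ‖f n‖ ^ 2)) a := by
  rw [← hasSum_add_single_iff p (h := fun n => w n * ((n p : ℝ) * ‖f n‖ ^ 2))]
  · simp only [norm_ann_sq, add_single_apply_self, Nat.cast_add, Nat.cast_one]
  · intro n hn; simp [hn]

theorem nsq_ann (p : P) (f : (P →₀ ℕ) → ℂ) : nsq (ann p f) = ∑' n, (n p : ℝ) * ‖f n‖ ^ 2 := by
  rw [nsq, ← tsum_add_single p (h := fun n : P →₀ ℕ => (n p : ℝ) * ‖f n‖ ^ 2)]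
  · simp only [norm_ann_sq, add_single_apply_self, Nat.cast_add, Nat.cast_one]
  · intro n hn; simp [hn]

theorem apply_le_degree (n : P →₀ ℕ) (p : P) : (n p : ℝ) ≤ n.degree := by
  exact_mod_cast Finsupp.le_degree p n

/-- Functions all of whose particle number moments are finite. -/
def rapid (P : Type*) : Submodule ℂ ((P →₀ ℕ) → ℂ) where
  carrier := {f | ∀ k : ℕ, Summable fun n => ((n.degree : ℝ) + 1) ^ k * ‖f n‖ ^ 2}
  zero_mem' := fun k => by simp
  add_mem' := fun {f g} hf hg k => by
    refine Summable.of_nonneg_of_le (fun n => by positivity) (fun n => ?_)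
      (((hf k).add (hg k)).mul_left 2)
    have h : ‖f n + g n‖ ^ 2 ≤ 2 * (‖f n‖ ^ 2 + ‖g n‖ ^ 2) := by
      have h1 := norm_add_le (f n) (g n)
      have h2 : ‖f n + g n‖ ^ 2 ≤ (‖f n‖ + ‖g n‖) ^ 2 := by gcongr
      nlinarith [sq_nonneg (‖f n‖ - ‖g n‖)]
    have h3 : (0 : ℝ) ≤ ((n.degree : ℝ) + 1) ^ k := by positivity
    rw [Pi.add_apply]
    nlinarith
  smul_mem' := fun c f hf k => by
    refine ((hf k).mul_left (‖c‖ ^ 2)).congr fun n => ?_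
    rw [Pi.smul_apply, smul_eq_mul, norm_mul]; ring

theorem rapid_sqSum {f : (P →₀ ℕ) → ℂ} (hf : f ∈ rapid P) : SqSum f := by
  simpa [SqSum] using hf 0

/-- A ladder operator costs one power of the particle number. Hence functions with all moments form
a common domain, invariant under polynomials in the ladder operators. -/
theorem ann_mem_rapid {f : (P →₀ ℕ) → ℂ} (hf : f ∈ rapid P) (p : P) : ann p f ∈ rapid P := by
  intro k
  have h1 : Summable fun n : P →₀ ℕ => ((n.degree : ℝ) + 1) ^ k * ((n p : ℝ) * ‖f n‖ ^ 2) := by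
    refine Summable.of_nonneg_of_le (fun n => by positivity) (fun n => ?_) (hf (k + 1))
    rw [pow_succ _ k, mul_assoc]
    have := apply_le_degree n p
    gcongr
    linarith
  obtain ⟨a, ha⟩ := h1
  have h2 := ((hasSum_ann_sq_iff p f (fun n => ((n.degree : ℝ) + 1) ^ k)).2 ha).summable
  refine Summable.of_nonneg_of_le (fun n => by positivity) (fun n => ?_) h2
  rw [degree_add_single]
  push_cast
  gcongr
  linarith

theorem cre_mem_rapid {f : (P →₀ ℕ) → ℂ} (hf : f ∈ rapid P) (p : P) : cre p f ∈ rapid P := by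
  intro k
  have h1 : Summable fun n : P →₀ ℕ =>
      (((n + Finsupp.single p 1).degree : ℝ) + 1) ^ k * ‖cre p f (n + Finsupp.single p 1)‖ ^ 2 := by
    refine Summable.of_nonneg_of_le (fun n => by positivity) (fun n => ?_)
      ((hf (k + 1)).mul_left (2 ^ k))
    rw [norm_cre_sq, add_tsub_cancel_right, add_single_apply_self, degree_add_single, pow_succ _ k,
      mul_assoc, ← mul_assoc (2 ^ k), ← mul_pow]
    have := apply_le_degree n p
    push_cast
    gcongr
    linarith [(Nat.cast_nonneg n.degree : (0 : ℝ) ≤ n.degree)]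
  obtain ⟨a, ha⟩ := h1
  refine ((hasSum_add_single_iff p (h := fun n : P →₀ ℕ =>
    ((n.degree : ℝ) + 1) ^ k * ‖cre p f n‖ ^ 2) ?_).1 ha).summable
  intro n hn
  simp [norm_cre_sq, hn]

end Ladder

/-! ### Bogoliubov transformations -/

/-- The parameters `cosh θ_p`, `sinh θ_p` of a Bogoliubov transformation mixing the modes `p` and
`-p`, for `p` in a finite set. -/
structure Bogoliubov (P : Type*) [InvolutiveNeg P] where
  ch : P → ℝ
  sh : P → ℝ
  modes : Finset P
  neg_ne : ∀ p : P, -p ≠ p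
  ch_pos : ∀ p, 0 < ch p
  ch_sq : ∀ p, ch p ^ 2 = 1 + sh p ^ 2
  ch_neg : ∀ p, ch (-p) = ch p
  sh_neg : ∀ p, sh (-p) = sh p
  sh_eq_zero : ∀ p, p ∉ modes → sh p = 0

namespace Bogoliubov

open ComplexConjugate

variable {P : Type*} [InvolutiveNeg P] (D : Bogoliubov P)

/-- The inverse transformation. -/
@[simps] def flip : Bogoliubov P where
  ch := D.ch
  sh := fun p => -D.sh p
  modes := D.modes
  neg_ne := D.neg_ne
  ch_pos := D.ch_pos
  ch_sq := fun p => by rw [neg_sq]; exact D.ch_sq p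
  ch_neg := D.ch_neg
  sh_neg := fun p => by rw [D.sh_neg]
  sh_eq_zero := fun p hp => by rw [D.sh_eq_zero p hp, neg_zero]

/-- The transformed annihilation operators. -/
def an (p : P) : ((P →₀ ℕ) → ℂ) →ₗ[ℂ] ((P →₀ ℕ) → ℂ) :=
  (D.ch p : ℂ) • ann p + (D.sh p : ℂ) • cre (-p)

/-- The transformed creation operators. -/
def cr (p : P) : ((P →₀ ℕ) → ℂ) →ₗ[ℂ] ((P →₀ ℕ) → ℂ) :=
  (D.ch p : ℂ) • cre p + (D.sh p : ℂ) • ann (-p)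

theorem an_apply (p : P) (f : (P →₀ ℕ) → ℂ) :
    D.an p f = (D.ch p : ℂ) • ann p f + (D.sh p : ℂ) • cre (-p) f := rfl

theorem cr_apply (p : P) (f : (P →₀ ℕ) → ℂ) :
    D.cr p f = (D.ch p : ℂ) • cre p f + (D.sh p : ℂ) • ann (-p) f := rfl

theorem ch_sq_sub (p : P) : (D.ch p : ℂ) * D.ch p - D.sh p * D.sh p = 1 := by
  have h := D.ch_sq p
  have h2 : D.ch p * D.ch p - D.sh p * D.sh p = 1 := by nlinarith
  exact_mod_cast h2

theorem ann_eq (p : P) (f : (P →₀ ℕ) → ℂ) :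
    ann p f = (D.ch p : ℂ) • D.an p f - (D.sh p : ℂ) • D.cr (-p) f := by
  rw [an_apply, cr_apply, D.ch_neg, D.sh_neg, neg_neg]
  have h := D.ch_sq_sub p
  ext n
  simp only [Pi.add_apply, Pi.sub_apply, Pi.smul_apply, smul_eq_mul]
  linear_combination (-(ann p f n)) * h

theorem cre_eq (p : P) (f : (P →₀ ℕ) → ℂ) :
    cre p f = (D.ch p : ℂ) • D.cr p f - (D.sh p : ℂ) • D.an (-p) f := by
  rw [an_apply, cr_apply, D.ch_neg, D.sh_neg, neg_neg]
  have h := D.ch_sq_sub p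
  ext n
  simp only [Pi.add_apply, Pi.sub_apply, Pi.smul_apply, smul_eq_mul]
  linear_combination (-(cre p f n)) * h

/-- Only `p = -q` is delicate: there the commutators of the modes `q` and `-q` contribute `ch * sh`
with opposite signs and cancel, because both parameters are even in the momentum. -/
theorem cr_comm (p q : P) (f : (P →₀ ℕ) → ℂ) : D.cr p (D.cr q f) = D.cr q (D.cr p f) := by
  simp only [cr_apply, map_add, map_smul]
  have h1 := cre_comm p q f
  have h2 := ann_comm (-p) (-q) f
  rcases eq_or_ne p (-q) with rfl | h
  · have h3 := ann_cre_self q f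
    have h4 := ann_cre_self (-q) f
    rw [neg_neg] at h2 ⊢
    rw [h1, h2, h3, h4, D.ch_neg, D.sh_neg]
    ext n
    simp only [Pi.add_apply, Pi.smul_apply, smul_eq_mul]
    ring
  · have h' : -p ≠ q := fun h0 => h (by rw [← h0, neg_neg])
    rw [h1, h2, ann_cre_of_ne h', ann_cre_of_ne h.symm]
    ext n
    simp only [Pi.add_apply, Pi.smul_apply, smul_eq_mul]
    ring

/-- The commutators add up to `ch² - sh² = 1`: the transformation preserves the canonical
commutation relations. -/
theorem an_cr_self (p : P) (f : (P →₀ ℕ) → ℂ) : D.an p (D.cr p f) = D.cr p (D.an p f) + f := by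
  simp only [cr_apply, an_apply, map_add, map_smul]
  have h1 := ann_cre_self p f
  have h2 := ann_cre_self (-p) f
  rw [ann_comm (-p) p f, cre_comm (-p) p f, h1, h2]
  have h := D.ch_sq_sub p
  ext n
  simp only [Pi.add_apply, Pi.smul_apply, smul_eq_mul]
  linear_combination (f n) * h

theorem an_cr_of_ne {p q : P} (h : p ≠ q) (f : (P →₀ ℕ) → ℂ) :
    D.an p (D.cr q f) = D.cr q (D.an p f) := by
  simp only [cr_apply, an_apply, map_add, map_smul]
  have h' : -q ≠ -p := fun h0 => h (neg_injective h0).symm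
  rw [ann_cre_of_ne h, ann_comm (-q) p f, cre_comm (-p) q f, ann_cre_of_ne h']
  ext n
  simp only [Pi.add_apply, Pi.smul_apply, smul_eq_mul]
  ring

theorem ip_cr_left {p : P} {f g : (P →₀ ℕ) → ℂ} (hf : f ∈ rapid P) (hg : SqSum g)
    (h1 : SqSum (ann p g)) (h2 : SqSum (cre (-p) g)) : ip (D.cr p f) g = ip f (D.an p g) := by
  have hf' := rapid_sqSum hf
  rw [cr_apply, an_apply, ip_add_left ((rapid_sqSum (cre_mem_rapid hf p)).smul _)
    ((rapid_sqSum (ann_mem_rapid hf (-p))).smul _) hg, ip_add_right hf' (h1.smul _) (h2.smul _),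
    ip_smul_left, ip_smul_left, ip_smul_right, ip_smul_right, ip_cre_left, ip_ann_left,
    Complex.conj_ofReal, Complex.conj_ofReal]

theorem an_mem_rapid {f : (P →₀ ℕ) → ℂ} (hf : f ∈ rapid P) (p : P) : D.an p f ∈ rapid P :=
  Submodule.add_mem _ (Submodule.smul_mem _ _ (ann_mem_rapid hf p))
    (Submodule.smul_mem _ _ (cre_mem_rapid hf (-p)))

theorem cr_mem_rapid {f : (P →₀ ℕ) → ℂ} (hf : f ∈ rapid P) (p : P) : D.cr p f ∈ rapid P :=
  Submodule.add_mem _ (Submodule.smul_mem _ _ (cre_mem_rapid hf p))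
    (Submodule.smul_mem _ _ (ann_mem_rapid hf (-p)))

/-! #### The quasi-particle vacuum -/

/-- `tanh θ_p` -/
def th (p : P) : ℝ := D.sh p / D.ch p

/-- A square root of `-tanh θ_p`. -/
def rt (p : P) : ℂ := (-(D.th p : ℂ)) ^ ((2 : ℂ)⁻¹)

/-- The vacuum should weigh `m` pairs in the modes `p` and `-p` by `(-tanh θ_p)^m`. Giving each of
the two modes a square root of this factor avoids choosing one representative of every pair. The
root is complex because the sign of `tanh θ_p` is arbitrary. -/
theorem rt_sq (p : P) : D.rt p ^ 2 = -(D.th p : ℂ) := by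
  rw [rt]
  exact_mod_cast Complex.cpow_nat_inv_pow (-(D.th p : ℂ)) (n := 2) two_ne_zero

theorem th_neg (p : P) : D.th (-p) = D.th p := by rw [th, D.ch_neg, D.sh_neg, th]

theorem rt_neg (p : P) : D.rt (-p) = D.rt p := by rw [rt, D.th_neg, rt]

theorem norm_rt_sq (p : P) : ‖D.rt p‖ ^ 2 = |D.th p| := by
  rw [← norm_pow, rt_sq, norm_neg, Complex.norm_real, Real.norm_eq_abs]

theorem abs_th_lt_one (p : P) : |D.th p| < 1 := by
  rw [th, abs_div, abs_of_pos (D.ch_pos p), div_lt_one (D.ch_pos p)]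
  refine abs_lt_of_sq_lt_sq ?_ (D.ch_pos p).le
  rw [D.ch_sq]; linarith

/-- Occupations with as many particles of momentum `-p` as of momentum `p`. -/
def IsPaired (n : P →₀ ℕ) : Prop := ∀ p, n (-p) = n p

open Classical in
/-- The vacuum of the transformed annihilation operators, up to normalization. -/
def vac (n : P →₀ ℕ) : ℂ := if IsPaired n then n.prod fun p m => D.rt p ^ m else 0

theorem vac_zero : D.vac 0 = 1 := by
  have h : IsPaired (0 : P →₀ ℕ) := fun p => rfl
  rw [vac, if_pos h, Finsupp.prod_zero_index]

theorem prod_rt_add (n : P →₀ ℕ) (p : P) :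
    (n + Finsupp.single p 1).prod (fun p m => D.rt p ^ m)
      = n.prod (fun p m => D.rt p ^ m) * D.rt p := by
  classical
  rw [Finsupp.prod_add_index' (h := fun p m => D.rt p ^ m) (fun _ => pow_zero _)
    (fun _ _ _ => pow_add _ _ _),
    Finsupp.prod_single_index (h := fun p m => D.rt p ^ m) (pow_zero _), pow_one]

theorem isPaired_add_iff (hne : ∀ p : P, -p ≠ p) (n : P →₀ ℕ) (p : P) :
    IsPaired (n + Finsupp.single p 1 + Finsupp.single (-p) 1) ↔ IsPaired n := by
  have key : ∀ q, (Finsupp.single p 1 + Finsupp.single (-p) 1 : P →₀ ℕ) (-q)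
      = (Finsupp.single p 1 + Finsupp.single (-p) 1 : P →₀ ℕ) q := by
    intro q
    classical
    simp only [Finsupp.add_apply, Finsupp.single_apply]
    have h1 : (p = -q) ↔ (-p = q) := by
      constructor
      · rintro rfl; exact neg_neg q
      · rintro rfl; exact (neg_neg p).symm
    have h2 : (-p = -q) ↔ (p = q) := neg_inj
    simp only [h1, h2]
    omega
  refine forall_congr' fun q => ?_
  rw [add_assoc, Finsupp.add_apply n, Finsupp.add_apply n, key]
  omega

/-- If `n (-p) = 0`, adding a particle in `p` leaves it without a partner and removing one from `-p`
is impossible, so both terms vanish. Otherwise both terms are multiples of the vacuum at `n` without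
the particle in `-p`, and they cancel by `ch * tanh = sh`. -/
theorem an_vac (p : P) : D.an p D.vac = 0 := by
  ext n
  rw [an_apply, Pi.add_apply, Pi.smul_apply, Pi.smul_apply, ann_apply, cre_apply, smul_eq_mul,
    smul_eq_mul, Pi.zero_apply]
  have hch : (D.ch p : ℂ) ≠ 0 := by exact_mod_cast (D.ch_pos p).ne'
  rcases eq_or_ne (n (-p)) 0 with h | h
  · have hno : ¬ IsPaired (n + Finsupp.single p 1) := fun hp => by
      have := hp p
      rw [add_single_apply_of_ne n (D.neg_ne p).symm, add_single_apply_self] at this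
      omega
    rw [vac, if_neg hno, h]
    simp
  · obtain ⟨m, rfl⟩ : ∃ m, n = m + Finsupp.single (-p) 1 :=
      ⟨n - Finsupp.single (-p) 1, (sub_single_add_single h).symm⟩
    rw [add_tsub_cancel_right, add_right_comm, add_single_apply_self,
      add_single_apply_of_ne m (D.neg_ne p)]
    by_cases hm : IsPaired m
    · rw [vac, if_pos ((isPaired_add_iff D.neg_ne m p).2 hm), vac, if_pos hm, prod_rt_add,
        prod_rt_add, hm p, D.rt_neg]
      have h2 : D.rt p * D.rt p = -(D.th p : ℂ) := by rw [← sq, rt_sq]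
      have h3 : (D.th p : ℂ) * D.ch p = D.sh p := by
        rw [th, Complex.ofReal_div, div_mul_cancel₀ _ hch]
      push_cast
      linear_combination ((D.ch p : ℂ) * (√((m p : ℝ) + 1) : ℝ)
        * m.prod (fun p m => D.rt p ^ m)) * h2
        - ((√((m p : ℝ) + 1) : ℝ) * m.prod (fun p m => D.rt p ^ m)) * h3
    · rw [vac, if_neg (fun h => hm ((isPaired_add_iff D.neg_ne m p).1 h)), vac, if_neg hm]
      simp

/-- The vacuum is unique. -/
theorem eq_smul_vac {f : (P →₀ ℕ) → ℂ} (hf : ∀ p, D.an p f = 0) : f = f 0 • D.vac := by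
  -- The equation `D.an p g = 0` at `m` expresses the value of `g` at `m` plus a particle in `p` by
  -- a value at lower degree; by induction on the degree, everything is determined by `g 0`.
  have huniq : ∀ g : (P →₀ ℕ) → ℂ, (∀ p, D.an p g = 0) → g 0 = 0 → ∀ N, ∀ n : P →₀ ℕ,
      n.degree ≤ N → g n = 0 := by
    intro g hg h0 N
    induction N with
    | zero =>
      intro n hn
      have : n = 0 := (Finsupp.degree_eq_zero_iff n).1 (Nat.le_zero.1 hn)
      rw [this, h0]
    | succ N ih =>
      intro n hn
      rcases eq_or_ne n 0 with rfl | hne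
      · exact h0
      obtain ⟨p, hp⟩ := Finsupp.ne_iff.1 hne
      obtain ⟨m, rfl⟩ : ∃ m, n = m + Finsupp.single p 1 :=
        ⟨n - Finsupp.single p 1, (sub_single_add_single hp).symm⟩
      rw [degree_add_single] at hn
      have h1 := congrFun (hg p) m
      rw [an_apply, Pi.add_apply, Pi.smul_apply, Pi.smul_apply, ann_apply, cre_apply, smul_eq_mul,
        smul_eq_mul, Pi.zero_apply, ih (m - Finsupp.single (-p) 1)
          ((Finsupp.degree_mono tsub_le_self).trans (by omega)), mul_zero, mul_zero, add_zero] at h1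
      have hch : (D.ch p : ℂ) ≠ 0 := by exact_mod_cast (D.ch_pos p).ne'
      have hs : ((√((m p : ℝ) + 1) : ℝ) : ℂ) ≠ 0 := by
        exact_mod_cast (Real.sqrt_pos.2 (by positivity)).ne'
      simpa [hch, hs] using h1
  have h := huniq (f - f 0 • D.vac) (fun p => by rw [map_sub, map_smul, hf, an_vac]; simp)
    (by simp [vac_zero])
  ext n
  have := h _ n le_rfl
  rwa [Pi.sub_apply, sub_eq_zero] at this

end Bogoliubov

/-- Summability of `r ^ |n|` over the occupations of finitely many modes. -/
theorem summable_pow_degree {P : Type*} (K : Finset P) {r : ℝ} (h0 : 0 ≤ r) (h1 : r < 1) :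
    Summable fun n : {n : P →₀ ℕ // n.support ⊆ K} => r ^ n.1.degree := by
  classical
  refine summable_of_sum_le (c := ∏ _p : K, (1 - r)⁻¹) (fun _ => by positivity) fun s => ?_
  -- A finite set of occupations lies in a box with side `L`, over which the sum is a product of
  -- finite geometric sums.
  let L := s.sup (fun n => n.1.degree) + 1
  let e : {n : P →₀ ℕ // n.support ⊆ K} → (K → ℕ) := fun n p => n.1 p
  have he : Function.Injective e := by
    intro a b hab
    ext p
    by_cases hp : p ∈ K
    · exact congrFun hab ⟨p, hp⟩
    · rw [Finsupp.notMem_support_iff.1 fun h => hp (a.2 h),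
        Finsupp.notMem_support_iff.1 fun h => hp (b.2 h)]
  have hdeg : ∀ n : {n : P →₀ ℕ // n.support ⊆ K}, r ^ n.1.degree = ∏ p : K, r ^ (e n p) := by
    intro n
    rw [Finset.prod_pow_eq_pow_sum, Finsupp.degree_apply]
    congr 1
    rw [Finset.sum_subset n.2 fun p _ hp => Finsupp.notMem_support_iff.1 hp]
    exact (Finset.sum_coe_sort K fun p => n.1 p).symm
  calc ∑ n ∈ s, r ^ n.1.degree = ∑ g ∈ s.image e, ∏ p : K, r ^ g p := by
        rw [Finset.sum_image fun a _ b _ h => he h]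
        exact Finset.sum_congr rfl fun n _ => hdeg n
    _ ≤ ∑ g ∈ Fintype.piFinset (fun _ : K => Finset.range L), ∏ p : K, r ^ g p := by
        refine Finset.sum_le_sum_of_subset_of_nonneg ?_ fun _ _ _ => by positivity
        intro g hg
        obtain ⟨n, hn, rfl⟩ := Finset.mem_image.1 hg
        rw [Fintype.mem_piFinset]
        intro p
        rw [Finset.mem_range, Nat.lt_succ_iff]
        exact (Finsupp.le_degree (p : P) n.1).trans
          (Finset.le_sup (f := fun n : {n : P →₀ ℕ // n.support ⊆ K} => n.1.degree) hn)
    _ = ∏ _p : K, ∑ j ∈ Finset.range L, r ^ j := by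
        rw [Finset.prod_univ_sum]
    _ ≤ ∏ _p : K, (1 - r)⁻¹ := by
        refine Finset.prod_le_prod (fun _ _ => Finset.sum_nonneg fun _ _ => by positivity)
          fun _ _ => ?_
        rw [← tsum_geometric_of_lt_one h0 h1]
        exact (summable_geometric_of_lt_one h0 h1).sum_le_tsum _ fun _ _ => by positivity

/-- With `r < t < s < 1`, the decay of `(t / s) ^ m` absorbs the polynomial and `s ^ m` remains
summable. -/
theorem summable_pow_mul_pow_degree {P : Type*} (K : Finset P) (k : ℕ) {r : ℝ} (h0 : 0 ≤ r)
    (h1 : r < 1) :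
    Summable fun n : {n : P →₀ ℕ // n.support ⊆ K} =>
      ((n.1.degree : ℝ) + 1) ^ k * r ^ n.1.degree := by
  obtain ⟨t, ht, ht1⟩ := exists_between h1
  obtain ⟨s, hs, hs1⟩ := exists_between ht1
  have ht0 : 0 < t := h0.trans_lt ht
  have hs0 : 0 < s := ht0.trans hs
  have hlim : Filter.Tendsto (fun m : ℕ => (m : ℝ) ^ k * (t / s) ^ m) Filter.atTop (nhds 0) :=
    tendsto_pow_const_mul_const_pow_of_abs_lt_one k (by
      rw [abs_of_nonneg (by positivity)]; exact (div_lt_one hs0).2 hs)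
  obtain ⟨C, hC⟩ := hlim.bddAbove_range
  refine Summable.of_nonneg_of_le (fun n => by positivity) (fun n => ?_)
    ((summable_pow_degree K hs0.le hs1).mul_left (C * (s / t)))
  have h := hC ⟨n.1.degree + 1, rfl⟩
  generalize n.1.degree = m at h ⊢
  simp only [Nat.cast_add, Nat.cast_one, div_pow] at h
  calc ((m : ℝ) + 1) ^ k * r ^ m ≤ ((m : ℝ) + 1) ^ k * t ^ m := by gcongr
    _ = (((m : ℝ) + 1) ^ k * (t ^ (m + 1) / s ^ (m + 1))) * (s / t) * s ^ m := by
        field_simp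
        ring
    _ ≤ C * (s / t) * s ^ m := by gcongr

namespace Bogoliubov

open ComplexConjugate

variable {P : Type*} [InvolutiveNeg P] (D : Bogoliubov P)

theorem support_subset_of_vac_ne_zero {n : P →₀ ℕ} (h : D.vac n ≠ 0) : n.support ⊆ D.modes := by
  intro p hp
  by_contra hK
  apply h
  have hrt : D.rt p = 0 := by
    have := D.rt_sq p
    rw [th, D.sh_eq_zero p hK] at this
    simpa using this
  rw [vac]
  split_ifs with hP
  · refine Finset.prod_eq_zero hp ?_
    change D.rt p ^ n p = 0
    rw [hrt]
    exact zero_pow (Finsupp.mem_support_iff.1 hp)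
  · rfl

/-- As only finitely many modes are mixed, `|tanh θ_p|` has a maximum below one, which serves as
`r`. -/
theorem exists_norm_vac_sq_le : ∃ r : ℝ, 0 ≤ r ∧ r < 1 ∧ ∀ n, ‖D.vac n‖ ^ 2 ≤ r ^ n.degree := by
  obtain ⟨r, hr0, hr1, hr⟩ : ∃ r : ℝ, 0 ≤ r ∧ r < 1 ∧ ∀ p ∈ D.modes, |D.th p| ≤ r := by
    rcases D.modes.eq_empty_or_nonempty with h | h
    · exact ⟨0, le_rfl, one_pos, by simp [h]⟩
    · obtain ⟨q, -, hq'⟩ := D.modes.exists_max_image (fun p => |D.th p|) h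
      exact ⟨|D.th q|, abs_nonneg _, D.abs_th_lt_one q, hq'⟩
  refine ⟨r, hr0, hr1, fun n => ?_⟩
  by_cases h : D.vac n = 0
  · rw [h]; simp; positivity
  have hsub := D.support_subset_of_vac_ne_zero h
  have hP : IsPaired n := by
    by_contra hP
    exact h (by rw [vac, if_neg hP])
  rw [vac, if_pos hP, Finsupp.prod, norm_prod, ← Finset.prod_pow, Finsupp.degree_apply,
    ← Finset.prod_pow_eq_pow_sum]
  refine Finset.prod_le_prod (fun _ _ => by positivity) fun p hp => ?_
  rw [norm_pow, ← pow_mul, mul_comm, pow_mul, norm_rt_sq]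
  exact pow_le_pow_left₀ (abs_nonneg _) (hr p (hsub hp)) _

theorem vac_mem_rapid : D.vac ∈ rapid P := by
  intro k
  obtain ⟨r, hr0, hr1, hr⟩ := D.exists_norm_vac_sq_le
  have h := summable_pow_mul_pow_degree D.modes k hr0 hr1
  have h2 : Summable ((fun n : P →₀ ℕ => ((n.degree : ℝ) + 1) ^ k * ‖D.vac n‖ ^ 2) ∘
      (Subtype.val : {n : P →₀ ℕ // n.support ⊆ D.modes} → _)) :=
    Summable.of_nonneg_of_le (fun n => by simp only [Function.comp]; positivity)
      (fun n => mul_le_mul_of_nonneg_left (hr n.1) (by positivity)) h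
  refine (Function.Injective.summable_iff Subtype.val_injective fun n hn => ?_).1 h2
  by_cases h0 : D.vac n = 0
  · simp [h0]
  · exact absurd ⟨⟨n, D.support_subset_of_vac_ne_zero h0⟩, rfl⟩ hn

theorem nsq_vac_pos : 0 < nsq D.vac := by
  have := norm_sq_le_nsq (rapid_sqSum D.vac_mem_rapid) 0
  rw [vac_zero] at this
  norm_num at this
  linarith

/-- Changing the sign of `tanh θ_p` changes its square root only by a phase. -/
theorem norm_vac_flip (n : P →₀ ℕ) : ‖D.flip.vac n‖ = ‖D.vac n‖ := by
  have h : ∀ p, ‖D.flip.rt p‖ = ‖D.rt p‖ := by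
    intro p
    have h1 : ‖D.flip.rt p‖ ^ 2 = ‖D.rt p‖ ^ 2 := by
      rw [norm_rt_sq, norm_rt_sq, th, th, flip_sh, flip_ch, neg_div, abs_neg]
    exact (sq_eq_sq₀ (norm_nonneg _) (norm_nonneg _)).1 h1
  rw [vac, vac]
  split_ifs
  · simp only [Finsupp.prod, norm_prod, norm_pow, h]
  · simp

theorem nsq_vac_flip : nsq D.flip.vac = nsq D.vac := by
  simp only [nsq, norm_vac_flip]

end Bogoliubov

/-! #### The quasi-particle basis -/

/-- The product of the factorials of the occupation numbers. -/
def occFactorial {P : Type*} (n : P →₀ ℕ) : ℕ := n.prod fun _ m => m.factorial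

theorem occFactorial_zero {P : Type*} : occFactorial (0 : P →₀ ℕ) = 1 := Finsupp.prod_zero_index

theorem occFactorial_pos {P : Type*} (n : P →₀ ℕ) : 0 < occFactorial n :=
  Finset.prod_pos fun _ _ => Nat.factorial_pos _

theorem occFactorial_add_single {P : Type*} (n : P →₀ ℕ) (p : P) :
    occFactorial (n + Finsupp.single p 1) = (n p + 1) * occFactorial n := by
  classical
  have h1 : n.support ⊆ insert p n.support := Finset.subset_insert _ _
  have h2 : (n + Finsupp.single p 1).support ⊆ insert p n.support := by
    intro q hq
    rw [Finset.mem_insert]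
    by_contra hcon
    push Not at hcon
    rw [Finsupp.mem_support_iff, add_single_apply_of_ne n hcon.1.symm] at hq
    exact hcon.2 (Finsupp.mem_support_iff.2 hq)
  rw [occFactorial, occFactorial, Finsupp.prod_of_support_subset _ h1 _ (by simp),
    Finsupp.prod_of_support_subset _ h2 _ (by simp),
    ← Finset.mul_prod_erase _ _ (Finset.mem_insert_self p n.support),
    ← Finset.mul_prod_erase _ (fun q => (n q).factorial) (Finset.mem_insert_self p n.support),
    add_single_apply_self, Nat.factorial_succ, mul_assoc]
  congr 2
  refine Finset.prod_congr rfl fun q hq => ?_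
  rw [add_single_apply_of_ne n (Finset.ne_of_mem_erase hq).symm]

namespace Bogoliubov

open ComplexConjugate

variable {P : Type*} [InvolutiveNeg P] (D : Bogoliubov P)

instance : LeftCommutative (fun (p : P) (f : (P →₀ ℕ) → ℂ) => D.cr p f) :=
  ⟨fun p q f => D.cr_comm p q f⟩

/-- Quasi-particles created from the vacuum, without normalization. -/
def exc (n : P →₀ ℕ) : (P →₀ ℕ) → ℂ :=
  Multiset.foldr (fun p f => D.cr p f) D.vac (Finsupp.toMultiset n)

theorem exc_zero : D.exc 0 = D.vac := by simp [exc]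

theorem exc_add_single (n : P →₀ ℕ) (p : P) :
    D.exc (n + Finsupp.single p 1) = D.cr p (D.exc n) := by
  rw [exc, add_comm, Finsupp.toMultiset_add, Finsupp.toMultiset_single, one_smul,
    Multiset.singleton_add, Multiset.foldr_cons, exc]

theorem exc_mem_rapid (n : P →₀ ℕ) : D.exc n ∈ rapid P := by
  induction n using occupation_induction with
  | h0 => rw [exc_zero]; exact D.vac_mem_rapid
  | hadd n p ih => rw [exc_add_single]; exact D.cr_mem_rapid ih p

/-- Commute the annihilator through the creators one at a time until it meets the vacuum. -/
theorem an_exc (p : P) (n : P →₀ ℕ) :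
    D.an p (D.exc n) = (n p : ℂ) • D.exc (n - Finsupp.single p 1) := by
  induction n using occupation_induction with
  | h0 => rw [exc_zero, an_vac]; simp
  | hadd n q ih =>
    rw [exc_add_single]
    rcases eq_or_ne p q with rfl | h
    · rw [an_cr_self, ih, map_smul, add_tsub_cancel_right, add_single_apply_self]
      rcases eq_or_ne (n p) 0 with h0 | h0
      · simp [h0]
      · rw [← exc_add_single, sub_single_add_single h0]
        push_cast
        rw [add_smul, one_smul]
    · rw [an_cr_of_ne _ h, ih, map_smul, add_single_apply_of_ne n h.symm]
      rcases eq_or_ne (n p) 0 with h0 | h0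
      · simp [h0]
      · rw [← exc_add_single, add_single_sub_single h0]

/-- The orthonormal basis of quasi-particle states. -/
def bas (n : P →₀ ℕ) : (P →₀ ℕ) → ℂ :=
  (((√(nsq D.vac))⁻¹ * (√(occFactorial n : ℝ))⁻¹ : ℝ) : ℂ) • D.exc n

theorem bas_mem_rapid (n : P →₀ ℕ) : D.bas n ∈ rapid P :=
  Submodule.smul_mem _ _ (D.exc_mem_rapid n)

theorem sqrt_occFactorial_add_single (n : P →₀ ℕ) (p : P) :
    √(occFactorial (n + Finsupp.single p 1) : ℝ)
      = √((n p : ℝ) + 1) * √(occFactorial n : ℝ) := by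
  rw [occFactorial_add_single]
  push_cast
  rw [Real.sqrt_mul (by positivity)]

theorem cr_bas (p : P) (n : P →₀ ℕ) :
    D.cr p (D.bas n) = ((√((n p : ℝ) + 1) : ℝ) : ℂ) • D.bas (n + Finsupp.single p 1) := by
  rw [bas, bas, map_smul, exc_add_single, smul_smul, sqrt_occFactorial_add_single]
  congr 1
  have : √((n p : ℝ) + 1) ≠ 0 := (Real.sqrt_pos.2 (by positivity)).ne'
  rw [← Complex.ofReal_mul]
  congr 1
  rw [mul_inv]
  field_simp

theorem an_bas (p : P) (n : P →₀ ℕ) :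
    D.an p (D.bas n) = ((√(n p : ℝ) : ℝ) : ℂ) • D.bas (n - Finsupp.single p 1) := by
  rw [bas, bas, map_smul, an_exc]
  rcases eq_or_ne (n p) 0 with h | h
  · simp [h]
  · obtain ⟨m, rfl⟩ : ∃ m, n = m + Finsupp.single p 1 :=
      ⟨n - Finsupp.single p 1, (sub_single_add_single h).symm⟩
    rw [add_tsub_cancel_right, sqrt_occFactorial_add_single, add_single_apply_self, smul_smul,
      smul_smul]
    congr 1
    have h1 : √((m p : ℝ) + 1) ≠ 0 := (Real.sqrt_pos.2 (by positivity)).ne'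
    have h2 : √((m p : ℝ) + 1) * √((m p : ℝ) + 1) = (m p : ℝ) + 1 :=
      Real.mul_self_sqrt (by positivity)
    rw [← Complex.ofReal_natCast, ← Complex.ofReal_mul, ← Complex.ofReal_mul]
    congr 1
    push_cast
    generalize √((m p : ℝ) + 1) = t at h1 h2
    rw [← h2, mul_inv]
    field_simp

theorem nsq_bas_zero : nsq (D.bas 0) = 1 := by
  rw [bas, nsq_smul, occFactorial_zero, exc_zero]
  have h := D.nsq_vac_pos
  simp only [Nat.cast_one, Real.sqrt_one, inv_one, mul_one, Complex.norm_real, Real.norm_eq_abs,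
    sq_abs, inv_pow, Real.sq_sqrt h.le]
  exact inv_mul_cancel₀ h.ne'

theorem ip_cr_rapid {p : P} {f g : (P →₀ ℕ) → ℂ} (hf : f ∈ rapid P) (hg : g ∈ rapid P) :
    ip (D.cr p f) g = ip f (D.an p g) :=
  D.ip_cr_left hf (rapid_sqSum hg) (rapid_sqSum (ann_mem_rapid hg p))
    (rapid_sqSum (cre_mem_rapid hg (-p)))

-- Orthonormality is algebra: one creator is moved to the other side at a time, until the vacuum is
-- paired with a state that is itself created, and this pairing vanishes.
open Classical in
theorem ip_bas (n m : P →₀ ℕ) : ip (D.bas n) (D.bas m) = if n = m then 1 else 0 := by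
  induction n using occupation_induction generalizing m with
  | h0 =>
    rcases eq_or_ne m 0 with rfl | hm
    · rw [if_pos rfl, ip_self, nsq_bas_zero, Complex.ofReal_one]
    · rw [if_neg hm.symm]
      obtain ⟨p, hp⟩ := Finsupp.ne_iff.1 hm
      obtain ⟨m, rfl⟩ : ∃ k, m = k + Finsupp.single p 1 :=
        ⟨m - Finsupp.single p 1, (sub_single_add_single hp).symm⟩
      have h1 := D.ip_cr_rapid (p := p) (D.bas_mem_rapid m) (D.bas_mem_rapid 0)
      rw [cr_bas, an_bas, ip_smul_left, ip_smul_right] at h1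
      have h2 : ((√((m p : ℝ) + 1) : ℝ) : ℂ) ≠ 0 := by
        exact_mod_cast (Real.sqrt_pos.2 (by positivity)).ne'
      have h3 : ip (D.bas (m + Finsupp.single p 1)) (D.bas 0) = 0 := by
        simpa [h2] using h1
      rw [← ip_conj, h3, map_zero]
  | hadd n p ih =>
    have h1 := D.ip_cr_rapid (p := p) (D.bas_mem_rapid n) (D.bas_mem_rapid m)
    rw [cr_bas, an_bas, ip_smul_left, ip_smul_right, ih, Complex.conj_ofReal] at h1
    have h2 : ((√((n p : ℝ) + 1) : ℝ) : ℂ) ≠ 0 := by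
      exact_mod_cast (Real.sqrt_pos.2 (by positivity)).ne'
    apply mul_left_cancel₀ h2
    rw [h1]
    rcases eq_or_ne (m p) 0 with h | h
    · have : n + Finsupp.single p 1 ≠ m := fun h0 => by
        rw [← h0, add_single_apply_self] at h; omega
      simp [h, this]
    · obtain ⟨k, rfl⟩ : ∃ k, m = k + Finsupp.single p 1 :=
        ⟨m - Finsupp.single p 1, (sub_single_add_single h).symm⟩
      rw [add_tsub_cancel_right, add_single_apply_self]
      by_cases hnk : n = k
      · subst hnk
        simp
      · have : n + Finsupp.single p 1 ≠ k + Finsupp.single p 1 := fun h => hnk (add_right_cancel h)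
        simp [hnk, this]

/-- The matrix of the basis change is transposed when the transformation is inverted. -/
theorem bas_flip (x y : P →₀ ℕ) : D.flip.bas x y = D.bas y x := by
  induction x using occupation_induction generalizing y with
  | h0 =>
    -- No bare creator has a component at zero occupation. Written in quasi-particle operators, this
    -- says that the column `y ↦ D.bas y 0` is annihilated by the inverse transformation, hence is a
    -- multiple of its vacuum. The value at zero fixes the factor.
    have hk : ∀ p, D.flip.an p (fun y => D.bas y 0) = 0 := by
      intro p
      ext y
      have h1 := congrFun (D.cre_eq p (D.bas y)) 0
      rw [cr_bas, an_bas, cre_apply] at h1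
      simp only [Finsupp.coe_zero, Pi.zero_apply, Nat.cast_zero, Real.sqrt_zero, Complex.ofReal_zero,
        zero_mul, Pi.sub_apply, Pi.smul_apply, smul_eq_mul] at h1
      rw [an_apply, flip_ch, flip_sh, Pi.add_apply, Pi.smul_apply, Pi.smul_apply, ann_apply,
        cre_apply, smul_eq_mul, smul_eq_mul, Pi.zero_apply, h1]
      push_cast
      ring
    have h := congrFun (D.flip.eq_smul_vac hk) y
    rw [Pi.smul_apply, smul_eq_mul] at h
    rw [h, bas, bas, exc_zero, exc_zero, nsq_vac_flip, Pi.smul_apply, Pi.smul_apply, vac_zero,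
      smul_eq_mul, smul_eq_mul, mul_one]
  | hadd x p ih =>
    have h1 := congrFun (D.flip.cr_bas p x) y
    have h2 : D.flip.bas x = fun y => D.bas y x := funext ih
    have h3 := congrFun (D.ann_eq p (D.bas y)) x
    rw [an_bas, cr_bas, ann_apply] at h3
    simp only [Pi.sub_apply, Pi.smul_apply, smul_eq_mul] at h3
    rw [h2, cr_apply, flip_ch, flip_sh, Pi.add_apply, Pi.smul_apply, Pi.smul_apply, Pi.smul_apply,
      cre_apply, ann_apply, smul_eq_mul, smul_eq_mul, smul_eq_mul] at h1
    have h4 : ((√((x p : ℝ) + 1) : ℝ) : ℂ) ≠ 0 := by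
      exact_mod_cast (Real.sqrt_pos.2 (by positivity)).ne'
    apply mul_left_cancel₀ h4
    rw [h3, ← h1]
    push_cast
    ring

/-- Parseval's identity for the quasi-particle basis. -/
theorem hasSum_norm_ip_bas_sq {f : (P →₀ ℕ) → ℂ} (hf : SqSum f) :
    HasSum (fun n => ‖ip (D.bas n) f‖ ^ 2) (nsq f) := by
  classical
  let b : (P →₀ ℕ) → lp (fun _ : P →₀ ℕ => ℂ) 2 := fun n => (rapid_sqSum (D.bas_mem_rapid n)).toLp
  let b' : (P →₀ ℕ) → lp (fun _ : P →₀ ℕ => ℂ) 2 :=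
    fun n => (rapid_sqSum (D.flip.bas_mem_rapid n)).toLp
  have hb : Orthonormal ℂ b := by
    rw [orthonormal_iff_ite]
    intro n m
    rw [SqSum.inner_toLp, ip_bas]
  have hb' : Orthonormal ℂ b' := by
    rw [orthonormal_iff_ite]
    intro n m
    rw [SqSum.inner_toLp, ip_bas]
  have hbot : (Submodule.span ℂ (Set.range b))ᗮ = ⊥ := by
    rw [Submodule.eq_bot_iff]
    intro g hg
    rw [Submodule.mem_orthogonal] at hg
    have hg0 : ∀ n, ⟪b n, g⟫_ℂ = 0 := fun n => hg _ (Submodule.subset_span ⟨n, rfl⟩)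
    -- the vector with coefficients `conj g` in the transposed basis vanishes
    have hs : SqSum (fun x => conj (g x)) := (lp_sqSum g).of_le fun x => by simp
    have h1 := hb'.orthogonalFamily.hasSum_linearIsometry hs.toLp
    have h2 : hb'.orthogonalFamily.linearIsometry hs.toLp = 0 := by
      ext n
      have h3 := (lp.evalCLM ℂ (fun _ : P →₀ ℕ => ℂ) 2 n).hasSum h1
      have h4 : ∑' x, (lp.evalCLM ℂ (fun _ : P →₀ ℕ => ℂ) 2 n)
          (LinearIsometry.toSpanSingleton ℂ _ (hb'.1 x) (hs.toLp x)) = conj (⟪b n, g⟫_ℂ) := by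
        rw [lp_inner, ip_conj]
        refine tsum_congr fun x => ?_
        change conj (g x) * D.flip.bas x n = conj (g x) * D.bas n x
        rw [bas_flip]
      rw [h3.tsum_eq, hg0, map_zero] at h4
      exact h4
    have h3 : hs.toLp = 0 := by
      apply hb'.orthogonalFamily.linearIsometry.injective
      rw [h2, map_zero]
    ext x
    have h4 : conj (g x) = 0 := congrArg (fun f : lp (fun _ : P →₀ ℕ => ℂ) 2 => f x) h3
    simpa using h4
  have hB := hasSum_norm_sq (HilbertBasis.mkOfOrthogonalEqBot hb hbot) hf.toLp
  rw [hf.norm_toLp_sq, HilbertBasis.coe_mkOfOrthogonalEqBot] at hB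
  simpa only [b, SqSum.inner_toLp] using hB

end Bogoliubov

namespace Bogoliubov

open ComplexConjugate

variable {P : Type*} [InvolutiveNeg P] (D : Bogoliubov P)

/-! #### The quasi-particle transform -/

/-- The coefficients of a function in the quasi-particle basis. -/
def hat (f : (P →₀ ℕ) → ℂ) (n : P →₀ ℕ) : ℂ := ip (D.bas n) f

theorem hasSum_hat {f : (P →₀ ℕ) → ℂ} (hf : SqSum f) :
    HasSum (fun n => ‖D.hat f n‖ ^ 2) (nsq f) := D.hasSum_norm_ip_bas_sq hf

theorem sqSum_hat {f : (P →₀ ℕ) → ℂ} (hf : SqSum f) : SqSum (D.hat f) := (D.hasSum_hat hf).summable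

theorem nsq_hat {f : (P →₀ ℕ) → ℂ} (hf : SqSum f) : nsq (D.hat f) = nsq f :=
  (D.hasSum_hat hf).tsum_eq

/-- The quasi-particle transform carries quasi-particle operators into the bare ones, so norm
computations with `D.an` and `D.cr` reduce to weighted sums over occupations. -/
theorem hat_an {f : (P →₀ ℕ) → ℂ} (hf : f ∈ rapid P) (p : P) : D.hat (D.an p f) = ann p (D.hat f) := by
  ext n
  rw [hat, ← D.ip_cr_rapid (D.bas_mem_rapid n) hf, cr_bas, ip_smul_left, Complex.conj_ofReal,
    ann_apply, hat]

theorem hat_cr {f : (P →₀ ℕ) → ℂ} (hf : f ∈ rapid P) (p : P) : D.hat (D.cr p f) = cre p (D.hat f) := by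
  ext n
  rw [hat, ← ip_conj, D.ip_cr_rapid hf (D.bas_mem_rapid n), an_bas, ip_smul_right, map_mul,
    Complex.conj_ofReal, ip_conj, cre_apply, hat]

theorem hat_add {f g : (P →₀ ℕ) → ℂ} (hf : SqSum f) (hg : SqSum g) :
    D.hat (f + g) = D.hat f + D.hat g := by
  ext n
  exact ip_add_right (rapid_sqSum (D.bas_mem_rapid n)) hf hg

theorem hat_smul (c : ℂ) (f : (P →₀ ℕ) → ℂ) : D.hat (c • f) = c • D.hat f := by
  ext n
  exact ip_smul_right _ _ _

theorem hat_sum {ι : Type*} (s : Finset ι) {f : ι → (P →₀ ℕ) → ℂ} (hf : ∀ i ∈ s, SqSum (f i)) :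
    D.hat (∑ i ∈ s, f i) = ∑ i ∈ s, D.hat (f i) := by
  classical
  induction s using Finset.induction_on with
  | empty => ext n; simp [hat]
  | insert a s ha ih =>
    have h1 : ∀ i ∈ s, SqSum (f i) := fun i hi => hf i (by simp [hi])
    rw [Finset.sum_insert ha, Finset.sum_insert ha,
      hat_add _ (hf a (by simp)) (sqSum_finset_sum s h1), ih h1]

open Classical in
theorem hat_bas (n m : P →₀ ℕ) : D.hat (D.bas n) m = if m = n then 1 else 0 := D.ip_bas m n

theorem nsq_an {f : (P →₀ ℕ) → ℂ} (hf : f ∈ rapid P) (p : P) :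
    nsq (D.an p f) = ∑' n, (n p : ℝ) * ‖D.hat f n‖ ^ 2 := by
  rw [← D.nsq_hat (rapid_sqSum (D.an_mem_rapid hf p)), hat_an _ hf, nsq_ann]

theorem summable_mul_hat {f : (P →₀ ℕ) → ℂ} (hf : f ∈ rapid P) (p : P) :
    Summable fun n : P →₀ ℕ => (n p : ℝ) * ‖D.hat f n‖ ^ 2 := by
  have h := D.sqSum_hat (rapid_sqSum (D.an_mem_rapid hf p))
  rw [hat_an _ hf] at h
  obtain ⟨a, ha⟩ := h
  have := (hasSum_ann_sq_iff p (D.hat f) (fun _ => 1) (a := a)).1 (by simpa using ha)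
  simpa using this.summable

end Bogoliubov

/-! #### Expectation values -/

section Form

open ComplexConjugate

variable {P : Type*}

/-- The real part of `⟨a_{-p} a_p G, G⟩`. -/
def pairing [Neg P] (p : P) (G : (P →₀ ℕ) → ℂ) : ℝ := (ip (ann (-p) (ann p G)) G).re

/-- The extra `nsq f` comes from the commutator and is the source of the vacuum energy. -/
theorem nsq_cre {f : (P →₀ ℕ) → ℂ} (hf : f ∈ rapid P) (p : P) :
    nsq (cre p f) = nsq (ann p f) + nsq f := by
  have h : ip (cre p f) (cre p f) = ip (ann p f) (ann p f) + ip f f := by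
    rw [ip_cre_left, ann_cre_self, ip_add_right (rapid_sqSum hf)
      (rapid_sqSum (cre_mem_rapid (ann_mem_rapid hf p) p)) (rapid_sqSum hf), ← ip_ann_left]
  rw [ip_self, ip_self, ip_self] at h
  exact_mod_cast h

namespace Bogoliubov

variable [InvolutiveNeg P] (D : Bogoliubov P)

theorem nsq_an_eq {f : (P →₀ ℕ) → ℂ} (hf : f ∈ rapid P) (p : P) :
    nsq (D.an p f) = D.ch p ^ 2 * nsq (ann p f) + D.sh p ^ 2 * (nsq (ann (-p) f) + nsq f)
      + 2 * (D.ch p * D.sh p) * pairing p f := by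
  rw [an_apply, nsq_add ((rapid_sqSum (ann_mem_rapid hf p)).smul _)
    ((rapid_sqSum (cre_mem_rapid hf (-p))).smul _), nsq_smul, nsq_smul, nsq_cre hf, ip_smul_left,
    ip_smul_right, ← ip_ann_left, pairing, Complex.conj_ofReal, ← mul_assoc, ← Complex.ofReal_mul,
    Complex.re_ofReal_mul, Complex.norm_real, Complex.norm_real, Real.norm_eq_abs,
    Real.norm_eq_abs, sq_abs, sq_abs]
  ring

end Bogoliubov

end Form

/-! #### Diagonalization of quadratic Hamiltonians -/

/-- A quadratic Hamiltonian `∑_p ε_p a†_p a_p + ∑_{p ∈ K} u_p (a†_p a_p + ½ (a†_p a†_{-p} + h.c.))`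
whose interaction involves finitely many modes. -/
structure Quadratic (P : Type*) [InvolutiveNeg P] where
  ε : P → ℝ
  u : P → ℝ
  modes : Finset P
  neg_ne : ∀ p : P, -p ≠ p
  one_le : ∀ p, 1 ≤ ε p
  u_nonneg : ∀ p, 0 ≤ u p
  ε_neg : ∀ p, ε (-p) = ε p
  u_neg : ∀ p, u (-p) = u p
  u_eq_zero : ∀ p, p ∉ modes → u p = 0
  neg_mem : ∀ p ∈ modes, -p ∈ modes

namespace Quadratic

variable {P : Type*} [InvolutiveNeg P] (Q : Quadratic P)

/-- The quasi-particle energy. -/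
def en (p : P) : ℝ := √(Q.ε p ^ 2 + 2 * Q.ε p * Q.u p)

theorem ε_pos (p : P) : 0 < Q.ε p := one_pos.trans_le (Q.one_le p)

theorem en_sq (p : P) : Q.en p ^ 2 = Q.ε p ^ 2 + 2 * Q.ε p * Q.u p :=
  Real.sq_sqrt (by have := Q.ε_pos p; have := Q.u_nonneg p; positivity)

theorem ε_le_en (p : P) : Q.ε p ≤ Q.en p := by
  refine Real.le_sqrt_of_sq_le ?_
  have := Q.ε_pos p; have := Q.u_nonneg p
  have : 0 ≤ 2 * Q.ε p * Q.u p := by positivity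
  linarith

theorem en_pos (p : P) : 0 < Q.en p := (Q.ε_pos p).trans_le (Q.ε_le_en p)

theorem en_le (p : P) : Q.en p ≤ Q.ε p + Q.u p := by
  refine Real.sqrt_le_iff.2 ⟨by linarith [Q.ε_pos p, Q.u_nonneg p], ?_⟩
  nlinarith [sq_nonneg (Q.u p)]

theorem en_neg (p : P) : Q.en (-p) = Q.en p := by rw [en, Q.ε_neg, Q.u_neg, en]

theorem en_eq {p : P} (hp : p ∉ Q.modes) : Q.en p = Q.ε p := by
  rw [en, Q.u_eq_zero p hp, mul_zero, add_zero, Real.sqrt_sq (Q.ε_pos p).le]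

/-- The Bogoliubov transformation diagonalizing the Hamiltonian. -/
@[simps] def bog : Bogoliubov P where
  -- Half-angle formulas for `cosh 2θ = (ε + u) / en` and `sinh 2θ = u / en`, the angle at which the
  -- pair terms cancel.
  ch := fun p => √(((Q.ε p + Q.u p) / Q.en p + 1) / 2)
  sh := fun p => √(((Q.ε p + Q.u p) / Q.en p - 1) / 2)
  modes := Q.modes
  neg_ne := Q.neg_ne
  ch_pos := fun p => Real.sqrt_pos.2 (by
    have := Q.ε_pos p; have := Q.u_nonneg p; have := Q.en_pos p; positivity)
  ch_sq := fun p => by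
    have h1 := Q.ε_pos p; have h2 := Q.u_nonneg p; have h3 := Q.en_pos p
    have h4 : 1 ≤ (Q.ε p + Q.u p) / Q.en p := (one_le_div h3).2 (Q.en_le p)
    rw [Real.sq_sqrt (by linarith), Real.sq_sqrt (by linarith)]
    ring
  ch_neg := fun p => by rw [Q.ε_neg, Q.u_neg, Q.en_neg]
  sh_neg := fun p => by rw [Q.ε_neg, Q.u_neg, Q.en_neg]
  sh_eq_zero := fun p hp => by
    rw [Q.u_eq_zero p hp, Q.en_eq hp, add_zero, div_self (Q.ε_pos p).ne']
    simp

theorem one_le_ratio (p : P) : 1 ≤ (Q.ε p + Q.u p) / Q.en p := (one_le_div (Q.en_pos p)).2 (Q.en_le p)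

theorem en_mul_ch_sq (p : P) : Q.en p * Q.bog.ch p ^ 2 = (Q.ε p + Q.u p + Q.en p) / 2 := by
  have h3 := Q.en_pos p
  have h4 := Q.one_le_ratio p
  rw [bog_ch, Real.sq_sqrt (by linarith)]
  field_simp

theorem en_mul_sh_sq (p : P) : Q.en p * Q.bog.sh p ^ 2 = (Q.ε p + Q.u p - Q.en p) / 2 := by
  have h3 := Q.en_pos p
  have h4 := Q.one_le_ratio p
  rw [bog_sh, Real.sq_sqrt (by linarith)]
  field_simp

theorem en_mul_ch_mul_sh (p : P) : Q.en p * (Q.bog.ch p * Q.bog.sh p) = Q.u p / 2 := by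
  have h3 := Q.en_pos p
  have h4 := Q.one_le_ratio p
  have h5 := Q.en_sq p
  have h0 : 0 ≤ Q.bog.ch p * Q.bog.sh p := by
    rw [bog_ch, bog_sh]; positivity
  have h6 : (Q.en p * (Q.bog.ch p * Q.bog.sh p)) ^ 2 = (Q.u p / 2) ^ 2 := by
    have : (Q.en p * (Q.bog.ch p * Q.bog.sh p)) ^ 2
        = (Q.en p * Q.bog.ch p ^ 2) * (Q.en p * Q.bog.sh p ^ 2) := by ring
    rw [this, en_mul_ch_sq, en_mul_sh_sq]
    nlinarith
  exact (sq_eq_sq₀ (by positivity) (by linarith [Q.u_nonneg p])).1 h6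

/-- From `en ≥ ε ≥ 1`. Such bounds by `u` make the sums over all modes depend on `∑ u` only,
whatever the finite set of interacting modes. -/
theorem sh_sq_le (p : P) : Q.bog.sh p ^ 2 ≤ Q.u p / 2 := by
  have h1 := Q.en_mul_sh_sq p
  have h2 := Q.ε_le_en p
  have h3 := Q.one_le p
  nlinarith [sq_nonneg (Q.bog.sh p)]

theorem ch_mul_sh_le (p : P) : Q.bog.ch p * Q.bog.sh p ≤ Q.u p / 2 := by
  have h1 := Q.en_mul_ch_mul_sh p
  have h2 := Q.ε_le_en p
  have h3 := Q.one_le p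
  have h0 : 0 ≤ Q.bog.ch p * Q.bog.sh p := by
    rw [bog_ch, bog_sh]; positivity
  nlinarith

theorem ch_mul_sh_nonneg (p : P) : 0 ≤ Q.bog.ch p * Q.bog.sh p := by
  rw [bog_ch, bog_sh]; positivity

/-- The interaction energy `∑_{p ∈ K} u_p (⟨a†_p a_p⟩ + Re ⟨a_{-p} a_p⟩)`. -/
def potential (G : (P →₀ ℕ) → ℂ) : ℝ := ∑ p ∈ Q.modes, Q.u p * (nsq (ann p G) + pairing p G)

/-- Minus the ground state energy. -/
def shift : ℝ := 1 / 2 * ∑ p ∈ Q.modes, (Q.ε p + Q.u p - Q.en p)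

/-- The kinetic energy of an occupation. -/
def kin (n : P →₀ ℕ) : ℝ := n.sum fun p m => Q.ε p * m

/-- The sum of the quasi-particle energies of an occupation. -/
def tot (n : P →₀ ℕ) : ℝ := n.sum fun p m => Q.en p * m

theorem kin_nonneg (n : P →₀ ℕ) : 0 ≤ Q.kin n :=
  Finset.sum_nonneg fun p _ => mul_nonneg (Q.ε_pos p).le (Nat.cast_nonneg _)

/-- Completing the square mode by mode: expanding `en ‖an G‖²` produces number terms at `p` and at
`-p`, a pairing term and a constant. The symmetry of `S` under `p ↦ -p` merges the number terms. -/
theorem sum_form_eq {G : (P →₀ ℕ) → ℂ} (hG : G ∈ rapid P) (S : Finset P) (hS : Q.modes ⊆ S)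
    (hneg : ∀ p ∈ S, -p ∈ S) :
    ∑ p ∈ S, Q.ε p * nsq (ann p G) + Q.potential G + Q.shift * nsq G
      = ∑ p ∈ S, Q.en p * nsq (Q.bog.an p G) := by
  have h1 : Q.potential G = ∑ p ∈ S, Q.u p * (nsq (ann p G) + pairing p G) :=
    Finset.sum_subset hS fun p _ hp => by rw [Q.u_eq_zero p hp, zero_mul]
  have h2 : Q.shift = 1 / 2 * ∑ p ∈ S, (Q.ε p + Q.u p - Q.en p) := by
    rw [shift, Finset.sum_subset hS fun p _ hp => by rw [Q.u_eq_zero p hp, Q.en_eq hp]; ring]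
  have h3 : ∑ p ∈ S, (Q.ε p + Q.u p - Q.en p) / 2 * nsq (ann (-p) G)
      = ∑ p ∈ S, (Q.ε p + Q.u p - Q.en p) / 2 * nsq (ann p G) := by
    refine Finset.sum_nbij' (fun p => -p) (fun p => -p) hneg hneg (fun p _ => neg_neg p)
      (fun p _ => neg_neg p) fun p _ => ?_
    rw [Q.ε_neg, Q.u_neg, Q.en_neg]
  have h4 : ∀ p, Q.en p * nsq (Q.bog.an p G)
      = (Q.ε p + Q.u p + Q.en p) / 2 * nsq (ann p G)
        + (Q.ε p + Q.u p - Q.en p) / 2 * nsq (ann (-p) G)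
        + (Q.ε p + Q.u p - Q.en p) / 2 * nsq G + Q.u p * pairing p G := by
    intro p
    rw [Q.bog.nsq_an_eq hG]
    have e1 := Q.en_mul_ch_sq p
    have e2 := Q.en_mul_sh_sq p
    have e3 := Q.en_mul_ch_mul_sh p
    linear_combination nsq (ann p G) * e1 + (nsq (ann (-p) G) + nsq G) * e2
      + 2 * pairing p G * e3
  simp only [h4, Finset.sum_add_distrib]
  rw [h3, h1, h2, Finset.mul_sum, Finset.sum_mul]
  simp only [← Finset.sum_add_distrib]
  refine Finset.sum_congr rfl fun p _ => ?_
  ring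

theorem summable_mul_norm_sq {G : (P →₀ ℕ) → ℂ} (hG : G ∈ rapid P) (p : P) :
    Summable fun n : P →₀ ℕ => (n p : ℝ) * ‖G n‖ ^ 2 := by
  refine Summable.of_nonneg_of_le (fun n => by positivity) (fun n => ?_) (hG 1)
  have := apply_le_degree n p
  rw [pow_one]
  gcongr
  linarith

/-- An inequality for each finite set of modes is all that the lower bound requires, so infinite
sums over modes are avoided. -/
theorem sum_kinetic_le {G : (P →₀ ℕ) → ℂ} (hG : G ∈ rapid P)
    (hT : Summable fun n => Q.kin n * ‖G n‖ ^ 2) (S : Finset P) :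
    ∑ p ∈ S, Q.ε p * nsq (ann p G) ≤ ∑' n, Q.kin n * ‖G n‖ ^ 2 := by
  classical
  simp only [nsq_ann, ← tsum_mul_left]
  rw [← Summable.tsum_finsetSum fun p _ => (summable_mul_norm_sq hG p).mul_left _]
  refine Summable.tsum_le_tsum (fun n => ?_)
    (summable_sum fun p _ => (summable_mul_norm_sq hG p).mul_left _) hT
  have : ∑ p ∈ S, Q.ε p * ((n p : ℝ) * ‖G n‖ ^ 2) = (∑ p ∈ S, Q.ε p * (n p : ℝ)) * ‖G n‖ ^ 2 := by
    rw [Finset.sum_mul]; exact Finset.sum_congr rfl fun p _ => by ring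
  rw [this]
  refine mul_le_mul_of_nonneg_right ?_ (by positivity)
  rw [kin, Finsupp.sum_of_support_subset n (Finset.subset_union_left (s₂ := S)) _ (by simp)]
  exact Finset.sum_le_sum_of_subset_of_nonneg Finset.subset_union_right fun p _ _ =>
    mul_nonneg (Q.ε_pos p).le (Nat.cast_nonneg _)

open Classical in
/-- A finite set of modes, closed under `p ↦ -p`, containing the interacting ones and `s`. -/
def enlarge (s : Finset P) : Finset P := Q.modes ∪ (s ∪ s.image fun p => -p)

theorem modes_subset_enlarge (s : Finset P) : Q.modes ⊆ Q.enlarge s := by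
  classical
  exact Finset.subset_union_left

theorem subset_enlarge (s : Finset P) : s ⊆ Q.enlarge s := by
  classical
  exact Finset.subset_union_left.trans Finset.subset_union_right

theorem neg_mem_enlarge (s : Finset P) : ∀ p ∈ Q.enlarge s, -p ∈ Q.enlarge s := by
  classical
  intro p hp
  simp only [enlarge, Finset.mem_union, Finset.mem_image] at hp ⊢
  rcases hp with h | h | ⟨q, h, rfl⟩
  · exact Or.inl (Q.neg_mem p h)
  · exact Or.inr (Or.inr ⟨p, h, rfl⟩)
  · exact Or.inr (Or.inl (by rwa [neg_neg]))

/-- Lower bound on the quadratic Hamiltonian: it is at least `μ` on functions without components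
in quasi-particle states of energy less than `μ`. -/
theorem mul_nsq_le {G : (P →₀ ℕ) → ℂ} (hG : G ∈ rapid P)
    (hT : Summable fun n => Q.kin n * ‖G n‖ ^ 2) {μ : ℝ}
    (hμ : ∀ n, Q.bog.hat G n ≠ 0 → μ ≤ Q.tot n) :
    μ * nsq G ≤ ∑' n, Q.kin n * ‖G n‖ ^ 2 + Q.potential G + Q.shift * nsq G := by
  classical
  have hsum := (Q.bog.hasSum_hat (rapid_sqSum hG)).mul_left μ
  refine hasSum_le_of_sum_le hsum fun F => ?_
  -- A partial sum over quasi-particle states involves finitely many modes, where the Hamiltonian is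
  -- a finite sum of squares.
  let S := Q.enlarge (F.biUnion fun n => n.support)
  have hsupp : ∀ n ∈ F, n.support ⊆ S := fun n hn =>
    (Finset.subset_biUnion_of_mem (fun n : P →₀ ℕ => n.support) hn).trans (Q.subset_enlarge _)
  have h1 := Q.sum_form_eq hG S (Q.modes_subset_enlarge _) (Q.neg_mem_enlarge _)
  have h2 := Q.sum_kinetic_le hG hT S
  have h3 : ∑ n ∈ F, μ * ‖Q.bog.hat G n‖ ^ 2 ≤ ∑ p ∈ S, Q.en p * nsq (Q.bog.an p G) := by
    calc ∑ n ∈ F, μ * ‖Q.bog.hat G n‖ ^ 2 ≤ ∑ n ∈ F, Q.tot n * ‖Q.bog.hat G n‖ ^ 2 := by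
          refine Finset.sum_le_sum fun n _ => ?_
          by_cases h0 : Q.bog.hat G n = 0
          · simp [h0]
          · exact mul_le_mul_of_nonneg_right (hμ n h0) (by positivity)
      _ = ∑ p ∈ S, Q.en p * ∑ n ∈ F, (n p : ℝ) * ‖Q.bog.hat G n‖ ^ 2 := by
          simp only [Finset.mul_sum]
          rw [Finset.sum_comm]
          refine Finset.sum_congr rfl fun n hn => ?_
          rw [tot, Finsupp.sum_of_support_subset n (hsupp n hn) _ (by simp), Finset.sum_mul]
          exact Finset.sum_congr rfl fun p _ => by ring
      _ ≤ ∑ p ∈ S, Q.en p * nsq (Q.bog.an p G) := by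
          refine Finset.sum_le_sum fun p _ => mul_le_mul_of_nonneg_left ?_ (Q.en_pos p).le
          rw [Q.bog.nsq_an hG]
          exact (Q.bog.summable_mul_hat hG p).sum_le_tsum F fun _ _ => by positivity
  linarith

end Quadratic

/-! ### States of bounded particle number -/

section Degree

variable {P : Type*}

/-- The particle number operator. -/
def numOp (f : (P →₀ ℕ) → ℂ) (n : P →₀ ℕ) : ℂ := (n.degree : ℂ) * f n

theorem cre_ann_apply (p : P) (f : (P →₀ ℕ) → ℂ) (n : P →₀ ℕ) :
    cre p (ann p f) n = (n p : ℂ) * f n := by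
  rw [cre_apply, ann_apply]
  rcases eq_or_ne (n p) 0 with h | h
  · simp [h]
  · obtain ⟨m, rfl⟩ : ∃ k, n = k + Finsupp.single p 1 :=
      ⟨n - Finsupp.single p 1, (sub_single_add_single h).symm⟩
    rw [add_tsub_cancel_right, add_single_apply_self, ← mul_assoc, ← Complex.ofReal_mul,
      Nat.cast_add, Nat.cast_one, Real.mul_self_sqrt (by positivity)]
    push_cast; rfl

/-- Functions of at most `L` particles. -/
def DegLE (L : ℕ) (f : (P →₀ ℕ) → ℂ) : Prop := ∀ n, L < n.degree → f n = 0

theorem DegLE.mem_rapid {L : ℕ} {f : (P →₀ ℕ) → ℂ} (hL : DegLE L f) (hf : SqSum f) : f ∈ rapid P := by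
  intro k
  refine Summable.of_nonneg_of_le (fun n => by positivity) (fun n => ?_)
    (hf.mul_left (((L : ℝ) + 1) ^ k))
  rcases lt_or_ge L n.degree with h | h
  · simp [hL n h]
  · have : (n.degree : ℝ) ≤ L := by exact_mod_cast h
    gcongr

theorem DegLE.ann {L : ℕ} {f : (P →₀ ℕ) → ℂ} (hL : DegLE L f) (p : P) : DegLE L (ann p f) := by
  intro n hn
  rw [ann_apply, hL _ (by rw [degree_add_single]; omega), mul_zero]

theorem DegLE.cre {L : ℕ} {f : (P →₀ ℕ) → ℂ} (hL : DegLE L f) (p : P) : DegLE (L + 1) (cre p f) := by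
  intro n hn
  rw [cre_apply]
  rcases eq_or_ne (n p) 0 with h | h
  · simp [h]
  · have h2 := congrArg Finsupp.degree (sub_single_add_single h)
    rw [degree_add_single] at h2
    rw [hL _ (by omega), mul_zero]

theorem DegLE.nsq_ann_le {L : ℕ} {f : (P →₀ ℕ) → ℂ} (hL : DegLE L f) (hf : SqSum f) (p : P) :
    nsq (BoseGas.ann p f) ≤ L * nsq f := by
  rw [nsq_ann, nsq, ← tsum_mul_left]
  have key : ∀ n : P →₀ ℕ, (n p : ℝ) * ‖f n‖ ^ 2 ≤ L * ‖f n‖ ^ 2 := by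
    intro n
    rcases lt_or_ge L n.degree with h | h
    · simp [hL n h]
    · have h1 : (n.degree : ℝ) ≤ L := by exact_mod_cast h
      have h2 := apply_le_degree n p
      exact mul_le_mul_of_nonneg_right (h2.trans h1) (by positivity)
  exact (Summable.of_nonneg_of_le (fun n => by positivity) key (hf.mul_left _)).tsum_le_tsum key
    (hf.mul_left _)

theorem DegLE.nsq_cre_le {L : ℕ} {f : (P →₀ ℕ) → ℂ} (hL : DegLE L f) (hf : SqSum f) (p : P) :
    nsq (BoseGas.cre p f) ≤ (L + 1) * nsq f := by
  rw [nsq_cre (hL.mem_rapid hf)]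
  linarith [hL.nsq_ann_le hf p]

/-- Stated for general weights because the part of the particle number that preserves the number of
quasi-particles multiplies by `∑ (ch² + sh²) n_p`. -/
theorem DegLE.nsq_numOp_le {L : ℕ} {f : (P →₀ ℕ) → ℂ} (hL : DegLE L f) (hf : SqSum f)
    {w : (P →₀ ℕ) → ℝ} {C : ℝ} (hC : 0 ≤ C) (hw : ∀ n, |w n| ≤ C * n.degree) :
    nsq (fun n => (w n : ℂ) * f n) ≤ (C * L) ^ 2 * nsq f := by
  rw [← abs_of_nonneg (show 0 ≤ C * (L : ℝ) by positivity), ← Real.norm_eq_abs, ← Complex.norm_real,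
    ← nsq_smul]
  refine nsq_mono (hf.smul _) fun n => ?_
  rw [Pi.smul_apply, smul_eq_mul, norm_mul, norm_mul, Complex.norm_real, Complex.norm_real,
    Real.norm_eq_abs, Real.norm_eq_abs, abs_of_nonneg (show 0 ≤ C * (L : ℝ) by positivity)]
  rcases lt_or_ge L n.degree with h | h
  · simp [hL n h]
  · have h1 : (n.degree : ℝ) ≤ L := by exact_mod_cast h
    refine mul_le_mul_of_nonneg_right ((hw n).trans ?_) (norm_nonneg _)
    gcongr

end Degree

/-! ### Trial states and their particle number -/

namespace Bogoliubov

open ComplexConjugate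

variable {P : Type*} [InvolutiveNeg P] (D : Bogoliubov P)

/-- The supports of the occupations occurring in `f` lie in `S`. -/
def SuppIn (S : Finset P) (f : (P →₀ ℕ) → ℂ) : Prop := ∀ n, f n ≠ 0 → n.support ⊆ S

theorem SuppIn.ann {S : Finset P} {f : (P →₀ ℕ) → ℂ} (hf : SuppIn S f) (p : P) :
    SuppIn S (ann p f) := by
  intro n hn
  have h : f (n + Finsupp.single p 1) ≠ 0 := fun h => hn (by rw [ann_apply, h, mul_zero])
  exact (Finsupp.support_mono (self_le_add_right n _)).trans (hf _ h)

theorem SuppIn.cre {S : Finset P} {f : (P →₀ ℕ) → ℂ} (hf : SuppIn S f) {p : P} (hp : p ∈ S) :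
    SuppIn S (cre p f) := by
  intro n hn q hq
  have h : f (n - Finsupp.single p 1) ≠ 0 := fun h => hn (by rw [cre_apply, h, mul_zero])
  rcases eq_or_ne p q with rfl | hne
  · exact hp
  · refine hf _ h (Finsupp.mem_support_iff.2 ?_)
    rw [sub_single_apply_of_ne n hne]
    exact Finsupp.mem_support_iff.1 hq

theorem SuppIn.add {S : Finset P} {f g : (P →₀ ℕ) → ℂ} (hf : SuppIn S f) (hg : SuppIn S g) :
    SuppIn S (f + g) := by
  intro n hn
  by_cases h : f n = 0
  · exact hg n fun h' => hn (by rw [Pi.add_apply, h, h', add_zero])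
  · exact hf n h

theorem SuppIn.smul {S : Finset P} {f : (P →₀ ℕ) → ℂ} (hf : SuppIn S f) (c : ℂ) :
    SuppIn S (c • f) := fun n hn => hf n fun h => hn (by rw [Pi.smul_apply, h, smul_zero])

/-- Quasi-particle states involve finitely many bare modes, so their kinetic energy is a finite sum
over modes. -/
theorem suppIn_exc {S : Finset P} (hS : D.modes ⊆ S) (hneg : ∀ p ∈ S, -p ∈ S) (n : P →₀ ℕ)
    (hn : n.support ⊆ S) : SuppIn S (D.exc n) := by
  induction n using occupation_induction with
  | h0 =>
    rw [exc_zero]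
    exact fun m hm => (D.support_subset_of_vac_ne_zero hm).trans hS
  | hadd n p ih =>
    have h1 : n.support ⊆ S := (Finsupp.support_mono (self_le_add_right n _)).trans hn
    have h2 : p ∈ S := hn (Finsupp.mem_support_iff.2 (by rw [add_single_apply_self]; omega))
    rw [exc_add_single, cr_apply]
    exact (((ih h1).cre h2).smul _).add (((ih h1).ann _).smul _)

theorem suppIn_bas {S : Finset P} (hS : D.modes ⊆ S) (hneg : ∀ p ∈ S, -p ∈ S) (n : P →₀ ℕ)
    (hn : n.support ⊆ S) : SuppIn S (D.bas n) := (D.suppIn_exc hS hneg n hn).smul _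

/-- Linear combinations of quasi-particle states. -/
def trial {ι : Type*} [Fintype ι] (ν : ι → P →₀ ℕ) : (ι → ℂ) →ₗ[ℂ] ((P →₀ ℕ) → ℂ) :=
  Fintype.linearCombination ℂ fun j => D.bas (ν j)

section Trial

variable {ι : Type*} [Fintype ι] {ν : ι → P →₀ ℕ} (c : ι → ℂ)

theorem trial_apply : D.trial ν c = ∑ j, c j • D.bas (ν j) := Fintype.linearCombination_apply ..

theorem trial_mem_rapid : D.trial ν c ∈ rapid P := by
  rw [trial_apply]
  exact Submodule.sum_mem _ fun j _ => Submodule.smul_mem _ _ (D.bas_mem_rapid _)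

theorem hat_trial (hν : Function.Injective ν) :
    (∀ j, D.hat (D.trial ν c) (ν j) = c j) ∧
      ∀ m, m ∉ Set.range ν → D.hat (D.trial ν c) m = 0 := by
  classical
  have h : ∀ m, D.hat (D.trial ν c) m = ∑ j, c j * if m = ν j then 1 else 0 := by
    intro m
    rw [trial_apply, hat_sum _ _ fun j _ => (rapid_sqSum (D.bas_mem_rapid _)).smul _,
      Finset.sum_apply]
    refine Finset.sum_congr rfl fun j _ => ?_
    rw [hat_smul, Pi.smul_apply, hat_bas, smul_eq_mul]
  refine ⟨fun j => ?_, fun m hm => ?_⟩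
  · rw [h, Finset.sum_eq_single j]
    · simp
    · intro k _ hk
      rw [if_neg fun h => hk (hν h).symm, mul_zero]
    · simp
  · rw [h]
    refine Finset.sum_eq_zero fun j _ => ?_
    rw [if_neg fun h => hm ⟨j, h.symm⟩, mul_zero]

theorem tsum_hat_trial (hν : Function.Injective ν) (w : (P →₀ ℕ) → ℝ) :
    ∑' m, w m * ‖D.hat (D.trial ν c) m‖ ^ 2 = ∑ j, w (ν j) * ‖c j‖ ^ 2 := by
  obtain ⟨h1, h2⟩ := D.hat_trial c hν
  rw [← hν.tsum_eq, tsum_fintype]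
  · simp only [h1]
  · intro m hm
    by_contra hcon
    exact hm (by simp [h2 m hcon])

theorem nsq_trial (hν : Function.Injective ν) : nsq (D.trial ν c) = ∑ j, ‖c j‖ ^ 2 := by
  rw [← D.nsq_hat (rapid_sqSum (D.trial_mem_rapid c)), nsq]
  simpa using D.tsum_hat_trial c hν (fun _ => 1)

theorem nsq_an_trial (hν : Function.Injective ν) (p : P) :
    nsq (D.an p (D.trial ν c)) = ∑ j, (ν j p : ℝ) * ‖c j‖ ^ 2 := by
  rw [D.nsq_an (D.trial_mem_rapid c)]
  exact D.tsum_hat_trial c hν (fun m => (m p : ℝ))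

theorem suppIn_trial {S : Finset P} (hS : D.modes ⊆ S) (hneg : ∀ p ∈ S, -p ∈ S)
    (hν : ∀ j, (ν j).support ⊆ S) : SuppIn S (D.trial ν c) := by
  intro n hn
  rw [trial_apply, Finset.sum_apply] at hn
  obtain ⟨j, -, hj⟩ := Finset.exists_ne_zero_of_sum_ne_zero hn
  exact (D.suppIn_bas hS hneg _ (hν j)).smul (c j) n hj

end Trial

theorem numOp_eq_sum {S : Finset P} {f : (P →₀ ℕ) → ℂ} (hf : SuppIn S f) :
    numOp f = ∑ p ∈ S, cre p (ann p f) := by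
  ext n
  rw [Finset.sum_apply]
  simp only [cre_ann_apply, numOp]
  by_cases h : f n = 0
  · simp [h]
  · rw [← Finset.sum_mul, Finsupp.degree_apply, Finset.sum_subset (hf n h)
      fun p _ hp => Finsupp.notMem_support_iff.1 hp]
    push_cast
    rfl

/-- The particle number in terms of quasi-particle operators. -/
theorem cre_ann_eq (p : P) (f : (P →₀ ℕ) → ℂ) :
    cre p (ann p f) = (D.ch p ^ 2 : ℂ) • D.cr p (D.an p f) + (D.sh p ^ 2 : ℂ) • D.cr (-p) (D.an (-p) f)
      + (D.sh p ^ 2 : ℂ) • f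
      + (-(D.ch p * D.sh p) : ℂ) • (D.cr p (D.cr (-p) f) + D.an (-p) (D.an p f)) := by
  rw [D.cre_eq p (ann p f), D.ann_eq p f, map_sub, map_sub, map_smul, map_smul, map_smul, map_smul,
    an_cr_self]
  ext n
  simp only [Pi.add_apply, Pi.sub_apply, Pi.smul_apply, smul_eq_mul]
  ring

/-- Moment bound for linear combinations of states of at most `L` quasi-particles. -/
theorem sqrt_nsq_numOp_le {S : Finset P} {f : (P →₀ ℕ) → ℂ} (hf : f ∈ rapid P) (hS : SuppIn S f)
    (hneg : ∀ p ∈ S, -p ∈ S) {L : ℕ} (hL : DegLE L (D.hat f)) {B : ℝ}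
    (hsh : ∑ p ∈ S, D.sh p ^ 2 ≤ B) (hchsh : ∑ p ∈ S, |D.ch p * D.sh p| ≤ B) :
    √(nsq (numOp f)) ≤ (1 + 5 * B) * (L + 1) * √(nsq f) := by
  have hB : 0 ≤ B := (Finset.sum_nonneg fun _ _ => by positivity).trans hsh
  have hf2 := rapid_sqSum hf
  have hh2 := D.sqSum_hat hf2
  set s := √(nsq f) with hs
  have hs0 : 0 ≤ s := Real.sqrt_nonneg _
  have hshle : ∀ p ∈ S, D.sh p ^ 2 ≤ B := fun p hp =>
    (Finset.single_le_sum (f := fun p => D.sh p ^ 2) (fun _ _ => by positivity) hp).trans hsh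
  -- In quasi-particle operators the particle number splits into a number-preserving part `f1`, a
  -- constant `f2`, pair creation `f3` and pair annihilation `f4`. On at most `L` quasi-particles
  -- their norms are at most `(1 + 2 B) L`, `B`, `B (L + 2)` and `B L` times that of `f`.
  let f1 := ∑ p ∈ S, ((D.ch p ^ 2 + D.sh p ^ 2 : ℝ) : ℂ) • D.cr p (D.an p f)
  let f2 := ((∑ p ∈ S, D.sh p ^ 2 : ℝ) : ℂ) • f
  let f3 := ∑ p ∈ S, (-(D.ch p * D.sh p) : ℂ) • D.cr p (D.cr (-p) f)
  let f4 := ∑ p ∈ S, (-(D.ch p * D.sh p) : ℂ) • D.an (-p) (D.an p f)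
  have hdecomp : numOp f = f1 + f2 + (f3 + f4) := by
    -- Reflecting `p` moves the `sh²` term at `-p` onto the one at `p`.
    have hre : ∑ p ∈ S, (D.sh p ^ 2 : ℂ) • D.cr (-p) (D.an (-p) f)
        = ∑ p ∈ S, (D.sh p ^ 2 : ℂ) • D.cr p (D.an p f) :=
      Finset.sum_nbij' (fun p => -p) (fun p => -p) hneg hneg (fun p _ => neg_neg p)
        (fun p _ => neg_neg p) fun p _ => by rw [D.sh_neg]
    rw [numOp_eq_sum hS]
    simp only [D.cre_ann_eq _ f, Finset.sum_add_distrib, smul_add]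
    rw [hre, ← Finset.sum_add_distrib, ← Finset.sum_smul]
    simp only [← add_smul, f1, f2, f3, f4]
    push_cast
    rfl
  have hq1 : ∀ p, D.cr p (D.an p f) ∈ rapid P := fun p => D.cr_mem_rapid (D.an_mem_rapid hf p) p
  have hq3 : ∀ p, D.cr p (D.cr (-p) f) ∈ rapid P := fun p => D.cr_mem_rapid (D.cr_mem_rapid hf _) p
  have hq4 : ∀ p, D.an (-p) (D.an p f) ∈ rapid P := fun p => D.an_mem_rapid (D.an_mem_rapid hf _) _
  have s1 : SqSum f1 := sqSum_finset_sum _ fun p _ => (rapid_sqSum (hq1 p)).smul _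
  have s2 : SqSum f2 := hf2.smul _
  have s3 : SqSum f3 := sqSum_finset_sum _ fun p _ => (rapid_sqSum (hq3 p)).smul _
  have s4 : SqSum f4 := sqSum_finset_sum _ fun p _ => (rapid_sqSum (hq4 p)).smul _
  have b1 : √(nsq f1) ≤ (1 + 2 * B) * L * s := by
    have hhat : D.hat f1 = fun n => ((∑ p ∈ S, (D.ch p ^ 2 + D.sh p ^ 2) * n p : ℝ) : ℂ) * D.hat f n := by
      simp only [f1]
      rw [hat_sum _ _ fun p _ => (rapid_sqSum (hq1 p)).smul _]
      ext n
      rw [Finset.sum_apply, Complex.ofReal_sum, Finset.sum_mul]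
      refine Finset.sum_congr rfl fun p _ => ?_
      rw [hat_smul, Pi.smul_apply, hat_cr _ (D.an_mem_rapid hf p), hat_an _ hf, cre_ann_apply,
        smul_eq_mul]
      push_cast
      ring
    rw [← D.nsq_hat s1, hhat]
    have h1 := hL.nsq_numOp_le hh2 (C := 1 + 2 * B) (by positivity)
      (w := fun n => ∑ p ∈ S, (D.ch p ^ 2 + D.sh p ^ 2) * n p) ?_
    · rw [D.nsq_hat hf2] at h1
      refine (Real.sqrt_le_sqrt h1).trans (le_of_eq ?_)
      rw [Real.sqrt_mul (by positivity), Real.sqrt_sq (by positivity)]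
    · intro n
      rw [abs_of_nonneg (Finset.sum_nonneg fun _ _ => by positivity)]
      calc ∑ p ∈ S, (D.ch p ^ 2 + D.sh p ^ 2) * (n p : ℝ)
          ≤ ∑ p ∈ S, (1 + 2 * B) * (n p : ℝ) := by
            refine Finset.sum_le_sum fun p hp => ?_
            have := hshle p hp
            rw [D.ch_sq]
            exact mul_le_mul_of_nonneg_right (by linarith) (Nat.cast_nonneg _)
        _ = (1 + 2 * B) * ((∑ p ∈ S, n p : ℕ) : ℝ) := by
            rw [← Finset.mul_sum]; push_cast; rfl
        _ ≤ (1 + 2 * B) * n.degree := by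
            gcongr
            classical
            rw [Finsupp.degree_apply, Finset.sum_subset
              (Finset.subset_union_left (s₁ := n.support) (s₂ := S))
              (fun p _ hp => Finsupp.notMem_support_iff.1 hp)]
            exact Finset.sum_le_sum_of_subset Finset.subset_union_right
  have b2 : √(nsq f2) ≤ B * s := by
    simp only [f2]
    rw [nsq_smul, Real.sqrt_mul (by positivity), Real.sqrt_sq (norm_nonneg _), Complex.norm_real,
      Real.norm_eq_abs, abs_of_nonneg (Finset.sum_nonneg fun _ _ => by positivity)]
    gcongr
  have hnorm : ∀ p, ‖(-(D.ch p * D.sh p) : ℂ)‖ = |D.ch p * D.sh p| := fun p => by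
    rw [norm_neg, ← Complex.ofReal_mul, Complex.norm_real, Real.norm_eq_abs]
  have aux : ∀ (g : P → (P →₀ ℕ) → ℂ) (C : ℝ), 0 ≤ C → (∀ p, SqSum (g p)) →
      (∀ p, nsq (g p) ≤ C ^ 2 * nsq f) →
      √(nsq (∑ p ∈ S, (-(D.ch p * D.sh p) : ℂ) • g p)) ≤ B * (C * s) := by
    intro g C hC hg hgC
    refine (sqrt_nsq_finset_sum_le S fun p _ => (hg p).smul _).trans ?_
    calc ∑ p ∈ S, √(nsq ((-(D.ch p * D.sh p) : ℂ) • g p))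
        ≤ ∑ p ∈ S, |D.ch p * D.sh p| * (C * s) := by
          refine Finset.sum_le_sum fun p _ => ?_
          rw [nsq_smul, Real.sqrt_mul (by positivity), Real.sqrt_sq (norm_nonneg _), hnorm]
          refine mul_le_mul_of_nonneg_left ?_ (abs_nonneg _)
          refine (Real.sqrt_le_sqrt (hgC p)).trans (le_of_eq ?_)
          rw [Real.sqrt_mul (by positivity), Real.sqrt_sq hC]
      _ ≤ B * (C * s) := by
          rw [← Finset.sum_mul]
          gcongr
  have hn0 : 0 ≤ nsq f := nsq_nonneg f
  have b3 : √(nsq f3) ≤ B * ((L + 2) * s) := by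
    refine aux _ _ (by positivity) (fun p => rapid_sqSum (hq3 p)) fun p => ?_
    rw [← D.nsq_hat (rapid_sqSum (hq3 p)), hat_cr _ (D.cr_mem_rapid hf _), hat_cr _ hf]
    have e1 := hL.nsq_cre_le hh2 (-p)
    have e2 := (hL.cre (-p)).nsq_cre_le (rapid_sqSum (cre_mem_rapid (hL.mem_rapid hh2) (-p))) p
    rw [D.nsq_hat hf2] at e1
    push_cast at e2
    nlinarith [nsq_nonneg (cre (-p) (D.hat f))]
  have b4 : √(nsq f4) ≤ B * (L * s) := by
    refine aux _ _ (by positivity) (fun p => rapid_sqSum (hq4 p)) fun p => ?_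
    rw [← D.nsq_hat (rapid_sqSum (hq4 p)), hat_an _ (D.an_mem_rapid hf _), hat_an _ hf]
    have e1 := hL.nsq_ann_le hh2 p
    have e2 := (hL.ann p).nsq_ann_le (rapid_sqSum (ann_mem_rapid (hL.mem_rapid hh2) p)) (-p)
    rw [D.nsq_hat hf2] at e1
    have : (0 : ℝ) ≤ L := Nat.cast_nonneg L
    nlinarith [nsq_nonneg (ann p (D.hat f))]
  rw [hdecomp]
  have t1 := sqrt_nsq_add_le (s1.add s2) (s3.add s4)
  have t2 := sqrt_nsq_add_le s1 s2
  have t3 := sqrt_nsq_add_le s3 s4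
  have : (0 : ℝ) ≤ L := Nat.cast_nonneg L
  have hBs : 0 ≤ B * s := by positivity
  have hBLs : 0 ≤ B * L * s := by positivity
  nlinarith

end Bogoliubov

namespace Quadratic

variable {P : Type*} [InvolutiveNeg P] (Q : Quadratic P)

open Bogoliubov

/-- The kinetic energy of functions of finitely many modes. -/
theorem hasSum_kinetic {G : (P →₀ ℕ) → ℂ} (hG : G ∈ rapid P) {S : Finset P} (hS : SuppIn S G) :
    HasSum (fun n => Q.kin n * ‖G n‖ ^ 2) (∑ p ∈ S, Q.ε p * nsq (ann p G)) := by
  have h : ∀ p ∈ S, HasSum (fun n : P →₀ ℕ => Q.ε p * ((n p : ℝ) * ‖G n‖ ^ 2))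
      (Q.ε p * nsq (ann p G)) := fun p _ => by
    rw [nsq_ann]
    exact (summable_mul_norm_sq hG p).hasSum.mul_left _
  refine (hasSum_sum h).congr_fun fun n => ?_
  by_cases h0 : G n = 0
  · simp [h0]
  · rw [kin, Finsupp.sum_of_support_subset n (hS n h0) _ (by simp), Finset.sum_mul]
    exact Finset.sum_congr rfl fun p _ => by ring

/-- Upper bound on the quadratic Hamiltonian in the span of quasi-particle states. -/
theorem trial_le {ι : Type*} [Fintype ι] {ν : ι → P →₀ ℕ} (hν : Function.Injective ν) (c : ι → ℂ)
    {μ : ℝ} (hμ : ∀ j, Q.tot (ν j) ≤ μ) :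
    ∑' n, Q.kin n * ‖Q.bog.trial ν c n‖ ^ 2 + Q.potential (Q.bog.trial ν c)
      + Q.shift * nsq (Q.bog.trial ν c) ≤ μ * nsq (Q.bog.trial ν c) := by
  classical
  let S := Q.enlarge (Finset.univ.biUnion fun j => (ν j).support)
  have hsupp : ∀ j, (ν j).support ⊆ S := fun j =>
    (Finset.subset_biUnion_of_mem (fun j => (ν j).support) (Finset.mem_univ j)).trans
      (Q.subset_enlarge _)
  have hG := Q.bog.trial_mem_rapid (ν := ν) c
  have hS := Q.bog.suppIn_trial c (Q.modes_subset_enlarge _) (Q.neg_mem_enlarge _) hsupp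
  rw [(Q.hasSum_kinetic hG hS).tsum_eq,
    Q.sum_form_eq hG S (Q.modes_subset_enlarge _) (Q.neg_mem_enlarge _), Q.bog.nsq_trial c hν,
    Finset.mul_sum]
  simp only [Q.bog.nsq_an_trial c hν, Finset.mul_sum]
  rw [Finset.sum_comm]
  refine Finset.sum_le_sum fun j _ => ?_
  have : ∑ p ∈ S, Q.en p * ((ν j p : ℝ) * ‖c j‖ ^ 2) = Q.tot (ν j) * ‖c j‖ ^ 2 := by
    rw [tot, Finsupp.sum_of_support_subset _ (hsupp j) _ (by simp), Finset.sum_mul]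
    exact Finset.sum_congr rfl fun p _ => by ring
  rw [this]
  exact mul_le_mul_of_nonneg_right (hμ j) (by positivity)

/-- Moment bound in the span of quasi-particle states. -/
theorem trial_numOp_le {ι : Type*} [Fintype ι] {ν : ι → P →₀ ℕ} (hν : Function.Injective ν)
    (c : ι → ℂ) {L : ℕ} (hL : ∀ j, (ν j).degree ≤ L) {B : ℝ} (hB : ∑ p ∈ Q.modes, Q.u p ≤ B) :
    √(nsq (numOp (Q.bog.trial ν c))) ≤ (1 + 5 * B) * (L + 1) * √(nsq (Q.bog.trial ν c)) := by
  classical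
  let S := Q.enlarge (Finset.univ.biUnion fun j => (ν j).support)
  have hsupp : ∀ j, (ν j).support ⊆ S := fun j =>
    (Finset.subset_biUnion_of_mem (fun j => (ν j).support) (Finset.mem_univ j)).trans
      (Q.subset_enlarge _)
  have hG := Q.bog.trial_mem_rapid (ν := ν) c
  have hS := Q.bog.suppIn_trial c (Q.modes_subset_enlarge _) (Q.neg_mem_enlarge _) hsupp
  -- Modes added to `S` for the trial states carry no interaction, so the bound does not depend on
  -- them.
  have hu : ∑ p ∈ S, Q.u p ≤ B := by
    rw [← Finset.sum_subset (Q.modes_subset_enlarge _) fun p _ hp => Q.u_eq_zero p hp]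
    exact hB
  refine Q.bog.sqrt_nsq_numOp_le hG hS (Q.neg_mem_enlarge _) (L := L) ?_ ?_ ?_
  · intro n hn
    refine (Q.bog.hat_trial c hν).2 n ?_
    rintro ⟨j, rfl⟩
    exact absurd (hL j) (by omega)
  · refine (Finset.sum_le_sum fun p _ => ?_).trans hu
    linarith [Q.sh_sq_le p, Q.u_nonneg p]
  · refine (Finset.sum_le_sum fun p _ => ?_).trans hu
    rw [abs_of_nonneg (Q.ch_mul_sh_nonneg p)]
    linarith [Q.ch_mul_sh_le p, Q.u_nonneg p]

end Quadratic

/-! ### Symmetric functions of momenta and occupation numbers -/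

section Fock

variable {Z : Type*} [AddCommGroup Z]

instance : InvolutiveNeg {k : Z // k ≠ 0} where
  neg p := ⟨-p.1, neg_ne_zero.2 p.2⟩
  neg_neg p := Subtype.ext (neg_neg p.1)

theorem coe_neg_mode (p : {k : Z // k ≠ 0}) : ((-p : {k : Z // k ≠ 0}) : Z) = -(p : Z) := rfl

open Classical in
/-- One particle of momentum `k`, not counted if `k = 0`. -/
def oneOcc (k : Z) : {k : Z // k ≠ 0} →₀ ℕ := if h : k ≠ 0 then Finsupp.single ⟨k, h⟩ 1 else 0

theorem oneOcc_zero : oneOcc (0 : Z) = 0 := by simp [oneOcc]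

theorem oneOcc_coe (p : {k : Z // k ≠ 0}) : oneOcc (p : Z) = Finsupp.single p 1 := by
  rw [oneOcc, dif_pos p.2]

/-- The occupation numbers of the nonzero momenta in a list of momenta. -/
def occOf {N : ℕ} (κ : Fin N → Z) : {k : Z // k ≠ 0} →₀ ℕ := ∑ i, oneOcc (κ i)

theorem occOf_cons {N : ℕ} (k : Z) (r : Fin N → Z) :
    occOf (Fin.cons k r : Fin (N + 1) → Z) = oneOcc k + occOf r := by
  rw [occOf, Fin.sum_univ_succ]; rfl

theorem occOf_cons_zero {N : ℕ} (r : Fin N → Z) :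
    occOf (Fin.cons 0 r : Fin (N + 1) → Z) = occOf r := by
  rw [occOf_cons, oneOcc_zero, zero_add]

theorem occOf_cons_coe {N : ℕ} (p : {k : Z // k ≠ 0}) (r : Fin N → Z) :
    occOf (Fin.cons (p : Z) r : Fin (N + 1) → Z) = occOf r + Finsupp.single p 1 := by
  rw [occOf_cons, oneOcc_coe, add_comm]

theorem degree_oneOcc_le (k : Z) : (oneOcc k).degree ≤ 1 := by
  by_cases h : k = 0
  · rw [h, oneOcc_zero]; simp
  · rw [oneOcc, dif_pos h, Finsupp.degree_single]

theorem degree_occOf_le {N : ℕ} (κ : Fin N → Z) : (occOf κ).degree ≤ N := by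
  rw [occOf, map_sum]
  exact (Finset.sum_le_sum fun i _ => degree_oneOcc_le (κ i)).trans (by simp)

theorem occOf_comp_perm {N : ℕ} (κ : Fin N → Z) (σ : Equiv.Perm (Fin N)) :
    occOf (κ ∘ σ) = occOf κ := Equiv.sum_comp σ fun i => oneOcc (κ i)

/-- The normalization factor between occupation states and symmetrized plane waves. -/
def fockWeight (N : ℕ) (n : {k : Z // k ≠ 0} →₀ ℕ) : ℝ :=
  -- For `n.degree ≤ N` the radicand is the inverse of the number of lists of `N` momenta with these
  -- occupations; the second factorial belongs to the condensate.
  √((occFactorial n : ℝ) * ((N - n.degree).factorial : ℝ) / (N.factorial : ℝ))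

theorem fockWeight_pos (N : ℕ) (n : {k : Z // k ≠ 0} →₀ ℕ) : 0 < fockWeight N n := by
  have h1 : (0 : ℝ) < occFactorial n := by exact_mod_cast occFactorial_pos n
  have h2 : (0 : ℝ) < ((N - n.degree).factorial : ℝ) := by exact_mod_cast Nat.factorial_pos _
  have h3 : (0 : ℝ) < (N.factorial : ℝ) := by exact_mod_cast Nat.factorial_pos _
  exact Real.sqrt_pos.2 (by positivity)

/-- The symmetric function of `N` momenta with given occupation number amplitudes. -/
def fock (N : ℕ) : (({k : Z // k ≠ 0} →₀ ℕ) → ℂ) →ₗ[ℂ] ((Fin N → Z) → ℂ) where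
  toFun G κ := (fockWeight N (occOf κ) : ℂ) * G (occOf κ)
  map_add' f g := by ext n; simp [mul_add]
  map_smul' c f := by ext n; simp [mul_left_comm]

theorem fock_apply (N : ℕ) (G : ({k : Z // k ≠ 0} →₀ ℕ) → ℂ) (κ : Fin N → Z) :
    fock N G κ = (fockWeight N (occOf κ) : ℂ) * G (occOf κ) := rfl

open Classical in
/-- Removing a particle of momentum `k` from a state of `N + 1` particles. -/
def lower (N : ℕ) (k : Z) (G : ({k : Z // k ≠ 0} →₀ ℕ) → ℂ) : ({k : Z // k ≠ 0} →₀ ℕ) → ℂ :=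
  if h : k ≠ 0 then ann ⟨k, h⟩ G else fun n => (√((N : ℝ) + 1 - n.degree) : ℝ) * G n

theorem lower_coe (N : ℕ) (p : {k : Z // k ≠ 0}) (G : ({k : Z // k ≠ 0} →₀ ℕ) → ℂ) :
    lower N (p : Z) G = ann p G := by rw [lower, dif_pos p.2]

theorem lower_zero (N : ℕ) (G : ({k : Z // k ≠ 0} →₀ ℕ) → ℂ) (n : {k : Z // k ≠ 0} →₀ ℕ) :
    lower N (0 : Z) G n = (√((N : ℝ) + 1 - n.degree) : ℝ) * G n := by
  rw [lower, dif_neg (by simp)]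

/-- Fixing the momentum of one particle is annihilating it, up to `(N + 1)^{-1/2}`; for the
condensate the annihilator is multiplication by `√(N + 1 - n.degree)`. The unitarity of the
occupation representation and the two-particle computations both rest on this. -/
theorem fock_cons (N : ℕ) (G : ({k : Z // k ≠ 0} →₀ ℕ) → ℂ) (k : Z) (r : Fin N → Z) :
    fock (N + 1) G (Fin.cons k r) = ((√((N : ℝ) + 1))⁻¹ : ℝ) * fock N (lower N k G) r := by
  have hN : (0 : ℝ) < (N : ℝ) + 1 := by positivity
  have hNf : (0 : ℝ) < (N.factorial : ℝ) := by exact_mod_cast Nat.factorial_pos _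
  rw [fock_apply, fock_apply]
  by_cases hk : k = 0
  · subst hk
    rw [occOf_cons_zero, lower_zero, ← mul_assoc, ← mul_assoc, ← Complex.ofReal_mul,
      ← Complex.ofReal_mul]
    congr 2
    set n := occOf r with hn
    have hle : n.degree ≤ N := degree_occOf_le r
    have hle' : (n.degree : ℝ) ≤ N := by exact_mod_cast hle
    rw [fockWeight, fockWeight, ← Real.sqrt_inv, ← Real.sqrt_mul (by positivity),
      ← Real.sqrt_mul (by positivity)]
    congr 1
    rw [Nat.succ_sub hle, Nat.factorial_succ, Nat.factorial_succ]
    push_cast [Nat.cast_sub hle]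
    field_simp
    ring
  · obtain ⟨p, rfl⟩ : ∃ p : {k : Z // k ≠ 0}, k = p := ⟨⟨k, hk⟩, rfl⟩
    rw [occOf_cons_coe, lower_coe, ann_apply, ← mul_assoc, ← mul_assoc, ← Complex.ofReal_mul,
      ← Complex.ofReal_mul]
    congr 2
    set n := occOf r with hn
    rw [fockWeight, fockWeight, ← Real.sqrt_inv, ← Real.sqrt_mul (by positivity),
      ← Real.sqrt_mul (by positivity)]
    congr 1
    rw [degree_add_single, Nat.add_sub_add_right, occFactorial_add_single, Nat.factorial_succ]
    push_cast
    field_simp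

open Classical in
/-- Restriction to at most `N` particles. -/
def cut {P : Type*} (N : ℕ) : ((P →₀ ℕ) → ℂ) →ₗ[ℂ] ((P →₀ ℕ) → ℂ) where
  toFun G n := if n.degree ≤ N then G n else 0
  map_add' f g := by ext n; by_cases h : n.degree ≤ N <;> simp [h]
  map_smul' c f := by ext n; by_cases h : n.degree ≤ N <;> simp [h]

theorem cut_apply_of_le {P : Type*} {N : ℕ} (G : (P →₀ ℕ) → ℂ) {n : P →₀ ℕ} (h : n.degree ≤ N) :
    cut N G n = G n := if_pos h

theorem cut_apply_of_lt {P : Type*} {N : ℕ} (G : (P →₀ ℕ) → ℂ) {n : P →₀ ℕ} (h : N < n.degree) :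
    cut N G n = 0 := if_neg (by omega)

theorem degLE_cut {P : Type*} (N : ℕ) (G : (P →₀ ℕ) → ℂ) : DegLE N (cut N G) :=
  fun _ h => cut_apply_of_lt G h

theorem DegLE.cut_eq {P : Type*} {N : ℕ} {G : (P →₀ ℕ) → ℂ} (h : DegLE N G) : cut N G = G := by
  ext n
  rcases le_or_gt n.degree N with hn | hn
  · exact cut_apply_of_le G hn
  · rw [cut_apply_of_lt G hn, h n hn]

theorem norm_cut_le {P : Type*} (N : ℕ) (G : (P →₀ ℕ) → ℂ) (n : P →₀ ℕ) :
    ‖cut N G n‖ ≤ ‖G n‖ := by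
  rcases le_or_gt n.degree N with hn | hn
  · rw [cut_apply_of_le G hn]
  · rw [cut_apply_of_lt G hn, norm_zero]; exact norm_nonneg _

theorem SqSum.cut {P : Type*} {G : (P →₀ ℕ) → ℂ} (hG : SqSum G) (N : ℕ) : SqSum (cut N G) :=
  hG.of_le (norm_cut_le N G)

/-- The squared modulus with values in `[0, ∞]`. -/
def esq (z : ℂ) : ℝ≥0∞ := ENNReal.ofReal (‖z‖ ^ 2)

theorem esq_zero : esq 0 = 0 := by simp [esq]

theorem esq_mul_ofReal (c : ℝ) (z : ℂ) : esq ((c : ℂ) * z) = ENNReal.ofReal (c ^ 2) * esq z := by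
  rw [esq, esq, norm_mul, mul_pow, Complex.norm_real, Real.norm_eq_abs, sq_abs,
    ENNReal.ofReal_mul (by positivity)]

theorem sum_degree_eq_tsum {P : Type*} (n : P →₀ ℕ) :
    ((n.degree : ℕ) : ℝ≥0∞) = ∑' p, ((n p : ℕ) : ℝ≥0∞) := by
  rw [tsum_eq_sum (s := n.support) fun p hp => by
    rw [Finsupp.notMem_support_iff.1 hp, Nat.cast_zero], Finsupp.degree_apply, Nat.cast_sum]

theorem tsum_mode (F : Z → ℝ≥0∞) :
    ∑' k, F k = F 0 + ∑' p : {k : Z // k ≠ 0}, F p := by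
  classical
  have h := ENNReal.summable.tsum_add_tsum_compl (f := F) (s := {0}) ENNReal.summable
  rw [tsum_singleton] at h
  exact h.symm

/-- Remove one particle and sum over its momentum: the condensate contributes `N + 1 - n.degree` and
the excited modes `n.degree`, together `N + 1`, which cancels the normalization. Values in `[0, ∞]`
permit exchanging the sums freely. -/
theorem tsum_esq_fock (N : ℕ) (G : ({k : Z // k ≠ 0} →₀ ℕ) → ℂ) :
    ∑' κ, esq (fock N G κ) = ∑' n, esq (cut N G n) := by
  induction N generalizing G with
  | zero =>
    rw [tsum_eq_single (0 : {k : Z // k ≠ 0} →₀ ℕ), tsum_eq_single (fun i => i.elim0)]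
    · rw [fock_apply, cut_apply_of_le _ (by simp)]
      have : occOf (fun i : Fin 0 => (i.elim0 : Z)) = 0 := by simp [occOf]
      rw [this, fockWeight, occFactorial_zero]
      simp
    · intro κ hκ
      exact absurd (funext fun i => i.elim0) hκ
    · intro n hn
      rw [cut_apply_of_lt, esq_zero]
      exact Nat.pos_of_ne_zero fun h => hn ((Finsupp.degree_eq_zero_iff n).1 h)
  | succ N ih =>
    have hN : (0 : ℝ) < (N : ℝ) + 1 := by positivity
    rw [← (Fin.consEquiv fun _ : Fin (N + 1) => Z).tsum_eq, ENNReal.tsum_prod']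
    have h1 : ∀ k : Z, ∑' r : Fin N → Z, esq (fock (N + 1) G (Fin.cons k r))
        = ENNReal.ofReal (((N : ℝ) + 1)⁻¹) * ∑' n, esq (cut N (lower N k G) n) := by
      intro k
      rw [← ih, ← ENNReal.tsum_mul_left]
      refine tsum_congr fun r => ?_
      rw [fock_cons, esq_mul_ofReal, inv_pow, Real.sq_sqrt hN.le]
    have h1' : ∀ k : Z, ∑' r : Fin N → Z, esq (fock (N + 1) G
        ((Fin.consEquiv fun _ : Fin (N + 1) => Z) (k, r)))
        = ENNReal.ofReal (((N : ℝ) + 1)⁻¹) * ∑' n, esq (cut N (lower N k G) n) := h1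
    simp only [h1']
    rw [ENNReal.tsum_mul_left, tsum_mode]
    have h2 : ∑' n, esq (cut N (lower N (0 : Z) G) n)
        = ∑' n : {k : Z // k ≠ 0} →₀ ℕ, ((N + 1 - n.degree : ℕ) : ℝ≥0∞) * esq (cut (N + 1) G n) := by
      refine tsum_congr fun n => ?_
      rcases le_or_gt n.degree N with hn | hn
      · have hn' : (n.degree : ℝ) ≤ N := by exact_mod_cast hn
        rw [cut_apply_of_le _ hn, cut_apply_of_le _ (by omega), lower_zero, esq_mul_ofReal,
          Real.sq_sqrt (by linarith)]
        congr 1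
        rw [← ENNReal.ofReal_natCast, Nat.cast_sub (by omega)]
        push_cast; rfl
      · rw [cut_apply_of_lt _ hn, esq_zero, Nat.sub_eq_zero_of_le hn, Nat.cast_zero, zero_mul]
    have h3 : ∀ p : {k : Z // k ≠ 0}, ∑' n, esq (cut N (lower N (p : Z) G) n)
        = ∑' n : {k : Z // k ≠ 0} →₀ ℕ, ((n p : ℕ) : ℝ≥0∞) * esq (cut (N + 1) G n) := by
      intro p
      rw [← tsum_add_single p (h := fun n : {k : Z // k ≠ 0} →₀ ℕ =>
        ((n p : ℕ) : ℝ≥0∞) * esq (cut (N + 1) G n))]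
      · refine tsum_congr fun n => ?_
        rw [lower_coe, add_single_apply_self]
        rcases le_or_gt n.degree N with hn | hn
        · rw [cut_apply_of_le _ hn, cut_apply_of_le _ (by rw [degree_add_single]; omega), ann_apply,
            esq_mul_ofReal, Real.sq_sqrt (by positivity)]
          congr 1
          rw [← ENNReal.ofReal_natCast]
          push_cast; rfl
        · rw [cut_apply_of_lt _ hn, cut_apply_of_lt _ (by rw [degree_add_single]; omega), esq_zero,
            mul_zero]
      · intro n hn
        rw [hn, Nat.cast_zero, zero_mul]
    simp only [h2, h3]
    rw [ENNReal.tsum_comm, ← ENNReal.tsum_add, ← ENNReal.tsum_mul_left]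
    refine tsum_congr fun n => ?_
    rw [ENNReal.tsum_mul_right, ← sum_degree_eq_tsum, ← add_mul, ← mul_assoc]
    rcases le_or_gt n.degree (N + 1) with hn | hn
    · rw [← Nat.cast_add, Nat.sub_add_cancel hn]
      rw [← ENNReal.ofReal_natCast, ← ENNReal.ofReal_mul (by positivity)]
      push_cast
      rw [inv_mul_cancel₀ hN.ne', ENNReal.ofReal_one, one_mul]
    · rw [cut_apply_of_lt _ hn, esq_zero, mul_zero]

theorem sqSum_iff_tsum_esq {X : Type*} {f : X → ℂ} : SqSum f ↔ ∑' x, esq (f x) ≠ ∞ := by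
  constructor
  · intro h
    simp only [esq]
    rw [← ENNReal.ofReal_tsum_of_nonneg (fun _ => by positivity) h]
    exact ENNReal.ofReal_ne_top
  · intro h
    have := ENNReal.summable_toReal h
    refine this.congr fun x => ?_
    rw [esq, ENNReal.toReal_ofReal (by positivity)]

theorem nsq_eq_toReal {X : Type*} (f : X → ℂ) : nsq f = (∑' x, esq (f x)).toReal := by
  rw [ENNReal.tsum_toReal_eq (f := fun x => esq (f x)) fun x => ENNReal.ofReal_ne_top]
  exact tsum_congr fun x => by rw [esq, ENNReal.toReal_ofReal (by positivity)]

theorem sqSum_fock_iff (N : ℕ) (G : ({k : Z // k ≠ 0} →₀ ℕ) → ℂ) :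
    SqSum (fock N G) ↔ SqSum (cut N G) := by
  rw [sqSum_iff_tsum_esq, sqSum_iff_tsum_esq, tsum_esq_fock]

theorem SqSum.fock {G : ({k : Z // k ≠ 0} →₀ ℕ) → ℂ} (hG : SqSum G) (N : ℕ) : SqSum (fock N G) :=
  (sqSum_fock_iff N G).2 (hG.cut N)

theorem nsq_fock (N : ℕ) (G : ({k : Z // k ≠ 0} →₀ ℕ) → ℂ) : nsq (fock N G) = nsq (cut N G) := by
  rw [nsq_eq_toReal, nsq_eq_toReal, tsum_esq_fock]

theorem ip_fock (N : ℕ) {F G : ({k : Z // k ≠ 0} →₀ ℕ) → ℂ} (hF : SqSum F) (hG : SqSum G) :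
    ip (fock N F) (fock N G) = ip (cut N F) (cut N G) :=
  ip_map_of_nsq_map (fock N) (cut N) (fun _ h => h.cut N) (fun f h => ⟨h.fock N, nsq_fock N f⟩) hF hG

open Classical in
/-- The occupation number amplitudes of a symmetric function of momenta. -/
def unfock (N : ℕ) : ((Fin N → Z) → ℂ) →ₗ[ℂ] (({k : Z // k ≠ 0} →₀ ℕ) → ℂ) where
  toFun f n := if h : ∃ κ : Fin N → Z, occOf κ = n then (fockWeight N n : ℂ)⁻¹ * f h.choose else 0
  map_add' f g := by ext n; by_cases h : ∃ κ : Fin N → Z, occOf κ = n <;> simp [h, mul_add]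
  map_smul' c f := by
    ext n; by_cases h : ∃ κ : Fin N → Z, occOf κ = n <;> simp [h, mul_left_comm]

theorem degLE_unfock {N : ℕ} (f : (Fin N → Z) → ℂ) : DegLE N (unfock N f) := by
  intro n hn
  refine dif_neg ?_
  rintro ⟨κ, rfl⟩
  exact absurd (degree_occOf_le κ) (by omega)

theorem fock_unfock {N : ℕ} {f : (Fin N → Z) → ℂ} (hf : ∀ κ κ', occOf κ = occOf κ' → f κ = f κ') :
    fock N (unfock N f) = f := by
  ext κ
  have h : ∃ κ' : Fin N → Z, occOf κ' = occOf κ := ⟨κ, rfl⟩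
  have hw : (fockWeight N (occOf κ) : ℂ) ≠ 0 := by exact_mod_cast (fockWeight_pos N _).ne'
  have e : unfock N f (occOf κ) = (fockWeight N (occOf κ) : ℂ)⁻¹ * f h.choose := dif_pos h
  rw [fock_apply, e, ← mul_assoc, mul_inv_cancel₀ hw, one_mul]
  exact hf _ _ h.choose_spec

/-- Lists of momenta with the same occupation numbers are permutations of each other. -/
theorem exists_perm_of_occOf_eq {N : ℕ} {κ κ' : Fin N → Z} (h : occOf κ = occOf κ') :
    ∃ σ : Equiv.Perm (Fin N), κ = κ' ∘ σ := by
  classical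
  have happ : ∀ (κ : Fin N → Z) (p : {k : Z // k ≠ 0}),
      occOf κ p = Fintype.card {i // κ i = p} := by
    intro κ p
    rw [occOf, Finsupp.finsetSum_apply, Fintype.card_subtype, Finset.card_filter]
    refine Finset.sum_congr rfl fun i _ => ?_
    by_cases hi : κ i = 0
    · rw [hi, oneOcc_zero, if_neg (fun h => p.2 h.symm)]; rfl
    · rw [oneOcc, dif_pos hi, Finsupp.single_apply]
      simp only [Subtype.ext_iff]
  have hne : ∀ p : {k : Z // k ≠ 0}, Fintype.card {i // κ i = p} = Fintype.card {i // κ' i = p} :=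
    fun p => by rw [← happ, ← happ, h]
  have hcard : ∀ k : Z, Nonempty ({i // κ i = k} ≃ {i // κ' i = k}) := by
    intro k
    by_cases hk : k = 0
    · subst hk
      -- Zero momentum is not counted by `occOf`; its multiplicity agrees because the numbers of
      -- particles with nonzero momentum do.
      have e : {i // κ i ≠ 0} ≃ {i // κ' i ≠ 0} := by
        refine (Equiv.sigmaFiberEquiv (fun i : {i // κ i ≠ 0} => (⟨κ i, i.2⟩ : {k : Z // k ≠ 0}))).symm.trans
          (Equiv.trans (Equiv.sigmaCongrRight fun p => ?_)
          (Equiv.sigmaFiberEquiv (fun i : {i // κ' i ≠ 0} => (⟨κ' i, i.2⟩ : {k : Z // k ≠ 0}))))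
        refine Equiv.trans ?_ ((Fintype.equivOfCardEq (hne p)).trans ?_)
        · exact ⟨fun i => ⟨i.1.1, congrArg Subtype.val i.2⟩,
            fun i => ⟨⟨i.1, by rw [i.2]; exact p.2⟩, Subtype.ext i.2⟩, fun _ => rfl, fun _ => rfl⟩
        · exact ⟨fun i => ⟨⟨i.1, by rw [i.2]; exact p.2⟩, Subtype.ext i.2⟩,
            fun i => ⟨i.1.1, congrArg Subtype.val i.2⟩, fun _ => rfl, fun _ => rfl⟩
      have := Fintype.card_congr e
      have c1 := Fintype.card_subtype_compl (fun i => κ i = 0)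
      have c2 := Fintype.card_subtype_compl (fun i => κ' i = 0)
      have l1 := Fintype.card_subtype_le (fun i => κ i = 0)
      have l2 := Fintype.card_subtype_le (fun i => κ' i = 0)
      refine ⟨Fintype.equivOfCardEq ?_⟩
      simp only [ne_eq] at this
      omega
    · exact ⟨Fintype.equivOfCardEq (hne ⟨k, hk⟩)⟩
  let e := fun k => (hcard k).some
  let σ : Equiv.Perm (Fin N) :=
    (Equiv.sigmaFiberEquiv κ).symm.trans ((Equiv.sigmaCongrRight e).trans (Equiv.sigmaFiberEquiv κ'))
  refine ⟨σ, funext fun i => ?_⟩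
  exact ((e (κ i) ⟨i, rfl⟩).2).symm

end Fock

/-! ### Pair interactions in momentum space -/

section PairForm

open ComplexConjugate

variable {X : Type*}

theorem SqSum.comp_equiv {f : X → ℂ} (hf : SqSum f) (e : X ≃ X) : SqSum (f ∘ e) :=
  (e.summable_iff (f := fun x => ‖f x‖ ^ 2)).2 hf

theorem nsq_comp_equiv (f : X → ℂ) (e : X ≃ X) : nsq (f ∘ e) = nsq f :=
  e.tsum_eq fun x => ‖f x‖ ^ 2

theorem ip_comp_equiv (f g : X → ℂ) (e : X ≃ X) : ip (f ∘ e) (g ∘ e) = ip f g :=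
  e.tsum_eq fun x => conj (f x) * g x

theorem SqSum.norm {f : X → ℂ} (hf : SqSum f) : SqSum fun x => (‖f x‖ : ℂ) :=
  hf.of_le fun x => by simp

theorem SqSum.summable_norm_mul {f g : X → ℂ} (hf : SqSum f) (hg : SqSum g) :
    Summable fun x => ‖f x‖ * ‖g x‖ :=
  (hf.summable_mul hg).norm.congr fun x => by simp

theorem tsum_norm_mul_le {f g : X → ℂ} (hf : SqSum f) (hg : SqSum g) :
    ∑' x, ‖f x‖ * ‖g x‖ ≤ √(nsq f) * √(nsq g) := by
  have h := norm_ip_le hf.norm hg.norm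
  have e : ip (fun x => (‖f x‖ : ℂ)) (fun x => (‖g x‖ : ℂ)) = ((∑' x, ‖f x‖ * ‖g x‖ : ℝ) : ℂ) := by
    rw [ip, Complex.ofReal_tsum]
    simp
  have e1 : ∀ f : X → ℂ, nsq (fun x => (‖f x‖ : ℂ)) = nsq f := fun f => by simp [nsq]
  rw [e, e1, e1, Complex.norm_real] at h
  exact (le_abs_self _).trans h

variable {Z R : Type*} [AddCommGroup Z]

/-- Transfer of the momentum `p` between two particles. -/
def transfer (p : Z) : (Z × Z) × R ≃ (Z × Z) × R where
  toFun x := ((x.1.1 - p, x.1.2 + p), x.2)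
  invFun x := ((x.1.1 + p, x.1.2 - p), x.2)
  left_inv x := by simp
  right_inv x := by simp

theorem transfer_apply (p : Z) (x : (Z × Z) × R) :
    transfer p x = ((x.1.1 - p, x.1.2 + p), x.2) := rfl

theorem transfer_zero : (transfer 0 : (Z × Z) × R ≃ (Z × Z) × R) = Equiv.refl _ := by
  ext x <;> simp [transfer_apply]

theorem transfer_neg (p : Z) : (transfer (-p) : (Z × Z) × R ≃ (Z × Z) × R) = (transfer p).symm := by
  ext x
  · simp [transfer_apply, transfer]
  · simp [transfer_apply, transfer, sub_eq_add_neg]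
  · rfl

/-- The form of the pair interaction with Fourier coefficients `u`. -/
def pairForm (u : Z → ℝ) (f g : (Z × Z) × R → ℂ) : ℂ :=
  ∑' p, (u p : ℂ) * ip f (g ∘ transfer p)

variable {u : Z → ℝ} {f g : (Z × Z) × R → ℂ}

theorem norm_ip_transfer_le (hf : SqSum f) (hg : SqSum g) (p : Z) :
    ‖ip f (g ∘ transfer p)‖ ≤ √(nsq f) * √(nsq g) := by
  have := norm_ip_le hf (hg.comp_equiv (transfer p))
  rwa [nsq_comp_equiv] at this

theorem summable_pairForm (hu0 : ∀ p, 0 ≤ u p) (hu : Summable u) (hf : SqSum f) (hg : SqSum g) :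
    Summable fun p => (u p : ℂ) * ip f (g ∘ transfer p) := by
  refine Summable.of_norm_bounded (hu.mul_right (√(nsq f) * √(nsq g))) fun p => ?_
  rw [norm_mul, Complex.norm_real, Real.norm_of_nonneg (hu0 p)]
  exact mul_le_mul_of_nonneg_left (norm_ip_transfer_le hf hg p) (hu0 p)

theorem hasSum_re_pairForm (hu0 : ∀ p, 0 ≤ u p) (hu : Summable u) (hf : SqSum f) (hg : SqSum g) :
    HasSum (fun p => u p * (ip f (g ∘ transfer p)).re) (pairForm u f g).re := by
  have h := Complex.hasSum_re (summable_pairForm hu0 hu hf hg).hasSum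
  simp only [Complex.re_ofReal_mul] at h
  exact h

open Classical in
/-- The part of a function where both particles have nonzero momentum. -/
def bothPart (f : (Z × Z) × R → ℂ) (x : (Z × Z) × R) : ℂ :=
  if x.1.1 ≠ 0 ∧ x.1.2 ≠ 0 then f x else 0

open Classical in
/-- The part of a function where exactly one of two particles has nonzero momentum. -/
def onePart (f : (Z × Z) × R → ℂ) (x : (Z × Z) × R) : ℂ :=
  if (x.1.1 ≠ 0 ∧ x.1.2 = 0) ∨ (x.1.1 = 0 ∧ x.1.2 ≠ 0) then f x else 0

theorem norm_bothPart_le (f : (Z × Z) × R → ℂ) (x) : ‖bothPart f x‖ ≤ ‖f x‖ := by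
  unfold bothPart; split_ifs <;> simp

theorem norm_onePart_le (f : (Z × Z) × R → ℂ) (x) : ‖onePart f x‖ ≤ ‖f x‖ := by
  unfold onePart; split_ifs <;> simp

theorem SqSum.bothPart (hf : SqSum f) : SqSum (bothPart f) := hf.of_le (norm_bothPart_le f)

theorem SqSum.onePart (hf : SqSum f) : SqSum (onePart f) := hf.of_le (norm_onePart_le f)

/-- Up to terms with at least three particles of nonzero momentum, a transfer of momentum acts
on states with at most two such particles. -/
theorem norm_ip_transfer_sub_le (hf : SqSum f) {p : Z} (hp : p ≠ 0) :
    ‖ip f (f ∘ transfer p) - (ip (fun r => f ((0, 0), r)) (fun r => f ((-p, p), r))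
      + ip (fun r => f ((p, -p), r)) (fun r => f ((0, 0), r))
      + ip (fun r => f ((p, 0), r)) (fun r => f ((0, p), r))
      + ip (fun r => f ((0, -p), r)) (fun r => f ((-p, 0), r)))‖
    ≤ 2 * (√(nsq (onePart f)) * √(nsq (bothPart f))) + nsq (bothPart f) := by
  classical
  -- For `p ≠ 0` each particle has nonzero momentum before or after the transfer. These are the
  -- configurations in which exactly two of the four momenta are nonzero. In all others three or
  -- four are, which pairs `bothPart` with `onePart` or with itself.
  set S : Finset (Z × Z) := {(0, 0), (p, -p), (p, 0), (0, -p)} with hS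
  set F : (Z × Z) × R → ℂ := fun x => conj (f x) * f (transfer p x) with hF
  have hFs : Summable F := hf.summable_mul (hf.comp_equiv (transfer p))
  set F1 : (Z × Z) × R → ℂ := fun x => if x.1 ∈ S then F x else 0 with hF1
  set F2 : (Z × Z) × R → ℂ := fun x => if x.1 ∈ S then 0 else F x with hF2
  have hF1s : Summable F1 := hFs.norm.of_norm_bounded fun x => by
    simp only [hF1]; split_ifs <;> simp
  have hF2s : Summable F2 := hFs.norm.of_norm_bounded fun x => by
    simp only [hF2]; split_ifs <;> simp
  have hadd : ip f (f ∘ transfer p) = ∑' x, F1 x + ∑' x, F2 x := by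
    rw [← hF1s.tsum_add hF2s]
    refine tsum_congr fun x => ?_
    simp only [hF1, hF2]; split_ifs <;> simp [hF]
  have h1 : ∑' x, F1 x = ip (fun r => f ((0, 0), r)) (fun r => f ((-p, p), r))
      + ip (fun r => f ((p, -p), r)) (fun r => f ((0, 0), r))
      + ip (fun r => f ((p, 0), r)) (fun r => f ((0, p), r))
      + ip (fun r => f ((0, -p), r)) (fun r => f ((-p, 0), r)) := by
    rw [hF1s.tsum_prod, tsum_eq_sum (s := S)]
    · have hp' : -p ≠ 0 := neg_ne_zero.2 hp
      rw [hS, Finset.sum_insert (by simp [hp, hp.symm]), Finset.sum_insert (by simp [hp, hp', hp.symm]),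
        Finset.sum_insert (by simp [hp]), Finset.sum_singleton]
      simp [hF1, hS, hF, transfer_apply, ip, add_assoc]
    · intro b hb
      simp [hF1, hb]
  rw [hadd, h1, add_sub_cancel_left]
  have hb := hf.onePart
  have hc := hf.bothPart
  have hbp := hb.comp_equiv (transfer p)
  have hcp := hc.comp_equiv (transfer p)
  have hpt : ∀ x, ‖F2 x‖ ≤ ‖onePart f x‖ * ‖bothPart f (transfer p x)‖
      + ‖bothPart f x‖ * ‖onePart f (transfer p x)‖
      + ‖bothPart f x‖ * ‖bothPart f (transfer p x)‖ := by
    intro x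
    by_cases hx : x.1 ∈ S
    · simp only [hF2, if_pos hx, norm_zero]; positivity
    · simp only [hF2, if_neg hx, hF, norm_mul, RCLike.norm_conj]
      obtain ⟨⟨k, l⟩, r⟩ := x
      simp only [hS, Finset.mem_insert, Finset.mem_singleton, Prod.mk.injEq, not_or, not_and] at hx
      obtain ⟨x1, x2, x3, x4⟩ := hx
      simp only [onePart, bothPart, transfer_apply]
      have e1 : k - p = 0 ↔ k = p := sub_eq_zero
      have e2 : l + p = 0 ↔ l = -p := add_eq_zero_iff_eq_neg
      by_cases hk : k = 0
      · subst hk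
        have hl : l ≠ 0 := x1 rfl
        have hl' : l + p ≠ 0 := fun h => x4 rfl (e2.1 h)
        have : (0 : Z) - p ≠ 0 := by simpa using hp
        simp [hl, hl', hp]
      · by_cases hl : l = 0
        · subst hl
          have hk' : k - p ≠ 0 := fun h => x3 (e1.1 h) rfl
          simp [hk, hk', hp]
        · by_cases hk' : k - p = 0
          · have hl' : l + p ≠ 0 := fun h => x2 (e1.1 hk') (e2.1 h)
            simp [hk, hl, hk', hl']
          · by_cases hl' : l + p = 0
            · simp [hk, hl, hk', hl']
            · simp [hk, hl, hk', hl']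
  have s1 := hb.summable_norm_mul hcp
  have s2 := hc.summable_norm_mul hbp
  have s3 := hc.summable_norm_mul hcp
  calc ‖∑' x, F2 x‖ ≤ ∑' x, ‖F2 x‖ := norm_tsum_le_tsum_norm hF2s.norm
    _ ≤ ∑' x, (‖onePart f x‖ * ‖bothPart f (transfer p x)‖
      + ‖bothPart f x‖ * ‖onePart f (transfer p x)‖
      + ‖bothPart f x‖ * ‖bothPart f (transfer p x)‖) :=
        hF2s.norm.tsum_le_tsum hpt ((s1.add s2).add s3)
    _ = _ := ((s1.add s2).tsum_add s3).trans (congrArg (· + _) (s1.tsum_add s2))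
    _ ≤ √(nsq (onePart f)) * √(nsq (bothPart f)) + √(nsq (bothPart f)) * √(nsq (onePart f))
        + √(nsq (bothPart f)) * √(nsq (bothPart f)) := by
        have t1 := tsum_norm_mul_le hb hcp
        have t2 := tsum_norm_mul_le hc hbp
        have t3 := tsum_norm_mul_le hc hcp
        rw [nsq_comp_equiv] at t1 t2 t3
        exact add_le_add (add_le_add t1 t2) t3
    _ = _ := by rw [Real.mul_self_sqrt (nsq_nonneg _)]; ring

/-- Commuting a weight that depends on the number of particles of nonzero momentum through the
pair interaction. -/
theorem abs_re_pairForm_sub_le (hu0 : ∀ p, 0 ≤ u p) (hu : Summable u) (hu' : ∀ p, u (-p) = u p)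
    (hf : SqSum f) (m : (Z × Z) × R → ℝ) (hm : ∀ x, 0 ≤ m x)
    (hmf : SqSum fun x => (m x : ℂ) * f x)
    (h2 : ∀ x p, |m x - m (transfer p x)| ≤ 2)
    (h0 : ∀ x p, ¬(x.1.1 ≠ 0 ∧ x.1.2 ≠ 0) → ¬(x.1.1 - p ≠ 0 ∧ x.1.2 + p ≠ 0) → m (transfer p x) = m x) :
    |(pairForm u (fun x => (m x : ℂ) * f x) f).re
      - (pairForm u (fun x => (√(m x) : ℂ) * f x) (fun x => (√(m x) : ℂ) * f x)).re|
    ≤ 2 * (∑' p, u p) * (√(nsq (bothPart f)) * √(nsq f)) := by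
  have hsf : SqSum fun x => (√(m x) : ℂ) * f x := by
    refine (hf.summable_norm_mul hmf).congr fun x => ?_
    rw [norm_mul, norm_mul, Complex.norm_real, Complex.norm_real, Real.norm_of_nonneg (hm x),
      Real.norm_of_nonneg (Real.sqrt_nonneg _), mul_pow, Real.sq_sqrt (hm x)]
    ring
  have hc := hf.bothPart
  set a : Z → ℝ := fun p => (ip (fun x => (m x : ℂ) * f x) (f ∘ transfer p)).re with ha
  -- Reversing the transfer moves the weight to the other side of the form, so the form may be
  -- averaged over both placements.
  have hneg : ∀ p, a (-p) = (ip f ((fun x => (m x : ℂ) * f x) ∘ transfer p)).re := by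
    intro p
    rw [ha, re_ip_comm f]
    simp only
    rw [← ip_comp_equiv _ _ (transfer p), Function.comp_assoc, transfer_neg]
    congr 2
    funext x; simp
  have hA := hasSum_re_pairForm hu0 hu hmf hf
  have hA' : HasSum (fun p => u p * a (-p)) (pairForm u (fun x => (m x : ℂ) * f x) f).re := by
    rw [← (Equiv.neg Z).hasSum_iff] at hA
    convert hA using 1
    funext p
    simp [hu', ha]
  have hD := hasSum_re_pairForm hu0 hu hsf hsf
  have hsum := (((hA.add hA').mul_left (1 / 2)).sub hD)
  have e : 1 / 2 * ((pairForm u (fun x => (m x : ℂ) * f x) f).re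
      + (pairForm u (fun x => (m x : ℂ) * f x) f).re)
      = (pairForm u (fun x => (m x : ℂ) * f x) f).re := by ring
  rw [e] at hsum
  rw [← hsum.tsum_eq, ← Real.norm_eq_abs]
  have hbd := hu.mul_right (2 * (√(nsq (bothPart f)) * √(nsq f)))
  refine (tsum_of_norm_bounded hbd.hasSum fun p => ?_).trans
    (le_of_eq (by rw [tsum_mul_right]; ring))
  rw [hneg p]
  have hfp := hf.comp_equiv (transfer p)
  have hcp := hc.comp_equiv (transfer p)
  have s1 := hmf.summable_mul hfp
  have s2 := hf.summable_mul (hmf.comp_equiv (transfer p))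
  have s3 := hsf.summable_mul (hsf.comp_equiv (transfer p))
  -- With `m` and `m'` the weights before and after the transfer, ½(m + m') - √m √m' = ½(√m - √m')²,
  -- which is at most ½|m - m'| ≤ 1 and vanishes unless both particles are excited before or after.
  have hcomb : 1 / 2 * (u p * a p + u p * (ip f ((fun x => (m x : ℂ) * f x) ∘ transfer p)).re)
      - u p * (ip (fun x => (√(m x) : ℂ) * f x) ((fun x => (√(m x) : ℂ) * f x) ∘ transfer p)).re
      = u p * (∑' x, (1 / 2 : ℂ) * ((√(m x) - √(m (transfer p x)) : ℝ) : ℂ) ^ 2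
        * (conj (f x) * f (transfer p x))).re := by
    have : ∑' x, (1 / 2 : ℂ) * ((√(m x) - √(m (transfer p x)) : ℝ) : ℂ) ^ 2
        * (conj (f x) * f (transfer p x))
        = (1 / 2 : ℂ) * (ip (fun x => (m x : ℂ) * f x) (f ∘ transfer p)
          + ip f ((fun x => (m x : ℂ) * f x) ∘ transfer p))
          - ip (fun x => (√(m x) : ℂ) * f x) ((fun x => (√(m x) : ℂ) * f x) ∘ transfer p) := by
      rw [ip, ip, ip, ← s1.tsum_add s2, ← tsum_mul_left, ← ((s1.add s2).mul_left _).tsum_sub s3]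
      refine tsum_congr fun x => ?_
      have q1 : ((√(m x) : ℝ) : ℂ) ^ 2 = m x := by rw [← Complex.ofReal_pow, Real.sq_sqrt (hm x)]
      have q2 : ((√(m (transfer p x)) : ℝ) : ℂ) ^ 2 = m (transfer p x) := by
        rw [← Complex.ofReal_pow, Real.sq_sqrt (hm _)]
      simp only [Function.comp_apply, map_mul, Complex.conj_ofReal, Complex.ofReal_sub]
      rw [← q1, ← q2]
      ring
    rw [this]
    simp only [ha, Complex.sub_re, Complex.add_re, Complex.mul_re]
    norm_num
    ring
  rw [hcomb, norm_mul, Real.norm_of_nonneg (hu0 p)]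
  refine mul_le_mul_of_nonneg_left ?_ (hu0 p)
  have t1 := hc.summable_norm_mul hfp
  have t2 := hf.summable_norm_mul hcp
  have b1 := tsum_norm_mul_le hc hfp
  have b2 := tsum_norm_mul_le hf hcp
  rw [nsq_comp_equiv] at b1 b2
  refine (Complex.abs_re_le_norm _).trans ((tsum_of_norm_bounded (t1.add t2).hasSum fun x => ?_).trans ?_)
  · rw [norm_mul, norm_mul, norm_pow, Complex.norm_real, norm_mul, RCLike.norm_conj, Real.norm_eq_abs,
      sq_abs]
    simp only [Function.comp_apply]
    have hsq : (√(m x) - √(m (transfer p x))) ^ 2 ≤ |m x - m (transfer p x)| := by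
      have h1 := Real.sq_sqrt (hm x)
      have h2 := Real.sq_sqrt (hm (transfer p x))
      have h3 := Real.sqrt_nonneg (m x)
      have h4 := Real.sqrt_nonneg (m (transfer p x))
      rcases le_total (√(m x)) (√(m (transfer p x))) with h | h
      · refine le_trans ?_ (neg_le_abs _); nlinarith
      · refine le_trans ?_ (le_abs_self _); nlinarith
    have hff : 0 ≤ ‖f x‖ * ‖f (transfer p x)‖ := by positivity
    have hn1 : ‖(1 / 2 : ℂ)‖ = 1 / 2 := by norm_num
    rw [hn1]
    have hle : 1 / 2 * (√(m x) - √(m (transfer p x))) ^ 2 * (‖f x‖ * ‖f (transfer p x)‖)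
        ≤ ‖f x‖ * ‖f (transfer p x)‖ := by
      have := h2 x p
      nlinarith
    by_cases c1 : x.1.1 ≠ 0 ∧ x.1.2 ≠ 0
    · have : bothPart f x = f x := if_pos c1
      rw [this]
      exact hle.trans (le_add_of_nonneg_right (by positivity))
    · by_cases c2 : x.1.1 - p ≠ 0 ∧ x.1.2 + p ≠ 0
      · have : bothPart f (transfer p x) = f (transfer p x) := if_pos c2
        rw [this]
        exact hle.trans (le_add_of_nonneg_left (by positivity))
      · rw [h0 x p c1 c2]
        simp only [sub_self, ne_eq, OfNat.ofNat_ne_zero, not_false_eq_true, zero_pow, mul_zero,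
          zero_mul]
        positivity
  · rw [t1.tsum_add t2]
    simp only [Function.comp_def] at b1 b2 ⊢
    linarith

end PairForm

/-! ### Two particles singled out of a bosonic state -/

section TwoBody

open ComplexConjugate

variable {Z : Type*} [AddCommGroup Z] {M : ℕ} {G : ({k : Z // k ≠ 0} →₀ ℕ) → ℂ}

theorem DegLE.lower {N : ℕ} (hG : DegLE (N + 1) G) (k : Z) : DegLE N (lower N k G) := by
  intro n hn
  by_cases hk : k = 0
  · subst hk
    rw [lower_zero]
    rcases eq_or_ne n.degree (N + 1) with h | h
    · simp [h]
    · rw [hG n (by omega), mul_zero]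
  · obtain ⟨p, rfl⟩ : ∃ p : {k : Z // k ≠ 0}, k = p := ⟨⟨k, hk⟩, rfl⟩
    rw [lower_coe, ann_apply, hG _ (by rw [degree_add_single]; omega), mul_zero]

theorem SqSum.ann {P : Type*} {G : (P →₀ ℕ) → ℂ} (hG : SqSum G) {N : ℕ} (hN : DegLE N G) (p : P) :
    SqSum (BoseGas.ann p G) :=
  rapid_sqSum (ann_mem_rapid (hN.mem_rapid hG) p)

theorem SqSum.lower {N : ℕ} (hG : SqSum G) (hN : DegLE (N + 1) G) (k : Z) : SqSum (lower N k G) := by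
  by_cases hk : k = 0
  · subst hk
    refine (hG.smul (√((N : ℝ) + 1) : ℝ)).of_le fun n => ?_
    rw [lower_zero, Pi.smul_apply, smul_eq_mul, norm_mul, norm_mul, Complex.norm_real,
      Complex.norm_real, Real.norm_of_nonneg (Real.sqrt_nonneg _),
      Real.norm_of_nonneg (Real.sqrt_nonneg _)]
    have : (0 : ℝ) ≤ n.degree := by positivity
    gcongr
    linarith
  · obtain ⟨p, rfl⟩ : ∃ p : {k : Z // k ≠ 0}, k = p := ⟨⟨k, hk⟩, rfl⟩
    rw [lower_coe]
    exact hG.ann hN p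

theorem lower_zero_ann (N : ℕ) (p : {k : Z // k ≠ 0}) :
    ann p (lower (N + 1) (0 : Z) G) = lower N (0 : Z) (ann p G) := by
  ext n
  rw [ann_apply, lower_zero, lower_zero, ann_apply, degree_add_single]
  have : ((N + 1 : ℕ) : ℝ) + 1 - ((n.degree + 1 : ℕ) : ℝ) = (N : ℝ) + 1 - n.degree := by
    push_cast; ring
  rw [this]; ring

/-- A list of momenta as the first two together with the rest. -/
def splitTwo (M : ℕ) : (Z × Z) × (Fin M → Z) ≃ (Fin (M + 2) → Z) where
  toFun x := Fin.cons x.1.1 (Fin.cons x.1.2 x.2)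
  invFun κ := ((κ 0, κ 1), fun i => κ i.succ.succ)
  left_inv x := rfl
  right_inv κ := by
    ext i
    refine Fin.cases rfl (fun i => ?_) i
    refine Fin.cases rfl (fun i => ?_) i
    rfl

theorem splitTwo_apply (x : (Z × Z) × (Fin M → Z)) :
    splitTwo M x = Fin.cons x.1.1 (Fin.cons x.1.2 x.2) := rfl

/-- A bosonic state as a function of the first two momenta and the rest. -/
def fockTwo (M : ℕ) (G : ({k : Z // k ≠ 0} →₀ ℕ) → ℂ) (x : (Z × Z) × (Fin M → Z)) : ℂ :=
  fock (M + 2) G (splitTwo M x)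

theorem SqSum.fockTwo (hG : SqSum G) : SqSum (fockTwo M G) :=
  ((splitTwo M).summable_iff (f := fun x => ‖BoseGas.fock (M + 2) G x‖ ^ 2)).2 (hG.fock _)

theorem nsq_fockTwo (hM : DegLE (M + 2) G) : nsq (fockTwo M G) = nsq G := by
  have := nsq_fock (M + 2) G
  rw [hM.cut_eq] at this
  rw [← this]
  exact (splitTwo M).tsum_eq fun x => ‖fock (M + 2) G x‖ ^ 2

/-- Normalization of states of two particles. -/
def pairNorm (M : ℕ) : ℝ := (√((M : ℝ) + 2))⁻¹ * (√((M : ℝ) + 1))⁻¹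

theorem pairNorm_sq (M : ℕ) : pairNorm M ^ 2 = (((M : ℝ) + 2) * ((M : ℝ) + 1))⁻¹ := by
  rw [pairNorm, mul_pow, inv_pow, inv_pow, Real.sq_sqrt (by positivity), Real.sq_sqrt (by positivity),
    mul_inv]

theorem fockTwo_apply (k l : Z) (r : Fin M → Z) :
    fockTwo M G ((k, l), r) = (pairNorm M : ℂ) * fock M (lower M l (lower (M + 1) k G)) r := by
  rw [fockTwo, splitTwo_apply, fock_cons, fock_cons, ← mul_assoc, ← Complex.ofReal_mul, pairNorm]
  congr 4
  push_cast; ring_nf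

/-- Two uses of `fock_cons` and the unitarity of `fock`: every two-particle matrix element becomes
one of products of two annihilators, divided by `N (N - 1)` with `N = M + 2`. -/
theorem ip_fockTwo (hG : SqSum G) (hM : DegLE (M + 2) G) (k l k' l' : Z) :
    ip (fun r => fockTwo M G ((k, l), r)) (fun r => fockTwo M G ((k', l'), r))
      = ((((M : ℝ) + 2) * ((M : ℝ) + 1))⁻¹ : ℝ)
        * ip (lower M l (lower (M + 1) k G)) (lower M l' (lower (M + 1) k' G)) := by
  have e : ∀ k l : Z, (fun r => fockTwo M G ((k, l), r))
      = (pairNorm M : ℂ) • fock M (lower M l (lower (M + 1) k G)) := fun k l => by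
    ext r; rw [fockTwo_apply]; rfl
  have h1 : ∀ k l : Z, DegLE M (lower M l (lower (M + 1) k G)) := fun k l => (hM.lower k).lower l
  have h2 : ∀ k l : Z, SqSum (lower M l (lower (M + 1) k G)) := fun k l =>
    (hG.lower hM k).lower (hM.lower k) l
  rw [e, e, ip_smul_left, ip_smul_right, ip_fock M (h2 _ _) (h2 _ _), (h1 _ _).cut_eq, (h1 _ _).cut_eq,
    ← pairNorm_sq, Complex.conj_ofReal]
  push_cast; ring

theorem SqSum.numOp {P : Type*} {G : (P →₀ ℕ) → ℂ} (hG : SqSum G) {N : ℕ} (hN : DegLE N G) :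
    SqSum (numOp G) := by
  refine (hG.smul (N : ℂ)).of_le fun n => ?_
  rw [BoseGas.numOp, Pi.smul_apply, smul_eq_mul, norm_mul, norm_mul, Complex.norm_natCast,
    Complex.norm_natCast]
  rcases lt_or_ge N n.degree with h | h
  · simp [hN n h]
  · have : (n.degree : ℝ) ≤ N := by exact_mod_cast h
    gcongr

/-- Annihilating a particle lowers the degree by one and weighs by `n p ≤ n.degree`, so two powers
of the degree suffice, uniformly in the mode. -/
theorem tsum_degree_ann_le {P : Type*} {G : (P →₀ ℕ) → ℂ} (hG : SqSum (numOp G)) (p : P) :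
    Summable (fun n => (n.degree : ℝ) * ‖ann p G n‖ ^ 2) ∧
      ∑' n, (n.degree : ℝ) * ‖ann p G n‖ ^ 2 ≤ nsq (numOp G) := by
  have hs : Summable fun n : P →₀ ℕ => (n.degree : ℝ) * ((n p : ℝ) * ‖G n‖ ^ 2) := by
    refine Summable.of_nonneg_of_le (fun _ => by positivity) (fun n => ?_) hG
    rw [BoseGas.numOp, norm_mul, mul_pow, Complex.norm_natCast, ← mul_assoc, sq (n.degree : ℝ)]
    have := apply_le_degree n p
    gcongr
  have h1 := (hasSum_ann_sq_iff p G (fun n => (n.degree : ℝ))).2 hs.hasSum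
  have hle : ∀ n : P →₀ ℕ, (n.degree : ℝ) * ‖ann p G n‖ ^ 2
      ≤ ((n + Finsupp.single p 1).degree : ℝ) * ‖ann p G n‖ ^ 2 := fun n => by
    rw [degree_add_single]; push_cast
    nlinarith [sq_nonneg ‖ann p G n‖]
  have hs' := Summable.of_nonneg_of_le (fun _ => by positivity) hle h1.summable
  refine ⟨hs', (hs'.tsum_le_tsum hle h1.summable).trans (h1.tsum_eq.le.trans ?_)⟩
  refine hs.tsum_le_tsum (fun n => ?_) hG
  rw [BoseGas.numOp, norm_mul, mul_pow, Complex.norm_natCast, ← mul_assoc, sq (n.degree : ℝ)]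
  have := apply_le_degree n p
  gcongr

theorem nsq_ann_ann_le {P : Type*} {G : (P →₀ ℕ) → ℂ} (hG : SqSum (numOp G)) (p q : P) :
    nsq (ann q (ann p G)) ≤ nsq (numOp G) := by
  obtain ⟨hs, hle⟩ := tsum_degree_ann_le hG p
  rw [nsq_ann]
  have hle' : ∀ n : P →₀ ℕ, (n q : ℝ) * ‖ann p G n‖ ^ 2 ≤ (n.degree : ℝ) * ‖ann p G n‖ ^ 2 :=
    fun n => mul_le_mul_of_nonneg_right (apply_le_degree n q) (by positivity)
  exact ((Summable.of_nonneg_of_le (fun _ => by positivity) hle' hs).tsum_le_tsum hle' hs).trans hle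

/-- Replacing the condensate number `M + 1 - n.degree` by `M + 1` costs exactly the degree-weighted
norm of `ann p G`. -/
theorem abs_nsq_lower_zero_sub_le (hG : SqSum G) (hM : DegLE (M + 2) G) (p : {k : Z // k ≠ 0}) :
    |nsq (lower M (0 : Z) (ann p G)) - ((M : ℝ) + 1) * nsq (ann p G)| ≤ nsq (numOp G) := by
  obtain ⟨hs, hle⟩ := tsum_degree_ann_le (hG.numOp hM) p
  have ha := hG.ann hM p
  have hdeg : DegLE (M + 1) (ann p G) := by
    have := hM.lower (p : Z)
    rwa [lower_coe] at this
  have e : nsq (lower M (0 : Z) (ann p G))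
      = ((M : ℝ) + 1) * nsq (ann p G) - ∑' n, (n.degree : ℝ) * ‖ann p G n‖ ^ 2 := by
    rw [nsq, nsq, ← tsum_mul_left, ← (Summable.mul_left _ ha).tsum_sub hs]
    refine tsum_congr fun n => ?_
    rw [lower_zero, norm_mul, mul_pow, Complex.norm_real, Real.norm_eq_abs, sq_abs]
    rcases lt_or_ge (M + 1) n.degree with h | h
    · simp [hdeg n h]
    · have : (n.degree : ℝ) ≤ (M : ℝ) + 1 := by exact_mod_cast h
      rw [Real.sq_sqrt (by linarith)]; ring
  have h0 : 0 ≤ ∑' n, (n.degree : ℝ) * ‖ann p G n‖ ^ 2 := tsum_nonneg fun _ => by positivity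
  rw [e, abs_le]
  constructor <;> linarith [nsq_nonneg (numOp G)]

/-- Two condensate annihilators multiply by `√(M + 1 - t) √(M + 2 - t)` with `t = n.degree`, which
differs from `M + 1` by at most `1 + t`. -/
theorem norm_ip_lower_zero_sub_le (hG : SqSum G) (hM : DegLE (M + 2) G) (p q : {k : Z // k ≠ 0}) :
    ‖ip (lower M (0 : Z) (lower (M + 1) 0 G)) (ann q (ann p G))
      - ((M : ℝ) + 1 : ℝ) * ip G (ann q (ann p G))‖
    ≤ (√(nsq G) + √(nsq (numOp G))) * √(nsq (numOp G)) := by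
  have ha : SqSum (ann q (ann p G)) := (hG.ann hM p).ann (hM.ann p) q
  have h00 : SqSum (lower M (0 : Z) (lower (M + 1) 0 G)) :=
    (hG.lower hM 0).lower (hM.lower 0) 0
  set F : ({k : Z // k ≠ 0} →₀ ℕ) → ℂ :=
    lower M (0 : Z) (lower (M + 1) 0 G) - (((M : ℝ) + 1 : ℝ) : ℂ) • G with hF
  have hGM := hG.smul (((M : ℝ) + 1 : ℝ) : ℂ)
  have hFs : SqSum F := h00.sub hGM
  have e : ip (lower M (0 : Z) (lower (M + 1) 0 G)) (ann q (ann p G))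
      - ((M : ℝ) + 1 : ℝ) * ip G (ann q (ann p G)) = ip F (ann q (ann p G)) := by
    have h1 := ip_add_left hFs hGM ha
    rw [hF, sub_add_cancel, ip_smul_left, Complex.conj_ofReal] at h1
    rw [h1, add_sub_cancel_right]
  rw [e]
  refine (norm_ip_le hFs ha).trans (mul_le_mul ?_ (Real.sqrt_le_sqrt (nsq_ann_ann_le (hG.numOp hM) p q))
    (Real.sqrt_nonneg _) (by positivity))
  have hnum := hG.numOp hM
  have hadd : √(nsq ((fun n => (‖G n‖ : ℂ)) + fun n => (‖numOp G n‖ : ℂ)))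
      ≤ √(nsq G) + √(nsq (numOp G)) := by
    refine (sqrt_nsq_add_le hG.norm hnum.norm).trans (le_of_eq ?_)
    simp [nsq]
  refine le_trans (Real.sqrt_le_sqrt (nsq_mono (hG.norm.add hnum.norm) fun n => ?_)) hadd
  rw [hF, Pi.sub_apply, Pi.add_apply, lower_zero, lower_zero, Pi.smul_apply, smul_eq_mul,
    ← Complex.ofReal_add, Complex.norm_real, Real.norm_of_nonneg (by positivity), BoseGas.numOp,
    norm_mul, Complex.norm_natCast, ← mul_assoc, ← Complex.ofReal_mul, ← sub_mul, ← Complex.ofReal_sub,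
    norm_mul, Complex.norm_real, Real.norm_eq_abs, ← one_add_mul]
  refine mul_le_mul_of_nonneg_right ?_ (norm_nonneg _)
  have hd : (0 : ℝ) ≤ n.degree := by positivity
  set t : ℝ := (n.degree : ℝ) with ht
  push_cast
  have hMM : (0 : ℝ) ≤ M := by positivity
  rcases le_or_gt n.degree (M + 1) with h | h
  · have h' : t ≤ (M : ℝ) + 1 := by rw [ht]; exact_mod_cast h
    have l1 : √((M : ℝ) + 1 - t) * √((M : ℝ) + 1 - t) = (M : ℝ) + 1 - t :=
      Real.mul_self_sqrt (by linarith)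
    have l2 : √((M : ℝ) + 1 + 1 - t) * √((M : ℝ) + 1 + 1 - t) = (M : ℝ) + 1 + 1 - t :=
      Real.mul_self_sqrt (by linarith)
    have l3 : √((M : ℝ) + 1 - t) ≤ √((M : ℝ) + 1 + 1 - t) := Real.sqrt_le_sqrt (by linarith)
    have l4 := Real.sqrt_nonneg ((M : ℝ) + 1 - t)
    rw [abs_le]
    constructor <;> nlinarith
  -- Beyond `M + 1` excited particles the truncated square root vanishes and `t` itself dominates `M
  -- + 1`.
  · have h' : (M : ℝ) + 1 ≤ t := by rw [ht]; exact_mod_cast h.le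
    rw [Real.sqrt_eq_zero_of_nonpos (by linarith : (M : ℝ) + 1 - t ≤ 0), zero_mul, zero_sub, abs_neg,
      abs_of_nonneg (by linarith)]
    linarith

theorem tsum_esq_ann {P : Type*} (G : (P →₀ ℕ) → ℂ) (w : ℕ → ℝ≥0∞) (p : P) :
    ∑' n, w n.degree * esq (ann p G n) = ∑' n, ((n p : ℕ) : ℝ≥0∞) * (w (n.degree - 1) * esq (G n)) := by
  rw [← tsum_add_single p
    (h := fun n : P →₀ ℕ => ((n p : ℕ) : ℝ≥0∞) * (w (n.degree - 1) * esq (G n)))]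
  · refine tsum_congr fun n => ?_
    rw [ann_apply, esq_mul_ofReal, Real.sq_sqrt (by positivity), degree_add_single,
      add_single_apply_self, Nat.add_sub_cancel, ← ENNReal.ofReal_natCast (n p + 1)]
    push_cast
    ring
  · intro n hn; simp [hn]

/-- Summing a†_p a_p over the modes gives the number of excited particles; a weight of the degree is
shifted by the particle removed. -/
theorem tsum_tsum_esq_ann {P : Type*} (G : (P →₀ ℕ) → ℂ) (w : ℕ → ℝ≥0∞) :
    ∑' p, ∑' n, w n.degree * esq (ann p G n)
      = ∑' n, ((n.degree : ℕ) : ℝ≥0∞) * (w (n.degree - 1) * esq (G n)) := by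
  simp only [tsum_esq_ann]
  rw [ENNReal.tsum_comm]
  refine tsum_congr fun n => ?_
  rw [ENNReal.tsum_mul_right, ← sum_degree_eq_tsum]

theorem tsum_esq_fockTwo (hM : DegLE (M + 2) G) (k l : Z) :
    ∑' r, esq (fockTwo M G ((k, l), r)) = ENNReal.ofReal (pairNorm M ^ 2)
      * ∑' n, esq (lower M l (lower (M + 1) k G) n) := by
  have h1 : DegLE M (lower M l (lower (M + 1) k G)) := (hM.lower k).lower l
  simp only [fockTwo_apply, esq_mul_ofReal]
  rw [ENNReal.tsum_mul_left, tsum_esq_fock, h1.cut_eq]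

/-- The weight of two given particles both being excited is the expectation of N₊ (N₊ - 1) divided
by `N (N - 1)`, where `N = M + 2`. -/
theorem nsq_bothPart_le (hG : SqSum G) (hM : DegLE (M + 2) G) :
    nsq (bothPart (fockTwo M G)) ≤ (((M : ℝ) + 2) * ((M : ℝ) + 1))⁻¹ * nsq (numOp G) := by
  classical
  have hs : ∀ k l : Z, ∑' r, esq (bothPart (fockTwo M G) ((k, l), r))
      = if k ≠ 0 ∧ l ≠ 0 then ENNReal.ofReal (pairNorm M ^ 2)
        * ∑' n, esq (lower M l (lower (M + 1) k G) n) else 0 := by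
    intro k l
    by_cases h : k ≠ 0 ∧ l ≠ 0
    · simp only [bothPart, if_pos h, tsum_esq_fockTwo hM]
    · simp only [bothPart, if_neg h, esq_zero, tsum_zero]
  have key : ∑' x, esq (bothPart (fockTwo M G) x)
      ≤ ENNReal.ofReal (pairNorm M ^ 2) * ∑' n, esq (numOp G n) := by
    rw [ENNReal.tsum_prod', ENNReal.tsum_prod', tsum_mode]
    simp only [hs]
    have h0 : ∀ p : {k : Z // k ≠ 0}, (∑' l : Z, if (p : Z) ≠ 0 ∧ l ≠ 0 then
        ENNReal.ofReal (pairNorm M ^ 2) * ∑' n, esq (lower M l (lower (M + 1) p G) n) else 0)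
        = ENNReal.ofReal (pairNorm M ^ 2) * ∑' q, ∑' n, esq (ann q (ann p G) n) := by
      intro p
      rw [tsum_mode, if_neg (by simp), zero_add, ← ENNReal.tsum_mul_left]
      refine tsum_congr fun q => ?_
      rw [if_pos ⟨p.2, q.2⟩, lower_coe, lower_coe]
    simp only [h0]
    simp only [ne_eq, not_true_eq_false, false_and, if_false, tsum_zero, zero_add]
    rw [ENNReal.tsum_mul_left]
    gcongr
    have h1 : ∀ p : {k : Z // k ≠ 0}, ∑' q, ∑' n, esq (ann q (ann p G) n)
        = ∑' n, ((n.degree : ℕ) : ℝ≥0∞) * esq (ann p G n) := by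
      intro p
      have := tsum_tsum_esq_ann (ann p G) (fun _ => 1)
      simpa only [one_mul] using this
    simp only [h1]
    rw [tsum_tsum_esq_ann G (fun m => (m : ℝ≥0∞))]
    refine ENNReal.tsum_le_tsum fun n => ?_
    rw [BoseGas.numOp, ← Complex.ofReal_natCast, esq_mul_ofReal, sq, ENNReal.ofReal_mul (by positivity),
      ENNReal.ofReal_natCast, mul_assoc]
    gcongr
    omega
  have hnum := sqSum_iff_tsum_esq.1 (hG.numOp hM)
  have := ENNReal.toReal_mono (ENNReal.mul_ne_top ENNReal.ofReal_ne_top hnum) key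
  rwa [ENNReal.toReal_mul, ← nsq_eq_toReal, ← nsq_eq_toReal, ENNReal.toReal_ofReal (by positivity),
    pairNorm_sq] at this

/-- The weight of exactly one of two particles being excited is at most `2 / N` times the
expectation of N₊, which Cauchy–Schwarz splits into `‖G‖ ‖N₊ G‖`. -/
theorem nsq_onePart_le (hG : SqSum G) (hM : DegLE (M + 2) G) :
    nsq (onePart (fockTwo M G)) ≤ 2 / ((M : ℝ) + 2) * (√(nsq G) * √(nsq (numOp G))) := by
  classical
  set c : ℝ≥0∞ := ENNReal.ofReal (pairNorm M ^ 2) * ENNReal.ofReal ((M : ℝ) + 1) with hc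
  have hlow : ∀ p : {k : Z // k ≠ 0}, ∑' n, esq (lower M (0 : Z) (ann p G) n)
      ≤ ENNReal.ofReal ((M : ℝ) + 1) * ∑' n, esq (ann p G n) := by
    intro p
    rw [← ENNReal.tsum_mul_left]
    refine ENNReal.tsum_le_tsum fun n => ?_
    rw [lower_zero, esq_mul_ofReal]
    gcongr
    rcases le_total 0 ((M : ℝ) + 1 - n.degree) with h | h
    · rw [Real.sq_sqrt h]; linarith [(Nat.cast_nonneg n.degree : (0 : ℝ) ≤ _)]
    · rw [Real.sqrt_eq_zero_of_nonpos h]; norm_num; positivity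
  have hs : ∀ k l : Z, ∑' r, esq (onePart (fockTwo M G) ((k, l), r))
      = if (k ≠ 0 ∧ l = 0) ∨ (k = 0 ∧ l ≠ 0) then ENNReal.ofReal (pairNorm M ^ 2)
        * ∑' n, esq (lower M l (lower (M + 1) k G) n) else 0 := by
    intro k l
    by_cases h : (k ≠ 0 ∧ l = 0) ∨ (k = 0 ∧ l ≠ 0)
    · simp only [onePart, if_pos h, tsum_esq_fockTwo hM]
    · simp only [onePart, if_neg h, esq_zero, tsum_zero]
  have hsum : ∑' p : {k : Z // k ≠ 0}, ∑' n, esq (ann p G n)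
      = ENNReal.ofReal (∑' n, ‖G n‖ * ‖numOp G n‖) := by
    have := tsum_tsum_esq_ann G (fun _ => 1)
    simp only [one_mul] at this
    rw [this, ENNReal.ofReal_tsum_of_nonneg (fun _ => by positivity)
      (hG.summable_norm_mul (hG.numOp hM))]
    refine tsum_congr fun n => ?_
    rw [BoseGas.numOp, norm_mul, Complex.norm_natCast, esq, ← ENNReal.ofReal_natCast,
      ← ENNReal.ofReal_mul (by positivity)]
    congr 1; ring
  have key : ∑' x, esq (onePart (fockTwo M G) x)
      ≤ 2 * (c * ENNReal.ofReal (∑' n, ‖G n‖ * ‖numOp G n‖)) := by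
    rw [ENNReal.tsum_prod', ENNReal.tsum_prod', tsum_mode]
    simp only [hs]
    rw [two_mul]
    refine add_le_add ?_ ?_
    · rw [tsum_mode, if_neg (by simp), zero_add, ← hsum, ← ENNReal.tsum_mul_left]
      refine ENNReal.tsum_le_tsum fun p => ?_
      rw [if_pos (by simp [p.2]), lower_coe, lower_zero_ann, hc, mul_assoc]
      gcongr
      exact hlow p
    · rw [← hsum, ← ENNReal.tsum_mul_left]
      refine ENNReal.tsum_le_tsum fun p => ?_
      rw [tsum_eq_single (0 : Z) fun l hl => if_neg (by simp [hl, p.2]), if_pos (Or.inl ⟨p.2, rfl⟩),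
        lower_coe, hc, mul_assoc]
      gcongr
      exact hlow p
  have := ENNReal.toReal_mono (ENNReal.mul_ne_top (by norm_num) (ENNReal.mul_ne_top
    (ENNReal.mul_ne_top ENNReal.ofReal_ne_top ENNReal.ofReal_ne_top) ENNReal.ofReal_ne_top)) key
  rw [← nsq_eq_toReal, ENNReal.toReal_mul, ENNReal.toReal_mul, ENNReal.toReal_mul,
    ENNReal.toReal_ofReal (by positivity), ENNReal.toReal_ofReal (by positivity),
    ENNReal.toReal_ofReal (tsum_nonneg fun _ => by positivity), pairNorm_sq] at this
  refine this.trans ?_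
  have h2 := tsum_norm_mul_le hG (hG.numOp hM)
  have e : (ENNReal.toReal 2) * ((((M : ℝ) + 2) * ((M : ℝ) + 1))⁻¹ * ((M : ℝ) + 1)
      * ∑' n, ‖G n‖ * ‖numOp G n‖) = 2 / ((M : ℝ) + 2) * ∑' n, ‖G n‖ * ‖numOp G n‖ := by
    rw [ENNReal.toReal_ofNat]; field_simp
  rw [e]
  gcongr

/-- The error in replacing the pair interaction by its quadratic part, for a state of norm `x`
and number of excitations `y`. -/
def pairError (M : ℕ) (x y : ℝ) : ℝ :=
  √(2 * (x * y)) * y / √((M : ℝ) + 1) + (3 * y ^ 2 + x * y) / ((M : ℝ) + 1)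

/-- The four configurations with two nonzero momenta give the quadratic terms of the mode `p`, up to
replacing condensate operators by numbers. The terms with three nonzero momenta pair `onePart` with
`bothPart`; they produce the leading error `√(2xy) y / √(M + 1)`, and the rest is of order `1 / (M +
1)`. -/
theorem abs_ip_transfer_sub_le (hG : SqSum G) (hM : DegLE (M + 2) G) (p : {k : Z // k ≠ 0}) :
    |((M : ℝ) + 2) / 2 * (ip (fockTwo M G) (fockTwo M G ∘ transfer (p : Z))).re
      - (1 / 2 * nsq (ann p G) + 1 / 2 * nsq (ann (-p) G) + pairing p G)|
    ≤ pairError M (√(nsq G)) (√(nsq (numOp G))) := by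
  set X := √(nsq G) with hX
  set Y := √(nsq (numOp G)) with hY
  have hX0 : 0 ≤ X := Real.sqrt_nonneg _
  have hY0 : 0 ≤ Y := Real.sqrt_nonneg _
  have hY2 : nsq (numOp G) = Y ^ 2 := (Real.sq_sqrt (nsq_nonneg _)).symm
  have hM1 : (0 : ℝ) < (M : ℝ) + 1 := by positivity
  have hM2 : (0 : ℝ) < (M : ℝ) + 2 := by positivity
  have h1 := norm_ip_transfer_sub_le (hG.fockTwo (M := M)) p.2
  simp only [ip_fockTwo hG hM] at h1
  rw [← coe_neg_mode] at h1
  simp only [lower_coe, lower_zero_ann] at h1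
  rw [ip_self, ip_self, ← mul_add, ← mul_add, ← mul_add, ann_comm p (-p) G] at h1
  set I := ip (fockTwo M G) (fockTwo M G ∘ transfer (p : Z)) with hI
  set J := ip (lower M (0 : Z) (lower (M + 1) 0 G)) (ann (-p) (ann p G)) with hJ
  have hJ' : ip (ann (-p) (ann p G)) (lower M (0 : Z) (lower (M + 1) 0 G)) = conj J := (ip_conj _ _).symm
  rw [hJ'] at h1
  have h2 := (Complex.abs_re_le_norm _).trans h1
  rw [Complex.sub_re, Complex.re_ofReal_mul, Complex.add_re, Complex.add_re, Complex.add_re,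
    Complex.conj_re, Complex.ofReal_re, Complex.ofReal_re] at h2
  have h3 := (Complex.abs_re_le_norm _).trans (norm_ip_lower_zero_sub_le hG hM p (-p))
  rw [← hJ, Complex.sub_re, Complex.re_ofReal_mul, re_ip_comm G] at h3
  have h4 := abs_nsq_lower_zero_sub_le hG hM p
  have h5 := abs_nsq_lower_zero_sub_le hG hM (-p)
  rw [hY2] at h4 h5
  change |J.re - ((M : ℝ) + 1) * pairing p G| ≤ (X + Y) * Y at h3
  set A := nsq (lower M (0 : Z) (ann p G)) with hA
  set A' := nsq (lower M (0 : Z) (ann (-p) G)) with hA'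
  have hc := nsq_bothPart_le hG hM
  have hb := nsq_onePart_le hG hM
  rw [hY2] at hc
  set c := nsq (bothPart (fockTwo M G)) with hcdef
  set b := nsq (onePart (fockTwo M G)) with hbdef
  have hbc : √b * √c ≤ √(2 * (X * Y)) * Y / √((M : ℝ) + 1) / ((M : ℝ) + 2) := by
    calc √b * √c ≤ √(2 / ((M : ℝ) + 2) * (X * Y)) * √((((M : ℝ) + 2) * ((M : ℝ) + 1))⁻¹ * Y ^ 2) := by
          gcongr
      _ = √(2 * (X * Y) * (Y ^ 2 * (((M : ℝ) + 1))⁻¹) * (((M : ℝ) + 2)⁻¹) ^ 2) := by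
          rw [← Real.sqrt_mul (by positivity)]
          congr 1; field_simp
      _ = _ := by
          rw [Real.sqrt_mul (by positivity), Real.sqrt_mul (by positivity), Real.sqrt_mul (sq_nonneg Y),
            Real.sqrt_sq hY0, Real.sqrt_sq (by positivity), Real.sqrt_inv]
          field_simp
  have e1 : ((M : ℝ) + 2) / 2 * I.re - (1 / 2 * nsq (ann p G) + 1 / 2 * nsq (ann (-p) G) + pairing p G)
      = ((M : ℝ) + 2) / 2 * (I.re - (((M : ℝ) + 2) * ((M : ℝ) + 1))⁻¹ * (J.re + J.re + A + A'))
      + (((M : ℝ) + 1)⁻¹ * (J.re - ((M : ℝ) + 1) * pairing p G)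
        + ((M : ℝ) + 1)⁻¹ / 2 * (A - ((M : ℝ) + 1) * nsq (ann p G))
        + ((M : ℝ) + 1)⁻¹ / 2 * (A' - ((M : ℝ) + 1) * nsq (ann (-p) G))) := by
    field_simp
    ring
  rw [e1]
  have t1 : |((M : ℝ) + 2) / 2 * (I.re - (((M : ℝ) + 2) * ((M : ℝ) + 1))⁻¹ * (J.re + J.re + A + A'))|
      ≤ √(2 * (X * Y)) * Y / √((M : ℝ) + 1) + 1 / 2 * Y ^ 2 / ((M : ℝ) + 1) := by
    rw [abs_mul, abs_of_pos (by positivity)]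
    calc _ ≤ ((M : ℝ) + 2) / 2 * (2 * (√(2 * (X * Y)) * Y / √((M : ℝ) + 1) / ((M : ℝ) + 2))
          + (((M : ℝ) + 2) * ((M : ℝ) + 1))⁻¹ * Y ^ 2) := by
          gcongr
          exact h2.trans (by gcongr)
      _ = _ := by field_simp
  have t2 : |((M : ℝ) + 1)⁻¹ * (J.re - ((M : ℝ) + 1) * pairing p G)| ≤ ((M : ℝ) + 1)⁻¹ * ((X + Y) * Y) := by
    rw [abs_mul, abs_of_pos (by positivity)]; gcongr
  have t3 : |((M : ℝ) + 1)⁻¹ / 2 * (A - ((M : ℝ) + 1) * nsq (ann p G))| ≤ ((M : ℝ) + 1)⁻¹ / 2 * Y ^ 2 := by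
    rw [abs_mul, abs_of_pos (by positivity)]; gcongr
  have t4 : |((M : ℝ) + 1)⁻¹ / 2 * (A' - ((M : ℝ) + 1) * nsq (ann (-p) G))|
      ≤ ((M : ℝ) + 1)⁻¹ / 2 * Y ^ 2 := by
    rw [abs_mul, abs_of_pos (by positivity)]; gcongr
  refine (abs_add_le _ _).trans ((add_le_add t1 ((abs_add_le _ _).trans
    (add_le_add ((abs_add_le _ _).trans (add_le_add t2 t3)) t4))).trans ?_)
  rw [pairError]
  have : 1 / 2 * Y ^ 2 / ((M : ℝ) + 1) + (((M : ℝ) + 1)⁻¹ * ((X + Y) * Y)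
      + ((M : ℝ) + 1)⁻¹ / 2 * Y ^ 2 + ((M : ℝ) + 1)⁻¹ / 2 * Y ^ 2)
      = (5 / 2 * Y ^ 2 + X * Y) / ((M : ℝ) + 1) := by field_simp; ring
  have h6 : (5 / 2 * Y ^ 2 + X * Y) / ((M : ℝ) + 1) ≤ (3 * Y ^ 2 + X * Y) / ((M : ℝ) + 1) := by
    gcongr; norm_num
  linarith

/-- Up to an error, the pair interaction is a constant plus its quadratic part in the excited
modes. -/
theorem abs_pairForm_sub_le {u : Z → ℝ} (hu0 : ∀ p, 0 ≤ u p) (hu : Summable u)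
    (hu' : ∀ p, u (-p) = u p) {K : Finset {k : Z // k ≠ 0}} (hK : ∀ p ∈ K, -p ∈ K) {τ : ℝ}
    (hτ : ∑' p, u p - u 0 - ∑ p ∈ K, u p ≤ τ) (hG : SqSum G) (hM : DegLE (M + 2) G) :
    |((M : ℝ) + 2) / 2 * (pairForm u (fockTwo M G) (fockTwo M G)).re
      - ((M : ℝ) + 2) / 2 * u 0 * nsq G - ∑ p ∈ K, u p * (nsq (ann p G) + pairing p G)|
    ≤ (∑' p, u p) * pairError M (√(nsq G)) (√(nsq (numOp G))) + ((M : ℝ) + 2) / 2 * τ * nsq G := by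
  classical
  set F := fockTwo M G with hF
  have hFs : SqSum F := hG.fockTwo
  have hFn : nsq F = nsq G := nsq_fockTwo hM
  set a : Z → ℝ := fun p => (ip F (F ∘ transfer p)).re with ha
  have ha0 : a 0 = nsq G := by
    simp only [ha]
    rw [transfer_zero, ← hFn]
    change (ip F F).re = _
    rw [ip_self, Complex.ofReal_re]
  have hab : ∀ p, |a p| ≤ nsq G := fun p => by
    refine (Complex.abs_re_le_norm _).trans ((norm_ip_transfer_le hFs hFs p).trans (le_of_eq ?_))
    rw [Real.mul_self_sqrt (nsq_nonneg _), hFn]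
  have hsum : HasSum (fun p => u p * a p) (pairForm u F F).re := hasSum_re_pairForm hu0 hu hFs hFs
  set K' : Finset Z := insert 0 (K.map (Function.Embedding.subtype _)) with hK'
  have hK'sum : ∀ w : Z → ℝ, ∑ p ∈ K', w p = w 0 + ∑ p ∈ K, w p := by
    intro w
    rw [hK', Finset.sum_insert (by simp), Finset.sum_map]
    rfl
  have e1 := hsum.summable.sum_add_tsum_compl (s := K')
  have e2 := hu.sum_add_tsum_compl (s := K')
  rw [hK'sum] at e1 e2
  rw [hsum.tsum_eq] at e1
  -- Modes outside `K` and zero are estimated trivially by their total weight `τ`.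
  have htail : |∑' p : ((K' : Set Z)ᶜ : Set Z), u p * a p| ≤ τ * nsq G := by
    have hus : Summable fun p : ((K' : Set Z)ᶜ : Set Z) => u p * nsq G :=
      (hu.subtype ((K' : Set Z)ᶜ)).mul_right (nsq G)
    have h := tsum_of_norm_bounded (f := fun p : ((K' : Set Z)ᶜ : Set Z) => u p * a p) hus.hasSum
      fun p => by
        rw [norm_mul, Real.norm_of_nonneg (hu0 _), Real.norm_eq_abs]
        exact mul_le_mul_of_nonneg_left (hab _) (hu0 _)
    rw [Real.norm_eq_abs, tsum_mul_right] at h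
    refine h.trans (mul_le_mul_of_nonneg_right ?_ (nsq_nonneg _))
    linarith
  have hsymm : ∑ p ∈ K, u p * (nsq (ann p G) + pairing p G)
      = ∑ p ∈ K, u p * (1 / 2 * nsq (ann p G) + 1 / 2 * nsq (ann (-p) G) + pairing p G) := by
    have : ∑ p ∈ K, u p * nsq (ann (-p) G) = ∑ p ∈ K, u p * nsq (ann p G) :=
      Finset.sum_nbij' (fun p => -p) (fun p => -p) hK hK (fun p _ => neg_neg p) (fun p _ => neg_neg p)
        fun p _ => by rw [coe_neg_mode, hu']
    simp only [mul_add, Finset.sum_add_distrib, mul_left_comm _ (1 / 2 : ℝ), ← Finset.mul_sum, this]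
    ring
  have hmode : |∑ p ∈ K, u p * (((M : ℝ) + 2) / 2 * a p
      - (1 / 2 * nsq (ann p G) + 1 / 2 * nsq (ann (-p) G) + pairing p G))|
      ≤ (∑' p, u p) * pairError M (√(nsq G)) (√(nsq (numOp G))) := by
    have hE : 0 ≤ pairError M (√(nsq G)) (√(nsq (numOp G))) := by unfold pairError; positivity
    refine (Finset.abs_sum_le_sum_abs _ _).trans ?_
    calc _ ≤ ∑ p ∈ K, u p * pairError M (√(nsq G)) (√(nsq (numOp G))) := by
          refine Finset.sum_le_sum fun p _ => ?_
          rw [abs_mul, abs_of_nonneg (hu0 _)]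
          exact mul_le_mul_of_nonneg_left (abs_ip_transfer_sub_le hG hM p) (hu0 _)
      _ = (∑ p ∈ K, u p) * pairError M (√(nsq G)) (√(nsq (numOp G))) := by rw [Finset.sum_mul]
      _ ≤ _ := by
          refine mul_le_mul_of_nonneg_right ?_ hE
          have := hu.sum_le_tsum K' (fun p _ => hu0 p)
          rw [hK'sum] at this
          linarith [hu0 0]
  have e3 : ((M : ℝ) + 2) / 2 * (pairForm u F F).re
      - ((M : ℝ) + 2) / 2 * u 0 * nsq G - ∑ p ∈ K, u p * (nsq (ann p G) + pairing p G)
      = ∑ p ∈ K, u p * (((M : ℝ) + 2) / 2 * a p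
      - (1 / 2 * nsq (ann p G) + 1 / 2 * nsq (ann (-p) G) + pairing p G))
      + ((M : ℝ) + 2) / 2 * ∑' p : ((K' : Set Z)ᶜ : Set Z), u p * a p := by
    rw [hsymm, ← e1]
    simp only [mul_sub, Finset.sum_sub_distrib]
    rw [ha0, mul_add, mul_add, Finset.mul_sum]
    simp only [mul_left_comm _ (((M : ℝ) + 2) / 2)]
    ring_nf
  rw [e3]
  refine (abs_add_le _ _).trans (add_le_add hmode ?_)
  rw [abs_mul, abs_of_pos (by positivity), mul_assoc]
  gcongr

/-- The square root of the particle number operator. -/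
def sqrtNumOp {P : Type*} (f : (P →₀ ℕ) → ℂ) (n : P →₀ ℕ) : ℂ := (√(n.degree : ℝ) : ℂ) * f n

theorem SqSum.sqrtNumOp {P : Type*} {G : (P →₀ ℕ) → ℂ} (hG : SqSum G) {N : ℕ} (hN : DegLE N G) :
    SqSum (sqrtNumOp G) := by
  refine (hG.summable_norm_mul (hG.numOp hN)).congr fun n => ?_
  rw [BoseGas.numOp, BoseGas.sqrtNumOp, norm_mul, norm_mul, Complex.norm_real, Complex.norm_natCast,
    Real.norm_of_nonneg (Real.sqrt_nonneg _), mul_pow, Real.sq_sqrt (by positivity)]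
  ring


/-- The particle number can be distributed symmetrically in the pair interaction. -/
theorem abs_pairForm_numOp_sub_le {u : Z → ℝ} (hu0 : ∀ p, 0 ≤ u p) (hu : Summable u)
    (hu' : ∀ p, u (-p) = u p) (hG : SqSum G) (hM : DegLE (M + 2) G) :
    |(pairForm u (fockTwo M (numOp G)) (fockTwo M G)).re
      - (pairForm u (fockTwo M (sqrtNumOp G)) (fockTwo M (sqrtNumOp G))).re|
    ≤ 2 * (∑' p, u p) * (√(nsq (bothPart (fockTwo M G))) * √(nsq G)) := by
  set m : (Z × Z) × (Fin M → Z) → ℝ := fun x => ((occOf (splitTwo M x)).degree : ℝ) with hm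
  have hmx : ∀ x, m x = ((oneOcc x.1.1).degree : ℝ) + ((oneOcc x.1.2).degree : ℝ)
      + ((occOf x.2).degree : ℝ) := by
    intro x
    simp only [hm]
    rw [splitTwo_apply, occOf_cons, occOf_cons, map_add, map_add]
    push_cast; ring
  have h1 : fockTwo M (numOp G) = fun x => (m x : ℂ) * fockTwo M G x := by
    ext x
    rw [fockTwo, fockTwo, fock_apply, fock_apply, BoseGas.numOp, hm]
    push_cast; ring
  have h2 : fockTwo M (sqrtNumOp G) = fun x => (√(m x) : ℂ) * fockTwo M G x := by
    ext x
    rw [fockTwo, fockTwo, fock_apply, fock_apply, BoseGas.sqrtNumOp, hm]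
    ring
  have h3 := abs_re_pairForm_sub_le hu0 hu hu' (hG.fockTwo (M := M)) m (fun x => by positivity)
    (by rw [← h1]; exact (hG.numOp hM).fockTwo) ?_ ?_
  · rwa [← h1, ← h2, nsq_fockTwo hM] at h3
  · intro x p
    rw [hmx, hmx, transfer_apply]
    simp only
    have a1 : ∀ k : Z, ((oneOcc k).degree : ℝ) ≤ 1 := fun k => by exact_mod_cast degree_oneOcc_le k
    have a0 : ∀ k : Z, (0 : ℝ) ≤ ((oneOcc k).degree : ℝ) := fun k => by positivity
    rw [abs_le]
    constructor <;>
      linarith [a1 x.1.1, a1 x.1.2, a1 (x.1.1 - p), a1 (x.1.2 + p), a0 x.1.1, a0 x.1.2, a0 (x.1.1 - p),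
        a0 (x.1.2 + p)]
  · intro x p c1 c2
    rw [hmx, hmx, transfer_apply]
    simp only
    obtain ⟨⟨k, l⟩, r⟩ := x
    simp only at c1 c2 ⊢
    congr 1
    -- If at most one of two particles is excited, whether one is depends only on the total
    -- momentum, which the transfer conserves.
    have key : ∀ k l : Z, ¬(k ≠ 0 ∧ l ≠ 0) →
        ((oneOcc k).degree : ℝ) + ((oneOcc l).degree : ℝ) = ((oneOcc (k + l)).degree : ℝ) := by
      intro k l h
      by_cases hk : k = 0
      · subst hk; rw [oneOcc_zero, zero_add]; simp
      · have hl : l = 0 := by by_contra hl; exact h ⟨hk, hl⟩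
        subst hl; rw [oneOcc_zero, add_zero]; simp
    rw [key _ _ c1, key _ _ c2]
    congr 3
    abel

end TwoBody

/-! ### Fourier series on the torus -/

section Torus

open ComplexConjugate UnitAddTorus

instance isProbabilityMeasure_volume_circle : IsProbabilityMeasure (volume : Measure UnitAddCircle) :=
  inferInstanceAs (IsProbabilityMeasure (AddCircle.haarAddCircle : Measure UnitAddCircle))

instance isAddHaarMeasure_volume_circle :
    Measure.IsAddHaarMeasure (volume : Measure UnitAddCircle) :=
  inferInstanceAs (Measure.IsAddHaarMeasure (AddCircle.haarAddCircle : Measure UnitAddCircle))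

variable {ι : Type*} [Fintype ι]

theorem norm_mFourier_apply (n : ι → ℤ) (x : UnitAddTorus ι) : ‖mFourier n x‖ = 1 := by
  simp only [mFourier, fourier_apply, ContinuousMap.coe_mk, norm_prod, Circle.norm_coe,
    Finset.prod_const_one]

theorem integral_mFourier (n : ι → ℤ) [Decidable (n = 0)] :
    ∫ x, mFourier n x = if n = 0 then 1 else 0 := by
  classical
  have h := orthonormal_iff_ite.1 (orthonormal_mFourier (d := ι)) 0 n
  simp only [mFourierLp, ContinuousMap.inner_toLp, ← mFourier_neg, ← mFourier_add, neg_zero, add_zero] at h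
  rw [h]
  simp only [eq_comm]

variable {v : UnitAddTorus ι → ℝ} {b : ℝ}

theorem integrable_of_bounded {E : Type*} [NormedAddCommGroup E] {f : UnitAddTorus ι → E}
    (hf : AEStronglyMeasurable f volume) {b : ℝ} (hb : ∀ x, ‖f x‖ ≤ b) : Integrable f volume :=
  Integrable.of_bound hf b (Filter.Eventually.of_forall hb)

/-- Testing a function against the squared modulus of an exponential sum counts its Fourier
coefficients at the differences of elements of `S`. -/
theorem re_integral_mul_norm_sq (hv : Measurable v) (hb : ∀ x, |v x| ≤ b) (S : Finset (ι → ℤ)) :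
    ∫ x, v x * ‖∑ k ∈ S, mFourier k x‖ ^ 2
      = ∑ k ∈ S, ∑ l ∈ S, (mFourierCoeff (fun x => (v x : ℂ)) (k - l)).re := by
  have hint : ∀ n : ι → ℤ, Integrable (fun x => mFourier (-n) x • (v x : ℂ)) volume := fun n => by
    refine integrable_of_bounded (b := b) ?_ fun x => ?_
    · exact ((mFourier (-n)).continuous.aestronglyMeasurable).smul
        (Complex.measurable_ofReal.comp hv).aestronglyMeasurable
    · rw [norm_smul, norm_mFourier_apply, one_mul, Complex.norm_real]; exact hb x
  have e : ∀ x, ((v x * ‖∑ k ∈ S, mFourier k x‖ ^ 2 : ℝ) : ℂ)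
      = ∑ k ∈ S, ∑ l ∈ S, mFourier (-(k - l)) x • (v x : ℂ) := by
    intro x
    rw [Complex.ofReal_mul, Complex.ofReal_pow, ← Complex.conj_mul', map_sum, Finset.sum_mul_sum,
      Finset.mul_sum]
    refine Finset.sum_congr rfl fun k _ => ?_
    rw [Finset.mul_sum]
    refine Finset.sum_congr rfl fun l _ => ?_
    rw [← mFourier_neg, ← mFourier_add, smul_eq_mul, mul_comm, neg_sub, sub_eq_neg_add]
  have h : ((∫ x, v x * ‖∑ k ∈ S, mFourier k x‖ ^ 2 : ℝ) : ℂ)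
      = ∑ k ∈ S, ∑ l ∈ S, mFourierCoeff (fun x => (v x : ℂ)) (k - l) := by
    rw [← integral_complex_ofReal]
    simp only [e]
    rw [integral_finsetSum _ fun k _ => integrable_finsetSum _ fun l _ => hint _]
    refine Finset.sum_congr rfl fun k _ => ?_
    rw [integral_finsetSum _ fun l _ => hint _]
    rfl
  have := congrArg Complex.re h
  simpa only [Complex.ofReal_re, Complex.re_sum] using this

theorem mFourierCoeff_one [DecidableEq (ι → ℤ)] (n : ι → ℤ) :
    mFourierCoeff (fun _ : UnitAddTorus ι => ((1 : ℝ) : ℂ)) n = if n = 0 then 1 else 0 := by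
  rw [mFourierCoeff]
  simp only [Complex.ofReal_one, smul_eq_mul, mul_one]
  rw [integral_mFourier]
  simp

/-- A bounded function with nonnegative Fourier coefficients has summable Fourier coefficients. -/
theorem summable_re_mFourierCoeff (hv : Measurable v) (hb : ∀ x, |v x| ≤ b)
    (h0 : ∀ k, 0 ≤ (mFourierCoeff (fun x => (v x : ℂ)) k).re) :
    Summable fun k => (mFourierCoeff (fun x => (v x : ℂ)) k).re := by
  classical
  set u : (ι → ℤ) → ℝ := fun k => (mFourierCoeff (fun x => (v x : ℂ)) k).re with hu
  refine summable_of_sum_le (c := 2 ^ Fintype.card ι * b) h0 fun F => ?_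
  obtain ⟨R, hR⟩ : ∃ R : ℕ, ∀ p ∈ F, ∀ i, |p i| ≤ R := by
    refine ⟨∑ p ∈ F, ∑ i, (p i).natAbs, fun p hp i => ?_⟩
    rw [Int.abs_eq_natAbs]
    exact_mod_cast (Finset.single_le_sum (f := fun i => (p i).natAbs) (fun _ _ => Nat.zero_le _)
      (Finset.mem_univ i)).trans (Finset.single_le_sum (f := fun p : ι → ℤ => ∑ i, (p i).natAbs)
      (fun _ _ => Nat.zero_le _) hp)
  set box : ℕ → Finset (ι → ℤ) := fun R => Fintype.piFinset fun _ => Finset.Icc (-(R : ℤ)) R with hbox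
  have hcard : ∀ R : ℕ, (box R).card = (2 * R + 1) ^ Fintype.card ι := by
    intro R
    rw [hbox, Fintype.card_piFinset]
    simp only [Int.card_Icc, Finset.prod_const, Finset.card_univ]
    congr 1
    omega
  have hmem : ∀ (R : ℕ) (k : ι → ℤ), k ∈ box R ↔ ∀ i, |k i| ≤ R := by
    intro R k
    simp [hbox, Fintype.mem_piFinset, abs_le]
  -- The sum over pairs in `S` is at most `b |S|` since `|v| ≤ b`. It is also at least the size of
  -- the box of radius `R` times the sum over `F`, because every translate of `F` by a point of the
  -- small box stays in `S`. The sizes of the two boxes are comparable.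
  set S := box (2 * R) with hS
  have hup : ∑ k ∈ S, ∑ l ∈ S, u (k - l) ≤ b * S.card := by
    rw [hu]
    rw [← re_integral_mul_norm_sq hv hb S]
    have h1 := re_integral_mul_norm_sq (v := fun _ : UnitAddTorus ι => 1) (b := 1) measurable_const
      (by simp) S
    have h2 : ∑ k ∈ S, ∑ l ∈ S, (mFourierCoeff (fun _ : UnitAddTorus ι => ((1 : ℝ) : ℂ)) (k - l)).re
        = S.card := by
      rw [Finset.card_eq_sum_ones, Nat.cast_sum]
      refine Finset.sum_congr rfl fun k hk => ?_
      simp only [mFourierCoeff_one, sub_eq_zero, apply_ite Complex.re, Complex.one_re, Complex.zero_re]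
      rw [Finset.sum_ite_eq, if_pos hk, Nat.cast_one]
    rw [h2] at h1
    rw [← h1, ← integral_const_mul]
    have hc : Continuous fun x : UnitAddTorus ι => ‖∑ k ∈ S, mFourier k x‖ ^ 2 := by fun_prop
    have hbd : ∀ x : UnitAddTorus ι, ‖∑ k ∈ S, mFourier k x‖ ^ 2 ≤ (S.card : ℝ) ^ 2 := fun x => by
      gcongr
      refine (norm_sum_le _ _).trans ?_
      simp [norm_mFourier_apply]
    refine integral_mono ?_ ?_ fun x => ?_
    · refine integrable_of_bounded (b := b * (S.card : ℝ) ^ 2)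
        (hv.aestronglyMeasurable.mul hc.aestronglyMeasurable) fun x => ?_
      rw [norm_mul, Real.norm_eq_abs, Real.norm_of_nonneg (by positivity)]
      exact mul_le_mul (hb x) (hbd x) (by positivity) ((abs_nonneg _).trans (hb x))
    · refine (integrable_of_bounded (b := (S.card : ℝ) ^ 2) ?_ fun x => ?_).const_mul b
      · simpa only [one_mul] using hc.aestronglyMeasurable
      · rw [one_mul, Real.norm_of_nonneg (by positivity)]; exact hbd x
    · simp only [one_mul]
      exact mul_le_mul_of_nonneg_right ((le_abs_self _).trans (hb x)) (by positivity)
  have hlow : ((box R).card : ℝ) * ∑ p ∈ F, u p ≤ ∑ k ∈ S, ∑ l ∈ S, u (k - l) := by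
    rw [Finset.sum_comm, ← nsmul_eq_mul, ← Finset.sum_const]
    refine (Finset.sum_le_sum fun l hl => ?_).trans (Finset.sum_le_sum_of_subset_of_nonneg
      (t := S) (f := fun l => ∑ k ∈ S, u (k - l)) ?_ fun l _ _ => Finset.sum_nonneg fun k _ => h0 _)
    · have : ∑ p ∈ F, u p = ∑ k ∈ F.map (addRightEmbedding l), u (k - l) := by
        rw [Finset.sum_map]
        exact Finset.sum_congr rfl fun p _ => by simp
      rw [this]
      refine Finset.sum_le_sum_of_subset_of_nonneg ?_ fun k _ _ => h0 _
      intro k hk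
      obtain ⟨p, hp, rfl⟩ := Finset.mem_map.1 hk
      rw [hS, hmem]
      intro i
      have h1 := hR p hp i
      have h2 := (hmem R l).1 hl i
      have h3 := abs_add_le (p i) (l i)
      simp only [addRightEmbedding_apply, Pi.add_apply]
      push_cast
      linarith
    · intro k hk
      rw [hS, hmem]
      intro i
      have h2 := (hmem R k).1 hk i
      push_cast
      have : (0 : ℤ) ≤ R := by positivity
      linarith
  have hb0 : 0 ≤ b := (abs_nonneg _).trans (hb 0)
  have hbox_pos : (0 : ℝ) < (box R).card := by rw [hcard]; positivity
  -- In each direction `4 R + 1 ≤ 2 (2 R + 1)`.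
  have hcomp : (S.card : ℝ) ≤ 2 ^ Fintype.card ι * (box R).card := by
    rw [hS, hcard, hcard]
    push_cast
    rw [← mul_pow]
    gcongr
    linarith
  have h3 : ((box R).card : ℝ) * ∑ p ∈ F, u p ≤ (box R).card * (2 ^ Fintype.card ι * b) :=
    calc _ ≤ b * S.card := hlow.trans hup
      _ ≤ b * (2 ^ Fintype.card ι * (box R).card) := by gcongr
      _ = _ := by ring
  exact le_of_mul_le_mul_left h3 hbox_pos

theorem mFourierCoeff_congr_ae {E : Type*} [NormedAddCommGroup E] [NormedSpace ℂ E]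
    {f g : UnitAddTorus ι → E} (h : f =ᵐ[volume] g) (n : ι → ℤ) :
    mFourierCoeff f n = mFourierCoeff g n :=
  integral_congr_ae (h.mono fun x hx => by simp only [hx])

/-- The Fourier coefficients of an even real function are real. -/
theorem mFourierCoeff_neg (hv : ∀ x, v (-x) = v x) (n : ι → ℤ) :
    mFourierCoeff (fun x => (v x : ℂ)) (-n) = mFourierCoeff (fun x => (v x : ℂ)) n := by
  rw [mFourierCoeff, mFourierCoeff]
  have hneg : ∀ x : UnitAddTorus ι, mFourier (-n) (-x) = mFourier n x := by
    intro x
    simp only [mFourier, ContinuousMap.coe_mk, Pi.neg_apply, fourier_apply, smul_neg, neg_smul, neg_neg]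
  have hmp : MeasurePreserving (negAddMonoidHom : UnitAddTorus ι →+ UnitAddTorus ι) volume volume :=
    AddMonoidHom.measurePreserving continuous_neg neg_surjective rfl
  have hemb : MeasurableEmbedding (negAddMonoidHom : UnitAddTorus ι →+ UnitAddTorus ι) :=
    (MeasurableEquiv.neg (UnitAddTorus ι)).measurableEmbedding
  rw [← hmp.integral_comp hemb]
  refine integral_congr_ae (Filter.Eventually.of_forall fun x => ?_)
  change mFourier (- -n) (-x) • ((v (-x) : ℝ) : ℂ) = _
  have := hneg (-x)
  rw [neg_neg] at this
  rw [hv, neg_neg, ← this]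

theorem conj_mFourierCoeff (n : ι → ℤ) :
    conj (mFourierCoeff (fun x => (v x : ℂ)) n) = mFourierCoeff (fun x => (v x : ℂ)) (-n) := by
  rw [mFourierCoeff, mFourierCoeff, ← integral_conj]
  refine integral_congr_ae (Filter.Eventually.of_forall fun x => ?_)
  simp only [smul_eq_mul, map_mul, Complex.conj_ofReal, ← mFourier_neg]

theorem ofReal_re_mFourierCoeff (hv : ∀ x, v (-x) = v x) (n : ι → ℤ) :
    (((mFourierCoeff (fun x => (v x : ℂ)) n).re : ℝ) : ℂ) = mFourierCoeff (fun x => (v x : ℂ)) n := by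
  refine Complex.conj_eq_iff_re.1 ?_
  rw [conj_mFourierCoeff, mFourierCoeff_neg hv]

theorem summable_smul_mFourier {u : (ι → ℤ) → ℝ} (hu0 : ∀ k, 0 ≤ u k) (hu : Summable u) :
    Summable fun k => (u k : ℂ) • mFourier (d := ι) k := by
  refine hu.of_norm_bounded fun k => ?_
  rw [norm_smul, mFourier_norm, mul_one, Complex.norm_real, Real.norm_of_nonneg (hu0 k)]

/-- A bounded even function with summable nonnegative Fourier coefficients is almost everywhere the
sum of its Fourier series. -/
theorem ae_hasSum_mFourier (hv : Measurable v) (hb : ∀ x, |v x| ≤ b) (hev : ∀ x, v (-x) = v x)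
    (h0 : ∀ k, 0 ≤ (mFourierCoeff (fun x => (v x : ℂ)) k).re) :
    ∀ᵐ x, HasSum (fun k => ((mFourierCoeff (fun x => (v x : ℂ)) k).re : ℂ) * mFourier k x) (v x : ℂ) := by
  have hmem : MemLp (fun x => (v x : ℂ)) 2 (volume : Measure (UnitAddTorus ι)) :=
    MemLp.of_bound (Complex.measurable_ofReal.comp hv).aestronglyMeasurable b
      (Filter.Eventually.of_forall fun x => by rw [Complex.norm_real]; exact hb x)
  have hs := summable_smul_mFourier h0 (summable_re_mFourierCoeff hv hb h0)
  set g : C(UnitAddTorus ι, ℂ) :=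
    ∑' k, ((mFourierCoeff (fun x => (v x : ℂ)) k).re : ℂ) • mFourier k with hg
  have h1 := hasSum_mFourier_series_L2 hmem.toLp
  have h2 := hs.hasSum.mapL (ContinuousMap.toLp (E := ℂ) 2 (volume : Measure (UnitAddTorus ι)) ℂ)
  -- The uniform sum and the `L²` sum of the Fourier series are the same element of `L²`; pointwise
  -- equality therefore holds almost everywhere only.
  have h3 : hmem.toLp = ContinuousMap.toLp (E := ℂ) 2 (volume : Measure (UnitAddTorus ι)) ℂ g := by
    refine h1.unique ?_
    convert h2 using 1
    funext k
    rw [map_smul, mFourierCoeff_congr_ae hmem.coeFn_toLp, ofReal_re_mFourierCoeff hev]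
  have h4 := hmem.coeFn_toLp
  rw [h3] at h4
  filter_upwards [h4, ContinuousMap.coeFn_toLp (p := 2) (𝕜 := ℂ) (volume : Measure (UnitAddTorus ι)) g]
    with x hx hx'
  rw [← hx, hx']
  exact ContinuousMap.hasSum_apply hs.hasSum x

end Torus

/-! ### Bounded multiplication operators and Fourier coefficients of many-particle functions -/

section Multiplication

open ComplexConjugate UnitAddTorus

variable {ι : Type*} [Fintype ι] {W : UnitAddTorus ι → ℝ} {b : ℝ}

theorem memLp_mul (hW : Measurable W) (hb : ∀ x, |W x| ≤ b) (f : L2 ι) :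
    MemLp (fun x => (W x : ℂ) * f x) 2 volume := by
  refine MemLp.of_le_mul (c := b) (Lp.memLp f)
    ((Complex.measurable_ofReal.comp hW).aestronglyMeasurable.mul (Lp.aestronglyMeasurable f)) ?_
  refine Filter.Eventually.of_forall fun x => ?_
  rw [norm_mul, Complex.norm_real]
  exact mul_le_mul_of_nonneg_right (hb x) (norm_nonneg _)

/-- Multiplication by a bounded function. -/
def mulCLM (hW : Measurable W) (hb : ∀ x, |W x| ≤ b) : L2 ι →L[ℂ] L2 ι :=
  LinearMap.mkContinuous
    { toFun := fun f => (memLp_mul hW hb f).toLp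
      map_add' := by
        intro f g
        rw [← MemLp.toLp_add]
        refine MemLp.toLp_congr _ _ ?_
        filter_upwards [Lp.coeFn_add f g] with x hx
        exact (congrArg ((W x : ℂ) * ·) hx).trans (mul_add _ _ _)
      map_smul' := by
        intro c f
        rw [RingHom.id_apply, ← MemLp.toLp_const_smul]
        refine MemLp.toLp_congr _ _ ?_
        filter_upwards [Lp.coeFn_smul c f] with x hx
        exact (congrArg ((W x : ℂ) * ·) hx).trans (mul_left_comm _ _ _) } b (by
      intro f
      refine Lp.norm_le_mul_norm_of_ae_le_mul ?_
      filter_upwards [(memLp_mul hW hb f).coeFn_toLp] with x hx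
      rw [LinearMap.coe_mk, AddHom.coe_mk, hx, norm_mul, Complex.norm_real]
      exact mul_le_mul_of_nonneg_right (hb x) (norm_nonneg _))

variable (hW : Measurable W) (hb : ∀ x, |W x| ≤ b)

theorem coeFn_mulCLM (f : L2 ι) : mulCLM hW hb f =ᵐ[volume] fun x => (W x : ℂ) * f x :=
  (memLp_mul hW hb f).coeFn_toLp

theorem norm_mulCLM_le : ‖mulCLM hW hb‖ ≤ b :=
  LinearMap.mkContinuous_norm_le _ ((abs_nonneg _).trans (hb 0)) _

theorem inner_mulCLM (f g : L2 ι) :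
    ⟪f, mulCLM hW hb g⟫_ℂ = ∫ x, conj (f x) * ((W x : ℂ) * g x) := by
  rw [L2.inner_def]
  refine integral_congr_ae ?_
  filter_upwards [coeFn_mulCLM hW hb g] with x hx
  rw [hx, RCLike.inner_apply, mul_comm]

theorem isSymmetric_mulCLM : (mulCLM hW hb : L2 ι →ₗ[ℂ] L2 ι).IsSymmetric := by
  intro f g
  change ⟪mulCLM hW hb f, g⟫_ℂ = ⟪f, mulCLM hW hb g⟫_ℂ
  rw [← inner_conj_symm, inner_mulCLM, inner_mulCLM, ← integral_conj]
  refine integral_congr_ae (Filter.Eventually.of_forall fun x => ?_)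
  simp only [map_mul, RCLike.conj_conj, Complex.conj_ofReal]
  ring

theorem integrable_conj_mul (f g : L2 ι) : Integrable (fun x => conj (f x) * g x) volume := by
  refine (L2.integrable_inner (𝕜 := ℂ) f g).congr (Filter.Eventually.of_forall fun x => ?_)
  simp only [RCLike.inner_apply, mul_comm]

theorem mul_norm_sq_le_re_inner_mulCLM {c : ℝ} (hc : ∀ᵐ x, c ≤ W x) (f : L2 ι) :
    c * ‖f‖ ^ 2 ≤ (⟪f, mulCLM hW hb f⟫_ℂ).re := by
  have h1 : ‖f‖ ^ 2 = ∫ x, ‖f x‖ ^ 2 := by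
    have h := inner_self_eq_norm_sq_to_K (𝕜 := ℂ) f
    rw [L2.inner_def] at h
    have h' : ∫ x, ⟪f x, f x⟫_ℂ = ((∫ x, ‖f x‖ ^ 2 : ℝ) : ℂ) := by
      rw [← integral_complex_ofReal]
      refine integral_congr_ae (Filter.Eventually.of_forall fun x => ?_)
      simp only [inner_self_eq_norm_sq_to_K]
      norm_cast
    rw [h'] at h
    have h2 : ((∫ x, ‖f x‖ ^ 2 : ℝ) : ℂ) = ((‖f‖ ^ 2 : ℝ) : ℂ) := by rw [h]; norm_cast
    exact_mod_cast h2.symm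
  have h2 : (⟪f, mulCLM hW hb f⟫_ℂ).re = ∫ x, W x * ‖f x‖ ^ 2 := by
    rw [inner_mulCLM]
    have : ∀ x, conj (f x) * ((W x : ℂ) * f x) = ((W x * ‖f x‖ ^ 2 : ℝ) : ℂ) := fun x => by
      rw [mul_left_comm, Complex.conj_mul', Complex.ofReal_mul, Complex.ofReal_pow]
    simp only [this]
    rw [integral_complex_ofReal, Complex.ofReal_re]
  have hi : Integrable (fun x => ‖f x‖ ^ 2) volume := (Lp.memLp f).integrable_norm_pow (by norm_num)
  rw [h1, h2, ← integral_const_mul]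
  refine integral_mono_ae (hi.const_mul c) ?_ ?_
  · refine (hi.const_mul b).mono (hW.aestronglyMeasurable.mul hi.aestronglyMeasurable) ?_
    refine Filter.Eventually.of_forall fun x => ?_
    rw [norm_mul, norm_mul, Real.norm_eq_abs]
    exact mul_le_mul_of_nonneg_right ((hb x).trans (le_abs_self b)) (norm_nonneg _)
  · filter_upwards [hc] with x hx
    exact mul_le_mul_of_nonneg_right hx (by positivity)

/-- Multiplication by a character shifts the Fourier coefficients. -/
theorem integral_conj_mul_mFourier_mul (f g : L2 ι) (q : ι → ℤ) :
    ∫ x, conj (f x) * (mFourier q x * g x)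
      = ip (fun k => mFourierBasis.repr f k) (fun k => mFourierBasis.repr g (k - q)) := by
  have hm : MemLp (fun x => mFourier q x * g x) 2 volume := by
    refine MemLp.of_le (Lp.memLp g)
      ((mFourier q).continuous.aestronglyMeasurable.mul (Lp.aestronglyMeasurable g)) ?_
    refine Filter.Eventually.of_forall fun x => ?_
    rw [norm_mul, norm_mFourier_apply, one_mul]
  have h := (hasSum_prod_mFourierCoeff f (hm.toLp : L2 ι)).tsum_eq
  have h1 : ∫ x, conj (f x) * (mFourier q x * g x) = ∫ x, conj (f x) * (hm.toLp : L2 ι) x := by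
    refine integral_congr_ae ?_
    filter_upwards [hm.coeFn_toLp] with x hx
    rw [hx]
  rw [h1, ← h, ip]
  refine tsum_congr fun k => ?_
  rw [mFourierBasis_repr, mFourierBasis_repr, mFourierCoeff_congr_ae hm.coeFn_toLp]
  congr 1
  refine integral_congr_ae (Filter.Eventually.of_forall fun x => ?_)
  simp only [smul_eq_mul]
  rw [← mul_assoc, ← mFourier_add]
  congr 3
  abel

/-- The form of multiplication by an absolutely convergent Fourier series. -/
theorem hasSum_integral_conj_mul {P : Type*} {u : P → ℝ} (hu0 : ∀ p, 0 ≤ u p) (hu : Summable u)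
    {q : P → ι → ℤ} {w : UnitAddTorus ι → ℝ}
    (hw : ∀ᵐ x, HasSum (fun p => (u p : ℂ) * mFourier (q p) x) (w x : ℂ)) [Countable P] (f g : L2 ι) :
    HasSum (fun p => (u p : ℂ) * ip (fun k => mFourierBasis.repr f k)
      (fun k => mFourierBasis.repr g (k - q p))) (∫ x, conj (f x) * ((w x : ℂ) * g x)) := by
  have hi := integrable_conj_mul f g
  have hF : ∀ p, Integrable (fun x => conj (f x) * ((u p : ℂ) * mFourier (q p) x * g x)) volume := by
    intro p
    refine (hi.norm.const_mul (u p)).mono ?_ ?_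
    · exact (Complex.continuous_conj.comp_aestronglyMeasurable (Lp.aestronglyMeasurable f)).mul
        (((mFourier (q p)).continuous.aestronglyMeasurable.const_mul _).mul (Lp.aestronglyMeasurable g))
    · refine Filter.Eventually.of_forall fun x => le_of_eq ?_
      simp only [norm_mul, norm_mFourier_apply, Complex.norm_real, Real.norm_of_nonneg (hu0 p), mul_one,
        RCLike.norm_conj, norm_norm]
      ring
  have hn : ∀ p, ∫ x, ‖conj (f x) * ((u p : ℂ) * mFourier (q p) x * g x)‖
      = u p * ∫ x, ‖conj (f x) * g x‖ := by
    intro p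
    rw [← integral_const_mul]
    refine integral_congr_ae (Filter.Eventually.of_forall fun x => ?_)
    simp only [norm_mul, norm_mFourier_apply, Complex.norm_real, Real.norm_of_nonneg (hu0 p), mul_one]
    ring
  have h := hasSum_integral_of_summable_integral_norm hF (by
    simp only [hn]
    exact hu.mul_right _)
  have e1 : ∀ p, ∫ x, conj (f x) * ((u p : ℂ) * mFourier (q p) x * g x)
      = (u p : ℂ) * ip (fun k => mFourierBasis.repr f k) (fun k => mFourierBasis.repr g (k - q p)) := by
    intro p
    rw [← integral_conj_mul_mFourier_mul, ← integral_const_mul]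
    refine integral_congr_ae (Filter.Eventually.of_forall fun x => ?_)
    simp only
    ring
  have e2 : ∫ x, ∑' p, conj (f x) * ((u p : ℂ) * mFourier (q p) x * g x)
      = ∫ x, conj (f x) * ((w x : ℂ) * g x) := by
    refine integral_congr_ae ?_
    filter_upwards [hw] with x hx
    rw [← ((hx.mul_right (g x)).mul_left (conj (f x))).tsum_eq]
  simp only [e1] at h
  rwa [e2] at h

end Multiplication

/-! ### Fourier coefficients and permutations of particles -/

section Configurations

open ComplexConjugate UnitAddTorus

variable {d N : ℕ}

/-- The Fourier coefficients of an `N`-particle function, as a function of the `N` momenta. -/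
def coef (f : L2 (Fin N × Fin d)) (κ : Fin N → Fin d → ℤ) : ℂ :=
  mFourierBasis.repr f (Function.uncurry κ)

theorem coef_add (f g : L2 (Fin N × Fin d)) : coef (f + g) = coef f + coef g := by
  ext κ; simp [coef]

theorem coef_smul (c : ℂ) (f : L2 (Fin N × Fin d)) : coef (c • f) = c • coef f := by
  ext κ; simp [coef]

theorem sqSum_coef (f : L2 (Fin N × Fin d)) : SqSum (coef f) :=
  ((Equiv.curry (Fin N) (Fin d) ℤ).symm.summable_iff
    (f := fun k => ‖mFourierBasis.repr f k‖ ^ 2)).2 (lp_sqSum _)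

theorem ip_coef_eq (f g : L2 (Fin N × Fin d)) (s : (Fin N → Fin d → ℤ) → (Fin N → Fin d → ℤ)) :
    ip (coef f) (coef g ∘ s) = ip (fun k => mFourierBasis.repr f k)
      (fun k => mFourierBasis.repr g (Function.uncurry (s (Function.curry k)))) :=
  (Equiv.curry (Fin N) (Fin d) ℤ).symm.tsum_eq
    (fun k => conj (mFourierBasis.repr f k) *
      mFourierBasis.repr g (Function.uncurry (s (Function.curry k))))

theorem ip_coef (f g : L2 (Fin N × Fin d)) : ip (coef f) (coef g) = ⟪f, g⟫_ℂ := by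
  have h := ip_coef_eq f g id
  rw [Function.comp_id] at h
  rw [h, ← mFourierBasis.repr.inner_map_map, lp_inner]
  rfl

theorem nsq_coef (f : L2 (Fin N × Fin d)) : nsq (coef f) = ‖f‖ ^ 2 := by
  rw [← mFourierBasis.repr.norm_map, lp_norm_sq]
  exact (Equiv.curry (Fin N) (Fin d) ℤ).symm.tsum_eq (fun k => ‖mFourierBasis.repr f k‖ ^ 2)

theorem coef_injective : Function.Injective (coef (d := d) (N := N)) := by
  intro f g h
  refine mFourierBasis.repr.injective (lp.ext (funext fun k => ?_))
  exact congrFun h (Function.curry k)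

/-- Every square summable family is the family of Fourier coefficients of a function. -/
theorem exists_coef_eq {f : (Fin N → Fin d → ℤ) → ℂ} (hf : SqSum f) :
    ∃ F : L2 (Fin N × Fin d), coef F = f := by
  have h : SqSum fun k => f (Function.curry k) :=
    ((Equiv.curry (Fin N) (Fin d) ℤ).summable_iff (f := fun κ => ‖f κ‖ ^ 2)).2 hf
  refine ⟨mFourierBasis.repr.symm h.toLp, funext fun κ => ?_⟩
  rw [coef, LinearIsometryEquiv.apply_symm_apply]
  rfl

theorem mFourier_relabel (n : Fin N × Fin d → ℤ) (σ : Equiv.Perm (Fin N))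
    (x : UnitAddTorus (Fin N × Fin d)) :
    mFourier (fun q => n (σ q.1, q.2)) (relabel σ x) = mFourier n x := by
  simp only [mFourier, ContinuousMap.coe_mk, relabel]
  exact Equiv.prod_comp (Equiv.prodCongr σ (Equiv.refl (Fin d))) fun q => fourier (n q) (x q)

theorem coef_relabel (f : L2 (Fin N × Fin d)) (σ : Equiv.Perm (Fin N)) (κ : Fin N → Fin d → ℤ) :
    coef (Lp.compMeasurePreserving (relabel σ) (measurePreserving_relabel σ) f) κ = coef f (κ ∘ σ) := by
  have hmp := measurePreserving_relabel (d := d) σ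
  rw [coef, coef, mFourierBasis_repr, mFourierBasis_repr,
    mFourierCoeff_congr_ae (Lp.coeFn_compMeasurePreserving f hmp), mFourierCoeff, mFourierCoeff]
  have hmeas : AEStronglyMeasurable (fun y => mFourier (-(Function.uncurry (κ ∘ σ))) y • f y)
      (Measure.map (relabel σ) volume) := by
    rw [hmp.map_eq]
    exact (mFourier _).continuous.aestronglyMeasurable.smul (Lp.aestronglyMeasurable f)
  have h := integral_map hmp.aemeasurable hmeas
  rw [hmp.map_eq] at h
  rw [h]
  refine integral_congr_ae (Filter.Eventually.of_forall fun x => ?_)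
  simp only [Function.comp_apply]
  rw [← mFourier_relabel (-(Function.uncurry κ)) σ x]
  rfl

theorem mem_bosonSpace_iff {f : L2 (Fin N × Fin d)} :
    f ∈ bosonSpace d N ↔ ∀ (σ : Equiv.Perm (Fin N)) (κ : Fin N → Fin d → ℤ), coef f (κ ∘ σ) = coef f κ := by
  constructor
  · intro h σ κ
    rw [← coef_relabel, h σ]
  · intro h σ
    refine coef_injective (funext fun κ => ?_)
    rw [coef_relabel, h]

/-- The difference of the positions of two particles. -/
def diffHom (d : ℕ) {N : ℕ} (i j : Fin N) : UnitAddTorus (Fin N × Fin d) →+ UnitAddTorus (Fin d) where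
  toFun x a := x (i, a) - x (j, a)
  map_zero' := by ext a; simp
  map_add' x y := by ext a; simp only [Pi.add_apply]; abel

/-- A continuous surjective homomorphism of compact groups carries Haar probability to Haar
probability. This pulls the almost everywhere convergence of the Fourier series of `v` back to
configurations. -/
theorem measurePreserving_diffHom {i j : Fin N} (h : i ≠ j) :
    MeasurePreserving (diffHom d i j) volume volume := by
  refine AddMonoidHom.measurePreserving ?_ ?_ ?_
  · exact continuous_pi fun a => (continuous_apply (i, a)).sub (continuous_apply (j, a))
  · intro y
    refine ⟨fun q => if q.1 = i then y q.2 else 0, ?_⟩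
    ext a
    simp [diffHom, h.symm]
  · simp

theorem mFourier_sub_apply {ι : Type*} [Fintype ι] (p : ι → ℤ) (y z : UnitAddTorus ι) :
    mFourier p (y - z) = mFourier p y * mFourier (-p) z := by
  simp only [mFourier, ContinuousMap.coe_mk, ← Finset.prod_mul_distrib]
  refine Finset.prod_congr rfl fun a _ => ?_
  simp only [Pi.sub_apply, Pi.neg_apply, fourier_apply, sub_eq_add_neg, smul_add, smul_neg, neg_smul,
    AddCircle.toCircle_add, Circle.coe_mul]

theorem mFourier_single_mode (i : Fin N) (p : Fin d → ℤ) (x : UnitAddTorus (Fin N × Fin d)) :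
    mFourier (Function.uncurry (Pi.single i p : Fin N → Fin d → ℤ)) x
      = mFourier p (fun a => x (i, a)) := by
  simp only [mFourier, ContinuousMap.coe_mk]
  rw [Fintype.prod_prod_type, Finset.prod_eq_single i]
  · simp
  · intro j _ hj
    simp [Function.uncurry, Pi.single_eq_of_ne hj]
  · simp

theorem mFourier_diffHom (i j : Fin N) (p : Fin d → ℤ) (x : UnitAddTorus (Fin N × Fin d)) :
    mFourier p (diffHom d i j x)
      = mFourier (Function.uncurry (Pi.single i p - Pi.single j p : Fin N → Fin d → ℤ)) x := by
  have e : Function.uncurry (Pi.single i p - Pi.single j p : Fin N → Fin d → ℤ)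
      = Function.uncurry (Pi.single i p : Fin N → Fin d → ℤ)
        + Function.uncurry (Pi.single j (-p) : Fin N → Fin d → ℤ) := by
    rw [Pi.single_neg, sub_eq_add_neg]; rfl
  rw [e, mFourier_add, mFourier_single_mode, mFourier_single_mode, ← mFourier_sub_apply]
  rfl

end Configurations

/-! ### The interaction -/

section Interaction

open ComplexConjugate UnitAddTorus

variable {d M : ℕ}

/-- The assumptions on the pair potential, with an explicit bound. -/
structure IsPotential (v : UnitAddTorus (Fin d) → ℝ) (b : ℝ) : Prop where
  meas : Measurable v
  bound : ∀ x, |v x| ≤ b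
  even : ∀ x, v (-x) = v x
  vhat_nonneg : ∀ k, 0 ≤ vhat v k

variable {v : UnitAddTorus (Fin d) → ℝ} {b : ℝ}

namespace IsPotential

theorem bound_nonneg (hv : IsPotential v b) : 0 ≤ b := (abs_nonneg _).trans (hv.bound 0)

theorem summable_vhat (hv : IsPotential v b) : Summable (vhat v) :=
  summable_re_mFourierCoeff hv.meas hv.bound hv.vhat_nonneg

theorem vhat_neg (hv : IsPotential v b) (k : Fin d → ℤ) : vhat v (-k) = vhat v k :=
  congrArg Complex.re (mFourierCoeff_neg hv.even k)

theorem ae_hasSum (hv : IsPotential v b) {N : ℕ} {i j : Fin N} (h : i ≠ j) :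
    ∀ᵐ x : UnitAddTorus (Fin N × Fin d), HasSum (fun p => (vhat v p : ℂ)
      * mFourier (Function.uncurry (Pi.single i p - Pi.single j p : Fin N → Fin d → ℤ)) x)
      (v (fun a => x (i, a) - x (j, a)) : ℂ) := by
  have h1 := ae_hasSum_mFourier hv.meas hv.bound hv.even hv.vhat_nonneg
  have h2 := (measurePreserving_diffHom (d := d) h).quasiMeasurePreserving.ae h1
  filter_upwards [h2] with x hx
  simp only [mFourier_diffHom] at hx
  exact hx

theorem sum_card_Ioi (M : ℕ) :
    ∑ i : Fin (M + 2), ((Finset.Ioi i).card : ℝ) = ((M : ℝ) + 2) * ((M : ℝ) + 1) / 2 := by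
  simp only [Fin.card_Ioi]
  have h : ∀ i : Fin (M + 2), ((M + 2 - 1 - (i : ℕ) : ℕ) : ℝ) = (M : ℝ) + 1 - ((i : ℕ) : ℝ) := by
    intro i
    rw [Nat.cast_sub (by omega)]
    push_cast; ring
  simp only [h]
  rw [Finset.sum_sub_distrib, Fin.sum_univ_eq_sum_range (fun i => (i : ℝ)), Finset.sum_const,
    Finset.card_univ, Fintype.card_fin, nsmul_eq_mul]
  have h2 := Finset.sum_range_id_mul_two (M + 2)
  have h3 : (∑ i ∈ Finset.range (M + 2), (i : ℝ)) * 2 = ((M : ℝ) + 2) * ((M : ℝ) + 1) := by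
    have h4 := congrArg (Nat.cast (R := ℝ)) h2
    rw [show M + 2 - 1 = M + 1 by omega] at h4
    push_cast at h4
    exact h4
  push_cast
  linarith

theorem measurable_interaction (hv : IsPotential v b) (N : ℕ) : Measurable (interaction N v) := by
  unfold interaction
  refine Measurable.const_mul (Finset.measurable_fun_sum _ fun i _ =>
    Finset.measurable_fun_sum _ fun j _ => hv.meas.comp ?_) _
  exact measurable_pi_lambda _ fun a => (measurable_pi_apply (i, a)).sub (measurable_pi_apply (j, a))

theorem abs_interaction_le (hv : IsPotential v b) (x : UnitAddTorus (Fin (M + 2) × Fin d)) :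
    |interaction (M + 2) v x| ≤ ((M : ℝ) + 2) / 2 * b := by
  have h : |∑ i : Fin (M + 2), ∑ j ∈ Finset.Ioi i, v (fun a => x (i, a) - x (j, a))|
      ≤ ((M : ℝ) + 2) * ((M : ℝ) + 1) / 2 * b := by
    rw [← sum_card_Ioi, Finset.sum_mul]
    refine (Finset.abs_sum_le_sum_abs _ _).trans (Finset.sum_le_sum fun i _ => ?_)
    refine (Finset.abs_sum_le_sum_abs _ _).trans ((Finset.sum_le_sum fun j _ => hv.bound _).trans ?_)
    rw [Finset.sum_const, nsmul_eq_mul]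
  have hM : (0 : ℝ) < (M : ℝ) + 1 := by positivity
  have e : ((M + 2 : ℕ) : ℝ) - 1 = (M : ℝ) + 1 := by push_cast; ring
  rw [interaction, e, abs_mul, abs_of_pos (by positivity)]
  calc _ ≤ ((M : ℝ) + 1)⁻¹ * (((M : ℝ) + 2) * ((M : ℝ) + 1) / 2 * b) := by gcongr
    _ = _ := by field_simp

/-- Discarding the square on the left bounds the pair sum below by `-N / 2`, which is where
nonnegative Fourier coefficients give stability. -/
theorem norm_sum_sq_eq {N : ℕ} (z : Fin N → ℂ) (hz : ∀ i, ‖z i‖ = 1) :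
    ‖∑ i, z i‖ ^ 2 = N + 2 * (∑ i, ∑ j ∈ Finset.Ioi i, z i * conj (z j)).re := by
  have h := Finset.sum_sum_Ioi_add_eq_sum_sum_off_diag fun i j : Fin N => z i * conj (z j)
  have h1 : ((‖∑ i, z i‖ ^ 2 : ℝ) : ℂ) = ∑ i, ∑ j, z j * conj (z i) := by
    rw [Complex.ofReal_pow, ← Complex.mul_conj', map_sum, Finset.sum_mul_sum, Finset.sum_comm]
  have h2 : ∀ i, ∑ j, z j * conj (z i) = 1 + ∑ j ∈ {i}ᶜ, z j * conj (z i) := by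
    intro i
    rw [← Finset.sum_add_sum_compl {i}, Finset.sum_singleton, Complex.mul_conj', hz]
    norm_num
  simp only [h2] at h1
  rw [Finset.sum_add_distrib, ← h] at h1
  have h3 := congrArg Complex.re h1
  rw [Complex.ofReal_re] at h3
  rw [h3]
  simp only [Finset.sum_add_distrib, Complex.add_re, Complex.re_sum, Finset.mul_sum, Finset.sum_const,
    Finset.card_univ, Fintype.card_fin, nsmul_eq_mul, mul_one]
  have h4 : ∀ i j, (z j * conj (z i)).re = (z i * conj (z j)).re := fun i j => by
    rw [← Complex.conj_re, map_mul, Complex.conj_conj, mul_comm]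
  simp only [h4]
  simp only [← Finset.sum_add_distrib, Complex.one_re, ← two_mul]
  simp [Finset.mul_sum]

/-- Stability: the interaction energy is bounded below by its mean field value. -/
theorem le_interaction (hv : IsPotential v b) : ∀ᵐ x : UnitAddTorus (Fin (M + 2) × Fin d),
    ((M : ℝ) + 2) / 2 * vhat v 0 - ∑' p, vhat v p ≤ interaction (M + 2) v x := by
  have hall : ∀ᵐ x : UnitAddTorus (Fin (M + 2) × Fin d), ∀ i j : Fin (M + 2), i ≠ j →
      HasSum (fun p => (vhat v p : ℂ)
        * mFourier (Function.uncurry (Pi.single i p - Pi.single j p : Fin (M + 2) → Fin d → ℤ)) x)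
        (v (fun a => x (i, a) - x (j, a)) : ℂ) := by
    rw [ae_all_iff]; intro i
    rw [ae_all_iff]; intro j
    by_cases h : i = j
    · simp [h]
    · simpa [h] using hv.ae_hasSum h
  filter_upwards [hall] with x hx
  have hM : (0 : ℝ) < (M : ℝ) + 1 := by positivity
  have hchar : ∀ (i j : Fin (M + 2)) (p : Fin d → ℤ),
      mFourier (Function.uncurry (Pi.single i p - Pi.single j p : Fin (M + 2) → Fin d → ℤ)) x
      = mFourier p (fun a => x (i, a)) * conj (mFourier p (fun a => x (j, a))) := by
    intro i j p
    rw [← mFourier_diffHom, ← mFourier_neg, ← mFourier_sub_apply]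
    rfl
  simp only [hchar] at hx
  have hs := hasSum_sum (s := Finset.univ) fun i (_ : i ∈ Finset.univ) =>
    hasSum_sum (s := Finset.Ioi i) fun j hj => hx i j (Finset.mem_Ioi.1 hj).ne
  have hs' := Complex.hasSum_re hs
  have hpull : ∀ p : Fin d → ℤ, (∑ i : Fin (M + 2), ∑ j ∈ Finset.Ioi i, (vhat v p : ℂ)
      * (mFourier p (fun a => x (i, a)) * conj (mFourier p (fun a => x (j, a))))).re
      = vhat v p * (∑ i : Fin (M + 2), ∑ j ∈ Finset.Ioi i,
        mFourier p (fun a => x (i, a)) * conj (mFourier p (fun a => x (j, a)))).re := by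
    intro p
    rw [← Complex.re_ofReal_mul, Finset.mul_sum]
    simp only [Finset.mul_sum]
  simp only [hpull] at hs'
  have hre : (∑ i : Fin (M + 2), ∑ j ∈ Finset.Ioi i, ((v fun a => x (i, a) - x (j, a) : ℝ) : ℂ)).re
      = ∑ i : Fin (M + 2), ∑ j ∈ Finset.Ioi i, v (fun a => x (i, a) - x (j, a)) := by
    simp
  rw [hre] at hs'
  have hsq : ∀ p, -((M : ℝ) + 2) / 2 ≤ (∑ i : Fin (M + 2), ∑ j ∈ Finset.Ioi i,
      mFourier p (fun a => x (i, a)) * conj (mFourier p (fun a => x (j, a)))).re := by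
    intro p
    have := norm_sum_sq_eq (fun i : Fin (M + 2) => mFourier p (fun a => x (i, a)))
      fun i => norm_mFourier_apply _ _
    push_cast at this
    nlinarith [sq_nonneg ‖∑ i : Fin (M + 2), mFourier p (fun a => x (i, a))‖]
  have h0 : (∑ i : Fin (M + 2), ∑ j ∈ Finset.Ioi i, mFourier (0 : Fin d → ℤ) (fun a => x (i, a))
      * conj (mFourier (0 : Fin d → ℤ) (fun a => x (j, a)))).re = ((M : ℝ) + 2) * ((M : ℝ) + 1) / 2 := by
    rw [← sum_card_Ioi]
    simp [mFourier_zero]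
  classical
  -- Every mode contributes at least `-N / 2` times its coefficient, with `N = M + 2`. The mode zero
  -- contributes `N (N - 1) / 2` exactly, hence the added `N² / 2`.
  have hsum2 := (hv.summable_vhat.hasSum.mul_right (-((M : ℝ) + 2) / 2)).add
    (hasSum_ite_eq (0 : Fin d → ℤ) (vhat v 0 * (((M : ℝ) + 2) * ((M : ℝ) + 2) / 2)))
  have hle := hasSum_le (fun p => ?_) hsum2 hs'
  · rw [interaction]
    have e : ((M + 2 : ℕ) : ℝ) - 1 = (M : ℝ) + 1 := by push_cast; ring
    rw [e, inv_mul_eq_div, le_div_iff₀ hM]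
    refine le_trans ?_ hle
    have h00 := hv.vhat_nonneg 0
    have hB : vhat v 0 ≤ ∑' p, vhat v p := hv.summable_vhat.le_tsum 0 fun p _ => hv.vhat_nonneg p
    have hMM : (0 : ℝ) ≤ M := by positivity
    nlinarith [mul_nonneg hMM h00, mul_nonneg hMM (h00.trans hB)]
  · by_cases hp : p = 0
    · subst hp
      rw [if_pos rfl, h0]
      apply le_of_eq; ring
    · rw [if_neg hp, add_zero]
      exact mul_le_mul_of_nonneg_left (hsq p) (hv.vhat_nonneg p)

/-- Any two particles can be moved to the first two places. -/
theorem exists_perm_zero_one {i j : Fin (M + 2)} (h : i ≠ j) :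
    ∃ σ : Equiv.Perm (Fin (M + 2)), σ 0 = i ∧ σ 1 = j := by
  have h01 : (0 : Fin (M + 2)) ≠ 1 := by simp
  have hj : Equiv.swap 0 i j ≠ 0 := by
    intro h'
    have h2 := congrArg (Equiv.swap 0 i) h'
    rw [Equiv.swap_apply_self, Equiv.swap_apply_left] at h2
    exact h h2.symm
  refine ⟨Equiv.swap 0 i * Equiv.swap 1 (Equiv.swap 0 i j), ?_, ?_⟩
  · rw [Equiv.Perm.mul_apply, Equiv.swap_apply_of_ne_of_ne h01 hj.symm, Equiv.swap_apply_left]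
  · rw [Equiv.Perm.mul_apply, Equiv.swap_apply_left, Equiv.swap_apply_self]

theorem splitTwo_transfer {Z : Type*} [AddCommGroup Z] (p : Z) (x : (Z × Z) × (Fin M → Z)) :
    splitTwo M (transfer p x) = splitTwo M x - (Pi.single 0 p - Pi.single 1 p) := by
  ext m
  refine Fin.cases ?_ (fun m => Fin.cases ?_ (fun m => ?_) m) m
  · simp [splitTwo_apply, transfer_apply]
  · have h11 : Fin.succ (0 : Fin (M + 1)) = 1 := rfl
    simp [splitTwo_apply, transfer_apply, h11]
  · have h10 : (m.succ.succ : Fin (M + 2)) ≠ 0 := Fin.succ_ne_zero _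
    have h11 : (m.succ.succ : Fin (M + 2)) ≠ 1 := by
      intro h; exact Fin.succ_ne_zero _ (Fin.succ_injective _ h)
    simp [splitTwo_apply, transfer_apply, Pi.single_eq_of_ne h10, Pi.single_eq_of_ne h11]

/-- The sum over all configurations of a pair shift does not depend on the pair, for symmetric
functions. -/
theorem ip_shift_eq {Z : Type*} [AddCommGroup Z] {f g : (Fin (M + 2) → Z) → ℂ}
    (hf : ∀ (σ : Equiv.Perm (Fin (M + 2))) κ, f (κ ∘ σ) = f κ)
    (hg : ∀ (σ : Equiv.Perm (Fin (M + 2))) κ, g (κ ∘ σ) = g κ) {i j : Fin (M + 2)} (h : i ≠ j) (p : Z) :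
    ip f (g ∘ fun κ => κ - (Pi.single i p - Pi.single j p))
      = ip (fun x => f (splitTwo M x)) ((fun x => g (splitTwo M x)) ∘ transfer p) := by
  -- Relabelling the summation variable by `σ` takes the pair `0, 1` to `i, j`, and symmetry of `f`
  -- and `g` absorbs the relabelling.
  obtain ⟨σ, h0, h1⟩ := exists_perm_zero_one h
  have e1 : ip (fun x => f (splitTwo M x)) ((fun x => g (splitTwo M x)) ∘ transfer p)
      = ip f (g ∘ fun κ => κ - (Pi.single 0 p - Pi.single 1 p)) := by
    rw [ip, ip, ← (splitTwo M).tsum_eq]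
    refine tsum_congr fun x => ?_
    rw [Function.comp_apply, Function.comp_apply, splitTwo_transfer]
  rw [e1, ip, ip]
  let e : (Fin (M + 2) → Z) ≃ (Fin (M + 2) → Z) := Equiv.arrowCongr σ.symm (Equiv.refl _)
  have he : ∀ κ, e κ = κ ∘ σ := fun κ => by ext; simp [e]
  let F : (Fin (M + 2) → Z) → ℂ := fun κ =>
    conj (f κ) * g (κ - ((Pi.single 0 p : Fin (M + 2) → Z) - (Pi.single 1 p : Fin (M + 2) → Z)))
  refine Eq.trans (tsum_congr fun κ => ?_) (e.tsum_eq F)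
  change _ = conj (f (e κ)) * g (e κ - (Pi.single 0 p - Pi.single 1 p))
  rw [he, hf, Function.comp_apply, ← hg σ]
  congr 2
  funext m
  have s0 : ∀ (i : Fin (M + 2)) (m : Fin (M + 2)), (Pi.single (σ i) p : Fin (M + 2) → Z) (σ m)
      = (Pi.single i p : Fin (M + 2) → Z) m := by
    intro i m
    by_cases hm : m = i
    · subst hm; simp
    · rw [Pi.single_eq_of_ne hm, Pi.single_eq_of_ne (fun h => hm (σ.injective h))]
  simp only [Function.comp_apply, Pi.sub_apply]
  rw [← h0, ← h1, s0, s0]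

/-- The Fourier coefficients of a function of `M + 2` particles, with the first two separated. -/
def coefTwo (f : L2 (Fin (M + 2) × Fin d)) (x : ((Fin d → ℤ) × (Fin d → ℤ)) × (Fin M → Fin d → ℤ)) : ℂ :=
  coef f (splitTwo M x)

theorem ip_coef_shift {f g : L2 (Fin (M + 2) × Fin d)} (hf : f ∈ bosonSpace d (M + 2))
    (hg : g ∈ bosonSpace d (M + 2)) {i j : Fin (M + 2)} (h : i ≠ j) (p : Fin d → ℤ) :
    ip (coef f) (coef g ∘ fun κ => κ - (Pi.single i p - Pi.single j p))
      = ip (coefTwo f) (coefTwo g ∘ transfer p) :=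
  ip_shift_eq (mem_bosonSpace_iff.1 hf) (mem_bosonSpace_iff.1 hg) h p

/-- The multiplication operator by the interaction. -/
def interactionCLM (hv : IsPotential v b) (M : ℕ) :
    L2 (Fin (M + 2) × Fin d) →L[ℂ] L2 (Fin (M + 2) × Fin d) :=
  mulCLM (hv.measurable_interaction (M + 2)) hv.abs_interaction_le

/-- The interaction energy in terms of Fourier coefficients. -/
theorem inner_interactionCLM (hv : IsPotential v b) {f g : L2 (Fin (M + 2) × Fin d)}
    (hf : f ∈ bosonSpace d (M + 2)) (hg : g ∈ bosonSpace d (M + 2)) :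
    ⟪f, hv.interactionCLM M g⟫_ℂ
      = ((((M : ℝ) + 2) / 2 : ℝ) : ℂ) * pairForm (vhat v) (coefTwo f) (coefTwo g) := by
  rw [interactionCLM, inner_mulCLM]
  have hpair : ∀ i j : Fin (M + 2), i ≠ j →
      ∫ x, conj (f x) * ((v (fun a => x (i, a) - x (j, a)) : ℂ) * g x)
        = pairForm (vhat v) (coefTwo f) (coefTwo g) := by
    intro i j hij
    rw [← (hasSum_integral_conj_mul hv.vhat_nonneg hv.summable_vhat (hv.ae_hasSum hij) f g).tsum_eq]
    refine tsum_congr fun p => ?_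
    rw [← ip_coef_shift hf hg hij, ip_coef_eq]
    rfl
  have hint : ∀ i j : Fin (M + 2),
      Integrable (fun x => conj (f x) * ((v (fun a => x (i, a) - x (j, a)) : ℂ) * g x)) volume := by
    intro i j
    have hm : Measurable fun x : UnitAddTorus (Fin (M + 2) × Fin d) => v (fun a => x (i, a) - x (j, a)) :=
      hv.meas.comp (measurable_pi_lambda _ fun a =>
        (measurable_pi_apply (i, a)).sub (measurable_pi_apply (j, a)))
    refine (integrable_conj_mul f (mulCLM hm (fun x => hv.bound _) g)).congr ?_
    filter_upwards [coeFn_mulCLM hm (fun x => hv.bound _) g] with x hx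
    rw [hx]
  have hexp : ∀ x, conj (f x) * ((interaction (M + 2) v x : ℂ) * g x)
      = ((((M : ℝ) + 1)⁻¹ : ℝ) : ℂ) * ∑ i : Fin (M + 2), ∑ j ∈ Finset.Ioi i,
        conj (f x) * ((v (fun a => x (i, a) - x (j, a)) : ℂ) * g x) := by
    intro x
    have e : ((M + 2 : ℕ) : ℝ) - 1 = (M : ℝ) + 1 := by push_cast; ring
    rw [interaction, e]
    simp only [← Finset.mul_sum, ← Finset.sum_mul]
    push_cast
    ring
  simp only [hexp]
  rw [integral_const_mul, integral_finsetSum _ fun i _ => integrable_finsetSum _ fun j _ => hint i j]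
  have hsum : ∀ i : Fin (M + 2), ∫ x, ∑ j ∈ Finset.Ioi i,
      conj (f x) * ((v (fun a => x (i, a) - x (j, a)) : ℂ) * g x)
      = ((Finset.Ioi i).card : ℂ) * pairForm (vhat v) (coefTwo f) (coefTwo g) := by
    intro i
    rw [integral_finsetSum _ fun j _ => hint i j, Finset.sum_congr rfl fun j hj =>
      hpair i j (Finset.mem_Ioi.1 hj).ne, Finset.sum_const, nsmul_eq_mul]
  simp only [hsum]
  rw [← Finset.sum_mul, ← mul_assoc]
  congr 1
  have hc : ∑ i : Fin (M + 2), ((Finset.Ioi i).card : ℂ)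
      = ((((M : ℝ) + 2) * ((M : ℝ) + 1) / 2 : ℝ) : ℂ) := by
    rw [← sum_card_Ioi]; push_cast; rfl
  rw [hc, ← Complex.ofReal_mul]
  congr 1
  have hM : (0 : ℝ) < (M : ℝ) + 1 := by positivity
  field_simp

end IsPotential

end Interaction

/-! ### Diagonal operators -/

section Diagonal

variable {X E : Type*} [NormedAddCommGroup E] [InnerProductSpace ℂ E] (ψ : HilbertBasis X ℂ E)

theorem norm_sq_eq_nsq_repr (f : E) : ‖f‖ ^ 2 = nsq (fun x => ψ.repr f x) := by
  rw [← ψ.repr.norm_map, lp_norm_sq]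

theorem inner_eq_ip_repr (f g : E) : ⟪f, g⟫_ℂ = ip (fun x => ψ.repr f x) (fun x => ψ.repr g x) := by
  rw [← ψ.repr.inner_map_map, lp_inner]

theorem sqSum_repr (f : E) : SqSum (fun x => ψ.repr f x) := lp_sqSum _

theorem eq_of_repr_eq {f g : E} (h : ∀ x, ψ.repr f x = ψ.repr g x) : f = g :=
  ψ.repr.injective (lp.ext (funext h))

theorem norm_le_of_repr_le {f g : E} {C : ℝ} (hC : 0 ≤ C)
    (h : ∀ x, ‖ψ.repr f x‖ ≤ C * ‖ψ.repr g x‖) : ‖f‖ ≤ C * ‖g‖ := by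
  refine abs_le_of_sq_le_sq' ?_ (by positivity) |>.2
  rw [mul_pow, norm_sq_eq_nsq_repr ψ, norm_sq_eq_nsq_repr ψ, nsq, nsq, ← tsum_mul_left]
  have hle : ∀ x, ‖ψ.repr f x‖ ^ 2 ≤ C ^ 2 * ‖ψ.repr g x‖ ^ 2 := fun x => by
    rw [← mul_pow]; exact pow_le_pow_left₀ (norm_nonneg _) (h x) 2
  exact (sqSum_repr ψ f).tsum_le_tsum hle (Summable.mul_left _ (sqSum_repr ψ g))

variable {m : X → ℝ} {C : ℝ} (hm : ∀ x, |m x| ≤ C)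

theorem sqSum_mul_repr (hm : ∀ x, |m x| ≤ C) (f : E) : SqSum fun x => (m x : ℂ) * ψ.repr f x := by
  refine ((sqSum_repr ψ f).smul (C : ℂ)).of_le fun x => ?_
  rw [Pi.smul_apply, smul_eq_mul, norm_mul, norm_mul, Complex.norm_real, Complex.norm_real]
  exact mul_le_mul_of_nonneg_right ((hm x).trans (le_abs_self C)) (norm_nonneg _)

/-- The operator that is diagonal in an orthonormal basis, with bounded entries `m`. -/
def diagOp : E →L[ℂ] E :=
  LinearMap.mkContinuous
    { toFun := fun f => ψ.repr.symm (sqSum_mul_repr ψ hm f).toLp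
      map_add' := fun f g => by
        refine eq_of_repr_eq ψ fun x => ?_
        simp [mul_add]
      map_smul' := fun c f => by
        refine eq_of_repr_eq ψ fun x => ?_
        simp [mul_left_comm] } |C| fun f => by
      refine norm_le_of_repr_le ψ (abs_nonneg C) fun x => ?_
      simp only [LinearMap.coe_mk, AddHom.coe_mk, LinearIsometryEquiv.apply_symm_apply,
        SqSum.toLp_apply, norm_mul, Complex.norm_real]
      exact mul_le_mul_of_nonneg_right ((hm x).trans (le_abs_self C)) (norm_nonneg _)

theorem repr_diagOp (f : E) (x : X) : ψ.repr (diagOp ψ hm f) x = m x * ψ.repr f x := by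
  simp [diagOp]

theorem isCompactOperator_rankOne (x : X) (c : ℂ) :
    IsCompactOperator (c • (innerSL ℂ (ψ x)).smulRight (ψ x) : E →L[ℂ] E) := by
  have h : IsCompactOperator (innerSL ℂ (ψ x)) :=
    isCompactOperator_of_locallyCompactSpace_dom _
  exact (h.clm_comp (ContinuousLinearMap.toSpanSingleton ℂ (ψ x))).smul c

/-- It is the norm limit of the finite rank operators keeping the entries of modulus at least `1 /
(n + 1)`. -/
theorem isCompactOperator_diagOp [CompleteSpace E] (h0 : ∀ ε > 0, {x | ε ≤ |m x|}.Finite) :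
    IsCompactOperator (diagOp ψ hm) := by
  classical
  let S : ℕ → Finset X := fun n => (h0 (1 / ((n : ℝ) + 1)) (by positivity)).toFinset
  let F : ℕ → E →L[ℂ] E := fun n => ∑ x ∈ S n, (m x : ℂ) • (innerSL ℂ (ψ x)).smulRight (ψ x)
  have hF : ∀ n, IsCompactOperator (F n) := by
    intro n
    have : ∀ T : Finset X,
        IsCompactOperator (∑ x ∈ T, (m x : ℂ) • (innerSL ℂ (ψ x)).smulRight (ψ x) : E →L[ℂ] E) := by
      intro T
      induction T using Finset.induction_on with
      | empty => simpa using isCompactOperator_zero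
      | insert a T ha ih =>
        rw [Finset.sum_insert ha]
        exact (isCompactOperator_rankOne ψ a _).add ih
    exact this _
  have hrepr : ∀ n f x, ψ.repr (F n f) x = if x ∈ S n then (m x : ℂ) * ψ.repr f x else 0 := by
    intro n f x
    have e : F n f = ∑ y ∈ S n, ((m y : ℂ) * ⟪ψ y, f⟫_ℂ) • ψ y := by
      simp only [F, sum_apply, smul_apply,
        ContinuousLinearMap.smulRight_apply, innerSL_apply_apply, smul_smul]
    rw [e, ψ.repr_apply_apply, inner_sum]
    simp only [inner_smul_right, orthonormal_iff_ite.1 ψ.orthonormal, mul_ite, mul_one, mul_zero]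
    rw [Finset.sum_ite_eq]
    simp only [ψ.repr_apply_apply]
  have hnorm : ∀ n : ℕ, ‖F n - diagOp ψ hm‖ ≤ 1 / ((n : ℝ) + 1) := by
    intro n
    refine ContinuousLinearMap.opNorm_le_bound _ (by positivity) fun f => ?_
    refine norm_le_of_repr_le ψ (by positivity) fun x => ?_
    have e : ψ.repr ((F n - diagOp ψ hm) f) x = ψ.repr (F n f) x - ψ.repr (diagOp ψ hm f) x := by
      rw [sub_apply, map_sub]; rfl
    rw [e, hrepr, repr_diagOp]
    by_cases hx : x ∈ S n
    · rw [if_pos hx, sub_self, norm_zero]; positivity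
    · rw [if_neg hx, zero_sub, norm_neg, norm_mul, Complex.norm_real, Real.norm_eq_abs]
      refine mul_le_mul_of_nonneg_right ?_ (norm_nonneg _)
      simp only [S, Set.Finite.mem_toFinset, Set.mem_ofPred_eq, not_le] at hx
      exact hx.le
  refine isCompactOperator_of_tendsto (l := Filter.atTop) (F := F) ?_ (Filter.Eventually.of_forall hF)
  rw [tendsto_iff_norm_sub_tendsto_zero]
  exact squeeze_zero (fun n => norm_nonneg _) hnorm tendsto_one_div_add_atTop_nhds_zero_nat

end Diagonal

/-! ### The resolvent of the Laplacian on the torus -/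

section Resolvent

open UnitAddTorus

variable {ι : Type*} [Fintype ι]

theorem momSq_nonneg (k : ι → ℤ) : 0 ≤ momSq k := by unfold momSq; positivity

theorem one_le_mul_sq : (1 : ℝ) ≤ (2 * Real.pi) ^ 2 := by
  nlinarith [Real.pi_gt_three]

theorem sum_sq_le_momSq (k : ι → ℤ) : ∑ i, (k i : ℝ) ^ 2 ≤ momSq k := by
  unfold momSq
  exact le_mul_of_one_le_left (by positivity) one_le_mul_sq

/-- The gap of the Laplacian, with `1` in place of the true `4π²`. Through it the kinetic energy
bounds the number of excited particles. -/
theorem one_le_momSq {k : ι → ℤ} (hk : k ≠ 0) : 1 ≤ momSq k := by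
  obtain ⟨i, hi⟩ := Function.ne_iff.1 hk
  refine le_trans ?_ (sum_sq_le_momSq k)
  refine le_trans ?_ (Finset.single_le_sum (f := fun i => (k i : ℝ) ^ 2) (fun _ _ => by positivity)
    (Finset.mem_univ i))
  have : (1 : ℤ) ≤ (k i) ^ 2 := by
    have := sq_nonneg (k i)
    have h2 : (k i) ^ 2 ≠ 0 := pow_ne_zero 2 hi
    omega
  exact_mod_cast this

theorem finite_momSq_le (r : ℝ) : {k : ι → ℤ | momSq k ≤ r}.Finite := by
  classical
  obtain ⟨R, hR⟩ := exists_nat_ge (max r 0)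
  refine Set.Finite.subset (Fintype.piFinset fun _ : ι => Finset.Icc (-(R : ℤ)) R).finite_toSet ?_
  intro k hk
  simp only [Finset.mem_coe, Fintype.mem_piFinset, Finset.mem_Icc]
  intro i
  have h1 : (k i : ℝ) ^ 2 ≤ R :=
    (Finset.single_le_sum (f := fun i => (k i : ℝ) ^ 2) (fun _ _ => by positivity)
      (Finset.mem_univ i)).trans ((sum_sq_le_momSq k).trans (le_trans hk ((le_max_left _ _).trans hR)))
  have h2 : (k i) ^ 2 ≤ (R : ℤ) := by exact_mod_cast h1
  have h3 : |k i| ≤ (k i) ^ 2 := by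
    rw [← sq_abs]
    rcases eq_or_ne (k i) 0 with h | h
    · simp [h]
    · have := Int.one_le_abs h; nlinarith
  exact abs_le.1 (h3.trans h2)

theorem abs_inv_momSq_add_le {c : ℝ} (hc : 0 < c) (k : ι → ℤ) : |(momSq k + c)⁻¹| ≤ c⁻¹ := by
  have := momSq_nonneg k
  rw [abs_of_pos (by positivity)]
  exact inv_anti₀ hc (by linarith)

variable (ι) in
/-- The resolvent `(-Δ + c)⁻¹`. -/
def resolvent {c : ℝ} (hc : 0 < c) : L2 ι →L[ℂ] L2 ι :=
  diagOp (mFourierBasis (d := ι)) (abs_inv_momSq_add_le hc)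

theorem repr_resolvent {c : ℝ} (hc : 0 < c) (f : L2 ι) (k : ι → ℤ) :
    mFourierBasis.repr (resolvent ι hc f) k = ((momSq k + c)⁻¹ : ℝ) * mFourierBasis.repr f k :=
  repr_diagOp _ _ f k

theorem isCompactOperator_resolvent {c : ℝ} (hc : 0 < c) : IsCompactOperator (resolvent ι hc) := by
  refine isCompactOperator_diagOp _ _ fun ε hε => (finite_momSq_le (ι := ι) ε⁻¹).subset fun k hk => ?_
  have h0 := momSq_nonneg k
  rw [Set.mem_ofPred_eq, abs_of_pos (by positivity)] at hk
  have h1 := inv_anti₀ hε hk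
  rw [inv_inv] at h1
  exact le_trans (by linarith) h1

/-- Nonnegativity of the Laplacian, in the form the perturbation argument consumes. -/
theorem re_inner_resolvent {c : ℝ} (hc : 0 < c) (f : L2 ι) :
    c * ‖resolvent ι hc f‖ ^ 2 ≤ (⟪f, resolvent ι hc f⟫_ℂ).re := by
  rw [norm_sq_eq_nsq_repr (mFourierBasis (d := ι)), inner_eq_ip_repr (mFourierBasis (d := ι))]
  have hs := (sqSum_repr (mFourierBasis (d := ι)) f).summable_mul
    (sqSum_repr (mFourierBasis (d := ι)) (resolvent ι hc f))
  rw [ip, ← (Complex.hasSum_re hs.hasSum).tsum_eq, nsq, ← tsum_mul_left]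
  refine Summable.tsum_le_tsum (fun k => ?_) (Summable.mul_left _ (sqSum_repr _ _))
    (Complex.hasSum_re hs.hasSum).summable
  have h0 := momSq_nonneg k
  rw [repr_resolvent, mul_left_comm, Complex.conj_mul', norm_mul, mul_pow, Complex.norm_real,
    Real.norm_eq_abs, sq_abs, ← Complex.ofReal_pow, ← Complex.ofReal_mul, Complex.ofReal_re, ← mul_assoc]
  refine mul_le_mul_of_nonneg_right ?_ (by positivity)
  rw [sq, ← mul_assoc]
  refine mul_le_of_le_one_left (by positivity) ?_
  rw [← div_eq_mul_inv, div_le_one (by positivity)]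
  linarith

theorem isSymmetric_resolvent {c : ℝ} (hc : 0 < c) :
    (resolvent ι hc : L2 ι →ₗ[ℂ] L2 ι).IsSymmetric := by
  intro f g
  change ⟪resolvent ι hc f, g⟫_ℂ = ⟪f, resolvent ι hc g⟫_ℂ
  rw [inner_eq_ip_repr (mFourierBasis (d := ι)), inner_eq_ip_repr (mFourierBasis (d := ι))]
  refine tsum_congr fun k => ?_
  beta_reduce
  rw [repr_resolvent, repr_resolvent, map_mul, Complex.conj_ofReal]
  ring

end Resolvent

/-! ### The eigenbasis of the Hamiltonian -/

section Hamiltonian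

open ComplexConjugate UnitAddTorus

variable {d N M : ℕ}

theorem isClosed_bosonSpace : IsClosed (bosonSpace d N : Set (L2 (Fin N × Fin d))) := by
  have : (bosonSpace d N : Set (L2 (Fin N × Fin d))) = ⋂ σ : Equiv.Perm (Fin N),
      {f | Lp.compMeasurePreserving (relabel σ) (measurePreserving_relabel σ) f = f} := by
    ext f
    rw [Set.mem_iInter]
    exact Iff.rfl
  rw [this]
  exact isClosed_iInter fun σ => isClosed_eq
    (Lp.isometry_compMeasurePreserving (measurePreserving_relabel σ)).continuous continuous_id

instance : CompleteSpace (bosonSpace d N) := isClosed_bosonSpace.completeSpace_coe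

theorem repr_negLaplacian {ι : Type*} [Fintype ι] (f : sobolevTwo ι) (k : ι → ℤ) :
    mFourierBasis.repr (negLaplacian ι f) k = (momSq k : ℂ) * mFourierBasis.repr (f : L2 ι) k := by
  change mFourierBasis.repr (mFourierBasis.repr.symm (⟨fun k => (momSq k : ℂ)
    * mFourierBasis.repr (f : L2 ι) k, f.2⟩ : lp (fun _ : ι → ℤ => ℂ) 2)) k = _
  rw [LinearIsometryEquiv.apply_symm_apply]

theorem momSq_uncurry (κ : Fin N → Fin d → ℤ) : momSq (Function.uncurry κ) = ∑ i, momSq (κ i) := by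
  simp only [momSq, ← Finset.mul_sum]
  rw [Fintype.sum_prod_type]
  rfl

theorem momSq_uncurry_comp (κ : Fin N → Fin d → ℤ) (σ : Equiv.Perm (Fin N)) :
    momSq (Function.uncurry (κ ∘ σ)) = momSq (Function.uncurry κ) := by
  rw [momSq_uncurry, momSq_uncurry]
  exact Equiv.sum_comp σ fun i => momSq (κ i)

theorem resolvent_mem {c : ℝ} (hc : 0 < c) {f : L2 (Fin N × Fin d)} (hf : f ∈ bosonSpace d N) :
    resolvent _ hc f ∈ bosonSpace d N := by
  rw [mem_bosonSpace_iff] at hf ⊢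
  intro σ κ
  have := hf σ κ
  rw [coef, coef] at this
  rw [coef, coef, repr_resolvent, repr_resolvent, momSq_uncurry_comp, this]

/-- The resolvent of the Laplacian on the bosonic space. -/
def bosonResolvent (d N : ℕ) {c : ℝ} (hc : 0 < c) : bosonSpace d N →L[ℂ] bosonSpace d N :=
  ((resolvent (Fin N × Fin d) hc).comp (bosonSpace d N).subtypeL).codRestrict (bosonSpace d N)
    fun f => resolvent_mem hc f.2

theorem isCompactOperator_bosonResolvent (d N : ℕ) {c : ℝ} (hc : 0 < c) :
    IsCompactOperator (bosonResolvent d N hc) := by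
  have h1 : IsCompactOperator ((resolvent (Fin N × Fin d) hc).comp (bosonSpace d N).subtypeL) :=
    (isCompactOperator_resolvent hc).comp_clm (bosonSpace d N).subtypeL
  exact h1.codRestrict (fun f => resolvent_mem hc f.2) isClosed_bosonSpace

variable {v : UnitAddTorus (Fin d) → ℝ} {b : ℝ}

/-- A permutation does not preserve the order of a pair. Twice the sum is the full double sum minus
the diagonal, both of which are invariant. -/
theorem sum_Ioi_comp_perm {α : Type*} [AddCommGroup α] [IsAddTorsionFree α] {F : Fin N → Fin N → α}
    (hF : ∀ i j, F i j = F j i) (σ : Equiv.Perm (Fin N)) :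
    ∑ i, ∑ j ∈ Finset.Ioi i, F (σ i) (σ j) = ∑ i, ∑ j ∈ Finset.Ioi i, F i j := by
  have key : ∀ G : Fin N → Fin N → α, (∀ i j, G i j = G j i) →
      2 • ∑ i, ∑ j ∈ Finset.Ioi i, G i j = ∑ i, ∑ j, G j i - ∑ i, G i i := by
    intro G hG
    have h := Finset.sum_sum_Ioi_add_eq_sum_sum_off_diag G
    have h2 : ∀ i, ∑ j, G j i = G i i + ∑ j ∈ {i}ᶜ, G j i := fun i => by
      rw [← Finset.sum_add_sum_compl {i}, Finset.sum_singleton]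
    simp only [h2, Finset.sum_add_distrib]
    rw [add_sub_cancel_left, ← h, Finset.smul_sum]
    refine Finset.sum_congr rfl fun i _ => ?_
    rw [Finset.smul_sum]
    refine Finset.sum_congr rfl fun j _ => ?_
    rw [two_nsmul, hG i j]
  have h2 : 2 • ∑ i, ∑ j ∈ Finset.Ioi i, F (σ i) (σ j) = 2 • ∑ i, ∑ j ∈ Finset.Ioi i, F i j := by
    rw [key F hF, key (fun i j => F (σ i) (σ j)) fun i j => hF _ _]
    congr 1
    · rw [← Equiv.sum_comp σ fun i => ∑ j, F j i]
      exact Finset.sum_congr rfl fun i _ => Equiv.sum_comp σ fun j => F j (σ i)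
    · exact Equiv.sum_comp σ fun i => F i i
  exact nsmul_right_injective (by norm_num) h2

theorem interaction_relabel (hv : ∀ x, v (-x) = v x) (σ : Equiv.Perm (Fin N))
    (x : UnitAddTorus (Fin N × Fin d)) : interaction N v (relabel σ x) = interaction N v x := by
  rw [interaction, interaction]
  congr 1
  refine sum_Ioi_comp_perm (F := fun i j => v (fun a => x (i, a) - x (j, a))) (fun i j => ?_) σ
  rw [← hv]
  congr 1
  ext a
  simp

namespace IsPotential

theorem interactionCLM_mem (hv : IsPotential v b) {f : L2 (Fin (M + 2) × Fin d)}
    (hf : f ∈ bosonSpace d (M + 2)) : hv.interactionCLM M f ∈ bosonSpace d (M + 2) := by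
  intro σ
  have hmp := measurePreserving_relabel (d := d) σ
  refine Lp.ext ?_
  have h1 := Lp.coeFn_compMeasurePreserving (hv.interactionCLM M f) hmp
  have h2 := coeFn_mulCLM (hv.measurable_interaction (M + 2)) hv.abs_interaction_le f
  have h3 := hmp.quasiMeasurePreserving.ae h2
  have h4 := Lp.coeFn_compMeasurePreserving f hmp
  rw [hf σ] at h4
  filter_upwards [h1, h2, h3, h4] with x e1 e2 e3 e4
  rw [e1]
  refine Eq.trans ?_ e2.symm
  refine Eq.trans e3 ?_
  rw [interaction_relabel hv.even, e4]
  rfl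

/-- The interaction on the bosonic space. -/
def bosonInteraction (hv : IsPotential v b) (M : ℕ) : bosonSpace d (M + 2) →L[ℂ] bosonSpace d (M + 2) :=
  ((hv.interactionCLM M).comp (bosonSpace d (M + 2)).subtypeL).codRestrict (bosonSpace d (M + 2))
    fun f => hv.interactionCLM_mem f.2

theorem norm_bosonInteraction_le (hv : IsPotential v b) (M : ℕ) :
    ‖hv.bosonInteraction M‖ ≤ ((M : ℝ) + 2) / 2 * b := by
  have hb := hv.bound_nonneg
  refine ContinuousLinearMap.opNorm_le_bound _ (by positivity) fun f => ?_
  exact (ContinuousLinearMap.le_opNorm (hv.interactionCLM M) _).trans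
    (mul_le_mul_of_nonneg_right (norm_mulCLM_le _ _) (norm_nonneg _))

theorem mem_domain_iff (hv : IsPotential v b) {f : bosonSpace d (M + 2)} :
    f ∈ (hamiltonian (M + 2) v).domain ↔ (f : L2 (Fin (M + 2) × Fin d)) ∈ sobolevTwo _ := by
  constructor
  · rintro ⟨h, -⟩
    exact h.1
  · intro h
    have h2 : (f : L2 (Fin (M + 2) × Fin d)) ∈ (negLaplacian (Fin (M + 2) × Fin d)
        + mulOp (interaction (M + 2) v)).domain :=
      ⟨h, memLp_mul (hv.measurable_interaction (M + 2)) hv.abs_interaction_le _⟩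
    refine ⟨h2, ?_⟩
    rw [LinearPMap.add_apply]
    refine Submodule.add_mem _ ?_ (hv.interactionCLM_mem f.2)
    rw [mem_bosonSpace_iff]
    intro σ κ
    have hf := mem_bosonSpace_iff.1 f.2 σ κ
    have e : ∀ κ, coef (negLaplacian (Fin (M + 2) × Fin d) ⟨f, h⟩) κ
        = (momSq (Function.uncurry κ) : ℂ) * coef (f : L2 (Fin (M + 2) × Fin d)) κ :=
      fun κ => repr_negLaplacian (ι := Fin (M + 2) × Fin d) ⟨f.1, h⟩ (Function.uncurry κ)
    rw [e, e, momSq_uncurry_comp, hf]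

/-- The Fourier coefficients of the kinetic part of the Hamiltonian. -/
theorem hamiltonian_apply (hv : IsPotential v b) (f : (hamiltonian (M + 2) v).domain) :
    ∃ g ∈ bosonSpace d (M + 2),
      (hamiltonian (M + 2) v f : L2 (Fin (M + 2) × Fin d)) = g + hv.interactionCLM M f.1 ∧
      ∀ κ, coef g κ = (momSq (Function.uncurry κ) : ℂ) * coef f.1.1 κ := by
  have hs := hv.mem_domain_iff.1 f.2
  refine ⟨negLaplacian (Fin (M + 2) × Fin d) ⟨f.1.1, hs⟩, ?_, rfl, fun κ =>
    repr_negLaplacian (ι := Fin (M + 2) × Fin d) ⟨f.1.1, hs⟩ (Function.uncurry κ)⟩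
  · have h1 := (hamiltonian (M + 2) v f).2
    have h2 := hv.interactionCLM_mem f.1.2
    have := Submodule.sub_mem _ h1 h2
    convert this using 1
    exact (add_sub_cancel_right _ _).symm

end IsPotential

/-- Plane waves with all particles in the same momentum are symmetric and linearly independent. -/
theorem not_finiteDimensional_bosonSpace (hd : 1 ≤ d) (hN : 1 ≤ N) :
    ¬ FiniteDimensional ℂ (bosonSpace d N) := by
  intro hfin
  have hinf : Infinite (Fin d → ℤ) := by
    have : Nonempty (Fin d) := ⟨⟨0, hd⟩⟩
    infer_instance
  have : Nonempty (Fin N) := ⟨⟨0, hN⟩⟩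
  let e : (Fin d → ℤ) → L2 (Fin N × Fin d) := fun k => mFourierBasis fun q => k q.2
  have hcoef : ∀ k κ, coef (e k) κ = (lp.single (E := fun _ : Fin N × Fin d → ℤ => ℂ) 2
      (fun q : Fin N × Fin d => k q.2) (1 : ℂ)) (Function.uncurry κ) := by
    intro k κ
    rw [coef, HilbertBasis.repr_self]
  have hmem : ∀ k, e k ∈ bosonSpace d N := by
    intro k
    rw [mem_bosonSpace_iff]
    intro σ κ
    rw [hcoef, hcoef]
    by_cases h : κ = fun _ => k
    · subst h; rfl
    · have h1 : Function.uncurry κ ≠ fun q : Fin N × Fin d => k q.2 := fun h2 =>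
        h (funext fun i => funext fun a => congrFun h2 (i, a))
      have h3 : Function.uncurry (κ ∘ σ) ≠ fun q : Fin N × Fin d => k q.2 := fun h2 =>
        h (funext fun i => funext fun a => by
          have := congrFun h2 (σ.symm i, a)
          simpa [Function.uncurry] using this)
      rw [lp.single_apply_ne _ _ _ h1, lp.single_apply_ne _ _ _ h3]
  have hinj : Function.Injective fun k : Fin d → ℤ => fun q : Fin N × Fin d => k q.2 := by
    intro k l h
    funext a
    exact congrFun h (⟨0, hN⟩, a)
  have hli : LinearIndependent ℂ fun k => (⟨e k, hmem k⟩ : bosonSpace d N) := by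
    have h1 : LinearIndependent ℂ e := mFourierBasis.orthonormal.linearIndependent.comp _ hinj
    exact LinearIndependent.of_comp (bosonSpace d N).subtype h1
  exact not_finite_iff_infinite.2 hinf (hli.finite)

namespace IsPotential

/-- The Hamiltonian has an orthonormal basis of eigenfunctions. -/
theorem exists_isEigenbasis (hv : IsPotential v b) (hd : 1 ≤ d) (M : ℕ) :
    ∃ (ψ : HilbertBasis ℕ ℂ (bosonSpace d (M + 2))) (ev : ℕ → ℝ),
      IsEigenbasis (hamiltonian (M + 2) v) ψ ev := by
  have hb := hv.bound_nonneg
  -- One more than the norm bound on the interaction, so that the interaction is a small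
  -- perturbation of `-Δ + c`.
  set c : ℝ := ((M : ℝ) + 2) / 2 * b + 1 with hc
  have hc0 : 0 < c := by positivity
  let R := bosonResolvent d (M + 2) hc0
  let V := hv.bosonInteraction M
  have hRrepr : ∀ (u : bosonSpace d (M + 2)) k, mFourierBasis.repr (R u : L2 (Fin (M + 2) × Fin d)) k
      = ((momSq k + c)⁻¹ : ℝ) * mFourierBasis.repr (u : L2 (Fin (M + 2) × Fin d)) k :=
    fun u k => repr_resolvent hc0 _ k
  have hmc : ∀ k : Fin (M + 2) × Fin d → ℤ, ((momSq k + c : ℝ) : ℂ) ≠ 0 := fun k => by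
    have := momSq_nonneg k
    exact_mod_cast (by positivity : momSq k + c ≠ 0)
  refine exists_isEigenbasis_of_perturbation (not_finiteDimensional_bosonSpace hd (by omega))
    (R := R) (V := V) (c := c) ?_ ?_ ?_ ?_ ?_ ?_ (hamiltonian (M + 2) v) ?_ ?_
  · exact isCompactOperator_bosonResolvent d (M + 2) hc0
  · intro f g
    exact isSymmetric_resolvent hc0 (f : L2 (Fin (M + 2) × Fin d)) (g : L2 (Fin (M + 2) × Fin d))
  · intro f g h
    refine Subtype.ext (eq_of_repr_eq mFourierBasis fun k => ?_)
    have h1 := hRrepr f k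
    rw [h, hRrepr g k] at h1
    have hne : (((momSq k + c)⁻¹ : ℝ) : ℂ) ≠ 0 := by
      rw [Complex.ofReal_inv]; exact inv_ne_zero (hmc k)
    exact (mul_left_cancel₀ hne h1).symm
  · intro f g
    exact isSymmetric_mulCLM (hv.measurable_interaction (M + 2)) hv.abs_interaction_le
      (f : L2 (Fin (M + 2) × Fin d)) (g : L2 (Fin (M + 2) × Fin d))
  · intro u
    exact re_inner_resolvent hc0 (u : L2 (Fin (M + 2) × Fin d))
  · exact (hv.norm_bosonInteraction_le M).trans_lt (by rw [hc]; linarith)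
  · intro u
    have hsob : (R u : L2 (Fin (M + 2) × Fin d)) ∈ sobolevTwo _ := by
      change Memℓp _ 2
      rw [← sqSum_iff_memℓp]
      refine (sqSum_repr mFourierBasis (u : L2 (Fin (M + 2) × Fin d))).of_le fun k => ?_
      rw [hRrepr, ← mul_assoc, ← Complex.ofReal_mul, norm_mul, Complex.norm_real]
      have h0 := momSq_nonneg k
      refine mul_le_of_le_one_left (norm_nonneg _) ?_
      rw [Real.norm_of_nonneg (by positivity), ← div_eq_mul_inv, div_le_one (by positivity)]
      linarith
    refine ⟨hv.mem_domain_iff.2 hsob, Subtype.ext ?_⟩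
    obtain ⟨g, -, hg, hgc⟩ := hv.hamiltonian_apply ⟨R u, hv.mem_domain_iff.2 hsob⟩
    rw [hg]
    change g + hv.interactionCLM M (R u) = ((u : L2 (Fin (M + 2) × Fin d))
      - (c : ℂ) • (R u : L2 (Fin (M + 2) × Fin d))) + hv.interactionCLM M (R u)
    congr 1
    refine coef_injective (funext fun κ => ?_)
    rw [hgc]
    have e : coef ((u : L2 (Fin (M + 2) × Fin d)) - (c : ℂ) • (R u : L2 (Fin (M + 2) × Fin d))) κ
        = coef (u : L2 (Fin (M + 2) × Fin d)) κ - c * coef (R u : L2 (Fin (M + 2) × Fin d)) κ := by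
      rw [sub_eq_add_neg, ← neg_smul, coef_add, coef_smul]
      simp only [Pi.add_apply, Pi.smul_apply, smul_eq_mul]; ring
    rw [e]
    have e2 : coef (u : L2 (Fin (M + 2) × Fin d)) κ
        = (momSq (Function.uncurry κ) + c : ℝ) * coef (R u : L2 (Fin (M + 2) × Fin d)) κ := by
      rw [coef, coef, hRrepr, ← mul_assoc, ← Complex.ofReal_mul, mul_inv_cancel₀
        (by exact_mod_cast hmc _), Complex.ofReal_one, one_mul]
    rw [e2]
    push_cast
    ring
  · intro f
    have hs := hv.mem_domain_iff.1 f.2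
    have hs' : SqSum fun k => (momSq k : ℂ) * mFourierBasis.repr (f.1 : L2 (Fin (M + 2) × Fin d)) k :=
      sqSum_iff_memℓp.2 hs
    have hs2 := hs'.add ((sqSum_repr mFourierBasis (f.1 : L2 (Fin (M + 2) × Fin d))).smul (c : ℂ))
    let u0 : L2 (Fin (M + 2) × Fin d) := mFourierBasis.repr.symm hs2.toLp
    have hu0 : ∀ k, mFourierBasis.repr u0 k
        = (momSq k + c : ℝ) * mFourierBasis.repr (f.1 : L2 (Fin (M + 2) × Fin d)) k := by
      intro k
      simp only [u0, LinearIsometryEquiv.apply_symm_apply, SqSum.toLp_apply, Pi.add_apply,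
        Pi.smul_apply, smul_eq_mul]
      push_cast; ring
    have hmem : u0 ∈ bosonSpace d (M + 2) := by
      rw [mem_bosonSpace_iff]
      intro σ κ
      have := mem_bosonSpace_iff.1 f.1.2 σ κ
      rw [coef, coef] at this
      rw [coef, coef, hu0, hu0, momSq_uncurry_comp, this]
    refine ⟨⟨u0, hmem⟩, Subtype.ext (eq_of_repr_eq mFourierBasis fun k => ?_)⟩
    rw [hRrepr, hu0, ← mul_assoc, ← Complex.ofReal_mul, inv_mul_cancel₀ (by exact_mod_cast hmc _),
      Complex.ofReal_one, one_mul]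

end IsPotential

end Hamiltonian

/-! ### Occupation number amplitudes of bosonic states -/

section Amplitudes

open ComplexConjugate UnitAddTorus

variable {d N M : ℕ}

/-- The Fourier coefficients of a bosonic function, as a linear map. -/
def bosonCoef : bosonSpace d N →ₗ[ℂ] ((Fin N → Fin d → ℤ) → ℂ) where
  toFun f := coef f.1
  map_add' f g := coef_add f.1 g.1
  map_smul' c f := coef_smul c f.1

/-- The occupation number amplitudes of a bosonic function. -/
def amp : bosonSpace d N →ₗ[ℂ] (Occupation d → ℂ) :=
  (unfock (Z := Fin d → ℤ) N).comp bosonCoef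

theorem degLE_amp (f : bosonSpace d N) : DegLE N (amp f) := degLE_unfock _

/-- A symmetric function of the momenta depends on them only through their occupation numbers. -/
theorem fock_amp (f : bosonSpace d N) : fock N (amp f) = coef f.1 := by
  refine fock_unfock fun κ κ' h => ?_
  obtain ⟨σ, rfl⟩ := exists_perm_of_occOf_eq h
  exact mem_bosonSpace_iff.1 f.2 σ κ'

theorem sqSum_amp (f : bosonSpace d N) : SqSum (amp f) := by
  have h := sqSum_coef f.1
  rw [← fock_amp, sqSum_fock_iff, (degLE_amp f).cut_eq] at h
  exact h

theorem nsq_amp (f : bosonSpace d N) : nsq (amp f) = ‖f‖ ^ 2 := by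
  have h := nsq_coef f.1
  rw [← fock_amp, nsq_fock, (degLE_amp f).cut_eq] at h
  exact h

theorem sqrt_nsq_amp (f : bosonSpace d N) : √(nsq (amp f)) = ‖f‖ := by
  rw [nsq_amp, Real.sqrt_sq (norm_nonneg _)]

/-- The functions of at most `N` excited particles are exactly the amplitudes, which lets trial
states be built in occupation space. -/
theorem exists_amp_eq {G : Occupation d → ℂ} (hG : SqSum G) (hN : DegLE N G) :
    ∃ f : bosonSpace d N, amp f = G := by
  obtain ⟨F, hF⟩ := exists_coef_eq (hG.fock N)
  have hmem : F ∈ bosonSpace d N := by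
    rw [mem_bosonSpace_iff]
    intro σ κ
    rw [hF, fock_apply, fock_apply, occOf_comp_perm]
  refine ⟨⟨F, hmem⟩, ?_⟩
  have h1 : fock N (amp ⟨F, hmem⟩ - G) = 0 := by
    rw [map_sub, fock_amp, sub_eq_zero]; exact hF
  have hs : SqSum (amp ⟨F, hmem⟩ - G) := (sqSum_amp _).sub hG
  have hd : DegLE N (amp ⟨F, hmem⟩ - G) := fun n hn => by
    rw [Pi.sub_apply, degLE_amp _ n hn, hN n hn, sub_zero]
  have h2 := nsq_fock N (amp ⟨F, hmem⟩ - G)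
  rw [h1, hd.cut_eq, nsq_zero] at h2
  exact sub_eq_zero.1 ((nsq_eq_zero_iff hs).1 h2.symm)

/-- The kinetic energy of an occupation. -/
def kinSum (n : Occupation d) : ℝ := n.sum fun k m => momSq k.1 * m

theorem kinSum_add (m n : Occupation d) : kinSum (m + n) = kinSum m + kinSum n := by
  classical
  exact Finsupp.sum_add_index' (fun _ => by simp) fun _ _ _ => by push_cast; ring

theorem kinSum_nonneg (n : Occupation d) : 0 ≤ kinSum n :=
  Finset.sum_nonneg fun k _ => mul_nonneg (momSq_nonneg _) (Nat.cast_nonneg _)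

theorem kinSum_oneOcc (k : Fin d → ℤ) : kinSum (oneOcc k) = momSq k := by
  by_cases h : k = 0
  · subst h
    rw [oneOcc_zero, kinSum, Finsupp.sum_zero_index]
    simp [momSq]
  · rw [oneOcc, dif_pos h, kinSum, Finsupp.sum_single_index (by simp)]
    simp

theorem momSq_uncurry_eq (κ : Fin N → Fin d → ℤ) : momSq (Function.uncurry κ) = kinSum (occOf κ) := by
  rw [momSq_uncurry, occOf]
  have h : ∀ s : Finset (Fin N), ∑ i ∈ s, momSq (κ i) = kinSum (∑ i ∈ s, oneOcc (κ i)) := by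
    classical
    intro s
    induction s using Finset.induction_on with
    | empty => simp [kinSum]
    | insert a s ha ih => rw [Finset.sum_insert ha, Finset.sum_insert ha, kinSum_add, kinSum_oneOcc, ih]
  exact h _

theorem degree_le_kinSum (n : Occupation d) : (n.degree : ℝ) ≤ kinSum n := by
  rw [Finsupp.degree_apply, Nat.cast_sum]
  exact Finset.sum_le_sum fun k _ => le_mul_of_one_le_left (Nat.cast_nonneg _) (one_le_momSq k.2)

/-- The kinetic energy operator on amplitudes. -/
def kinOp (G : Occupation d → ℂ) (n : Occupation d) : ℂ := (kinSum n : ℂ) * G n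

variable {v : UnitAddTorus (Fin d) → ℝ} {b : ℝ}

namespace IsPotential

theorem fock_kinOp (f : bosonSpace d N) (κ : Fin N → Fin d → ℤ) :
    fock N (kinOp (amp f)) κ = (momSq (Function.uncurry κ) : ℂ) * coef f.1 κ := by
  rw [← fock_amp, fock_apply, fock_apply, kinOp, momSq_uncurry_eq]
  ring

theorem degLE_kinOp {G : Occupation d → ℂ} (hG : DegLE N G) : DegLE N (kinOp G) := fun n hn => by
  rw [kinOp, hG n hn, mul_zero]

theorem mem_domain_iff_sqSum (hv : IsPotential v b) {f : bosonSpace d (M + 2)} :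
    f ∈ (hamiltonian (M + 2) v).domain ↔ SqSum (kinOp (amp f)) := by
  rw [hv.mem_domain_iff, ← (degLE_kinOp (degLE_amp f)).cut_eq, ← sqSum_fock_iff]
  have h : SqSum (fock (M + 2) (kinOp (amp f))) ↔ SqSum fun k : Fin (M + 2) × Fin d → ℤ =>
      (momSq k : ℂ) * mFourierBasis.repr f.1 k := by
    refine Iff.trans ?_ ((Equiv.curry (Fin (M + 2)) (Fin d) ℤ).symm.summable_iff (f := fun k =>
      ‖(momSq k : ℂ) * mFourierBasis.repr f.1 k‖ ^ 2))
    refine summable_congr fun κ => ?_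
    rw [fock_kinOp]
    rfl
  rw [h, sqSum_iff_memℓp]
  rfl

theorem coefTwo_eq (f : bosonSpace d (M + 2)) : coefTwo f.1 = fockTwo M (amp f) := by
  funext x
  rw [coefTwo, fockTwo, fock_amp]

/-- The energy form in terms of amplitudes. -/
theorem inner_hamiltonian (hv : IsPotential v b) (g : bosonSpace d (M + 2))
    (f : (hamiltonian (M + 2) v).domain) :
    ⟪g, hamiltonian (M + 2) v f⟫_ℂ = ip (amp g) (kinOp (amp f.1))
      + ((((M : ℝ) + 2) / 2 : ℝ) : ℂ) * pairForm (vhat v) (fockTwo M (amp g)) (fockTwo M (amp f.1)) := by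
  obtain ⟨T, -, hT, hTc⟩ := hv.hamiltonian_apply f
  have hk := hv.mem_domain_iff_sqSum.1 f.2
  rw [Submodule.coe_inner, hT, inner_add_right, hv.inner_interactionCLM g.2 f.1.2, coefTwo_eq, coefTwo_eq,
    ← ip_coef]
  congr 1
  have e : coef T = fock (M + 2) (kinOp (amp f.1)) := by
    funext κ; rw [hTc, fock_kinOp]
  rw [e, ← fock_amp, ip_fock _ (sqSum_amp g) hk, (degLE_amp g).cut_eq,
    (degLE_kinOp (degLE_amp f.1)).cut_eq]

theorem summable_kinSum {G : Occupation d → ℂ} (hG : SqSum G) (hk : SqSum (kinOp G)) :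
    Summable fun n => kinSum n * ‖G n‖ ^ 2 := by
  refine (hG.summable_norm_mul hk).congr fun n => ?_
  rw [kinOp, norm_mul, Complex.norm_real, Real.norm_of_nonneg (kinSum_nonneg n)]
  ring

theorem re_ip_kinOp {G : Occupation d → ℂ} (hG : SqSum G) (hk : SqSum (kinOp G)) :
    (ip G (kinOp G)).re = ∑' n, kinSum n * ‖G n‖ ^ 2 := by
  rw [ip, ← (Complex.hasSum_re (hG.summable_mul hk).hasSum).tsum_eq]
  refine tsum_congr fun n => ?_
  rw [kinOp, mul_left_comm, Complex.conj_mul', ← Complex.ofReal_pow, ← Complex.ofReal_mul,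
    Complex.ofReal_re]

theorem re_inner_hamiltonian (hv : IsPotential v b) (f : (hamiltonian (M + 2) v).domain) :
    (⟪f.1, hamiltonian (M + 2) v f⟫_ℂ).re = ∑' n, kinSum n * ‖amp f.1 n‖ ^ 2
      + ((M : ℝ) + 2) / 2 * (pairForm (vhat v) (fockTwo M (amp f.1)) (fockTwo M (amp f.1))).re := by
  rw [hv.inner_hamiltonian, Complex.add_re, Complex.re_ofReal_mul,
    re_ip_kinOp (sqSum_amp _) (hv.mem_domain_iff_sqSum.1 f.2)]

/-- Stability of the interaction energy in terms of amplitudes. -/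
theorem le_pairForm (hv : IsPotential v b) {G : Occupation d → ℂ} (hG : SqSum G) (hM : DegLE (M + 2) G) :
    (((M : ℝ) + 2) / 2 * vhat v 0 - ∑' p, vhat v p) * nsq G
      ≤ ((M : ℝ) + 2) / 2 * (pairForm (vhat v) (fockTwo M G) (fockTwo M G)).re := by
  obtain ⟨f, rfl⟩ := exists_amp_eq hG hM
  rw [← coefTwo_eq, ← Complex.re_ofReal_mul, ← hv.inner_interactionCLM f.2 f.2, nsq_amp]
  exact mul_norm_sq_le_re_inner_mulCLM _ _ hv.le_interaction f.1

theorem pairForm_le (hv : IsPotential v b) {G : Occupation d → ℂ} (hG : SqSum G) (hM : DegLE (M + 2) G) :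
    ((M : ℝ) + 2) / 2 * (pairForm (vhat v) (fockTwo M G) (fockTwo M G)).re
      ≤ ((M : ℝ) + 2) / 2 * b * nsq G := by
  obtain ⟨f, rfl⟩ := exists_amp_eq hG hM
  rw [← coefTwo_eq, ← Complex.re_ofReal_mul, ← hv.inner_interactionCLM f.2 f.2, nsq_amp]
  refine (Complex.re_le_norm _).trans ((norm_inner_le_norm _ _).trans ?_)
  have h := (ContinuousLinearMap.le_opNorm (hv.interactionCLM M) f.1).trans
    (mul_le_mul_of_nonneg_right (norm_mulCLM_le (hv.measurable_interaction (M + 2))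
      hv.abs_interaction_le) (norm_nonneg _))
  have h2 := mul_le_mul_of_nonneg_left h (norm_nonneg f.1)
  refine h2.trans (le_of_eq ?_)
  rw [Submodule.coe_norm]
  ring

end IsPotential

end Amplitudes

/-! ### The excitation number of low energy states -/

section Moment

open ComplexConjugate

variable {d M : ℕ} {v : UnitAddTorus (Fin d) → ℝ} {b : ℝ}

theorem DegLE.numOp {P : Type*} {L : ℕ} {f : (P →₀ ℕ) → ℂ} (hL : DegLE L f) : DegLE L (numOp f) :=
  fun n hn => by rw [BoseGas.numOp, hL n hn, mul_zero]

theorem DegLE.sqrtNumOp {P : Type*} {L : ℕ} {f : (P →₀ ℕ) → ℂ} (hL : DegLE L f) :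
    DegLE L (sqrtNumOp f) :=
  fun n hn => by rw [BoseGas.sqrtNumOp, hL n hn, mul_zero]

theorem ip_numOp_self {P : Type*} (G : (P →₀ ℕ) → ℂ) : (ip (numOp G) G).re = nsq (sqrtNumOp G) := by
  have h : ip (numOp G) G = ip (sqrtNumOp G) (sqrtNumOp G) := by
    refine tsum_congr fun n => ?_
    rw [numOp, sqrtNumOp, map_mul, map_mul, Complex.conj_natCast, Complex.conj_ofReal]
    have h2 : ((√(n.degree : ℝ) : ℝ) : ℂ) * ((√(n.degree : ℝ) : ℝ) : ℂ) = (n.degree : ℂ) := by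
      rw [← Complex.ofReal_mul, Real.mul_self_sqrt (by positivity), Complex.ofReal_natCast]
    rw [← h2]; ring
  rw [h, ip_self, Complex.ofReal_re]

/-- Both operators are diagonal and the particle number is at most the kinetic energy. -/
theorem nsq_numOp_le_re_ip_kinOp {G : Occupation d → ℂ} (hG : SqSum (numOp G)) (hk : SqSum (kinOp G)) :
    nsq (numOp G) ≤ (ip (numOp G) (kinOp G)).re := by
  have hs := Complex.hasSum_re (hG.summable_mul hk).hasSum
  rw [ip, ← hs.tsum_eq]
  refine Summable.tsum_le_tsum (fun n => ?_) hG hs.summable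
  have e : conj (numOp G n) * kinOp G n = ((n.degree * kinSum n * ‖G n‖ ^ 2 : ℝ) : ℂ) := by
    rw [numOp, kinOp, map_mul, Complex.conj_natCast]
    push_cast
    rw [← Complex.conj_mul']
    ring
  rw [e, Complex.ofReal_re, numOp, norm_mul, Complex.norm_natCast, mul_pow]
  gcongr
  rw [sq]
  gcongr
  exact degree_le_kinSum n

namespace IsPotential

/-- Pair `(H - e) f` with N₊ f, where `e` is the stability bound. The kinetic part gives at least
`‖N₊ f‖²`. The interaction is replaced by its expectation in √N₊ f, which is at least `e` times the
expectation of N₊. The error of this replacement involves the weight of two excited particles, which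
is of order `‖N₊ f‖ / N`; this compensates the factor `N / 2` of the interaction and leaves `2 B ‖f‖
‖N₊ f‖`. Dividing by `‖N₊ f‖` gives the claim. -/
theorem sqrt_nsq_numOp_le (hv : IsPotential v b) (f : (hamiltonian (M + 2) v).domain) :
    √(nsq (numOp (amp f.1)))
      ≤ ‖hamiltonian (M + 2) v f - ((((M : ℝ) + 2) / 2 * vhat v 0 - ∑' p, vhat v p : ℝ) : ℂ) • f.1‖
        + 2 * (∑' p, vhat v p) * ‖f.1‖ := by
  set G := amp f.1 with hGdef
  set B := ∑' p, vhat v p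
  set e := ((M : ℝ) + 2) / 2 * vhat v 0 - B with he
  have hB : 0 ≤ B := tsum_nonneg hv.vhat_nonneg
  have hG : SqSum G := sqSum_amp _
  have hM : DegLE (M + 2) G := degLE_amp _
  have hk : SqSum (kinOp G) := hv.mem_domain_iff_sqSum.1 f.2
  -- The state N₊ f exists in the bosonic space because at most `M + 2` particles are excited.
  obtain ⟨g, hg⟩ := exists_amp_eq (hG.numOp hM) hM.numOp
  have hgn : ‖g‖ = √(nsq (numOp G)) := by rw [← sqrt_nsq_amp, hg]
  have h1 := congrArg Complex.re (hv.inner_hamiltonian g f)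
  rw [Complex.add_re, Complex.re_ofReal_mul, hg, ← hGdef] at h1
  have h2 : (⟪g, f.1⟫_ℂ).re = nsq (sqrtNumOp G) := by
    rw [Submodule.coe_inner, ← ip_coef, ← fock_amp, ← fock_amp, ip_fock _ (sqSum_amp g) hG,
      (degLE_amp g).cut_eq, hM.cut_eq, hg, ip_numOp_self]
  have h3 := nsq_numOp_le_re_ip_kinOp (hG.numOp hM) hk
  have h4 := hv.le_pairForm (hG.sqrtNumOp hM) hM.sqrtNumOp
  have h5 := (abs_le.1 (abs_pairForm_numOp_sub_le hv.vhat_nonneg hv.summable_vhat hv.vhat_neg hG hM)).1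
  have h6 := nsq_bothPart_le hG hM
  have h7 : (⟪g, hamiltonian (M + 2) v f - (e : ℂ) • f.1⟫_ℂ).re
      = (⟪g, hamiltonian (M + 2) v f⟫_ℂ).re - e * nsq (sqrtNumOp G) := by
    have hs : ⟪g, (e : ℂ) • f.1⟫_ℂ = (e : ℂ) * ⟪g, f.1⟫_ℂ :=
      inner_smul_right (𝕜 := ℂ) (E := bosonSpace d (M + 2)) g f.1 (e : ℂ)
    rw [inner_sub_right, hs, Complex.sub_re, Complex.re_ofReal_mul, h2]
  have h8 := (Complex.re_le_norm _).trans
    (norm_inner_le_norm (𝕜 := ℂ) g (hamiltonian (M + 2) v f - (e : ℂ) • f.1))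
  rw [hgn] at h8
  set Y := √(nsq (numOp G)) with hY
  set D := ‖hamiltonian (M + 2) v f - (e : ℂ) • f.1‖
  have hXn : √(nsq G) = ‖f.1‖ := sqrt_nsq_amp _
  have hY2 : Y ^ 2 = nsq (numOp G) := Real.sq_sqrt (nsq_nonneg _)
  have hY0 : 0 ≤ Y := Real.sqrt_nonneg _
  set c := √(nsq (bothPart (fockTwo M G))) with hc
  have hcY : ((M : ℝ) + 2) * c ≤ 2 * Y := by
    refine abs_le_of_sq_le_sq' ?_ (by positivity) |>.2
    rw [mul_pow, hc, Real.sq_sqrt (nsq_nonneg _), mul_pow, hY2]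
    calc ((M : ℝ) + 2) ^ 2 * nsq (bothPart (fockTwo M G))
        ≤ ((M : ℝ) + 2) ^ 2 * ((((M : ℝ) + 2) * ((M : ℝ) + 1))⁻¹ * nsq (numOp G)) := by gcongr
      _ = ((M : ℝ) + 2) / ((M : ℝ) + 1) * nsq (numOp G) := by field_simp
      _ ≤ 2 ^ 2 * nsq (numOp G) := by
        have := nsq_nonneg (numOp G)
        gcongr
        rw [div_le_iff₀ (by positivity)]
        have : (0 : ℝ) ≤ M := by positivity
        linarith
  rw [hXn] at h5
  change -(2 * B * (c * ‖f.1‖)) ≤ _ at h5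
  change e * _ ≤ _ at h4
  have hX0 := norm_nonneg f.1
  have h9 : Y ^ 2 ≤ Y * (D + 2 * B * ‖f.1‖) := by
    have a1 : ((M : ℝ) + 2) / 2 * (2 * B * (c * ‖f.1‖)) ≤ B * (2 * Y) * ‖f.1‖ := by
      calc ((M : ℝ) + 2) / 2 * (2 * B * (c * ‖f.1‖)) = B * (((M : ℝ) + 2) * c) * ‖f.1‖ := by ring
        _ ≤ _ := by gcongr
    have a2 := mul_le_mul_of_nonneg_left h5 (show (0 : ℝ) ≤ ((M : ℝ) + 2) / 2 by positivity)
    rw [hY2]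
    nlinarith only [a1, a2, h1, h3, h4, h7, h8]
  rcases hY0.eq_or_lt with h | h
  · rw [← h]; positivity
  · rw [sq] at h9
    exact le_of_mul_le_mul_left h9 h

end IsPotential

end Moment

/-! ### Truncation of the particle number -/

section Cut

open ComplexConjugate

variable {P : Type*} {G : (P →₀ ℕ) → ℂ}

theorem sqSum_numOp_of_mem_rapid (hG : G ∈ rapid P) : SqSum (numOp G) := by
  refine Summable.of_nonneg_of_le (fun _ => by positivity) (fun n => ?_) (hG 2)
  rw [numOp, norm_mul, Complex.norm_natCast, mul_pow]
  gcongr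
  linarith

theorem nsq_cut_le (hG : SqSum G) (N : ℕ) : nsq (cut N G) ≤ nsq G := nsq_mono hG (norm_cut_le N G)

theorem norm_numOp_cut_le (N : ℕ) (G : (P →₀ ℕ) → ℂ) (n : P →₀ ℕ) :
    ‖numOp (cut N G) n‖ ≤ ‖numOp G n‖ := by
  rw [numOp, numOp, norm_mul, norm_mul]
  gcongr
  exact norm_cut_le N G n

theorem nsq_numOp_cut_le (hG : SqSum (numOp G)) (N : ℕ) : nsq (numOp (cut N G)) ≤ nsq (numOp G) :=
  nsq_mono hG (norm_numOp_cut_le N G)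

/-- Chebyshev's inequality for the particle number. -/
theorem nsq_le_nsq_cut_add (hG : SqSum G) (hn : SqSum (numOp G)) {N : ℕ} (hN : 0 < N) :
    nsq G ≤ nsq (cut N G) + nsq (numOp G) / (N : ℝ) ^ 2 := by
  have h1 : HasSum (fun n => ‖cut N G n‖ ^ 2 + ‖numOp G n‖ ^ 2 / (N : ℝ) ^ 2)
      (nsq (cut N G) + nsq (numOp G) / (N : ℝ) ^ 2) :=
    (hG.cut N).hasSum.add (hn.hasSum.div_const _)
  rw [← h1.tsum_eq]
  refine hG.tsum_le_tsum (fun n => ?_) h1.summable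
  have hN' : (0 : ℝ) < N := by exact_mod_cast hN
  rcases lt_or_ge N n.degree with h | h
  · have h' : (N : ℝ) ≤ n.degree := by exact_mod_cast h.le
    rw [cut_apply_of_lt G h, numOp, norm_mul, Complex.norm_natCast, mul_pow, norm_zero, ← div_mul_eq_mul_div,
      ← div_pow]
    have h2 : 1 ≤ (n.degree : ℝ) / N := (one_le_div hN').2 h'
    have h3 : 1 ≤ ((n.degree : ℝ) / N) ^ 2 := one_le_pow₀ h2
    nlinarith [sq_nonneg ‖G n‖]
  · rw [cut_apply_of_le G h]
    have : 0 ≤ ‖numOp G n‖ ^ 2 / (N : ℝ) ^ 2 := by positivity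
    linarith

theorem nsq_ann_cut_le (hG : G ∈ rapid P) (N : ℕ) (p : P) : nsq (ann p (cut N G)) ≤ nsq (ann p G) := by
  refine nsq_mono (rapid_sqSum (ann_mem_rapid hG p)) fun n => ?_
  rw [ann_apply, ann_apply, norm_mul, norm_mul]
  gcongr
  exact norm_cut_le N G _

/-- Truncation alters the summand at `n` only when `n` with two more particles exceeds `M + 2`. Then
`n.degree ≥ M + 1`, and one factor of the degree over `M + 1` is available. -/
theorem abs_pairing_cut_sub_le [Neg P] (hG : G ∈ rapid P) (M : ℕ) (p : P) :
    |pairing p (cut (M + 2) G) - pairing p G| ≤ nsq (numOp G) / ((M : ℝ) + 1) := by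
  have hn := sqSum_numOp_of_mem_rapid hG
  have hGs := rapid_sqSum hG
  have hA : SqSum (ann (-p) (ann p G)) := rapid_sqSum (ann_mem_rapid (ann_mem_rapid hG p) (-p))
  have hle : ∀ n, ‖ann (-p) (ann p (cut (M + 2) G)) n‖ ≤ ‖ann (-p) (ann p G) n‖ := fun n => by
    simp only [ann_apply, norm_mul]
    gcongr
    exact norm_cut_le _ G _
  have hA' : SqSum (ann (-p) (ann p (cut (M + 2) G))) := hA.of_le hle
  have hM : (0 : ℝ) < (M : ℝ) + 1 := by positivity
  have hD : ∀ n, ‖conj (ann (-p) (ann p (cut (M + 2) G)) n) * cut (M + 2) G n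
      - conj (ann (-p) (ann p G) n) * G n‖
      ≤ ‖ann (-p) (ann p G) n‖ * ‖numOp G n‖ / ((M : ℝ) + 1) := by
    intro n
    have hd : (n + Finsupp.single (-p) 1 + Finsupp.single p 1).degree = n.degree + 2 := by
      rw [degree_add_single, degree_add_single]
    rcases lt_or_ge (M + 2) (n.degree + 2) with h | h
    · have h0 : ann (-p) (ann p (cut (M + 2) G)) n = 0 := by
        rw [ann_apply, ann_apply, cut_apply_of_lt G (by rw [hd]; exact h)]
        simp
      rw [h0, map_zero, zero_mul, zero_sub, norm_neg, norm_mul, RCLike.norm_conj, mul_div_assoc]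
      gcongr
      rw [numOp, norm_mul, Complex.norm_natCast, le_div_iff₀ hM, mul_comm]
      gcongr
      have : M + 1 ≤ n.degree := by omega
      exact_mod_cast this
    · have h0 : ann (-p) (ann p (cut (M + 2) G)) n = ann (-p) (ann p G) n := by
        rw [ann_apply, ann_apply, ann_apply, ann_apply, cut_apply_of_le G (by rw [hd]; exact h)]
      rw [h0, cut_apply_of_le G (by omega), sub_self, norm_zero]
      positivity
  have hs := ((hA.summable_norm_mul hn).div_const ((M : ℝ) + 1))
  have hs1 := hA'.summable_mul (hGs.cut (M + 2))
  have hs2 := hA.summable_mul hGs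
  rw [pairing, pairing, ← Complex.sub_re, ip, ip, ← hs1.tsum_sub hs2]
  refine (Complex.abs_re_le_norm _).trans ((tsum_of_norm_bounded hs.hasSum hD).trans ?_)
  rw [tsum_div_const]
  gcongr
  refine (tsum_norm_mul_le hA hn).trans ?_
  calc √(nsq (ann (-p) (ann p G))) * √(nsq (numOp G)) ≤ √(nsq (numOp G)) * √(nsq (numOp G)) := by
        gcongr
        exact nsq_ann_ann_le hn p (-p)
    _ = nsq (numOp G) := Real.mul_self_sqrt (nsq_nonneg _)

end Cut

/-! ### The energy of truncated trial states -/

namespace Quadratic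

variable {P : Type*} [InvolutiveNeg P] (Q : Quadratic P)

open Bogoliubov

theorem shift_nonneg : 0 ≤ Q.shift :=
  mul_nonneg (by norm_num) (Finset.sum_nonneg fun p _ => by linarith [Q.en_le p])

theorem shift_le {B : ℝ} (hB : ∑ p ∈ Q.modes, Q.u p ≤ B) : Q.shift ≤ B / 2 := by
  have : ∑ p ∈ Q.modes, (Q.ε p + Q.u p - Q.en p) ≤ ∑ p ∈ Q.modes, Q.u p :=
    Finset.sum_le_sum fun p _ => by linarith [Q.ε_le_en p]
  rw [shift]
  linarith

theorem potential_cut_le {G : (P →₀ ℕ) → ℂ} (hG : G ∈ rapid P) (M : ℕ) {B : ℝ}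
    (hB : ∑ p ∈ Q.modes, Q.u p ≤ B) :
    Q.potential (cut (M + 2) G) ≤ Q.potential G + B * (nsq (numOp G) / ((M : ℝ) + 1)) := by
  have h : Q.potential (cut (M + 2) G)
      ≤ ∑ p ∈ Q.modes, (Q.u p * (nsq (ann p G) + pairing p G) + Q.u p * (nsq (numOp G) / ((M : ℝ) + 1))) := by
    refine Finset.sum_le_sum fun p _ => ?_
    rw [← mul_add]
    have h1 := nsq_ann_cut_le hG (M + 2) p
    have h2 := (abs_le.1 (abs_pairing_cut_sub_le hG M p)).2
    exact mul_le_mul_of_nonneg_left (by linarith) (Q.u_nonneg p)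
  rw [Finset.sum_add_distrib, ← Finset.sum_mul] at h
  have h3 : 0 ≤ nsq (numOp G) / ((M : ℝ) + 1) := div_nonneg (nsq_nonneg _) (by positivity)
  have h4 := mul_le_mul_of_nonneg_right hB h3
  rw [potential, potential] at *
  linarith

theorem summable_kin_trial {ι : Type*} [Fintype ι] (ν : ι → P →₀ ℕ) (c : ι → ℂ) :
    Summable fun n => Q.kin n * ‖Q.bog.trial ν c n‖ ^ 2 := by
  classical
  let S := Q.enlarge (Finset.univ.biUnion fun j => (ν j).support)
  have hsupp : ∀ j, (ν j).support ⊆ S := fun j =>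
    (Finset.subset_biUnion_of_mem (fun j => (ν j).support) (Finset.mem_univ j)).trans
      (Q.subset_enlarge _)
  exact (Q.hasSum_kinetic (Q.bog.trial_mem_rapid c)
    (Q.bog.suppIn_trial c (Q.modes_subset_enlarge _) (Q.neg_mem_enlarge _) hsupp)).summable

/-- The energy of particle number truncated combinations of quasi-particle states. -/
theorem cut_trial_le {ι : Type*} [Fintype ι] {ν : ι → P →₀ ℕ} (hν : Function.Injective ν) (c : ι → ℂ)
    {μ B y : ℝ} (hμ0 : 0 ≤ μ) (hμ : ∀ j, Q.tot (ν j) ≤ μ) (hL : ∀ j, ((ν j).degree : ℝ) ≤ μ)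
    (hB : ∑ p ∈ Q.modes, Q.u p ≤ B) (hy : y = (1 + 5 * B) * (μ + 1)) {M : ℕ}
    (hM : 2 * y ≤ (M : ℝ) + 2) :
    nsq (Q.bog.trial ν c) ≤ 2 * nsq (cut (M + 2) (Q.bog.trial ν c)) ∧
    √(nsq (numOp (cut (M + 2) (Q.bog.trial ν c)))) ≤ 2 * y * √(nsq (cut (M + 2) (Q.bog.trial ν c))) ∧
    ∑' n, Q.kin n * ‖cut (M + 2) (Q.bog.trial ν c) n‖ ^ 2 + Q.potential (cut (M + 2) (Q.bog.trial ν c))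
      + Q.shift * nsq (cut (M + 2) (Q.bog.trial ν c))
      ≤ (μ + (2 + 2 * B) * (y ^ 2 / ((M : ℝ) + 1))) * nsq (cut (M + 2) (Q.bog.trial ν c)) := by
  have hkin := Q.summable_kin_trial ν c
  have hrap : Q.bog.trial ν c ∈ rapid P := Q.bog.trial_mem_rapid c
  have htr := Q.trial_le hν c hμ
  have hnum := Q.trial_numOp_le hν c (L := ⌊μ⌋₊) (fun j => Nat.le_floor (hL j)) hB
  set G := Q.bog.trial ν c
  have hB0 : 0 ≤ B := (Finset.sum_nonneg fun p _ => Q.u_nonneg p).trans hB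
  have hs := rapid_sqSum hrap
  have hn := sqSum_numOp_of_mem_rapid hrap
  have hy1 : 1 ≤ y := by rw [hy]; nlinarith
  have hY : √(nsq (numOp G)) ≤ y * √(nsq G) := by
    refine hnum.trans ?_
    rw [hy]
    have := Nat.floor_le hμ0
    gcongr
  have hY2 : nsq (numOp G) ≤ y ^ 2 * nsq G := by
    have h := pow_le_pow_left₀ (Real.sqrt_nonneg _) hY 2
    rwa [mul_pow, Real.sq_sqrt (nsq_nonneg _), Real.sq_sqrt (nsq_nonneg _)] at h
  have hX0 := nsq_nonneg G
  have hN : (0 : ℝ) < (M : ℝ) + 2 := by positivity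
  have hcut := nsq_le_nsq_cut_add hs hn (N := M + 2) (by omega)
  push_cast at hcut
  -- The requirement `2 y ≤ N` leaves at least half of the squared norm after truncation, so errors
  -- may be measured relative to the truncated state.
  have hfrac : nsq (numOp G) / ((M : ℝ) + 2) ^ 2 ≤ 1 / 2 * nsq G := by
    rw [div_le_iff₀ (by positivity)]
    have h4 : (2 * y) ^ 2 ≤ ((M : ℝ) + 2) ^ 2 := pow_le_pow_left₀ (by linarith) hM 2
    nlinarith
  have h1 : nsq G ≤ 2 * nsq (cut (M + 2) G) := by linarith
  have hX' := nsq_nonneg (cut (M + 2) G)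
  refine ⟨h1, ?_, ?_⟩
  · refine (Real.sqrt_le_sqrt (nsq_numOp_cut_le hn _)).trans (hY.trans ?_)
    have h2 : √(nsq G) ≤ 2 * √(nsq (cut (M + 2) G)) := by
      rw [show (2 : ℝ) = √4 by rw [show (4 : ℝ) = 2 ^ 2 by norm_num]; simp, ← Real.sqrt_mul (by norm_num)]
      exact Real.sqrt_le_sqrt (by linarith)
    nlinarith
  · have hk : ∑' n, Q.kin n * ‖cut (M + 2) G n‖ ^ 2 ≤ ∑' n, Q.kin n * ‖G n‖ ^ 2 := by
      have hle : ∀ n, Q.kin n * ‖cut (M + 2) G n‖ ^ 2 ≤ Q.kin n * ‖G n‖ ^ 2 := fun n => by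
        have := Q.kin_nonneg n
        gcongr
        exact norm_cut_le _ G n
      exact (Summable.of_nonneg_of_le (fun n => mul_nonneg (Q.kin_nonneg n) (by positivity)) hle
        hkin).tsum_le_tsum hle hkin
    have hp := Q.potential_cut_le hrap M hB
    have hsh0 := Q.shift_nonneg
    have hsh := Q.shift_le hB
    have hXX : nsq (cut (M + 2) G) ≤ nsq G := nsq_cut_le hs _
    have hM1 : (0 : ℝ) < (M : ℝ) + 1 := by positivity
    have hZ : nsq (numOp G) / ((M : ℝ) + 1) ≤ 2 * (y ^ 2 / ((M : ℝ) + 1)) * nsq (cut (M + 2) G) := by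
      rw [div_le_iff₀ hM1]
      have : 2 * (y ^ 2 / ((M : ℝ) + 1)) * nsq (cut (M + 2) G) * ((M : ℝ) + 1)
          = y ^ 2 * (2 * nsq (cut (M + 2) G)) := by field_simp
      rw [this]
      exact hY2.trans (by gcongr)
    have hmy : μ ≤ y := by rw [hy]; nlinarith
    -- The energy `μ` must be charged to the truncated norm. The lost mass is of order `y² / N²`,
    -- and `μ ≤ y ≤ N` leaves an error of order `y² / N`.
    have hd : (μ - Q.shift) * (nsq G - nsq (cut (M + 2) G))
        ≤ nsq (numOp G) / ((M : ℝ) + 1) := by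
      have a1 : nsq G - nsq (cut (M + 2) G) ≤ nsq (numOp G) / ((M : ℝ) + 2) ^ 2 := by linarith
      have a2 : 0 ≤ nsq (numOp G) / ((M : ℝ) + 2) ^ 2 := div_nonneg (nsq_nonneg _) (by positivity)
      calc (μ - Q.shift) * (nsq G - nsq (cut (M + 2) G))
          ≤ y * (nsq (numOp G) / ((M : ℝ) + 2) ^ 2) := by
            refine mul_le_mul (by linarith) a1 (by linarith) (by linarith)
        _ ≤ ((M : ℝ) + 2) * (nsq (numOp G) / ((M : ℝ) + 2) ^ 2) := by gcongr; linarith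
        _ = nsq (numOp G) / ((M : ℝ) + 2) := by field_simp
        _ ≤ nsq (numOp G) / ((M : ℝ) + 1) := by
            have := nsq_nonneg (numOp G)
            gcongr
            norm_num
    have hBZ := mul_le_mul_of_nonneg_left hZ hB0
    nlinarith only [hk, hp, htr, hd, hZ, hBZ]

end Quadratic

/-! ### The Bogoliubov Hamiltonian of a potential -/

section BogoliubovHamiltonian

variable {d M : ℕ} {v : UnitAddTorus (Fin d) → ℝ} {b : ℝ}

theorem momSq_neg {ι : Type*} [Fintype ι] (k : ι → ℤ) : momSq (-k) = momSq k := by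
  simp [momSq]

theorem neg_mode_ne (p : {k : Fin d → ℤ // k ≠ 0}) : -p ≠ p := by
  intro h
  apply p.2
  have h1 : -(p : Fin d → ℤ) = p := congrArg Subtype.val h
  funext i
  have h2 := congrFun h1 i
  simp only [Pi.neg_apply] at h2
  rw [Pi.zero_apply]
  omega

theorem excitationSum_nonneg (n : Occupation d) : 0 ≤ excitationSum v n :=
  Finset.sum_nonneg fun k _ => mul_nonneg (Real.sqrt_nonneg _) (Nat.cast_nonneg _)

namespace IsPotential

open Classical in
/-- The quadratic Hamiltonian with interaction restricted to the modes in `K`. -/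
def quad (hv : IsPotential v b) (K : Finset {k : Fin d → ℤ // k ≠ 0}) (hK : ∀ p ∈ K, -p ∈ K) :
    Quadratic {k : Fin d → ℤ // k ≠ 0} where
  ε p := momSq p.1
  u p := if p ∈ K then vhat v p.1 else 0
  modes := K
  neg_ne := neg_mode_ne
  one_le p := one_le_momSq p.2
  u_nonneg p := by split_ifs; exacts [hv.vhat_nonneg _, le_rfl]
  ε_neg p := momSq_neg _
  u_neg p := by
    have : -p ∈ K ↔ p ∈ K := ⟨fun h => by simpa using hK _ h, hK p⟩
    simp only [this, coe_neg_mode, hv.vhat_neg]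
  u_eq_zero p hp := if_neg hp
  neg_mem := hK

variable (hv : IsPotential v b) {K : Finset {k : Fin d → ℤ // k ≠ 0}} (hK : ∀ p ∈ K, -p ∈ K)

theorem elemEnergy_le (k : Fin d → ℤ) (hv : IsPotential v b) : elemEnergy v k ≤ momSq k + vhat v k := by
  have h1 := momSq_nonneg k
  have h2 := hv.vhat_nonneg k
  rw [elemEnergy, Real.sqrt_le_left (by linarith)]
  nlinarith [sq_nonneg (vhat v k)]

theorem momSq_le_elemEnergy (k : Fin d → ℤ) (hv : IsPotential v b) : momSq k ≤ elemEnergy v k := by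
  refine Real.le_sqrt_of_sq_le ?_
  have := mul_nonneg (momSq_nonneg k) (hv.vhat_nonneg k)
  linarith

theorem bogTerm_nonneg (hv : IsPotential v b) (k : {k : Fin d → ℤ // k ≠ 0}) : 0 ≤ bogTerm v k := by
  have := hv.elemEnergy_le k.1
  rw [bogTerm]; linarith

/-- Since `e_p ≥ |p|²`. Together with nonnegativity this reduces the convergence of the Bogoliubov
energy to that of `∑ v̂(p)`. -/
theorem bogTerm_le (hv : IsPotential v b) (k : {k : Fin d → ℤ // k ≠ 0}) : bogTerm v k ≤ vhat v k.1 := by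
  have := hv.momSq_le_elemEnergy k.1
  rw [bogTerm]; linarith

theorem summable_vhat_mode (hv : IsPotential v b) :
    Summable fun k : {k : Fin d → ℤ // k ≠ 0} => vhat v k.1 :=
  hv.summable_vhat.comp_injective Subtype.val_injective

theorem summable_bogTerm (hv : IsPotential v b) : Summable (bogTerm v) :=
  Summable.of_nonneg_of_le hv.bogTerm_nonneg hv.bogTerm_le hv.summable_vhat_mode

theorem tsum_vhat_eq (hv : IsPotential v b) :
    ∑' p, vhat v p = vhat v 0 + ∑' p : {k : Fin d → ℤ // k ≠ 0}, vhat v p.1 := by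
  classical
  have h := hv.summable_vhat.sum_add_tsum_compl (s := {0})
  rw [← h, Finset.sum_singleton]
  congr 1
  exact (Equiv.subtypeEquivRight fun k => by simp).tsum_eq
    (fun p : {k : Fin d → ℤ // k ≠ 0} => vhat v p.1)

theorem quad_en_of_mem (p : {k : Fin d → ℤ // k ≠ 0}) (hp : p ∈ K) :
    (hv.quad K hK).en p = elemEnergy v p.1 := by
  simp [Quadratic.en, quad, hp, elemEnergy]

theorem quad_en_le (p : {k : Fin d → ℤ // k ≠ 0}) : (hv.quad K hK).en p ≤ elemEnergy v p.1 := by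
  by_cases hp : p ∈ K
  · exact (hv.quad_en_of_mem hK p hp).le
  · rw [Quadratic.en_eq _ hp]
    exact hv.momSq_le_elemEnergy _

theorem quad_tot_le (n : Occupation d) : (hv.quad K hK).tot n ≤ excitationSum v n :=
  Finset.sum_le_sum fun p _ => mul_le_mul_of_nonneg_right (hv.quad_en_le hK p) (Nat.cast_nonneg _)

/-- Outside the cutoff the quasi-particle energy is `|p|²` instead of `e_p ≤ |p|² + τ`, and `|p|² ≥
1` makes the loss multiplicative. -/
theorem excitationSum_le_mul_tot {τ : ℝ} (hτ0 : 0 ≤ τ) (hτ : ∀ p ∉ K, vhat v p.1 ≤ τ)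
    (n : Occupation d) : excitationSum v n ≤ (1 + τ) * (hv.quad K hK).tot n := by
  rw [Quadratic.tot, excitationSum, Finsupp.sum, Finsupp.sum, Finset.mul_sum]
  refine Finset.sum_le_sum fun p _ => ?_
  rw [← mul_assoc]
  refine mul_le_mul_of_nonneg_right ?_ (Nat.cast_nonneg _)
  have h1 := (hv.quad K hK).en_pos p
  by_cases hp : p ∈ K
  · rw [hv.quad_en_of_mem hK p hp] at h1 ⊢
    nlinarith
  · rw [Quadratic.en_eq _ hp]
    have h2 : elemEnergy v p.1 ≤ _ := hv.elemEnergy_le p.1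
    have h3 := hτ p hp
    have h4 := one_le_momSq p.2
    change elemEnergy v p.1 ≤ (1 + τ) * momSq p.1
    nlinarith

theorem quad_potential (G : Occupation d → ℂ) : (hv.quad K hK).potential G
    = ∑ p ∈ K, vhat v p.1 * (nsq (ann p G) + pairing p G) :=
  Finset.sum_congr rfl fun p hp => by
    change (if p ∈ K then _ else _) * _ = _
    rw [if_pos hp]

theorem quad_shift : (hv.quad K hK).shift = 1 / 2 * ∑ p ∈ K, bogTerm v p := by
  rw [Quadratic.shift]
  congr 1
  refine Finset.sum_congr rfl fun p hp => ?_
  have hp' : p ∈ K := hp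
  rw [hv.quad_en_of_mem hK p hp', bogTerm]
  simp [quad, hp']

theorem sum_quad_u : ∑ p ∈ (hv.quad K hK).modes, (hv.quad K hK).u p = ∑ p ∈ K, vhat v p.1 :=
  Finset.sum_congr rfl fun p hp => if_pos hp

/-- Finite symmetric sets of modes exhaust the interaction. -/
theorem exists_modes (hv : IsPotential v b) {τ : ℝ} (hτ : 0 < τ) :
    ∃ K : Finset {k : Fin d → ℤ // k ≠ 0}, (∀ p ∈ K, -p ∈ K) ∧
      ∑' p, vhat v p - vhat v 0 - ∑ p ∈ K, vhat v p.1 ≤ τ ∧ (∀ p ∉ K, vhat v p.1 ≤ τ) ∧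
      ∑ p ∈ K, vhat v p.1 ≤ ∑' p, vhat v p ∧
      -bogEnergy v - τ / 2 ≤ 1 / 2 * ∑ p ∈ K, bogTerm v p ∧
      1 / 2 * ∑ p ∈ K, bogTerm v p ≤ -bogEnergy v := by
  classical
  have hs := hv.summable_vhat_mode
  have h0 : ∀ p : {k : Fin d → ℤ // k ≠ 0}, 0 ≤ vhat v p.1 := fun p => hv.vhat_nonneg _
  -- A finite set carrying all but `τ` of the total weight, then made symmetric. The tail bounds
  -- single coefficients outside it and, since `0 ≤ bogTerm ≤ v̂`, the missing vacuum energy too.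
  obtain ⟨s, hs'⟩ := (hs.hasSum.eventually_const_lt
    (sub_lt_self (∑' p : {k : Fin d → ℤ // k ≠ 0}, vhat v p.1) hτ)).exists
  let K := s ∪ s.image fun p => -p
  have hsK : s ⊆ K := Finset.subset_union_left
  have hK : ∀ p ∈ K, -p ∈ K := by
    intro p hp
    simp only [K, Finset.mem_union, Finset.mem_image] at hp ⊢
    rcases hp with h | ⟨q, h, rfl⟩
    · exact Or.inr ⟨p, h, rfl⟩
    · left; simpa using h
  have hle : ∑ p ∈ s, vhat v p.1 ≤ ∑ p ∈ K, vhat v p.1 :=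
    Finset.sum_le_sum_of_subset_of_nonneg hsK fun p _ _ => h0 p
  have htail : ∑' p : {k : Fin d → ℤ // k ≠ 0}, vhat v p.1 - ∑ p ∈ K, vhat v p.1 ≤ τ := by linarith
  have hb : bogEnergy v = -(1 / 2) * ∑' p, bogTerm v p := rfl
  refine ⟨K, hK, ?_, ?_, ?_, ?_, ?_⟩
  · rw [hv.tsum_vhat_eq]; linarith
  · intro p hp
    have h1 := hs.sum_le_tsum (insert p K) fun q _ => h0 q
    rw [Finset.sum_insert hp] at h1
    linarith
  · rw [hv.tsum_vhat_eq]
    have := hs.sum_le_tsum K fun q _ => h0 q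
    have := hv.vhat_nonneg 0
    linarith
  · have h1 := (hs.sub hv.summable_bogTerm).sum_le_tsum K fun q _ => sub_nonneg.2 (hv.bogTerm_le q)
    rw [hs.tsum_sub hv.summable_bogTerm, Finset.sum_sub_distrib] at h1
    rw [hb]
    linarith
  · have := hv.summable_bogTerm.sum_le_tsum K fun q _ => hv.bogTerm_nonneg q
    rw [hb]
    linarith

end IsPotential

theorem pairError_mono {x y y' : ℝ} (hx : 0 ≤ x) (hy : 0 ≤ y) (h : y ≤ y') (M : ℕ) :
    pairError M x y ≤ pairError M x y' := by
  rw [pairError, pairError]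
  gcongr

/-- The error is homogeneous of degree two, so it is proportional to the squared norm once the
excitation number is bounded relative to the norm. -/
theorem pairError_mul {x y : ℝ} (hx : 0 ≤ x) (M : ℕ) :
    pairError M x (y * x) = pairError M 1 y * x ^ 2 := by
  rw [pairError, pairError, show 2 * (x * (y * x)) = x ^ 2 * (2 * (1 * y)) by ring,
    Real.sqrt_mul (by positivity), Real.sqrt_sq hx]
  ring

/-- As long as `y` is at most of order `N`, the term `y² / N` is dominated by `y^{3/2} / √N`. -/
theorem pairError_le {y A : ℝ} (hy : 1 ≤ y) (hA : 0 ≤ A) (hyA : y ≤ A ^ 2 * ((M : ℝ) + 2)) :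
    pairError M 1 y ≤ (2 + 8 * A) * (y * √y / √((M : ℝ) + 2)) := by
  have hN : (0 : ℝ) < (M : ℝ) + 2 := by positivity
  have hM : ((M : ℝ) + 2) / 2 ≤ (M : ℝ) + 1 := by
    have : (0 : ℝ) ≤ M := by positivity
    linarith
  have h1 : √(2 * (1 * y)) * y / √((M : ℝ) + 1) ≤ 2 * (y * √y / √((M : ℝ) + 2)) := by
    calc √(2 * (1 * y)) * y / √((M : ℝ) + 1) ≤ √(2 * (1 * y)) * y / √(((M : ℝ) + 2) / 2) := by gcongr
      _ = 2 * (y * √y / √((M : ℝ) + 2)) := by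
        rw [one_mul, Real.sqrt_mul (by norm_num), Real.sqrt_div hN.le]
        have h2 : √(2 : ℝ) * √2 = 2 := Real.mul_self_sqrt (by norm_num)
        have : √((M : ℝ) + 2) ≠ 0 := (Real.sqrt_pos.2 hN).ne'
        field_simp
        nlinarith
  have h3 : √y ≤ A * √((M : ℝ) + 2) := by
    rw [← Real.sqrt_sq hA, ← Real.sqrt_mul (sq_nonneg A)]
    exact Real.sqrt_le_sqrt hyA
  have h4 : (3 * y ^ 2 + 1 * y) / ((M : ℝ) + 1) ≤ 8 * A * (y * √y / √((M : ℝ) + 2)) := by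
    have hs : √((M : ℝ) + 2) * √((M : ℝ) + 2) = (M : ℝ) + 2 := Real.mul_self_sqrt hN.le
    have hs0 : 0 < √((M : ℝ) + 2) := Real.sqrt_pos.2 hN
    have hy2 : √y * √y = y := Real.mul_self_sqrt (by linarith)
    calc (3 * y ^ 2 + 1 * y) / ((M : ℝ) + 1) ≤ (4 * y ^ 2) / (((M : ℝ) + 2) / 2) := by
          gcongr
          nlinarith
      _ = 8 * y * √y * √y / (√((M : ℝ) + 2) * √((M : ℝ) + 2)) := by
          rw [hs, mul_assoc (8 * y), hy2]; field_simp; norm_num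
      _ ≤ 8 * y * √y * (A * √((M : ℝ) + 2)) / (√((M : ℝ) + 2) * √((M : ℝ) + 2)) := by gcongr
      _ = 8 * A * (y * √y / √((M : ℝ) + 2)) := by field_simp
  rw [pairError]
  linarith

/-- Removes the momentum cutoff: its cost has the form `τ` times a quantity depending on `N` and the
energy, which are held fixed. -/
theorem le_of_forall_pos_le_add_mul {a x c : ℝ} (hc : 0 ≤ c) (h : ∀ τ > 0, a ≤ x + τ * c) : a ≤ x := by
  refine le_of_forall_pos_le_add fun ε hε => ?_
  have h1 := h (ε / (c + 1)) (by positivity)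
  have h2 : ε / (c + 1) * c ≤ ε := by
    rw [div_mul_eq_mul_div, div_le_iff₀ (by positivity)]
    nlinarith
  linarith

end BogoliubovHamiltonian

/-! ### Bounds on the eigenvalues -/

/-- Dimension count: `i` linear conditions on the span of `i + 1` eigenvectors. The conditions will
be orthogonality to the `i` lowest states of the comparison Hamiltonian. -/
theorem IsEigenbasis.exists_low {E : Type*} [NormedAddCommGroup E] [InnerProductSpace ℂ E]
    {A : E →ₗ.[ℂ] E} {ψ : HilbertBasis ℕ ℂ E} {ev : ℕ → ℝ} (hA : IsEigenbasis A ψ ev) (i : ℕ)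
    (ℓ : Fin i → E →ₗ[ℂ] ℂ) :
    ∃ f : A.domain, (f : E) ≠ 0 ∧ (∀ j, ℓ j f = 0) ∧
      (⟪(f : E), A f⟫_ℂ).re ≤ ev i * ‖(f : E)‖ ^ 2 ∧
      ‖A f - (ev 0 : ℂ) • (f : E)‖ ≤ (ev i - ev 0) * ‖(f : E)‖ := by
  obtain ⟨c, hc, h0⟩ := IsEigenbasis.exists_ne_zero_forall_eq_zero
    (LinearMap.pi ℓ ∘ₗ IsEigenbasis.lowSpan ψ i)
  obtain ⟨h, h1, h2⟩ := hA.lowSpan_spec i c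
  refine ⟨⟨_, h⟩, ?_, h0, h1, h2⟩
  intro hz
  have h3 := IsEigenbasis.norm_sq_sum_smul (ψ := ψ) i c
  rw [← IsEigenbasis.lowSpan_apply, show IsEigenbasis.lowSpan ψ i c = 0 from hz, norm_zero,
    zero_pow two_ne_zero, eq_comm, Finset.sum_eq_zero_iff_of_nonneg (fun _ _ => by positivity)] at h3
  exact hc (funext fun j => by simpa using h3 j (Finset.mem_univ j))

section Bounds

variable {d M : ℕ} {v : UnitAddTorus (Fin d) → ℝ} {b : ℝ}

theorem sqSum_kinOp {G : Occupation d → ℂ} (hG : SqSum G) {C : ℝ} (hC : ∀ n, G n ≠ 0 → kinSum n ≤ C) :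
    SqSum (kinOp G) := by
  refine (hG.smul (C : ℂ)).of_le fun n => ?_
  by_cases h : G n = 0
  · simp [kinOp, h]
  · have h1 := hC n h
    have h2 := kinSum_nonneg n
    rw [kinOp, Pi.smul_apply, smul_eq_mul, norm_mul, norm_mul, Complex.norm_real, Complex.norm_real,
      Real.norm_of_nonneg h2, Real.norm_of_nonneg (h2.trans h1)]
    gcongr

theorem IsPotential.kinSum_le_excitationSum (hv : IsPotential v b) (n : Occupation d) :
    kinSum n ≤ excitationSum v n :=
  Finset.sum_le_sum fun p _ => mul_le_mul_of_nonneg_right (hv.momSq_le_elemEnergy _) (Nat.cast_nonneg _)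

theorem IsPotential.excitationSum_le_kinSum (hv : IsPotential v b) (n : Occupation d) :
    excitationSum v n ≤ (1 + ∑' p, vhat v p) * kinSum n := by
  rw [excitationSum, kinSum, Finsupp.sum, Finsupp.sum, Finset.mul_sum]
  refine Finset.sum_le_sum fun p _ => ?_
  rw [← mul_assoc]
  refine mul_le_mul_of_nonneg_right ?_ (Nat.cast_nonneg _)
  have h1 := hv.elemEnergy_le p.1
  have h2 := hv.summable_vhat.le_tsum p.1 fun q _ => hv.vhat_nonneg q
  have h3 := one_le_momSq p.2
  have h4 := hv.vhat_nonneg p.1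
  nlinarith

variable {ψ : HilbertBasis ℕ ℂ (bosonSpace d (M + 2))} {ev : ℕ → ℝ} {occ : ℕ ≃ Occupation d}

namespace IsPotential

/-- Upper bounds on eigenvalues from spaces of amplitudes. -/
theorem eigenvalue_le_of_amplitudes (hv : IsPotential v b)
    (hE : IsEigenbasis (hamiltonian (M + 2) v) ψ ev) {i : ℕ} {β : ℝ}
    (T : (Fin (i + 1) → ℂ) →ₗ[ℂ] (Occupation d → ℂ)) (hs : ∀ c, SqSum (T c))
    (hd : ∀ c, DegLE (M + 2) (T c)) (hk : ∀ c, SqSum (kinOp (T c))) (hne : ∀ c, c ≠ 0 → T c ≠ 0)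
    (hβ : ∀ c, ∑' n, kinSum n * ‖T c n‖ ^ 2
      + ((M : ℝ) + 2) / 2 * (pairForm (vhat v) (fockTwo M (T c)) (fockTwo M (T c))).re
      ≤ β * nsq (T c)) : ev i ≤ β := by
  classical
  choose g hg using fun j : Fin (i + 1) =>
    exists_amp_eq (hs (Pi.single j 1)) (hd (Pi.single j 1))
  let F : (Fin (i + 1) → ℂ) →ₗ[ℂ] bosonSpace d (M + 2) := Fintype.linearCombination ℂ g
  have hF : ∀ c, amp (F c) = T c := by
    intro c
    rw [LinearMap.pi_apply_eq_sum_univ T c, show F c = ∑ j, c j • g j from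
      Fintype.linearCombination_apply .., map_sum]
    refine Finset.sum_congr rfl fun j _ => ?_
    rw [map_smul, hg]
    congr 2
    ext k
    simp [Pi.single_apply, eq_comm]
  have hdom : ∀ c, F c ∈ (hamiltonian (M + 2) v).domain := fun c =>
    hv.mem_domain_iff_sqSum.2 (by rw [hF]; exact hk c)
  refine hE.le_of_forall_re_inner_le F hdom (fun c hc h0 => hne c hc ?_) fun c => ?_
  · rw [← hF, h0, map_zero]
  · have h := hv.re_inner_hamiltonian ⟨F c, hdom c⟩
    rw [← nsq_amp, hF]
    refine h.le.trans ?_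
    simp only [hF]
    exact hβ c

/-- Stability of the interaction and positivity of the kinetic energy. -/
theorem le_eigenvalue_zero (hv : IsPotential v b) (hE : IsEigenbasis (hamiltonian (M + 2) v) ψ ev) :
    ((M : ℝ) + 2) / 2 * vhat v 0 - ∑' p, vhat v p ≤ ev 0 := by
  obtain ⟨f, hf, -, h1, -⟩ := hE.exists_low 0 Fin.elim0
  rw [hv.re_inner_hamiltonian] at h1
  have h2 := hv.le_pairForm (sqSum_amp f.1) (degLE_amp f.1)
  have h3 : 0 ≤ ∑' n, kinSum n * ‖amp f.1 n‖ ^ 2 :=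
    tsum_nonneg fun n => mul_nonneg (kinSum_nonneg n) (by positivity)
  rw [nsq_amp] at h2
  have h4 : 0 < ‖f.1‖ ^ 2 := by have := norm_pos_iff.2 hf; positivity
  exact le_of_mul_le_mul_right (by linarith) h4

/-- A crude lower bound for energies beyond `N`. The Hamiltonian is at least the kinetic energy plus
the stability constant, and the kinetic energy of an occupation is at least its excitation energy
divided by `1 + B`; the comparison states are the bare occupations. -/
theorem excitationSum_le_of_eigenvalue (hv : IsPotential v b)
    (hE : IsEigenbasis (hamiltonian (M + 2) v) ψ ev)
    (hocc : Monotone fun i => excitationSum v (occ i)) (i : ℕ) :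
    excitationSum v (occ i) ≤ (1 + ∑' p, vhat v p)
      * (ev i - (((M : ℝ) + 2) / 2 * vhat v 0 - ∑' p, vhat v p)) := by
  obtain ⟨f, hf, h0, h1, -⟩ := hE.exists_low i fun j => LinearMap.proj (occ j) ∘ₗ amp
  rw [hv.re_inner_hamiltonian] at h1
  have h2 := hv.le_pairForm (sqSum_amp f.1) (degLE_amp f.1)
  have hB : 0 ≤ ∑' p, vhat v p := tsum_nonneg hv.vhat_nonneg
  have hk := summable_kinSum (sqSum_amp f.1) (hv.mem_domain_iff_sqSum.1 f.2)
  have h3 : excitationSum v (occ i) * nsq (amp f.1)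
      ≤ (1 + ∑' p, vhat v p) * ∑' n, kinSum n * ‖amp f.1 n‖ ^ 2 := by
    rw [nsq, ← tsum_mul_left, ← tsum_mul_left]
    refine ((sqSum_amp f.1).mul_left _).tsum_le_tsum (fun n => ?_) (hk.mul_left _)
    obtain ⟨j, rfl⟩ := occ.surjective n
    rcases lt_or_ge j i with hj | hj
    · have : amp f.1 (occ j) = 0 := h0 ⟨j, hj⟩
      simp [this]
    · rw [← mul_assoc]
      exact mul_le_mul_of_nonneg_right ((hocc hj).trans (hv.excitationSum_le_kinSum _)) (by positivity)
  rw [nsq_amp] at h2 h3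
  have h4 : 0 < ‖f.1‖ ^ 2 := by have := norm_pos_iff.2 hf; positivity
  refine le_of_mul_le_mul_right (h3.trans ?_) h4
  rw [mul_assoc]
  refine mul_le_mul_of_nonneg_left ?_ (by linarith)
  linarith

/-- The crude counterpart from above: the trial space is spanned by the first `i + 1` bare
occupations and the interaction is bounded by its norm. Energy at most `N` ensures that these
occupations contain at most `N` particles. -/
theorem eigenvalue_le_of_bound (hv : IsPotential v b) (hE : IsEigenbasis (hamiltonian (M + 2) v) ψ ev)
    (hocc : Monotone fun i => excitationSum v (occ i)) {i : ℕ}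
    (hi : excitationSum v (occ i) ≤ (M : ℝ) + 2) :
    ev i ≤ excitationSum v (occ i) + ((M : ℝ) + 2) / 2 * b := by
  classical
  let T : (Fin (i + 1) → ℂ) →ₗ[ℂ] (Occupation d → ℂ) :=
    LinearMap.pi fun n => if h : occ.symm n < i + 1 then LinearMap.proj ⟨occ.symm n, h⟩ else 0
  have hT : ∀ c n, T c n = if h : occ.symm n < i + 1 then c ⟨occ.symm n, h⟩ else 0 := by
    intro c n
    simp only [T, LinearMap.pi_apply]
    split_ifs <;> rfl
  have hT0 : ∀ c n, T c n ≠ 0 → occ.symm n < i + 1 := by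
    intro c n hn
    by_contra h
    exact hn (by rw [hT, dif_neg h])
  have hTe : ∀ c n, T c n ≠ 0 → excitationSum v n ≤ excitationSum v (occ i) := by
    intro c n hn
    have := hocc (Nat.lt_succ_iff.1 (hT0 c n hn))
    simpa using this
  have hs : ∀ c, SqSum (T c) := fun c => sqSum_of_finite_support <| by
    refine (Set.finite_range fun j : Fin (i + 1) => occ j).subset fun n hn => ?_
    exact ⟨⟨_, hT0 c n hn⟩, by simp⟩
  have hTk : ∀ c n, T c n ≠ 0 → kinSum n ≤ excitationSum v (occ i) := fun c n hn =>
    (hv.kinSum_le_excitationSum n).trans (hTe c n hn)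
  have hd : ∀ c, DegLE (M + 2) (T c) := by
    intro c n hn
    by_contra h
    have h1 := ((degree_le_kinSum n).trans (hTk c n h)).trans hi
    have h2 : ((M + 2 : ℕ) : ℝ) < n.degree := by exact_mod_cast hn
    push_cast at h2
    linarith
  have hk : ∀ c, SqSum (kinOp (T c)) := fun c => sqSum_kinOp (hs c) (hTk c)
  refine hv.eigenvalue_le_of_amplitudes hE T hs hd hk (fun c hc h => hc ?_) fun c => ?_
  · funext j
    have h1 := congrFun h (occ j)
    rw [hT, dif_pos (by rw [occ.symm_apply_apply]; exact j.2)] at h1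
    simpa using h1
  · have h1 := hv.pairForm_le (hs c) (hd c)
    have h2 : ∑' n, kinSum n * ‖T c n‖ ^ 2 ≤ excitationSum v (occ i) * nsq (T c) := by
      rw [nsq, ← tsum_mul_left]
      refine (summable_kinSum (hs c) (hk c)).tsum_le_tsum (fun n => ?_) ((hs c).mul_left _)
      by_cases h : T c n = 0
      · simp [h]
      · exact mul_le_mul_of_nonneg_right (hTk c n h) (by positivity)
    linarith

/-- The eigenvalues are bounded below by the Bogoliubov spectrum. -/
theorem bogoliubov_le_eigenvalue (hv : IsPotential v b)
    (hE : IsEigenbasis (hamiltonian (M + 2) v) ψ ev)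
    (hocc : Monotone fun i => excitationSum v (occ i)) (i : ℕ) {y : ℝ}
    (hy : ev i - (((M : ℝ) + 2) / 2 * vhat v 0 - ∑' p, vhat v p) + 2 * ∑' p, vhat v p ≤ y) :
    ((M : ℝ) + 2) / 2 * vhat v 0 + bogEnergy v + excitationSum v (occ i)
      - (∑' p, vhat v p) * pairError M 1 y ≤ ev i := by
  set B := ∑' p, vhat v p
  set e := ((M : ℝ) + 2) / 2 * vhat v 0 - B
  have hB : 0 ≤ B := tsum_nonneg hv.vhat_nonneg
  have he : e ≤ ev 0 := hv.le_eigenvalue_zero hE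
  set μ := excitationSum v (occ i) with hμ
  have hμ0 : 0 ≤ μ := excitationSum_nonneg _
  refine le_of_forall_pos_le_add_mul (c := ((M : ℝ) + 2) / 2 + μ) (by positivity) fun τ hτ => ?_
  obtain ⟨K, hK, hK1, hK2, -, -, hK5⟩ := hv.exists_modes hτ
  let Q := hv.quad K hK
  -- The low-energy vector is taken orthogonal to the `i` lowest quasi-particle states of the
  -- cut-off Hamiltonian.
  let ℓ : Fin i → bosonSpace d (M + 2) →ₗ[ℂ] ℂ := fun j =>
    { toFun := fun f => Q.bog.hat (amp f) (occ j)
      map_add' := fun f g => by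
        rw [map_add, Bogoliubov.hat_add _ (sqSum_amp f) (sqSum_amp g)]; rfl
      map_smul' := fun c f => by
        rw [map_smul, Bogoliubov.hat_smul]; rfl }
  obtain ⟨f, hf, h0, h1, h2⟩ := hE.exists_low i ℓ
  set G := amp f.1 with hG
  have hGs : SqSum G := sqSum_amp _
  have hGd : DegLE (M + 2) G := degLE_amp _
  have hX : nsq G = ‖f.1‖ ^ 2 := nsq_amp _
  have hY := hv.sqrt_nsq_numOp_le f
  have hY' : √(nsq (numOp G)) ≤ y * ‖f.1‖ := by
    have h3 : ‖hamiltonian (M + 2) v f - (e : ℂ) • f.1‖ ≤ (ev i - ev 0) * ‖f.1‖ + (ev 0 - e) * ‖f.1‖ := by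
      have h4 : hamiltonian (M + 2) v f - (e : ℂ) • f.1
          = (hamiltonian (M + 2) v f - (ev 0 : ℂ) • f.1) + ((ev 0 - e : ℝ) : ℂ) • f.1 := by
        rw [Complex.ofReal_sub (ev 0) e, sub_smul]; abel
      rw [h4]
      refine (norm_add_le _ _).trans (add_le_add h2 ?_)
      rw [norm_smul, Complex.norm_real, Real.norm_of_nonneg (by linarith)]
    have h5 := hY.trans (add_le_add_left h3 _)
    refine h5.trans ?_
    have := norm_nonneg f.1
    calc _ = (ev i - e + 2 * B) * ‖f.1‖ := by ring
      _ ≤ _ := by gcongr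
  have hpf := (abs_le.1 (abs_pairForm_sub_le hv.vhat_nonneg hv.summable_vhat hv.vhat_neg hK hK1 hGs hGd)).1
  have hpe : pairError M (√(nsq G)) (√(nsq (numOp G))) ≤ pairError M 1 y * ‖f.1‖ ^ 2 := by
    rw [← pairError_mul (norm_nonneg _), hX, Real.sqrt_sq (norm_nonneg _)]
    exact pairError_mono (norm_nonneg _) (Real.sqrt_nonneg _) hY' M
  -- From `μ ≤ (1 + τ) tot` follows `μ (1 - τ) ≤ (1 - τ²) tot ≤ tot` for `τ < 1`; for `τ ≥ 1` the
  -- left side is not positive.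
  have hq := Q.mul_nsq_le (G := G) (μ := μ * (1 - τ)) (hGd.mem_rapid hGs)
    (summable_kinSum hGs (hv.mem_domain_iff_sqSum.1 f.2)) (by
      intro n hn
      obtain ⟨j, rfl⟩ := occ.surjective n
      rcases lt_or_ge j i with hj | hj
      · exact absurd (h0 ⟨j, hj⟩) hn
      · have h6 : μ ≤ (1 + τ) * Q.tot (occ j) :=
          (hocc hj).trans (hv.excitationSum_le_mul_tot hK hτ.le hK2 _)
        have h7 : 0 ≤ Q.tot (occ j) := by
          by_contra h
          nlinarith
        rcases le_or_gt 1 τ with h8 | h8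
        · nlinarith
        · nlinarith [mul_le_mul_of_nonneg_right h6 (show 0 ≤ 1 - τ by linarith),
            mul_nonneg (sq_nonneg τ) h7])
  have hpot : Q.potential G = ∑ p ∈ K, vhat v p.1 * (nsq (ann p G) + pairing p G) :=
    hv.quad_potential hK G
  have hsh : Q.shift ≤ -bogEnergy v := by rw [hv.quad_shift hK]; exact hK5
  rw [hv.re_inner_hamiltonian, ← hG] at h1
  have hkin : ∑' n, Q.kin n * ‖G n‖ ^ 2 = ∑' n, kinSum n * ‖G n‖ ^ 2 := rfl
  rw [hkin, hpot, hX] at hq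
  rw [hX] at hpf hpe
  have hX0 : 0 < ‖f.1‖ ^ 2 := by have := norm_pos_iff.2 hf; positivity
  refine le_of_mul_le_mul_right ?_ hX0
  have hBp := mul_le_mul_of_nonneg_left hpe hB
  have hshX := mul_le_mul_of_nonneg_right hsh hX0.le
  change -(B * _ + _) ≤ _ at hpf
  nlinarith only [h1, hpf, hq, hBp, hshX]

/-- The eigenvalues are bounded above by the Bogoliubov spectrum. -/
theorem eigenvalue_le_bogoliubov (hv : IsPotential v b)
    (hE : IsEigenbasis (hamiltonian (M + 2) v) ψ ev)
    (hocc : Monotone fun i => excitationSum v (occ i)) (i : ℕ) {y : ℝ}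
    (hy : y = (1 + 5 * ∑' p, vhat v p) * (excitationSum v (occ i) + 1)) (hM : 2 * y ≤ (M : ℝ) + 2) :
    ev i ≤ ((M : ℝ) + 2) / 2 * vhat v 0 + bogEnergy v + excitationSum v (occ i)
      + ((2 + 2 * ∑' p, vhat v p) * (y ^ 2 / ((M : ℝ) + 1))
        + (∑' p, vhat v p) * pairError M 1 (2 * y)) := by
  classical
  set B := ∑' p, vhat v p
  have hB : 0 ≤ B := tsum_nonneg hv.vhat_nonneg
  set μ := excitationSum v (occ i) with hμ
  have hμ0 : 0 ≤ μ := excitationSum_nonneg _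
  have hy0 : 0 ≤ y := by rw [hy]; positivity
  refine le_of_forall_pos_le_add_mul (c := ((M : ℝ) + 2) / 2 + 1 / 2) (by positivity) fun τ hτ => ?_
  obtain ⟨K, hK, hK1, hK2, hK3, hK4, -⟩ := hv.exists_modes hτ
  let Q := hv.quad K hK
  let ν : Fin (i + 1) → Occupation d := fun j => occ j
  have hν : Function.Injective ν := occ.injective.comp Fin.val_injective
  have hνe : ∀ j, excitationSum v (ν j) ≤ μ := fun j => hocc (Nat.lt_succ_iff.1 j.2)
  have hνt : ∀ j, Q.tot (ν j) ≤ μ := fun j => (hv.quad_tot_le hK _).trans (hνe j)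
  have hνd : ∀ j, ((ν j).degree : ℝ) ≤ μ := fun j =>
    ((degree_le_kinSum _).trans (hv.kinSum_le_excitationSum _)).trans (hνe j)
  have hu : ∑ p ∈ Q.modes, Q.u p ≤ B := (hv.sum_quad_u hK).le.trans hK3
  let T : (Fin (i + 1) → ℂ) →ₗ[ℂ] (Occupation d → ℂ) := cut (M + 2) ∘ₗ Q.bog.trial ν
  have hs : ∀ c, SqSum (T c) := fun c => (rapid_sqSum (Q.bog.trial_mem_rapid c)).cut _
  have hd : ∀ c, DegLE (M + 2) (T c) := fun c => degLE_cut _ _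
  let S := Q.enlarge (Finset.univ.biUnion fun j => (ν j).support)
  have hsupp : ∀ c, Bogoliubov.SuppIn S (Q.bog.trial ν c) := fun c =>
    Q.bog.suppIn_trial c (Q.modes_subset_enlarge _) (Q.neg_mem_enlarge _) fun j =>
      (Finset.subset_biUnion_of_mem (fun j => (ν j).support) (Finset.mem_univ j)).trans
        (Q.subset_enlarge _)
  -- Truncated trial states lie in the operator domain: they involve finitely many modes and at most
  -- `M + 2` particles, so their kinetic energy is bounded.
  have hk : ∀ c, SqSum (kinOp (T c)) := fun c =>
    sqSum_kinOp (C := ∑ p ∈ S, momSq p.1 * ((M + 2 : ℕ) : ℝ)) (hs c) fun n hn => by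
      have hdeg : n.degree ≤ M + 2 := by
        by_contra h
        exact hn (hd c n (not_le.1 h))
      have hnS : n.support ⊆ S := hsupp c n fun h => hn (by
        change cut (M + 2) (Q.bog.trial ν c) n = 0
        rw [cut_apply_of_le _ hdeg, h])
      refine (Finset.sum_le_sum_of_subset_of_nonneg hnS fun p _ _ =>
        mul_nonneg (momSq_nonneg _) (Nat.cast_nonneg _)).trans (Finset.sum_le_sum fun p _ => ?_)
      have h1 := apply_le_degree n p
      have h2 : (n.degree : ℝ) ≤ ((M + 2 : ℕ) : ℝ) := by exact_mod_cast hdeg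
      exact mul_le_mul_of_nonneg_left (h1.trans h2) (momSq_nonneg _)
  refine hv.eigenvalue_le_of_amplitudes hE T hs hd hk (fun c hc h => hc ?_) fun c => ?_
  -- Truncation keeps at least half of the squared norm, so the trial space keeps its dimension.
  · have h1 := (Q.cut_trial_le hν c hμ0 hνt hνd hu hy hM).1
    have h2 : cut (M + 2) (Q.bog.trial ν c) = 0 := h
    rw [h2, nsq_zero, mul_zero, Bogoliubov.nsq_trial _ _ hν] at h1
    have h3 := (Finset.sum_eq_zero_iff_of_nonneg (fun _ _ => by positivity)).1
      (le_antisymm h1 (Finset.sum_nonneg fun _ _ => by positivity))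
    exact funext fun j => by simpa using h3 j (Finset.mem_univ j)
  · obtain ⟨-, hY, hen⟩ := Q.cut_trial_le hν c hμ0 hνt hνd hu hy hM
    change √(nsq (numOp (T c))) ≤ 2 * y * √(nsq (T c)) at hY
    change ∑' n, kinSum n * ‖T c n‖ ^ 2 + Q.potential (T c) + Q.shift * nsq (T c)
      ≤ (μ + (2 + 2 * B) * (y ^ 2 / ((M : ℝ) + 1))) * nsq (T c) at hen
    have hpf := (abs_le.1 (abs_pairForm_sub_le hv.vhat_nonneg hv.summable_vhat hv.vhat_neg hK hK1
      (hs c) (hd c))).2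
    have hpe : pairError M (√(nsq (T c))) (√(nsq (numOp (T c)))) ≤ pairError M 1 (2 * y) * nsq (T c) := by
      refine (pairError_mono (Real.sqrt_nonneg _) (Real.sqrt_nonneg _) hY M).trans (le_of_eq ?_)
      rw [pairError_mul (Real.sqrt_nonneg _), Real.sq_sqrt (nsq_nonneg _)]
    have hpot : Q.potential (T c) = ∑ p ∈ K, vhat v p.1 * (nsq (ann p (T c)) + pairing p (T c)) :=
      hv.quad_potential hK _
    have hsh : -bogEnergy v - τ / 2 ≤ Q.shift := by rw [hv.quad_shift hK]; exact hK4
    rw [hpot] at hen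
    have hX := nsq_nonneg (T c)
    have hBp := mul_le_mul_of_nonneg_left hpe hB
    have hshX := mul_le_mul_of_nonneg_right hsh hX
    change _ ≤ B * _ + _ at hpf
    nlinarith only [hpf, hen, hBp, hshX]

end IsPotential

end Bounds

/-! ### Comparison of the spectra -/

section Sesq

/-- The function `x ^ (3 / 2)`. -/
def sesq (x : ℝ) : ℝ := x * √x

theorem sesq_nonneg {x : ℝ} (hx : 0 ≤ x) : 0 ≤ sesq x := mul_nonneg hx (Real.sqrt_nonneg x)

theorem sesq_mono {x y : ℝ} (hx : 0 ≤ x) (h : x ≤ y) : sesq x ≤ sesq y :=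
  mul_le_mul h (Real.sqrt_le_sqrt h) (Real.sqrt_nonneg x) (hx.trans h)

theorem sesq_mul {x : ℝ} (hx : 0 ≤ x) (y : ℝ) : sesq (x * y) = sesq x * sesq y := by
  rw [sesq, sesq, sesq, Real.sqrt_mul hx]; ring

theorem one_le_sesq {x : ℝ} (hx : 1 ≤ x) : 1 ≤ sesq x := by
  have := sesq_mono zero_le_one hx
  rwa [sesq, Real.sqrt_one, one_mul] at this

theorem sesq_eq_rpow {x : ℝ} (hx : 0 < x) : sesq x = x ^ (3 / 2 : ℝ) := by
  rw [sesq, Real.sqrt_eq_rpow, show (3 / 2 : ℝ) = 1 + 1 / 2 by norm_num, Real.rpow_add hx, Real.rpow_one]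

/-- Beyond `n` the permitted error exceeds the energy itself; this settles the regime of energies
above the particle number. -/
theorem le_sesq_div_sqrt {x n : ℝ} (hn : 0 < n) (h : n ≤ x) : x ≤ sesq x / √n := by
  rw [le_div_iff₀ (Real.sqrt_pos.2 hn), sesq]
  exact mul_le_mul_of_nonneg_left (Real.sqrt_le_sqrt h) (hn.le.trans h)

/-- Away from zero an additive constant can be absorbed into a factor, turning errors in `(ξ +
c)^{3/2}` into errors in `ξ^{3/2}`. -/
theorem add_le_mul_sesq {x c t : ℝ} (hc : 0 ≤ c) (ht : 0 < t) (hx : t ≤ x) :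
    sesq (x + c) ≤ sesq (1 + c / t) * sesq x := by
  have hct : 0 ≤ c / t := by positivity
  rw [← sesq_mul (by linarith)]
  refine sesq_mono (by linarith) ?_
  have : c ≤ c / t * x := by
    rw [div_mul_eq_mul_div, le_div_iff₀ ht]
    exact mul_le_mul_of_nonneg_left hx hc
  linarith

end Sesq

/-! ### Error bounds of order ξ^{3/2} N^{-1/2} -/

section Estimates

variable {d M : ℕ} {v : UnitAddTorus (Fin d) → ℝ} {b : ℝ}
  {ψ : HilbertBasis ℕ ℂ (bosonSpace d (M + 2))} {ev : ℕ → ℝ} {occ : ℕ ≃ Occupation d}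

theorem trial_error_le {y B : ℝ} (hB : 0 ≤ B) (hy : 1 ≤ y) (hM : 2 * y ≤ (M : ℝ) + 2) :
    (2 + 2 * B) * (y ^ 2 / ((M : ℝ) + 1)) + B * pairError M 1 (2 * y)
      ≤ (4 + 34 * B) * (sesq y / √((M : ℝ) + 2)) := by
  have hN : (0 : ℝ) < (M : ℝ) + 2 := by positivity
  have hs0 : 0 < √((M : ℝ) + 2) := Real.sqrt_pos.2 hN
  have hs : √((M : ℝ) + 2) * √((M : ℝ) + 2) = (M : ℝ) + 2 := Real.mul_self_sqrt hN.le
  have hyy : √y * √y = y := Real.mul_self_sqrt (by linarith)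
  have h1 : y ^ 2 / ((M : ℝ) + 1) ≤ 2 * (sesq y / √((M : ℝ) + 2)) := by
    have hM' : ((M : ℝ) + 2) / 2 ≤ (M : ℝ) + 1 := by
      have : (0 : ℝ) ≤ M := by positivity
      linarith
    calc y ^ 2 / ((M : ℝ) + 1) ≤ y ^ 2 / (((M : ℝ) + 2) / 2) := by gcongr
      _ = 2 * (y * √y * √y / (√((M : ℝ) + 2) * √((M : ℝ) + 2))) := by
        rw [hs, mul_assoc, hyy]; field_simp
      _ ≤ 2 * (y * √y * √((M : ℝ) + 2) / (√((M : ℝ) + 2) * √((M : ℝ) + 2))) := by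
        gcongr; linarith
      _ = 2 * (sesq y / √((M : ℝ) + 2)) := by rw [sesq]; field_simp
  have h2 : pairError M 1 (2 * y) ≤ 10 * (sesq (2 * y) / √((M : ℝ) + 2)) := by
    have := pairError_le (M := M) (y := 2 * y) (A := 1) (by linarith) zero_le_one (by linarith)
    rw [sesq]; linarith
  have h3 : sesq (2 * y) ≤ 3 * sesq y := by
    rw [sesq_mul (by norm_num)]
    refine mul_le_mul_of_nonneg_right ?_ (sesq_nonneg (by linarith))
    have : √(2 : ℝ) ≤ 3 / 2 := by rw [Real.sqrt_le_left (by norm_num)]; norm_num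
    rw [sesq]; linarith
  have h4 : sesq (2 * y) / √((M : ℝ) + 2) ≤ 3 * (sesq y / √((M : ℝ) + 2)) := by
    rw [← mul_div_assoc]; gcongr
  have h5 := mul_le_mul_of_nonneg_left h1 (show 0 ≤ 2 + 2 * B by linarith)
  have h6 := mul_le_mul_of_nonneg_left (h2.trans (mul_le_mul_of_nonneg_left h4 (by norm_num))) hB
  linarith

namespace IsPotential

theorem excitationSum_occ_zero (hocc : Monotone fun i => excitationSum v (occ i)) :
    excitationSum v (occ 0) = 0 := by
  refine le_antisymm ?_ (excitationSum_nonneg _)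
  have h := hocc (Nat.zero_le (occ.symm 0))
  simpa [excitationSum] using h

/-- Each excitation costs at least `1`, so only the empty occupation has energy zero. -/
theorem one_le_excitationSum_occ (hv : IsPotential v b)
    (hocc : Monotone fun i => excitationSum v (occ i)) {i : ℕ} (hi : i ≠ 0) :
    1 ≤ excitationSum v (occ i) := by
  have h : ∀ n : Occupation d, n ≠ 0 → 1 ≤ excitationSum v n := fun n hn => by
    have h1 := (degree_le_kinSum n).trans (hv.kinSum_le_excitationSum n)
    have h2 : n.degree ≠ 0 := fun h => hn ((Finsupp.degree_eq_zero_iff n).1 h)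
    have h3 : (1 : ℝ) ≤ n.degree := by exact_mod_cast Nat.one_le_iff_ne_zero.2 h2
    linarith
  have h0 : occ 0 = 0 := by
    by_contra hne
    linarith [h _ hne, excitationSum_occ_zero hocc]
  exact h _ fun hne => hi (occ.injective (hne.trans h0.symm))

theorem bogEnergy_nonpos (hv : IsPotential v b) : bogEnergy v ≤ 0 := by
  have : 0 ≤ ∑' k, bogTerm v k := tsum_nonneg hv.bogTerm_nonneg
  rw [bogEnergy]; linarith

/-- The upper bound comes first: with the Bogoliubov energy nonpositive it bounds the distance of
`ev 0` from the stability constant by `c`. That distance controls the excitation number in the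
ground state, and the lower bound follows from it. -/
theorem ground_estimate (hv : IsPotential v b) (hE : IsEigenbasis (hamiltonian (M + 2) v) ψ ev)
    (hocc : Monotone fun i => excitationSum v (occ i)) {B a U c : ℝ} (hB : B = ∑' p, vhat v p)
    (ha : a = 1 + 5 * B) (hU : U = 4 + 34 * B) (hc : c = 3 * B + U * sesq a + 1)
    (ha' : 2 * a ≤ (M : ℝ) + 2) (hc' : c ≤ (M : ℝ) + 2) :
    ev 0 - (((M : ℝ) + 2) / 2 * vhat v 0 - B) + 2 * B ≤ c ∧
    |ev 0 - (((M : ℝ) + 2) / 2 * vhat v 0 + bogEnergy v)|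
      ≤ (U * sesq a + 10 * B * sesq c) / √((M : ℝ) + 2) := by
  have hB0 : 0 ≤ B := by rw [hB]; exact tsum_nonneg hv.vhat_nonneg
  have ha1 : 1 ≤ a := by linarith
  have hU0 : 0 ≤ U := by linarith
  have hsa := one_le_sesq ha1
  have hc1 : 1 ≤ c := by rw [hc]; nlinarith
  have hN : (0 : ℝ) < (M : ℝ) + 2 := by positivity
  have hs0 : 0 < √((M : ℝ) + 2) := Real.sqrt_pos.2 hN
  have hs1 : 1 ≤ √((M : ℝ) + 2) := by
    rw [Real.one_le_sqrt]
    have : (0 : ℝ) ≤ M := by positivity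
    linarith
  have h0 := excitationSum_occ_zero hocc
  have hup := hv.eigenvalue_le_bogoliubov hE hocc 0 (y := a) (by rw [h0, ← hB, ha]; ring) ha'
  rw [h0, ← hB] at hup
  have herr := trial_error_le (M := M) hB0 ha1 ha'
  rw [← hU] at herr
  have hup' : ev 0 ≤ ((M : ℝ) + 2) / 2 * vhat v 0 + bogEnergy v + U * (sesq a / √((M : ℝ) + 2)) := by
    linarith
  have hb := hv.bogEnergy_nonpos
  have h1 : sesq a / √((M : ℝ) + 2) ≤ sesq a := div_le_self (by linarith) hs1
  have h2 := mul_le_mul_of_nonneg_left h1 hU0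
  have h3 : ev 0 - (((M : ℝ) + 2) / 2 * vhat v 0 - B) + 2 * B ≤ c := by linarith
  refine ⟨h3, ?_⟩
  have hlo := hv.bogoliubov_le_eigenvalue hE hocc 0 (y := c) (by rw [← hB]; exact h3)
  rw [h0, ← hB] at hlo
  have hpe := pairError_le (M := M) (A := 1) hc1 zero_le_one (by linarith)
  have h4 : B * pairError M 1 c ≤ 10 * B * (sesq c / √((M : ℝ) + 2)) := by
    rw [sesq]
    nlinarith [mul_le_mul_of_nonneg_left hpe hB0]
  have h5 : (U * sesq a + 10 * B * sesq c) / √((M : ℝ) + 2)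
      = U * (sesq a / √((M : ℝ) + 2)) + 10 * B * (sesq c / √((M : ℝ) + 2)) := by ring
  have h6 : 0 ≤ U * (sesq a / √((M : ℝ) + 2)) := by positivity
  have h7 : 0 ≤ 10 * B * (sesq c / √((M : ℝ) + 2)) := by
    have := one_le_sesq hc1
    positivity
  rw [h5, abs_le]
  constructor <;> linarith

/-- Up to energy `N` the Bogoliubov lower bound applies with `y = l + c ≤ 2 N`. Above `N` the crude
bound gives an excitation energy of at most `2 (1 + B)` times the permitted error. -/
theorem lower_estimate (hv : IsPotential v b) (hE : IsEigenbasis (hamiltonian (M + 2) v) ψ ev)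
    (hocc : Monotone fun i => excitationSum v (occ i)) {B c C : ℝ} (hB : B = ∑' p, vhat v p)
    (hc1 : 1 ≤ c) (hc' : c ≤ (M : ℝ) + 2) (hC : 0 ≤ C)
    (h0 : ev 0 - (((M : ℝ) + 2) / 2 * vhat v 0 - B) + 2 * B ≤ c)
    (hg : |ev 0 - (((M : ℝ) + 2) / 2 * vhat v 0 + bogEnergy v)| ≤ C / √((M : ℝ) + 2)) (i : ℕ) :
    excitationSum v (occ i) - (ev i - ev 0)
      ≤ (18 * B + C + 2 * (1 + B)) * (sesq (ev i - ev 0 + c) / √((M : ℝ) + 2)) := by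
  have hB0 : 0 ≤ B := by rw [hB]; exact tsum_nonneg hv.vhat_nonneg
  have hN : (0 : ℝ) < (M : ℝ) + 2 := by positivity
  have hs0 : 0 < √((M : ℝ) + 2) := Real.sqrt_pos.2 hN
  have hl0 : 0 ≤ ev i - ev 0 := sub_nonneg.2 (hE.mono (Nat.zero_le i))
  set l := ev i - ev 0 with hl
  have hone := one_le_sesq (show 1 ≤ l + c by linarith)
  set R := sesq (l + c) / √((M : ℝ) + 2) with hR
  have hR0 : 0 ≤ R := by positivity
  have hCR : C / √((M : ℝ) + 2) ≤ C * R := by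
    rw [hR, ← mul_div_assoc]
    gcongr
    exact le_mul_of_one_le_right hC hone
  rcases le_or_gt l ((M : ℝ) + 2) with h | h
  · have hlo := hv.bogoliubov_le_eigenvalue hE hocc i (y := l + c) (by rw [← hB]; linarith)
    rw [← hB] at hlo
    have hpe := pairError_le (M := M) (y := l + c) (A := 2) (by linarith) (by norm_num) (by linarith)
    change _ ≤ _ * R at hpe
    have h1 := mul_le_mul_of_nonneg_left hpe hB0
    have h2 := (abs_le.1 hg).1
    have h3 := (abs_le.1 hg).2
    have h4 : 0 ≤ (1 + B) * R := by positivity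
    nlinarith only [hlo, h1, h2, h3, h4, hCR, hl]
  · have hcr := hv.excitationSum_le_of_eigenvalue hE hocc i
    rw [← hB] at hcr
    have h1 : l ≤ R := (le_sesq_div_sqrt hN h.le).trans
      (div_le_div_of_nonneg_right (sesq_mono hl0 (by linarith)) hs0.le)
    have h2 : excitationSum v (occ i) ≤ (1 + B) * (2 * R) := by
      refine hcr.trans (mul_le_mul_of_nonneg_left ?_ (by linarith))
      linarith
    have h3 : 0 ≤ (18 * B + C) * R := by positivity
    nlinarith only [h2, h3, hl0]

/-- If the excitation energy is a small fraction of `N`, quasi-particle trial states apply.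
Otherwise `N` itself is bounded by the permitted error, and so is the crude difference of order `N`.
-/
theorem upper_estimate (hv : IsPotential v b) (hE : IsEigenbasis (hamiltonian (M + 2) v) ψ ev)
    (hocc : Monotone fun i => excitationSum v (occ i)) {B a U C : ℝ} (hB : B = ∑' p, vhat v p)
    (ha : a = 1 + 5 * B) (hU : U = 4 + 34 * B) (hC : 0 ≤ C)
    (hg : |ev 0 - (((M : ℝ) + 2) / 2 * vhat v 0 + bogEnergy v)| ≤ C / √((M : ℝ) + 2)) {i : ℕ}
    (hi : excitationSum v (occ i) ≤ (M : ℝ) + 2) :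
    ev i - ev 0 - excitationSum v (occ i) ≤ (U * sesq a + C + (b / 2 + B) * sesq (2 * a))
      * (sesq (excitationSum v (occ i) + 1) / √((M : ℝ) + 2)) := by
  have hB0 : 0 ≤ B := by rw [hB]; exact tsum_nonneg hv.vhat_nonneg
  have hb0 := hv.bound_nonneg
  have hN : (0 : ℝ) < (M : ℝ) + 2 := by positivity
  have hs0 : 0 < √((M : ℝ) + 2) := Real.sqrt_pos.2 hN
  set μ := excitationSum v (occ i) with hμ
  have hμ0 : 0 ≤ μ := excitationSum_nonneg _
  have ha1 : 1 ≤ a := by linarith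
  have hU0 : 0 ≤ U := by linarith
  have hone := one_le_sesq (show 1 ≤ μ + 1 by linarith)
  set R := sesq (μ + 1) / √((M : ℝ) + 2) with hR
  have hR0 : 0 ≤ R := by positivity
  have hsa : 0 ≤ sesq a := sesq_nonneg (by linarith)
  have hs2a : 0 ≤ sesq (2 * a) := sesq_nonneg (by linarith)
  rcases le_or_gt (2 * (a * (μ + 1))) ((M : ℝ) + 2) with h | h
  · have hy1 : 1 ≤ a * (μ + 1) := by nlinarith
    have hup := hv.eigenvalue_le_bogoliubov hE hocc i (y := a * (μ + 1)) (by rw [← hB, ha]) h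
    rw [← hB] at hup
    have herr := trial_error_le (M := M) hB0 hy1 h
    rw [sesq_mul (by linarith), mul_div_assoc, ← hU] at herr
    change _ ≤ U * (sesq a * R) at herr
    have hCR : C / √((M : ℝ) + 2) ≤ C * R := by
      rw [hR, ← mul_div_assoc]
      gcongr
      exact le_mul_of_one_le_right hC hone
    have h2 := (abs_le.1 hg).1
    have h4 : 0 ≤ (b / 2 + B) * sesq (2 * a) * R := by positivity
    nlinarith only [hup, herr, hCR, h2, h4]
  · have hup := hv.eigenvalue_le_of_bound hE hocc hi
    have hlo := hv.le_eigenvalue_zero hE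
    rw [← hB] at hlo
    have hv0 := hv.vhat_nonneg 0
    have h1 : (M : ℝ) + 2 ≤ sesq (2 * a) * R := by
      have h2 := le_sesq_div_sqrt hN le_rfl
      refine h2.trans ?_
      rw [hR, ← mul_div_assoc, ← sesq_mul (by linarith)]
      refine div_le_div_of_nonneg_right (sesq_mono hN.le ?_) hs0.le
      linarith
    have h3 : ev i - ev 0 - μ ≤ (b / 2 + B) * ((M : ℝ) + 2) := by
      have h4 : 0 ≤ ((M : ℝ) + 2) / 2 * vhat v 0 := by positivity
      have h5 : B ≤ B * ((M : ℝ) + 2) := le_mul_of_one_le_right hB0 (by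
        have : (0 : ℝ) ≤ M := by positivity
        linarith)
      linarith
    have h6 := mul_le_mul_of_nonneg_left h1 (show 0 ≤ b / 2 + B by positivity)
    have h7 : 0 ≤ (U * sesq a + C) * R := by positivity
    nlinarith only [h3, h6, h7]

/-- The excitation spectrum agrees with the Bogoliubov spectrum. -/
theorem exists_spectral_estimate (hv : IsPotential v b)
    (hocc : Monotone fun i => excitationSum v (occ i)) :
    ∃ C N₀ : ℝ, 0 ≤ C ∧ ∀ (M : ℕ) (ψ : HilbertBasis ℕ ℂ (bosonSpace d (M + 2))) (ev : ℕ → ℝ),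
      N₀ ≤ (M : ℝ) + 2 → IsEigenbasis (hamiltonian (M + 2) v) ψ ev →
      |ev 0 - (((M : ℝ) + 2) / 2 * vhat v 0 + bogEnergy v)| ≤ C / √((M : ℝ) + 2) ∧
      ∀ i, |ev i - ev 0 - excitationSum v (occ i)| ≤ C * (sesq (ev i - ev 0) / √((M : ℝ) + 2)) ∧
        (excitationSum v (occ i) ≤ (M : ℝ) + 2 → |ev i - ev 0 - excitationSum v (occ i)|
          ≤ C * (sesq (excitationSum v (occ i)) / √((M : ℝ) + 2))) := by
  obtain ⟨B, hB⟩ : ∃ B, B = ∑' p, vhat v p := ⟨_, rfl⟩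
  obtain ⟨a, ha⟩ : ∃ a, a = 1 + 5 * B := ⟨_, rfl⟩
  obtain ⟨U, hU⟩ : ∃ U, U = 4 + 34 * B := ⟨_, rfl⟩
  obtain ⟨c, hc⟩ : ∃ c, c = 3 * B + U * sesq a + 1 := ⟨_, rfl⟩
  obtain ⟨C₁, hC₁⟩ : ∃ C₁, C₁ = U * sesq a + 10 * B * sesq c := ⟨_, rfl⟩
  obtain ⟨C₂, hC₂⟩ : ∃ C₂, C₂ = 18 * B + C₁ + 2 * (1 + B) := ⟨_, rfl⟩
  obtain ⟨C₃, hC₃⟩ : ∃ C₃, C₃ = U * sesq a + C₁ + (b / 2 + B) * sesq (2 * a) := ⟨_, rfl⟩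
  have hB0 : 0 ≤ B := by rw [hB]; exact tsum_nonneg hv.vhat_nonneg
  have hb0 := hv.bound_nonneg
  have ha1 : 1 ≤ a := by linarith
  have hU0 : 0 ≤ U := by linarith
  have hsa : 0 ≤ sesq a := sesq_nonneg (by linarith)
  have hc1 : 1 ≤ c := by rw [hc]; nlinarith
  have hC₁0 : 0 ≤ C₁ := by have := sesq_nonneg (show 0 ≤ c by linarith); rw [hC₁]; positivity
  have hC₂0 : 0 ≤ C₂ := by rw [hC₂]; positivity
  have hC₃0 : 0 ≤ C₃ := by
    have := sesq_nonneg (show 0 ≤ 2 * a by linarith)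
    rw [hC₃]; positivity
  have hk1 := one_le_sesq (show 1 ≤ 1 + c / (1 / 2) by rw [le_add_iff_nonneg_right]; positivity)
  have hk2 := one_le_sesq (show (1 : ℝ) ≤ 1 + 1 / 1 by norm_num)
  obtain ⟨k₁, hk₁⟩ : ∃ k, k = sesq (1 + c / (1 / 2)) := ⟨_, rfl⟩
  obtain ⟨k₂, hk₂⟩ : ∃ k : ℝ, k = sesq (1 + 1 / 1) := ⟨_, rfl⟩
  rw [← hk₁] at hk1
  rw [← hk₂] at hk2
  -- The last entry of the maximum makes the error at energies below `1 / 2` less than `1 / 2`,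
  -- which yields the gap `hl`.
  refine ⟨C₁ + C₂ * k₁ + C₃ * k₂ + 1, max (max (2 * a) c) ((2 * C₂ * sesq (1 / 2 + c) + 1) ^ 2),
    by positivity, fun M ψ ev hM hE => ?_⟩
  have hM1 : 2 * a ≤ (M : ℝ) + 2 := (le_max_left _ _).trans ((le_max_left _ _).trans hM)
  have hM2 : c ≤ (M : ℝ) + 2 := (le_max_right _ _).trans ((le_max_left _ _).trans hM)
  have hM3 : (2 * C₂ * sesq (1 / 2 + c) + 1) ^ 2 ≤ (M : ℝ) + 2 := (le_max_right _ _).trans hM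
  have hN : (0 : ℝ) < (M : ℝ) + 2 := by positivity
  have hs0 : 0 < √((M : ℝ) + 2) := Real.sqrt_pos.2 hN
  obtain ⟨h0, hg⟩ := hv.ground_estimate hE hocc hB ha hU hc hM1 hM2
  rw [← hC₁] at hg
  have hC1 : 0 ≤ C₂ * k₁ + C₃ * k₂ + 1 := by positivity
  refine ⟨hg.trans (div_le_div_of_nonneg_right (by linarith) hs0.le), fun i => ?_⟩
  -- The ground state is separate because the permitted error vanishes there; both excitation
  -- energies are exactly zero.
  rcases eq_or_ne i 0 with rfl | hi
  · simp [excitationSum_occ_zero hocc, sesq]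
  have hL := hv.lower_estimate hE hocc hB hc1 hM2 hC₁0 h0 hg i
  have hU' := fun h => hv.upper_estimate hE hocc hB ha hU hC₁0 hg (i := i) h
  have hμ1 := hv.one_le_excitationSum_occ hocc hi
  rw [← hC₂] at hL
  rw [← hC₃] at hU'
  have hl0 : 0 ≤ ev i - ev 0 := sub_nonneg.2 (hE.mono (Nat.zero_le i))
  set l := ev i - ev 0
  set μ := excitationSum v (occ i)
  -- The comparison energy `μ` is at least `1`, so an eigenvalue within `1 / 2` of the ground state
  -- would contradict `hL`. With this gap the constant `c` is absorbed into `k₁`.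
  have hl : 1 / 2 ≤ l := by
    by_contra hlt
    have h1 : sesq (l + c) ≤ sesq (1 / 2 + c) := sesq_mono (by linarith) (by linarith)
    have h2 : 2 * C₂ * sesq (1 / 2 + c) + 1 ≤ √((M : ℝ) + 2) := Real.le_sqrt_of_sq_le hM3
    have h3 : C₂ * (sesq (l + c) / √((M : ℝ) + 2)) ≤ 1 / 2 := by
      rw [← mul_div_assoc, div_le_iff₀ hs0]
      nlinarith [mul_le_mul_of_nonneg_left h1 hC₂0]
    linarith
  have hL' : μ - l ≤ C₂ * k₁ * (sesq l / √((M : ℝ) + 2)) := by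
    refine hL.trans ?_
    rw [mul_assoc, ← mul_div_assoc k₁]
    have := add_le_mul_sesq (c := c) (by linarith) (by norm_num : (0 : ℝ) < 1 / 2) hl
    rw [← hk₁] at this
    gcongr
  have hU'' : μ ≤ (M : ℝ) + 2 → l - μ ≤ C₃ * k₂ * (sesq μ / √((M : ℝ) + 2)) := by
    intro h
    refine (hU' h).trans ?_
    rw [mul_assoc, ← mul_div_assoc k₂]
    have := add_le_mul_sesq (c := 1) zero_le_one one_pos hμ1
    rw [← hk₂] at this
    gcongr
  have hdiv : ∀ {x y : ℝ}, 0 ≤ x → x ≤ y → sesq x / √((M : ℝ) + 2) ≤ sesq y / √((M : ℝ) + 2) :=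
    fun hx h => div_le_div_of_nonneg_right (sesq_mono hx h) hs0.le
  have hμ0 : 0 ≤ μ := by linarith
  have hRl : 0 ≤ sesq l / √((M : ℝ) + 2) := div_nonneg (sesq_nonneg hl0) hs0.le
  have hRμ : 0 ≤ sesq μ / √((M : ℝ) + 2) := div_nonneg (sesq_nonneg hμ0) hs0.le
  have hp1 : 0 ≤ C₂ * k₁ := by positivity
  have hp2 : 0 ≤ C₃ * k₂ := by positivity
  have hconst : ∀ {K R : ℝ}, 0 ≤ R → K ≤ C₁ + C₂ * k₁ + C₃ * k₂ + 1 →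
      K * R ≤ (C₁ + C₂ * k₁ + C₃ * k₂ + 1) * R := fun hR h => mul_le_mul_of_nonneg_right h hR
  refine ⟨?_, fun h => ?_⟩
  -- Each one-sided estimate comes with an error in one of the two energies. When the sign makes it
  -- relevant, the other energy is the larger one, so monotonicity exchanges them. If both exceed
  -- `N`, the permitted error exceeds `l` itself.
  · rw [abs_le']
    constructor
    · rcases le_or_gt l μ with h | h
      · exact (sub_nonpos.2 h).trans (by positivity)
      rcases le_or_gt μ ((M : ℝ) + 2) with h' | h'
      · exact ((hU'' h').trans (mul_le_mul_of_nonneg_left (hdiv hμ0 h.le) hp2)).trans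
          (hconst hRl (by linarith))
      · have h1 : l ≤ 1 * (sesq l / √((M : ℝ) + 2)) := by
          rw [one_mul]; exact le_sesq_div_sqrt hN (h'.le.trans h.le)
        exact (by linarith : l - μ ≤ l).trans (h1.trans (hconst hRl (by linarith)))
    · rw [neg_sub]
      exact hL'.trans (hconst hRl (by linarith))
  · rw [abs_le']
    constructor
    · exact (hU'' h).trans (hconst hRμ (by linarith))
    · rw [neg_sub]
      rcases le_or_gt μ l with h' | h'
      · exact (sub_nonpos.2 h').trans (by positivity)
      · exact (hL'.trans (mul_le_mul_of_nonneg_left (hdiv hl0 h'.le) hp1)).trans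
          (hconst hRμ (by linarith))

/-- The occupations can be listed by increasing excitation energy. -/
theorem exists_occ (hv : IsPotential v b) (hd : 1 ≤ d) :
    ∃ occ : ℕ ≃ Occupation d, Monotone fun i => excitationSum v (occ i) := by
  classical
  have : Nonempty {k : Fin d → ℤ // k ≠ 0} :=
    ⟨⟨fun _ => 1, fun h => one_ne_zero (congrFun h ⟨0, hd⟩)⟩⟩
  refine exists_equiv_nat_monotone _ fun r => ?_
  let S : Finset {k : Fin d → ℤ // k ≠ 0} :=
    ((finite_momSq_le r).preimage Subtype.val_injective.injOn).toFinset
  -- Bounded energy bounds both the momenta that can occur and the number of particles, since every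
  -- mode costs at least `|p|² ≥ 1`.
  refine Set.Finite.subset (Finset.finite_toSet (S.finsupp fun _ => Finset.range (⌊r⌋₊ + 1))) fun n hn => ?_
  have hn' : excitationSum v n ≤ r := hn
  have hk := (hv.kinSum_le_excitationSum n).trans hn'
  have hd := (degree_le_kinSum n).trans hk
  rw [Finset.mem_coe, Finset.mem_finsupp_iff]
  refine ⟨fun p hp => ?_, fun p _ => ?_⟩
  · have h1 : momSq p.1 * (n p : ℝ) ≤ kinSum n := Finset.single_le_sum
      (f := fun p => momSq p.1 * (n p : ℝ)) (fun q _ => mul_nonneg (momSq_nonneg _) (Nat.cast_nonneg _)) hp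
    have h2 : (1 : ℝ) ≤ n p := by
      exact_mod_cast Nat.one_le_iff_ne_zero.2 (Finsupp.mem_support_iff.1 hp)
    have h3 := le_mul_of_one_le_right (momSq_nonneg p.1) h2
    simp only [S, Set.Finite.mem_toFinset, Set.mem_preimage]
    exact (h3.trans h1).trans hk
  · rw [Finset.mem_range, Nat.lt_succ_iff]
    exact Nat.le_floor ((apply_le_degree n p).trans hd)

end IsPotential

end Estimates

end BoseGas
end

/-! ### The excitation spectrum of the mean-field Bose gas -/

open BoseGas in
theorem theorem1 (d : ℕ) (hd : 1 ≤ d) (v : UnitAddTorus (Fin d) → ℝ)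
    (v_meas : Measurable v) (v_bdd : ∃ M : ℝ, ∀ x, |v x| ≤ M)
    (v_nonneg : ∀ x, 0 ≤ v x) (v_even : ∀ x, v (-x) = v x)
    (vhat_nonneg : ∀ k, 0 ≤ vhat v k) :
    Summable (bogTerm v) ∧
    -- the sums `∑ e_p n_p`, listed in increasing order with multiplicity
    ∃ occ : ℕ ≃ Occupation d, Monotone (fun i => excitationSum v (occ i)) ∧
    ∃ (C : ℝ) (N₀ : ℕ), ∀ N : ℕ, N₀ ≤ N →
      |groundStateEnergy (hamiltonian N v) - ((N : ℝ) / 2 * vhat v 0 + bogEnergy v)|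
        ≤ C * (N : ℝ) ^ (-(1 / 2) : ℝ) ∧
      -- the eigenvalues `lam i` of `H_N - E_0(N)`, listed in increasing order with multiplicity
      ∃ (ψ : HilbertBasis ℕ ℂ (bosonSpace d N)) (lam : ℕ → ℝ),
        Monotone lam ∧
        (∀ i, ∃ h : ψ i ∈ (hamiltonian N v).domain,
          hamiltonian N v ⟨ψ i, h⟩
            = ((groundStateEnergy (hamiltonian N v) + lam i : ℝ) : ℂ) • ψ i) ∧
        opSpectrum (hamiltonian N v)
          = Set.range (fun i => ((groundStateEnergy (hamiltonian N v) + lam i : ℝ) : ℂ)) ∧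
        ∀ ξ : ℝ, 0 < ξ →
          (∀ i, lam i ≤ ξ →
            |lam i - excitationSum v (occ i)| ≤ C * (ξ ^ (3 / 2 : ℝ) * (N : ℝ) ^ (-(1 / 2) : ℝ))) ∧
          (∀ n : Occupation d, excitationSum v n ≤ ξ → ∃ i,
            |lam i - excitationSum v n| ≤ C * (ξ ^ (3 / 2 : ℝ) * (N : ℝ) ^ (-(1 / 2) : ℝ))) ∧
          (ξ ≤ N → ∀ i, excitationSum v (occ i) ≤ ξ →
            |lam i - excitationSum v (occ i)| ≤ C * (ξ ^ (3 / 2 : ℝ) * (N : ℝ) ^ (-(1 / 2) : ℝ))) := by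
  obtain ⟨b, hb⟩ := v_bdd
  have hv : IsPotential v b := ⟨v_meas, hb, v_even, vhat_nonneg⟩
  obtain ⟨occ, hocc⟩ := hv.exists_occ hd
  obtain ⟨C, N₁, hC, H⟩ := hv.exists_spectral_estimate hocc
  -- The extra `1` in the constant serves the case `ξ > N` of the converse, where the permitted
  -- error must exceed `ξ`.
  refine ⟨hv.summable_bogTerm, occ, hocc, C + 1, max 2 ⌈N₁⌉₊, fun N hN => ?_⟩
  obtain ⟨M, rfl⟩ : ∃ M, N = M + 2 := ⟨N - 2, by have := (le_max_left _ _).trans hN; omega⟩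
  have hN' : N₁ ≤ (M : ℝ) + 2 := by
    have h1 : ⌈N₁⌉₊ ≤ M + 2 := (le_max_right _ _).trans hN
    exact_mod_cast Nat.ceil_le.1 h1
  obtain ⟨ψ, ev, hE⟩ := hv.exists_isEigenbasis hd M
  obtain ⟨hground, hspec⟩ := H M ψ ev hN' hE
  have hn : (0 : ℝ) < (M : ℝ) + 2 := by positivity
  have hcast : ((M + 2 : ℕ) : ℝ) = (M : ℝ) + 2 := by push_cast; rfl
  have hpow : ((M : ℝ) + 2) ^ (-(1 / 2) : ℝ) = (√((M : ℝ) + 2))⁻¹ := by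
    rw [Real.rpow_neg hn.le, Real.sqrt_eq_rpow]
  have hs0 : 0 < √((M : ℝ) + 2) := Real.sqrt_pos.2 hn
  rw [hE.groundStateEnergy_eq, hcast, hpow]
  have hadd : ∀ i, ev 0 + (ev i - ev 0) = ev i := fun i => by ring
  refine ⟨hground.trans ?_, ψ, fun i => ev i - ev 0, fun i j h => sub_le_sub_right (hE.mono h) _,
    fun i => ?_, ?_, fun ξ hξ => ?_⟩
  · rw [div_eq_mul_inv]
    gcongr
    linarith
  · simp only [hadd]
    exact hE.eigen i
  · simp only [hadd]
    exact hE.spectrum_eq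
  have hl0 : ∀ i, 0 ≤ ev i - ev 0 := fun i => sub_nonneg.2 (hE.mono (Nat.zero_le i))
  have key : ∀ {x : ℝ}, 0 ≤ x → x ≤ ξ → C * (sesq x / √((M : ℝ) + 2))
      ≤ (C + 1) * (ξ ^ (3 / 2 : ℝ) * (√((M : ℝ) + 2))⁻¹) := by
    intro x hx h
    rw [← sesq_eq_rpow hξ, ← div_eq_mul_inv]
    have h1 := div_le_div_of_nonneg_right (sesq_mono hx h) hs0.le
    have h2 := div_nonneg (sesq_nonneg hξ.le) hs0.le
    nlinarith [mul_le_mul_of_nonneg_left h1 hC]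
  have hc : ξ ≤ (M : ℝ) + 2 → ∀ i, excitationSum v (occ i) ≤ ξ →
      |ev i - ev 0 - excitationSum v (occ i)|
        ≤ (C + 1) * (ξ ^ (3 / 2 : ℝ) * (√((M : ℝ) + 2))⁻¹) := fun hξN i hi =>
    ((hspec i).2 (hi.trans hξN)).trans (key (excitationSum_nonneg _) hi)
  refine ⟨fun i hi => (hspec i).1.trans (key (hl0 i) hi), fun n hn' => ?_, hc⟩
  rcases le_or_gt ξ ((M : ℝ) + 2) with h | h
  · exact ⟨occ.symm n, by simpa using hc h (occ.symm n) (by simpa using hn')⟩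
  -- For `ξ > N` the ground state serves every occupation: the discrepancy is at most `ξ ≤ ξ^{3/2}
  -- N^{-1/2}`.
  · refine ⟨0, ?_⟩
    have h0 := excitationSum_nonneg (v := v) n
    beta_reduce
    rw [sub_self, zero_sub, abs_neg, abs_of_nonneg h0]
    have h1 := le_sesq_div_sqrt hn h.le
    rw [← sesq_eq_rpow hξ, ← div_eq_mul_inv]
    have h2 := mul_nonneg hC (div_nonneg (sesq_nonneg hξ.le) hs0.le)
    linarith
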